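/- Write $\|f\|_{L^{2,m}}=\|(1+|\cdot|)^m f\|_{L^2(\mathbb R)}$, $H^{1,1}(\mathbb R)=H^1(\mathbb R)\cap L^{2,1}(\mathbb R)$, and let $\mathcal I^{m,n}_1$ be the set of $q:\mathbb R\to\mathbb C$ with $q-\tanh\in L^{2,m}(\mathbb R)$ and weak derivative $q'\in L^{2,n}(\mathbb R)$. For real $z\neq 0$ let $\lambda(z)=\tfrac12(z+z^{-1})$, $\zeta(z)=\tfrac12(z-z^{-1})$, and let $\psi^{(\pm)}_1(x;z),\psi^{(\pm)}_2(x;z)\in\mathbb C^2$ be the Jost solutions of $$\psi_x=i\sigma_3\bigl(Q(x)-\lambda(z)\bigr)\psi,\qquad Q=\begin{pmatrix}0&\bar q\\ q&0\end{pmatrix},\qquad \sigma_3=\begin{pmatrix}1&0\\0&-1\end{pmatrix},$$ that is, the solutions with $$\lim_{x\to\pm\infty}e^{ix\zeta(z)}\psi^{(\pm)}_1(x;z)=(1,\pm z^{-1})^{T},\qquad \lim_{x\to\pm\infty}e^{-ix\zeta(z)}\psi^{(\pm)}_2(x;z)=(\pm z^{-1},1)^{T}.$$ For $z\in\mathbb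 R\setminus\{0,1,-1\}$ let $$a(z)=\frac{\det[\psi^{(-)}_1,\psi^{(+)}_2]}{1-z^{-2}},\qquad b(z)=\frac{\det[\psi^{(+)}_1,\psi^{(-)}_1]}{1-z^{-2}},\qquad r(z)=\frac{b(z)}{a(z)}$$ (the determinants do not depend on $x$). Call $q$ generic if $\det[\psi^{(+)}_1,\psi^{(-)}_1]\neq0$ at $z=1$ and at $z=-1$. If $q\in\mathcal I^{2,1}_1$, then for every real $z\ne0$ the four Jost solutions exist and are unique; if in addition $q$ is generic, then $r\in H^{1,1}(\mathbb R)$. If $q\in\mathcal I^{3,1}_1$ is generic, then moreover the weak second derivative of $r$ on $(1/2,3/2)\cup(-3/2,-1/2)$ exists and lies in $L^2\bigl((1/2,3/2)\cup(-3/2,-1/2)\bigr)$. -/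

import Mathlib

open MeasureTheory Filter Topology
open scoped ContDiff

noncomputable section

namespace DefocusingNLS

/-- `g` is the weak derivative of order `k` of `f` on the open set `U ⊆ ℝ`. -/
def HasWeakDerivOn (k : ℕ) (U : Set ℝ) (f g : ℝ → ℂ) : Prop :=
  LocallyIntegrableOn f U ∧ LocallyIntegrableOn g U ∧
    ∀ φ : ℝ → ℝ, ContDiff ℝ ∞ φ → HasCompactSupport φ → tsupport φ ⊆ U →
      ∫ x, iteratedDeriv k φ x • f x = (-1 : ℝ) ^ k • ∫ x, φ x • g x

/-- The weighted space `L^{2,m}(ℝ)`, with norm `‖(1 + |·|)^m f‖_{L²}`. -/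
def MemL2Weighted (m : ℕ) (f : ℝ → ℂ) : Prop :=
  MemLp (fun x : ℝ => (1 + |x|) ^ m • f x) 2 volume

/-- `H^{m,n}(ℝ) = H^m(ℝ) ∩ L^{2,n}(ℝ)`: the weak derivatives up to order `m` are in `L²`. -/
def MemSobolevWeighted (m n : ℕ) (f : ℝ → ℂ) : Prop :=
  (∀ j ≤ m, ∃ g : ℝ → ℂ, HasWeakDerivOn j Set.univ f g ∧ MemLp g 2 volume) ∧
    MemL2Weighted n f

/-- The space `I^{m,n}_k` (for `k ≥ 1`): `q - tanh ∈ L^{2,m}` and the weak derivative `q^{(k)}`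
is in `L^{2,n}`. -/
def MemWeightedEnergy (m n k : ℕ) (q : ℝ → ℂ) : Prop :=
  MemL2Weighted m (fun x => q x - (Real.tanh x : ℂ)) ∧
    ∃ g : ℝ → ℂ, HasWeakDerivOn k Set.univ q g ∧ MemL2Weighted n g

/-- `λ(z) = (z + z⁻¹) / 2`. -/
def spectralLambda (z : ℝ) : ℝ := (z + z⁻¹) / 2

/-- `ζ(z) = (z - z⁻¹) / 2`. -/
def spectralZeta (z : ℝ) : ℝ := (z - z⁻¹) / 2

/-- The third Pauli matrix. -/
def pauli3 : Matrix (Fin 2) (Fin 2) ℂ := !![1, 0; 0, -1]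

/-- The potential matrix `Q(x)`. -/
def potential (q : ℝ → ℂ) (x : ℝ) : Matrix (Fin 2) (Fin 2) ℂ :=
  !![0, starRingEnd ℂ (q x); q x, 0]

/-- The matrix `i σ₃ (Q(x) - λ(z))` of the spatial part of the Lax pair. -/
def laxMatrix (q : ℝ → ℂ) (z x : ℝ) : Matrix (Fin 2) (Fin 2) ℂ :=
  Complex.I • (pauli3 * (potential q x - (spectralLambda z : ℂ) • 1))

/-- `ψ` is an absolutely continuous solution on `ℝ` of `ψ' = i σ₃ (Q - λ(z)) ψ`.
The integrated form of the equation does not depend on the representative of `q`. -/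
def IsLaxSolution (q : ℝ → ℂ) (z : ℝ) (ψ : ℝ → Fin 2 → ℂ) : Prop :=
  Continuous ψ ∧ ∀ x y : ℝ,
    IntervalIntegrable (fun t => (laxMatrix q z t).mulVec (ψ t)) volume x y ∧
      ψ y - ψ x = ∫ t in x..y, (laxMatrix q z t).mulVec (ψ t)

/-- `ψ` solves the Lax equation and `ψ(x) ∼ v e^{iκx}` along the filter `l` (at `±∞`). -/
def IsJost (q : ℝ → ℂ) (z : ℝ) (l : Filter ℝ) (v : Fin 2 → ℂ) (κ : ℝ)
    (ψ : ℝ → Fin 2 → ℂ) : Prop :=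
  IsLaxSolution q z ψ ∧
    Tendsto (fun x : ℝ => Complex.exp (-(Complex.I * (κ * x : ℝ))) • ψ x) l (𝓝 v)

/-- `ψ₁⁽⁻⁾ ∼ (1, -z⁻¹) e^{-ixζ(z)}` at `-∞`. -/
def IsJostMinus1 (q : ℝ → ℂ) (z : ℝ) (ψ : ℝ → Fin 2 → ℂ) : Prop :=
  IsJost q z atBot ![1, -(z : ℂ)⁻¹] (-spectralZeta z) ψ

/-- `ψ₂⁽⁻⁾ ∼ (-z⁻¹, 1) e^{ixζ(z)}` at `-∞`. -/
def IsJostMinus2 (q : ℝ → ℂ) (z : ℝ) (ψ : ℝ → Fin 2 → ℂ) : Prop :=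
  IsJost q z atBot ![-(z : ℂ)⁻¹, 1] (spectralZeta z) ψ

/-- `ψ₁⁽⁺⁾ ∼ (1, z⁻¹) e^{-ixζ(z)}` at `+∞`. -/
def IsJostPlus1 (q : ℝ → ℂ) (z : ℝ) (ψ : ℝ → Fin 2 → ℂ) : Prop :=
  IsJost q z atTop ![1, (z : ℂ)⁻¹] (-spectralZeta z) ψ

/-- `ψ₂⁽⁺⁾ ∼ (z⁻¹, 1) e^{ixζ(z)}` at `+∞`. -/
def IsJostPlus2 (q : ℝ → ℂ) (z : ℝ) (ψ : ℝ → Fin 2 → ℂ) : Prop :=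
  IsJost q z atTop ![(z : ℂ)⁻¹, 1] (spectralZeta z) ψ

/-- All four Jost solutions exist and are unique at the spectral parameter `z`. -/
def JostWellDefined (q : ℝ → ℂ) (z : ℝ) : Prop :=
  (∃! ψ, IsJostMinus1 q z ψ) ∧ (∃! ψ, IsJostMinus2 q z ψ) ∧
    (∃! ψ, IsJostPlus1 q z ψ) ∧ (∃! ψ, IsJostPlus2 q z ψ)

open Classical in
/-- The function with property `P` (the zero function if there is none). -/
def chosen (P : (ℝ → Fin 2 → ℂ) → Prop) : ℝ → Fin 2 → ℂ :=
  if h : ∃ ψ, P ψ then h.choose else 0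

/-- The Jost solution `ψ₁⁽⁻⁾(·; z)`. -/
def jostMinus1 (q : ℝ → ℂ) (z : ℝ) : ℝ → Fin 2 → ℂ := chosen (IsJostMinus1 q z)

/-- The Jost solution `ψ₁⁽⁺⁾(·; z)`. -/
def jostPlus1 (q : ℝ → ℂ) (z : ℝ) : ℝ → Fin 2 → ℂ := chosen (IsJostPlus1 q z)

/-- The Jost solution `ψ₂⁽⁺⁾(·; z)`. -/
def jostPlus2 (q : ℝ → ℂ) (z : ℝ) : ℝ → Fin 2 → ℂ := chosen (IsJostPlus2 q z)

/-- The determinant of the matrix with columns `u`, `v`. -/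
def colDet (u v : Fin 2 → ℂ) : ℂ := !![u 0, v 0; u 1, v 1].det

/-- `det [ψ₁⁽⁻⁾(x; z), ψ₂⁽⁺⁾(x; z)]`. The Lax matrix has trace zero, so this does not depend
on `x`; it is evaluated at `x = 0`. -/
def detA (q : ℝ → ℂ) (z : ℝ) : ℂ := colDet (jostMinus1 q z 0) (jostPlus2 q z 0)

/-- `det [ψ₁⁽⁺⁾(x; z), ψ₁⁽⁻⁾(x; z)]`, again independent of `x` and evaluated at `x = 0`. -/
def detB (q : ℝ → ℂ) (z : ℝ) : ℂ := colDet (jostPlus1 q z 0) (jostMinus1 q z 0)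

/-- The scattering coefficient `a(z)`, for `z ∉ {0, 1, -1}`. -/
def scatA (q : ℝ → ℂ) (z : ℝ) : ℂ := detA q z / (1 - ((z : ℂ) ^ 2)⁻¹)

/-- The scattering coefficient `b(z)`, for `z ∉ {0, 1, -1}`. -/
def scatB (q : ℝ → ℂ) (z : ℝ) : ℂ := detB q z / (1 - ((z : ℂ) ^ 2)⁻¹)

/-- The reflection coefficient `r(z) = b(z) / a(z)`. Its values on the null set `{0, 1, -1}` are
immaterial. -/
def reflection (q : ℝ → ℂ) (z : ℝ) : ℂ := scatB q z / scatA q z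

/-- The generic condition at `z = ±1`:
`det [ψ₁⁽⁺⁾, ψ₁⁽⁻⁾](±1) = ∓ det [ψ₁⁽⁻⁾, ψ₂⁽⁺⁾](±1) ≠ 0`. The equality always holds, because
`ψ₂⁽⁺⁾(·; ±1) = ±ψ₁⁽⁺⁾(·; ±1)`. -/
def IsGeneric (q : ℝ → ℂ) : Prop := detB q 1 ≠ 0 ∧ detB q (-1) ≠ 0

end DefocusingNLS

end

open MeasureTheory Filter Topology
open scoped ContDiff

noncomputable section

namespace DefocusingNLS

open scoped ENNReal FourierTransform SchwartzMap ComplexConjugate BoundedContinuousFunction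

/-! ### Integral inequalities -/

/-! The potential may be replaced by its continuous representative, a primitive of its weak
derivative, because the integrated equation ignores null sets. The symmetries `IsJost.swap`
(conjugation), `IsJost.reflect` (x to -x, which turns the limit -1 of q at -∞ into the limit 1 at
+∞) and inversion z to 1/z reduce all four Jost solutions to the first one at +∞ with |z| ≥ 1/4.

For that solution, m = e^{iζx}ψ satisfies m' = N(z)m + Vm, where N(z) has determinant zero and trace
2iζ. Hence exp(-sN) = 1 + φ₀(ζ,s)N with φ₀ = -∫₀ˢ e^{-2iζt}dt, which stays regular at ζ = 0, that is
at z = ±1, where diagonalization breaks down. Variation of constants gives a Volterra equation on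
the half line. An exponential weight makes its operator have norm at most 1/2 for all |z| ≥ 1/4 at
once (`norm_jostOp_le`), so a single resolvent yields existence, uniqueness and dependence on z.

The two determinants are bilinear in the values at x = 0 of the half line solutions for q and for
its reflection. The conserved form |ψ₀|² - |ψ₁|² gives |det_A|² - |det_B|² = (1 - z⁻²)², so det_A
vanishes nowhere when q is generic (`detA_ne_zero`), and r = det_B/det_A away from |z| = 1.

Near z = ±1 each ζ-derivative of the kernel costs one power of y. If q - 1 has weight k + 2 in L²,
then k derivatives of the resolvent are continuous, while the next one exists off |z| = 1 and is
bounded by a moment with kernel min(1, 1/(|ζ|y)). Schur's test makes this bound square integrable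
(`memLp_min_moment`). The resulting class `SobolevReg` is closed under products and inverses, so it
contains r: k = 0 serves the H¹ statement and k = 1 the second derivative.

For |z| > 2 the combination zm₁ - qm₀ at x = 0 equals the half line Fourier transform of q' at ζ(z)
plus O(1/z), and Plancherel applies. The z-derivative is subtler, since yq' is only in L². A gauge
factor exp(-(i/z)∫ₓ^∞(|q|² - 1)) removes m₁ from the integrand, and the remaining dangerous product
y q'(m₀ - 1) is integrable because m₀ - 1 is controlled by a tail integral which is in L² by Hardy's
inequality. This gives zr and zr' in L² at infinity (`exists_outer_bounds`). Finally r(1/z) is the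
conjugate of r(z), so the behaviour near z = 0 is that at infinity; the inversion consumes exactly
the weight |z| on r' (`memSobolevWeighted_of_inv`). -/

theorem lintegral_mul_sq_le {α : Type*} [MeasurableSpace α] (μ : Measure α) {f g : α → ℝ≥0∞}
    (hf : AEMeasurable f μ) (hg : AEMeasurable g μ) :
    (∫⁻ a, f a * g a ∂μ) ^ 2 ≤ (∫⁻ a, f a ^ 2 ∂μ) * ∫⁻ a, g a ^ 2 ∂μ := by
  have h := ENNReal.lintegral_mul_le_Lp_mul_Lq μ Real.HolderConjugate.two_two hf hg
  have h2 := pow_le_pow_left' h 2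
  simp only [Pi.mul_apply] at h2
  refine h2.trans_eq ?_
  rw [mul_pow, ← ENNReal.rpow_natCast, ← ENNReal.rpow_natCast, ← ENNReal.rpow_mul,
    ← ENNReal.rpow_mul]
  norm_num

/-- Schur's test on `L²`. -/
theorem lintegral_schur {α β : Type*} [MeasurableSpace α] [MeasurableSpace β]
    {μ : Measure α} {ν : Measure β} [SFinite μ] [SFinite ν]
    {k : α → β → ℝ≥0∞} (hk : Measurable (Function.uncurry k)) {h : β → ℝ≥0∞} (hh : Measurable h)
    {u : β → ℝ≥0∞} {v : α → ℝ≥0∞} (hu : Measurable u) (hv : Measurable v)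
    (hu0 : ∀ᵐ y ∂ν, u y ≠ 0 ∧ u y ≠ ⊤) {A B : ℝ≥0∞}
    (hA : ∀ᵐ t ∂μ, ∫⁻ y, k t y * u y ∂ν ≤ A * v t)
    (hB : ∀ᵐ y ∂ν, ∫⁻ t, k t y * v t ∂μ ≤ B * u y) :
    ∫⁻ t, (∫⁻ y, k t y * h y ∂ν) ^ 2 ∂μ ≤ A * B * ∫⁻ y, h y ^ 2 ∂ν := by
  have hkt : ∀ t, Measurable (k t) := fun t => hk.of_uncurry_left
  have hpt : ∀ᵐ t ∂μ, (∫⁻ y, k t y * h y ∂ν) ^ 2 ≤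
      A * v t * ∫⁻ y, k t y * ((u y)⁻¹ * h y ^ 2) ∂ν := by
    filter_upwards [hA] with t ht
    -- Cauchy–Schwarz will be applied to the splitting kh = (ku)^{1/2} · ((k/u)^{1/2} h).
    have e1 : ∫⁻ y, k t y * h y ∂ν =
        ∫⁻ y, (k t y * u y) ^ (1 / 2 : ℝ) * ((k t y * (u y)⁻¹) ^ (1 / 2 : ℝ) * h y) ∂ν := by
      refine lintegral_congr_ae ?_
      filter_upwards [hu0] with y hy
      rw [← mul_assoc, ← ENNReal.mul_rpow_of_nonneg _ _ (by norm_num)]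
      have : k t y * u y * (k t y * (u y)⁻¹) = k t y ^ (2 : ℝ) := by
        rw [mul_mul_mul_comm, ENNReal.mul_inv_cancel hy.1 hy.2, mul_one, ENNReal.rpow_two, sq]
      rw [this, ← ENNReal.rpow_mul]
      norm_num
    rw [e1]
    have hkt' := hkt t
    refine (lintegral_mul_sq_le ν (f := fun y => (k t y * u y) ^ (1 / 2 : ℝ))
      (g := fun y => (k t y * (u y)⁻¹) ^ (1 / 2 : ℝ) * h y) (by fun_prop) (by fun_prop)).trans ?_
    refine mul_le_mul' ?_ ?_
    · refine le_trans (le_of_eq ?_) ht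
      refine lintegral_congr fun y => ?_
      rw [← ENNReal.rpow_two, ← ENNReal.rpow_mul]
      norm_num
    · refine le_of_eq (lintegral_congr fun y => ?_)
      rw [mul_pow, ← ENNReal.rpow_two ((k t y * (u y)⁻¹) ^ (1 / 2 : ℝ)), ← ENNReal.rpow_mul]
      norm_num
      ring
  refine (lintegral_mono_ae hpt).trans ?_
  have hm1 : Measurable (fun z : α × β => k z.1 z.2) := hk
  calc ∫⁻ t, A * v t * ∫⁻ y, k t y * ((u y)⁻¹ * h y ^ 2) ∂ν ∂μ
      = ∫⁻ t, ∫⁻ y, A * v t * (k t y * ((u y)⁻¹ * h y ^ 2)) ∂ν ∂μ := by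
        refine lintegral_congr fun t => ?_
        have hkt' := hkt t
        rw [lintegral_const_mul _ (by fun_prop)]
    _ = ∫⁻ y, ∫⁻ t, A * v t * (k t y * ((u y)⁻¹ * h y ^ 2)) ∂μ ∂ν := by
        refine lintegral_lintegral_swap (Measurable.aemeasurable ?_)
        simp only [Function.uncurry_def]
        fun_prop
    _ = ∫⁻ y, A * ((u y)⁻¹ * h y ^ 2) * ∫⁻ t, k t y * v t ∂μ ∂ν := by
        refine lintegral_congr fun y => ?_
        rw [← lintegral_const_mul _ (by fun_prop)]
        refine lintegral_congr fun t => ?_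
        ring
    _ ≤ ∫⁻ y, A * B * h y ^ 2 ∂ν := by
        refine lintegral_mono_ae ?_
        filter_upwards [hu0, hB] with y hy hBy
        calc A * ((u y)⁻¹ * h y ^ 2) * ∫⁻ t, k t y * v t ∂μ
            ≤ A * ((u y)⁻¹ * h y ^ 2) * (B * u y) := by gcongr
          _ = A * B * h y ^ 2 * (u y * (u y)⁻¹) := by ring
          _ = A * B * h y ^ 2 := by rw [ENNReal.mul_inv_cancel hy.1 hy.2, mul_one]
    _ = A * B * ∫⁻ y, h y ^ 2 ∂ν := lintegral_const_mul _ (hh.pow_const 2)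

/-! ### Plancherel for functions in `L¹ ∩ L²` -/

/-- Plancherel holds for the transform defined abstractly on `Lp`. It agrees almost everywhere with
the Fourier integral because both have the same pairing with every test function: the first by its
distributional definition, the second by Fubini. -/
theorem eLpNorm_fourier_eq {f : ℝ → ℂ} (hf : Integrable f) (hf2 : MemLp f 2 volume) :
    MemLp (𝓕 f) 2 volume ∧ eLpNorm (𝓕 f) 2 volume = eLpNorm f 2 volume := by
  set F : Lp ℂ 2 (volume : Measure ℝ) := hf2.toLp f with hF
  have hcont : Continuous (𝓕 f) :=
    VectorFourier.fourierIntegral_continuous Real.continuous_fourierChar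
      (by exact continuous_inner) hf
  have key : ∀ᵐ x, (𝓕 F : Lp ℂ 2 (volume : Measure ℝ)) x = 𝓕 f x := by
    refine ae_eq_of_integral_contDiff_smul_eq
      ((Lp.memLp (𝓕 F)).locallyIntegrable (by norm_num)) hcont.locallyIntegrable ?_
    intro φ hφ hφc
    have hg₁ : HasCompactSupport (Complex.ofRealCLM ∘ φ) := hφc.comp_left rfl
    have hg₂ : ContDiff ℝ ∞ (Complex.ofRealCLM ∘ φ) := by fun_prop
    set G : 𝓢(ℝ, ℂ) := hg₁.toSchwartzMap hg₂
    have h1 := DFunLike.congr_fun (Lp.fourier_toTemperedDistribution_eq F) G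
    rw [TemperedDistribution.fourier_apply, Lp.toTemperedDistribution_apply,
      Lp.toTemperedDistribution_apply] at h1
    have h2 : ∫ x, G x • (𝓕 F : Lp ℂ 2 (volume : Measure ℝ)) x = ∫ x, φ x • (𝓕 F : Lp ℂ 2 (volume : Measure ℝ)) x := by
      congr 1
    have h3 : ∫ x, G x • 𝓕 f x = ∫ x, φ x • 𝓕 f x := by
      congr 1
    rw [← h2, ← h3, ← h1]
    have h4 : ∫ x, (𝓕 G) x • F x = ∫ x, (𝓕 G) x • f x := by
      refine integral_congr_ae ?_
      filter_upwards [hf2.coeFn_toLp] with x hx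
      rw [hx]
    rw [h4]
    have := VectorFourier.integral_fourierIntegral_smul_eq_flip (L := innerₗ ℝ) (μ := volume)
      (ν := volume) Real.continuous_fourierChar (by exact continuous_inner) (G.integrable (μ := volume)) hf
    rw [flip_innerₗ] at this
    exact this
  refine ⟨(memLp_congr_ae key).1 (Lp.memLp _), ?_⟩
  rw [← eLpNorm_congr_ae key]
  have h5 : ‖(𝓕 F : Lp ℂ 2 (volume : Measure ℝ))‖ = ‖F‖ := Lp.norm_fourier_eq F
  rw [Lp.norm_def, Lp.norm_def, ENNReal.toReal_eq_toReal_iff' (Lp.eLpNorm_ne_top _)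
    (Lp.eLpNorm_ne_top _)] at h5
  rw [h5]
  exact eLpNorm_congr_ae hf2.coeFn_toLp

/-! ### Integration by parts against a primitive -/

/-- Here u need not be differentiable at any given point, since g is only integrable; the product
rule is replaced by Fubini on the triangle y < x. This is what allows integration by parts against q
when q' is merely in L². -/
theorem integral_primitive_mul {u g B B' : ℝ → ℂ} {a b : ℝ} (hab : a ≤ b)
    (hg : IntervalIntegrable g volume a b) (hu : ∀ x ∈ Set.Icc a b, u x = u a + ∫ t in a..x, g t)
    (hB : ContinuousOn B (Set.Icc a b)) (hB1 : ∀ x ∈ Set.Ioo a b, HasDerivAt B (B' x) x)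
    (hB' : IntervalIntegrable B' volume a b) :
    ∫ x in a..b, (g x * B x + u x * B' x) = u b * B b - u a * B a := by
  have hFTC : ∀ y ∈ Set.Icc a b, ∫ x in y..b, B' x = B b - B y := by
    intro y hy
    refine intervalIntegral.integral_eq_sub_of_hasDerivAt_of_le hy.2
      (hB.mono (Set.Icc_subset_Icc_left hy.1)) (fun x hx => hB1 x ⟨hy.1.trans_lt hx.1, hx.2⟩)
      (hB'.mono_set ?_)
    rw [Set.uIcc_of_le hy.2, Set.uIcc_of_le hab]
    exact Set.Icc_subset_Icc_left hy.1
  have hgB : IntervalIntegrable (fun x => g x * B x) volume a b :=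
    hg.mul_continuousOn (by rwa [Set.uIcc_of_le hab])
  have hucont : ContinuousOn u (Set.Icc a b) := by
    have h1 : ContinuousOn (fun x => u a + ∫ t in a..x, g t) (Set.Icc a b) := by
      have := intervalIntegral.continuousOn_primitive_interval
        (f := g) (μ := volume) (a := a) (b := b) ?_
      · rw [Set.uIcc_of_le hab] at this
        exact continuousOn_const.add this
      · rw [Set.uIcc_of_le hab]
        exact (intervalIntegrable_iff_integrableOn_Icc_of_le hab).1 hg
    exact h1.congr hu
  have huB : IntervalIntegrable (fun x => u x * B' x) volume a b :=
    hB'.continuousOn_mul (by rwa [Set.uIcc_of_le hab])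
  rw [intervalIntegral.integral_add hgB huB]
  set μ := volume.restrict (Set.Ioc a b)
  have hgi : Integrable g μ := (intervalIntegrable_iff_integrableOn_Ioc_of_le hab).1 hg
  have hBi : Integrable B' μ := (intervalIntegrable_iff_integrableOn_Ioc_of_le hab).1 hB'
  -- Integrating g(y)B'(x) over y < x in the order x, y produces B(b) - B(y); in the order y, x it
  -- produces u(x) - u(a).
  have hswap : ∫ y, ∫ x, Set.indicator {z : ℝ × ℝ | z.1 < z.2} (fun z => g z.1 * B' z.2) (y, x) ∂μ ∂μ
      = ∫ x, ∫ y, Set.indicator {z : ℝ × ℝ | z.1 < z.2} (fun z => g z.1 * B' z.2) (y, x) ∂μ ∂μ := by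
    refine integral_integral_swap ?_
    exact (hgi.mul_prod hBi).indicator (measurableSet_lt measurable_fst measurable_snd)
  have hL : ∫ y, ∫ x, Set.indicator {z : ℝ × ℝ | z.1 < z.2} (fun z => g z.1 * B' z.2) (y, x) ∂μ ∂μ
      = ∫ y in a..b, g y * (B b - B y) := by
    rw [intervalIntegral.integral_of_le hab]
    refine setIntegral_congr_fun measurableSet_Ioc fun y hy => ?_
    have : ∀ x, Set.indicator {z : ℝ × ℝ | z.1 < z.2} (fun z => g z.1 * B' z.2) (y, x)
        = g y * Set.indicator (Set.Ioi y) B' x := by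
      intro x
      by_cases h : y < x <;> simp [Set.indicator, h]
    simp only [this]
    rw [integral_const_mul, setIntegral_indicator measurableSet_Ioi, ← hFTC y ⟨hy.1.le, hy.2⟩,
      intervalIntegral.integral_of_le hy.2, Set.Ioc_inter_Ioi, max_eq_right hy.1.le]
  have hR : ∫ x, ∫ y, Set.indicator {z : ℝ × ℝ | z.1 < z.2} (fun z => g z.1 * B' z.2) (y, x) ∂μ ∂μ
      = ∫ x in a..b, (u x - u a) * B' x := by
    rw [intervalIntegral.integral_of_le hab]
    refine setIntegral_congr_fun measurableSet_Ioc fun x hx => ?_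
    have : ∀ y, Set.indicator {z : ℝ × ℝ | z.1 < z.2} (fun z => g z.1 * B' z.2) (y, x)
        = Set.indicator (Set.Iio x) g y * B' x := by
      intro y
      by_cases h : y < x <;> simp [Set.indicator, h]
    simp only [this]
    rw [integral_mul_const, setIntegral_indicator measurableSet_Iio, hu x ⟨hx.1.le, hx.2⟩,
      add_sub_cancel_left, intervalIntegral.integral_of_le hx.1.le]
    congr 1
    have e : Set.Ioc a b ∩ Set.Iio x = Set.Ioo a x := by
      ext t
      simp only [Set.mem_inter_iff, Set.mem_Ioc, Set.mem_Iio, Set.mem_Ioo]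
      constructor
      · rintro ⟨⟨h1, h2⟩, h3⟩; exact ⟨h1, h3⟩
      · rintro ⟨h1, h2⟩; exact ⟨⟨h1, h2.le.trans hx.2⟩, h2⟩
    rw [e, integral_Ioc_eq_integral_Ioo]
  rw [hL, hR] at hswap
  simp only [mul_sub, sub_mul] at hswap
  rw [intervalIntegral.integral_sub (hg.mul_const _) hgB,
    intervalIntegral.integral_sub huB (hB'.const_mul _), intervalIntegral.integral_mul_const,
    intervalIntegral.integral_const_mul, hFTC a ⟨le_rfl, hab⟩] at hswap
  rw [hu b ⟨hab, le_rfl⟩]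
  linear_combination -hswap

/-! ### Weak derivatives -/

theorem exists_tsupport_subset_Ioo {φ : ℝ → ℝ} (hc : HasCompactSupport φ) :
    ∃ R : ℝ, 0 < R ∧ tsupport φ ⊆ Set.Ioo (-R) R := by
  obtain ⟨R, hR⟩ := hc.isCompact.isBounded.subset_ball 0
  refine ⟨max R 1, by positivity, hR.trans ?_⟩
  rw [Real.ball_eq_Ioo]
  refine Set.Ioo_subset_Ioo ?_ ?_ <;> simp

theorem integral_eq_intervalIntegral {E : Type*} [NormedAddCommGroup E] [NormedSpace ℝ E]
    {f : ℝ → E} {R : ℝ} (hR : 0 < R) (h : ∀ x ∉ Set.Ioo (-R) R, f x = 0) :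
    ∫ x, f x = ∫ x in (-R)..R, f x := by
  rw [intervalIntegral.integral_of_le (by linarith)]
  symm
  refine setIntegral_eq_integral_of_forall_compl_eq_zero fun x hx => h x fun h' => hx ⟨h'.1, h'.2.le⟩

/-- Continuity across the countable set S prevents a singular part of the derivative there. In the
application S consists of the points 0, 1, -1. -/
theorem integral_deriv_smul_eq {U S : Set ℝ} (hS : S.Countable) {f f' : ℝ → ℂ}
    (hU : IsOpen U) (hf : ContinuousOn f U) (hd : ∀ x ∈ U \ S, HasDerivAt f (f' x) x)
    (hf' : LocallyIntegrableOn f' U) {φ : ℝ → ℝ} (hφ : ContDiff ℝ ∞ φ) (hφc : HasCompactSupport φ)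
    (hφU : tsupport φ ⊆ U) :
    ∫ x, deriv φ x • f x = - ∫ x, φ x • f' x := by
  obtain ⟨R, hR0, hR⟩ := exists_tsupport_subset_Ioo hφc
  have hφ0 : ∀ x ∉ tsupport φ, φ x = 0 := fun x hx => image_eq_zero_of_notMem_tsupport hx
  have hφ0' : ∀ x ∉ tsupport φ, deriv φ x = 0 := fun x hx =>
    image_eq_zero_of_notMem_tsupport fun h => hx (tsupport_deriv_subset (𝕜 := ℝ) (f := φ) h)
  have hdφ : ∀ x, HasDerivAt φ (deriv φ x) x := fun x =>
    ((hφ.differentiable (by simp)) x).hasDerivAt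
  have hcdφ : Continuous (deriv φ) := hφ.continuous_deriv (by simp)
  have hcont : ∀ {θ : ℝ → ℝ}, Continuous θ → (∀ x ∉ tsupport φ, θ x = 0) →
      Continuous fun x => θ x • f x := by
    intro θ hθ hθ0
    rw [continuous_iff_continuousAt]
    intro x
    by_cases hx : x ∈ U
    · exact hθ.continuousAt.smul (hf.continuousAt (hU.mem_nhds hx))
    · have hxt : x ∉ tsupport φ := fun h => hx (hφU h)
      have : (fun y => θ y • f y) =ᶠ[𝓝 x] fun _ => 0 := by
        filter_upwards [(isClosed_tsupport φ).isOpen_compl.mem_nhds hxt] with y hy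
        rw [hθ0 y hy, zero_smul]
      exact continuousAt_const.congr this.symm
  have hc1 := hcont hφ.continuous hφ0
  have hc2 := hcont hcdφ hφ0'
  have hderiv : ∀ x ∉ S, HasDerivAt (fun y => φ y • f y) (deriv φ x • f x + φ x • f' x) x := by
    intro x hxS
    by_cases hx : x ∈ U
    · have := (hdφ x).smul (hd x ⟨hx, hxS⟩)
      rwa [add_comm] at this
    · have hxt : x ∉ tsupport φ := fun h => hx (hφU h)
      have : (fun y => φ y • f y) =ᶠ[𝓝 x] fun _ => 0 := by
        filter_upwards [(isClosed_tsupport φ).isOpen_compl.mem_nhds hxt] with y hy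
        rw [hφ0 y hy, zero_smul]
      rw [hφ0 x hxt, hφ0' x hxt, zero_smul, zero_smul, add_zero]
      exact (hasDerivAt_const x (0 : ℂ)).congr_of_eventuallyEq this
  have hi1 : Integrable fun x => deriv φ x • f x :=
    hc2.integrable_of_hasCompactSupport (hφc.deriv.smul_right)
  have hi2 : Integrable fun x => φ x • f' x := by
    have h1 : IntegrableOn f' (tsupport φ) := hf'.integrableOn_compact_subset hφU hφc.isCompact
    have h2 : IntegrableOn (fun x => φ x • f' x) (tsupport φ) :=
      h1.continuousOn_smul hφ.continuous.continuousOn hφc.isCompact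
    refine (integrableOn_iff_integrable_of_support_subset ?_).1 h2
    intro x hx
    by_contra h
    exact hx (by simp [hφ0 x h])
  have hz : ∀ x ∉ Set.Ioo (-R) R, x ∉ tsupport φ := fun x hx h => hx (hR h)
  have hFTC := intervalIntegral_eq (a := -R) (b := R) hS hc1 hderiv (hi1.add hi2)
  rw [eq_neg_iff_add_eq_zero, ← integral_add hi1 hi2,
    integral_eq_intervalIntegral hR0 (fun x hx => by simp [hφ0 x (hz x hx), hφ0' x (hz x hx)]), hFTC,
    hφ0 R (hz R (by simp)), hφ0 (-R) (hz (-R) (by simp))]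
  simp
where
  intervalIntegral_eq {a b : ℝ} {S : Set ℝ} (hS : S.Countable) {F F' : ℝ → ℂ} (hF : Continuous F)
      (hF' : ∀ x ∉ S, HasDerivAt F (F' x) x) (hi : Integrable F') :
      ∫ x in a..b, F' x = F b - F a :=
    MeasureTheory.integral_eq_of_hasDerivAt_off_countable F F' hS hF.continuousOn
      (fun x hx => hF' x hx.2) hi.intervalIntegrable

theorem hasWeakDerivOn_one {U S : Set ℝ} (hS : S.Countable) {f f' : ℝ → ℂ}
    (hU : IsOpen U) (hf : ContinuousOn f U) (hd : ∀ x ∈ U \ S, HasDerivAt f (f' x) x)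
    (hf' : LocallyIntegrableOn f' U) : HasWeakDerivOn 1 U f f' := by
  refine ⟨hf.locallyIntegrableOn hU.measurableSet, hf', fun φ h1 h2 h3 => ?_⟩
  simp only [iteratedDeriv_one, pow_one, neg_smul, one_smul]
  exact integral_deriv_smul_eq hS hU hf hd hf' h1 h2 h3

theorem hasWeakDerivOn_two {U S : Set ℝ} (hS : S.Countable) {f f' f'' : ℝ → ℂ}
    (hU : IsOpen U) (hd : ∀ x ∈ U, HasDerivAt f (f' x) x) (hf' : ContinuousOn f' U)
    (hd' : ∀ x ∈ U \ S, HasDerivAt f' (f'' x) x)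
    (hf'' : LocallyIntegrableOn f'' U) : HasWeakDerivOn 2 U f f'' := by
  have hf : ContinuousOn f U := fun x hx => (hd x hx).continuousAt.continuousWithinAt
  refine ⟨hf.locallyIntegrableOn hU.measurableSet, hf'', fun φ h1 h2 h3 => ?_⟩
  have hdφ : ContDiff ℝ ∞ (deriv φ) := (contDiff_infty_iff_deriv.1 h1).2
  have hsub := (tsupport_deriv_subset (𝕜 := ℝ) (f := φ)).trans h3
  have e2 : iteratedDeriv 2 φ = deriv (deriv φ) := by
    rw [iteratedDeriv_succ, iteratedDeriv_one]
  rw [e2, integral_deriv_smul_eq hS hU hf (fun x hx => hd x hx.1)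
    (hf'.locallyIntegrableOn hU.measurableSet) hdφ h2.deriv hsub,
    integral_deriv_smul_eq hS hU hf' hd' hf'' h1 h2 h3]
  simp

theorem HasWeakDerivOn.congr_ae {k : ℕ} {U : Set ℝ} {f f₁ g : ℝ → ℂ} (h : HasWeakDerivOn k U f g)
    (hf : f =ᵐ[volume] f₁) : HasWeakDerivOn k U f₁ g := by
  refine ⟨fun x hx => ?_, h.2.1, fun φ h1 h2 h3 => ?_⟩
  · obtain ⟨s, hs, hi⟩ := h.1 x hx
    exact ⟨s, hs, hi.congr_fun_ae (ae_restrict_of_ae hf)⟩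
  · rw [← h.2.2 φ h1 h2 h3]
    refine integral_congr_ae ?_
    filter_upwards [hf] with x hx
    rw [hx]

/-- A locally integrable function with a weak derivative is a.e. equal to a primitive of it. -/
theorem exists_ae_eq_primitive {q g : ℝ → ℂ} (h : HasWeakDerivOn 1 Set.univ q g) :
    ∃ c : ℂ, q =ᵐ[volume] fun x => c + ∫ t in (0 : ℝ)..x, g t := by
  obtain ⟨hq, hg, hw⟩ := h
  rw [locallyIntegrableOn_univ] at hq hg
  have hgi : ∀ a b, IntervalIntegrable g volume a b := fun a b =>
    (intervalIntegrable_iff').2 (hg.integrableOn_isCompact isCompact_uIcc)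
  set u : ℝ → ℂ := fun x => ∫ t in (0 : ℝ)..x, g t with hu
  have hucont : Continuous u := intervalIntegral.continuous_primitive hgi 0
  have hzero : ∀ φ : ℝ → ℝ, ContDiff ℝ ∞ φ → HasCompactSupport φ →
      ∫ x, deriv φ x • (q x - u x) = 0 := by
    intro φ hφ hφc
    obtain ⟨R, hR0, hR⟩ := exists_tsupport_subset_Ioo hφc
    have hz : ∀ x ∉ Set.Ioo (-R) R, φ x = 0 := fun x hx =>
      image_eq_zero_of_notMem_tsupport fun h => hx (hR h)
    have hz' : ∀ x ∉ Set.Ioo (-R) R, deriv φ x = 0 := fun x hx =>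
      image_eq_zero_of_notMem_tsupport fun h =>
        hx (hR (tsupport_deriv_subset (𝕜 := ℝ) (f := φ) h))
    have hcdφ : Continuous (deriv φ) := hφ.continuous_deriv (by simp)
    have hi1 : Integrable fun x => deriv φ x • q x :=
      hq.integrable_smul_left_of_hasCompactSupport hcdφ hφc.deriv
    have hi2 : Integrable fun x => deriv φ x • u x :=
      hucont.locallyIntegrable.integrable_smul_left_of_hasCompactSupport hcdφ hφc.deriv
    have hi3 : Integrable fun x => φ x • g x :=
      hg.integrable_smul_left_of_hasCompactSupport hφ.continuous hφc
    have hibp := integral_primitive_mul (u := u) (g := g) (B := fun x => (φ x : ℂ))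
      (B' := fun x => ((deriv φ x : ℝ) : ℂ)) (a := -R) (b := R) (by linarith) (hgi _ _)
      (fun x _ => by
        simp only [hu]
        rw [intervalIntegral.integral_add_adjacent_intervals (hgi _ _) (hgi _ _)])
      (Complex.continuous_ofReal.comp hφ.continuous).continuousOn
      (fun x _ => ((hφ.differentiable (by simp)) x).hasDerivAt.ofReal_comp)
      ((Complex.continuous_ofReal.comp hcdφ).intervalIntegrable _ _)
    have h1 := hw φ hφ hφc (Set.subset_univ _)
    simp only [iteratedDeriv_one, pow_one, neg_smul, one_smul] at h1
    simp only [smul_sub]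
    rw [integral_sub hi1 hi2, h1, sub_eq_zero, neg_eq_iff_add_eq_zero, ← integral_add hi3 hi2,
      integral_eq_intervalIntegral hR0 (fun x hx => by simp [hz x hx, hz' x hx])]
    simp only [hz R (by simp), hz (-R) (by simp), Complex.ofReal_zero, mul_zero, sub_zero] at hibp
    rw [← hibp]
    refine intervalIntegral.integral_congr fun x _ => ?_
    simp only [Complex.real_smul]
    ring
  obtain ⟨φ₀, hφ₀, hφ₀c, hφ₀1⟩ : ∃ φ₀ : ℝ → ℝ, ContDiff ℝ ∞ φ₀ ∧ HasCompactSupport φ₀ ∧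
      ∫ x, φ₀ x = 1 := by
    let b : ContDiffBump (0 : ℝ) := ⟨1, 2, by norm_num, by norm_num⟩
    exact ⟨b.normed volume, b.contDiff_normed, b.hasCompactSupport_normed, b.integral_normed⟩
  have hloc : LocallyIntegrable (fun x => q x - u x) := hq.sub hucont.locallyIntegrable
  set c : ℂ := ∫ x, φ₀ x • (q x - u x) with hc
  refine ⟨c, ?_⟩
  have hfin := ae_eq_of_integral_contDiff_smul_eq (f' := fun _ => c) hloc
    (locallyIntegrable_const c) ?_
  · filter_upwards [hfin] with x hx
    rw [← hx]; ring
  intro ψ hψ hψc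
  set I : ℝ := ∫ x, ψ x with hI
  -- The argument of du Bois-Reymond: removing the right multiple of a normalized bump leaves mean
  -- zero, so the primitive from -R has compact support and is an admissible test function.
  set η : ℝ → ℝ := fun x => ψ x - I * φ₀ x with hη
  have hηs : ContDiff ℝ ∞ η := hψ.sub (contDiff_const.mul hφ₀)
  have hηc : HasCompactSupport η := hψc.sub (hφ₀c.mul_left)
  have hψi : Integrable ψ := hψ.continuous.integrable_of_hasCompactSupport hψc
  have hφi : Integrable φ₀ := hφ₀.continuous.integrable_of_hasCompactSupport hφ₀c
  have hη0 : ∫ x, η x = 0 := by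
    simp only [hη]
    rw [integral_sub hψi (hφi.const_mul I), integral_const_mul, hφ₀1, mul_one, ← hI, sub_self]
  obtain ⟨R, hR0, hR⟩ := exists_tsupport_subset_Ioo hηc
  have hηz : ∀ x ∉ Set.Ioo (-R) R, η x = 0 := fun x hx =>
      image_eq_zero_of_notMem_tsupport fun h => hx (hR h)
  set φ : ℝ → ℝ := fun x => ∫ t in (-R)..x, η t with hφ
  have hdφ : ∀ x, HasDerivAt φ (η x) x := fun x => hηs.continuous.integral_hasStrictDerivAt (-R) x |>.hasDerivAt
  have hdφ' : deriv φ = η := funext fun x => (hdφ x).deriv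
  have hφs : ContDiff ℝ ∞ φ := by
    rw [contDiff_infty_iff_deriv, hdφ']
    exact ⟨fun x => (hdφ x).differentiableAt, hηs⟩
  have hint : ∀ a b, IntervalIntegrable η volume a b :=
    fun a b => hηs.continuous.intervalIntegrable a b
  have hφc : HasCompactSupport φ := by
    refine HasCompactSupport.intro (isCompact_Icc (a := -R) (b := R)) fun x hx => ?_
    simp only [hφ]
    rw [Set.mem_Icc, not_and_or, not_le, not_le] at hx
    rcases hx with hx | hx
    · rw [intervalIntegral.integral_symm, neg_eq_zero]
      refine (intervalIntegral.integral_congr (g := fun _ => (0 : ℝ)) fun t ht => ?_).trans (by simp)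
      rw [Set.uIcc_of_le hx.le] at ht
      exact hηz t fun h => absurd h.1 (by linarith [ht.2])
    · rw [← intervalIntegral.integral_add_adjacent_intervals (hint (-R) R) (hint R x),
        ← integral_eq_intervalIntegral hR0 hηz, hη0, zero_add]
      refine (intervalIntegral.integral_congr (g := fun _ => (0 : ℝ)) fun t ht => ?_).trans (by simp)
      rw [Set.uIcc_of_le hx.le] at ht
      exact hηz t fun h => absurd h.2 (by linarith [ht.1])
  have h0 := hzero φ hφs hφc
  rw [hdφ'] at h0
  have hi1 : Integrable fun x => ψ x • (q x - u x) :=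
    hloc.integrable_smul_left_of_hasCompactSupport hψ.continuous hψc
  have hi2 : Integrable fun x => φ₀ x • (q x - u x) :=
    hloc.integrable_smul_left_of_hasCompactSupport hφ₀.continuous hφ₀c
  simp only [hη, sub_smul, mul_smul] at h0
  have hi3 : Integrable fun x => I • φ₀ x • (q x - u x) := hi2.smul I
  rw [integral_sub hi1 hi3, integral_smul, ← hc, sub_eq_zero] at h0
  rw [h0, integral_smul_const]

/-! ### Volterra operators on the half line -/

/-- The coefficient `V` and the exponential weight `γ` of a Volterra operator on `[0, ∞)`. -/
structure VolterraData (E : Type*) [NormedAddCommGroup E] [NormedSpace ℂ E] where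
  V : ℝ → E →L[ℂ] E
  γ : ℝ → ℝ
  continuous_V : Continuous V
  continuous_γ : Continuous γ
  anti : ∀ x y, 0 ≤ x → x ≤ y → γ y ≤ γ x

namespace VolterraData

variable {E : Type*} [NormedAddCommGroup E] [NormedSpace ℂ E] (D : VolterraData E)

/-- Dominating functions for convolution kernels, integrable against `‖V‖`. -/
def Dominates (w : ℝ → ℝ) (κ : ℝ → ℂ) : Prop :=
  (∀ s y, 0 ≤ s → s ≤ y → ‖κ s‖ ≤ w y) ∧ IntegrableOn (fun y => w y * ‖D.V y‖) (Set.Ioi 0)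

/-- The kernels which define a bounded Volterra operator. -/
def goodKernel : Submodule ℂ (ℝ → ℂ) where
  carrier := {κ | Continuous κ ∧ ∃ w, D.Dominates w κ}
  zero_mem' := ⟨continuous_const, 0, by simp, by simp⟩
  add_mem' := by
    rintro κ κ' ⟨h1, w, h2, h3⟩ ⟨h1', w', h2', h3'⟩
    refine ⟨h1.add h1', w + w', fun s y hs hy => (norm_add_le _ _).trans
      (add_le_add (h2 s y hs hy) (h2' s y hs hy)), ?_⟩
    simpa only [Pi.add_apply, add_mul] using! h3.add h3'
  smul_mem' := by
    rintro c κ ⟨h1, w, h2, h3⟩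
    refine ⟨h1.const_smul c, fun y => ‖c‖ * w y, fun s y hs hy => ?_, ?_⟩
    · simp only [Pi.smul_apply, smul_eq_mul, norm_mul]
      exact mul_le_mul_of_nonneg_left (h2 s y hs hy) (norm_nonneg _)
    · simpa only [mul_assoc] using! h3.const_mul ‖c‖

/-- The integrand of the Volterra operator, for `y > x ≥ 0`. -/
def integrand (κ : ℝ → ℂ) (f : ℝ → E) (x y : ℝ) : E :=
  (κ (y - x) * Real.exp (D.γ y - D.γ x)) • D.V y (f y)

variable {D}

theorem continuous_integrand {κ : ℝ → ℂ} (hκ : Continuous κ) {f : ℝ → E} (hf : Continuous f) :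
    Continuous fun z : ℝ × ℝ => D.integrand κ f z.1 z.2 := by
  have := D.continuous_V
  have := D.continuous_γ
  unfold integrand
  fun_prop

theorem norm_integrand_le (κ : ℝ → ℂ) (f : ℝ →ᵇ E) (x y : ℝ) :
    ‖D.integrand κ f x y‖ ≤ ‖κ (y - x)‖ * Real.exp (D.γ y - D.γ x) * ‖D.V y‖ * ‖f‖ := by
  unfold integrand
  rw [norm_smul, norm_mul, Complex.norm_real, Real.norm_of_nonneg (Real.exp_nonneg _), mul_assoc _ ‖D.V y‖]
  refine mul_le_mul_of_nonneg_left ?_ (by positivity)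
  exact (D.V y).le_of_opNorm_le_of_le le_rfl (f.norm_coe_le_norm y)

/-- The exponential factor is at most 1 because γ decreases, and the argument y - x of the kernel
lies in [0, y]. -/
theorem norm_integrand_le_of_dominates {κ : ℝ → ℂ} {w : ℝ → ℝ} (h : D.Dominates w κ) (f : ℝ →ᵇ E)
    {x y : ℝ} (hx : 0 ≤ x) (hy : x ≤ y) :
    ‖D.integrand κ f x y‖ ≤ w y * ‖D.V y‖ * ‖f‖ := by
  refine (norm_integrand_le κ f x y).trans ?_
  have h1 := h.1 (y - x) y (by linarith) (by linarith)
  have h2 : Real.exp (D.γ y - D.γ x) ≤ 1 := by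
    rw [Real.exp_le_one_iff]; linarith [D.anti x y hx hy]
  have h3 : ‖κ (y - x)‖ * Real.exp (D.γ y - D.γ x) ≤ w y :=
    (mul_le_of_le_one_right (norm_nonneg _) h2).trans h1
  gcongr

theorem integrableOn_integrand {κ : ℝ → ℂ} (hκ : κ ∈ D.goodKernel) (f : ℝ →ᵇ E)
    {x : ℝ} (hx : 0 ≤ x) : IntegrableOn (D.integrand κ f x) (Set.Ioi x) := by
  obtain ⟨hc, w, hw⟩ := hκ
  have h1 : IntegrableOn (fun y => w y * ‖D.V y‖ * ‖f‖) (Set.Ioi x) :=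
    (hw.2.mono_set (Set.Ioi_subset_Ioi hx)).mul_const _
  refine Integrable.mono' h1 ?_ ?_
  · exact ((continuous_integrand hc f.continuous).comp (Continuous.prodMk_right x)).aestronglyMeasurable
  · filter_upwards [ae_restrict_mem measurableSet_Ioi] with y hy
    exact norm_integrand_le_of_dominates hw f hx (le_of_lt hy)

theorem norm_integral_integrand_le {κ : ℝ → ℂ} {w : ℝ → ℝ} (h : D.Dominates w κ) (f : ℝ →ᵇ E)
    {x : ℝ} (hx : 0 ≤ x) :
    ‖∫ y in Set.Ioi x, D.integrand κ f x y‖ ≤ (∫ y in Set.Ioi 0, w y * ‖D.V y‖) * ‖f‖ := by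
  have h0 : ∀ y, 0 ≤ y → 0 ≤ w y := fun y hy => (norm_nonneg _).trans (h.1 y y hy le_rfl)
  have h1 : IntegrableOn (fun y => w y * ‖D.V y‖ * ‖f‖) (Set.Ioi 0) := h.2.mul_const _
  calc ‖∫ y in Set.Ioi x, D.integrand κ f x y‖
      ≤ ∫ y in Set.Ioi x, w y * ‖D.V y‖ * ‖f‖ := by
        refine norm_integral_le_of_norm_le (h1.mono_set (Set.Ioi_subset_Ioi hx)) ?_
        filter_upwards [ae_restrict_mem measurableSet_Ioi] with y hy
        exact norm_integrand_le_of_dominates h f hx (le_of_lt hy)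
    _ ≤ ∫ y in Set.Ioi 0, w y * ‖D.V y‖ * ‖f‖ := by
        refine setIntegral_mono_set h1 ?_ (Set.Ioi_subset_Ioi hx).eventuallyLE
        filter_upwards [ae_restrict_mem measurableSet_Ioi] with y hy
        have := h0 y (le_of_lt hy)
        positivity
    _ = _ := integral_mul_const _ _

/-- Dominated convergence once the moving domain is written as an indicator on (0,∞); the indicator
is discontinuous in x only when y = max x 0, a null set. Replacing x by max x 0 extends the function
constantly to the left, so that everything lives in the bounded continuous functions on ℝ. -/
theorem continuous_integral_integrand {κ : ℝ → ℂ} (hκ : κ ∈ D.goodKernel) (f : ℝ →ᵇ E) :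
    Continuous fun x => ∫ y in Set.Ioi (max x 0), D.integrand κ f (max x 0) y := by
  obtain ⟨hc, w, hw⟩ := id hκ
  have hci := continuous_integrand (D := D) hc f.continuous
  have e : ∀ x : ℝ, ∫ y in Set.Ioi (max x 0), D.integrand κ f (max x 0) y =
      ∫ y in Set.Ioi 0, Set.indicator (Set.Ioi (max x 0)) (D.integrand κ f (max x 0)) y := by
    intro x
    rw [setIntegral_indicator measurableSet_Ioi, Set.Ioi_inter_Ioi, max_eq_right (le_max_right x 0)]
  simp only [e]
  rw [continuous_iff_continuousAt]
  intro x
  refine continuousAt_of_dominated (bound := fun y => w y * ‖D.V y‖ * ‖f‖) ?_ ?_ (hw.2.mul_const _) ?_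
  · refine Eventually.of_forall fun x => ?_
    exact ((hci.comp (Continuous.prodMk_right _)).aestronglyMeasurable).indicator measurableSet_Ioi
  · refine Eventually.of_forall fun x => ?_
    filter_upwards [ae_restrict_mem measurableSet_Ioi] with y hy
    have h0 : 0 ≤ w y := (norm_nonneg _).trans (hw.1 y y (le_of_lt hy) le_rfl)
    by_cases h : y ∈ Set.Ioi (max x 0)
    · rw [Set.indicator_of_mem h]
      exact norm_integrand_le_of_dominates hw f (le_max_right _ _) (le_of_lt h)
    · rw [Set.indicator_of_notMem h, norm_zero]
      positivity
  · have hne : ∀ᵐ y ∂(volume.restrict (Set.Ioi (0 : ℝ))), y ≠ max x 0 :=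
      ae_restrict_of_ae (Measure.ae_ne volume _)
    filter_upwards [hne] with y hy
    have hmax : Continuous fun x : ℝ => max x 0 := by fun_prop
    rcases lt_or_gt_of_ne hy with h | h
    · have : (fun x' => Set.indicator (Set.Ioi (max x' 0)) (D.integrand κ f (max x' 0)) y)
          =ᶠ[𝓝 x] fun _ => 0 := by
        filter_upwards [hmax.continuousAt.eventually_const_lt h] with x' hx'
        exact Set.indicator_of_notMem (fun hm => absurd hx' (not_lt.2 (le_of_lt hm))) _
      exact continuousAt_const.congr this.symm
    · have : (fun x' => Set.indicator (Set.Ioi (max x' 0)) (D.integrand κ f (max x' 0)) y)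
          =ᶠ[𝓝 x] fun x' => D.integrand κ f (max x' 0) y := by
        filter_upwards [hmax.continuousAt.eventually_lt_const h] with x' hx'
        exact Set.indicator_of_mem hx' _
      refine ContinuousAt.congr ?_ this.symm
      exact (hci.comp (hmax.prodMk continuous_const)).continuousAt

/-- The Volterra operator with kernel `κ`, as a bounded operator. -/
def op (κ : D.goodKernel) : (ℝ →ᵇ E) →L[ℂ] (ℝ →ᵇ E) :=
  LinearMap.mkContinuousOfExistsBound
    { toFun := fun f => BoundedContinuousFunction.ofNormedAddCommGroup
        (fun x => ∫ y in Set.Ioi (max x 0), D.integrand κ f (max x 0) y)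
        (continuous_integral_integrand κ.2 f)
        ((∫ y in Set.Ioi 0, κ.2.2.choose y * ‖D.V y‖) * ‖f‖)
        (fun x => norm_integral_integrand_le κ.2.2.choose_spec f (le_max_right _ _))
      map_add' := fun f g => by
        ext x
        simp only [BoundedContinuousFunction.coe_ofNormedAddCommGroup,
          BoundedContinuousFunction.add_apply]
        rw [← integral_add (integrableOn_integrand κ.2 f (le_max_right _ _))
          (integrableOn_integrand κ.2 g (le_max_right _ _))]
        simp [integrand]
      map_smul' := fun c f => by
        ext x
        simp only [BoundedContinuousFunction.coe_ofNormedAddCommGroup,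
          BoundedContinuousFunction.smul_apply, RingHom.id_apply]
        rw [← integral_smul]
        congr 1
        ext y
        simp only [integrand, BoundedContinuousFunction.smul_apply, map_smul, smul_comm c] }
    ⟨∫ y in Set.Ioi 0, κ.2.2.choose y * ‖D.V y‖, fun f => by
      refine (BoundedContinuousFunction.norm_le ?_).2 fun x => ?_
      · exact (norm_nonneg _).trans
          (norm_integral_integrand_le κ.2.2.choose_spec f (le_refl 0))
      · exact norm_integral_integrand_le κ.2.2.choose_spec f (le_max_right _ _)⟩

theorem op_apply (κ : D.goodKernel) (f : ℝ →ᵇ E) (x : ℝ) :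
    op κ f x = ∫ y in Set.Ioi (max x 0), D.integrand κ f (max x 0) y := rfl

theorem op_sub (κ κ' : D.goodKernel) : op (κ - κ') = op κ - op κ' := by
  ext f x
  rw [sub_apply, BoundedContinuousFunction.sub_apply, op_apply, op_apply,
    op_apply, ← integral_sub (integrableOn_integrand κ.2 f (le_max_right _ _))
          (integrableOn_integrand κ'.2 f (le_max_right _ _))]
  simp [integrand, sub_mul, sub_smul]

theorem op_smul (c : ℂ) (κ : D.goodKernel) : op (c • κ) = c • op κ := by
  ext f x
  rw [smul_apply, BoundedContinuousFunction.smul_apply, op_apply, op_apply,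
    ← integral_smul]
  simp [integrand, mul_assoc, mul_smul]

theorem norm_op_le {κ : D.goodKernel} {w : ℝ → ℝ} (h : D.Dominates w κ) :
    ‖op κ‖ ≤ ∫ y in Set.Ioi 0, w y * ‖D.V y‖ := by
  have hnn : 0 ≤ ∫ y in Set.Ioi 0, w y * ‖D.V y‖ := by
    refine setIntegral_nonneg measurableSet_Ioi fun y hy => ?_
    have := (norm_nonneg _).trans (h.1 y y (le_of_lt hy) le_rfl)
    positivity
  refine ContinuousLinearMap.opNorm_le_bound _ hnn fun f => ?_
  exact (BoundedContinuousFunction.norm_le (by positivity)).2 fun x =>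
    norm_integral_integrand_le h f (le_max_right _ _)

/-- Unlike `norm_op_le`, this bound keeps the factor e^{γ(y)-γ(x)}. That factor is the only source
of smallness for a potential of arbitrary size. -/
theorem norm_op_le_of_forall {κ : D.goodKernel} {M : ℝ} (hM : 0 ≤ M) {w : ℝ → ℝ}
    (h : ∀ x y, 0 ≤ x → x ≤ y → ‖(κ : ℝ → ℂ) (y - x)‖ * ‖D.V y‖ ≤ w y)
    (hi : ∀ x, 0 ≤ x → IntegrableOn (fun y => w y * Real.exp (D.γ y - D.γ x)) (Set.Ioi x))
    (hw : ∀ x, 0 ≤ x → ∫ y in Set.Ioi x, w y * Real.exp (D.γ y - D.γ x) ≤ M) :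
    ‖op κ‖ ≤ M := by
  refine ContinuousLinearMap.opNorm_le_bound _ hM fun f => ?_
  refine (BoundedContinuousFunction.norm_le (by positivity)).2 fun x => ?_
  have hx : 0 ≤ max x 0 := le_max_right _ _
  rw [op_apply]
  calc _ ≤ ∫ y in Set.Ioi (max x 0), w y * Real.exp (D.γ y - D.γ (max x 0)) * ‖f‖ := by
        refine norm_integral_le_of_norm_le ((hi _ hx).mul_const _) ?_
        filter_upwards [ae_restrict_mem measurableSet_Ioi] with y hy
        refine (norm_integrand_le _ f _ y).trans ?_
        have := h _ y hx (le_of_lt hy)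
        calc _ = (‖(κ : ℝ → ℂ) (y - max x 0)‖ * ‖D.V y‖) * Real.exp (D.γ y - D.γ (max x 0)) * ‖f‖ := by
              ring
          _ ≤ _ := by gcongr
    _ ≤ M * ‖f‖ := by
        rw [integral_mul_const]
        exact mul_le_mul_of_nonneg_right (hw _ hx) (norm_nonneg _)

/-- Dominated convergence with w₁ as majorant. The function w₂ gives pointwise convergence only and
need not be integrable against ‖V‖, so increments in ζ cost no extra moment. -/
theorem tendsto_integral_min {w₁ w₂ : ℝ → ℝ} (h₁ : IntegrableOn (fun y => w₁ y * ‖D.V y‖) (Set.Ioi 0))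
    (hc₁ : Continuous w₁) (hc₂ : Continuous w₂) (h0 : ∀ y, 0 < y → 0 ≤ w₁ y ∧ 0 ≤ w₂ y) (ζ₀ : ℝ) :
    Tendsto (fun ζ : ℝ => ∫ y in Set.Ioi 0, min (w₁ y) (|ζ - ζ₀| * w₂ y) * ‖D.V y‖) (𝓝 ζ₀) (𝓝 0) := by
  have hV := D.continuous_V
  suffices h : Tendsto (fun ζ : ℝ => ∫ y in Set.Ioi 0, min (w₁ y) (|ζ - ζ₀| * w₂ y) * ‖D.V y‖)
      (𝓝 ζ₀) (𝓝 (∫ _ in Set.Ioi (0 : ℝ), (0 : ℝ))) by simpa using h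
  refine tendsto_integral_filter_of_dominated_convergence (fun y => w₁ y * ‖D.V y‖) ?_ ?_ h₁ ?_
  · refine Eventually.of_forall fun ζ => Continuous.aestronglyMeasurable (by fun_prop)
  · refine Eventually.of_forall fun ζ => ?_
    filter_upwards [ae_restrict_mem measurableSet_Ioi] with y hy
    obtain ⟨h1, h2⟩ := h0 y hy
    rw [Real.norm_of_nonneg (by positivity)]
    gcongr
    exact min_le_left _ _
  · filter_upwards [ae_restrict_mem measurableSet_Ioi] with y hy
    obtain ⟨h1, h2⟩ := h0 y hy
    have hc : Continuous fun ζ : ℝ => min (w₁ y) (|ζ - ζ₀| * w₂ y) * ‖D.V y‖ := by fun_prop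
    have := hc.tendsto ζ₀
    simpa [h1] using this

theorem integrableOn_min {w₁ w₂ : ℝ → ℝ} (h₁ : IntegrableOn (fun y => w₁ y * ‖D.V y‖) (Set.Ioi 0))
    (hc₁ : Continuous w₁) (hc₂ : Continuous w₂) (h0 : ∀ y, 0 < y → 0 ≤ w₁ y ∧ 0 ≤ w₂ y)
    {h : ℝ} (hh : 0 ≤ h) :
    IntegrableOn (fun y => min (w₁ y) (h * w₂ y) * ‖D.V y‖) (Set.Ioi 0) := by
  have hV := D.continuous_V
  refine Integrable.mono' h₁ (Continuous.aestronglyMeasurable (by fun_prop)) ?_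
  filter_upwards [ae_restrict_mem measurableSet_Ioi] with y hy
  obtain ⟨h1, h2⟩ := h0 y hy
  rw [Real.norm_of_nonneg (by positivity)]
  gcongr
  exact min_le_left _ _

theorem continuousAt_op {κ : ℝ → D.goodKernel} {w₁ w₂ : ℝ → ℝ} {ζ₀ : ℝ}
    (h₁ : IntegrableOn (fun y => w₁ y * ‖D.V y‖) (Set.Ioi 0))
    (hc₁ : Continuous w₁) (hc₂ : Continuous w₂) (h0 : ∀ y, 0 < y → 0 ≤ w₁ y ∧ 0 ≤ w₂ y)
    (hκ : ∀ᶠ ζ in 𝓝 ζ₀, ∀ s y, 0 ≤ s → s ≤ y →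
      ‖(κ ζ : ℝ → ℂ) s - (κ ζ₀ : ℝ → ℂ) s‖ ≤ min (w₁ y) (|ζ - ζ₀| * w₂ y)) :
    ContinuousAt (fun ζ => op (κ ζ)) ζ₀ := by
  rw [ContinuousAt, tendsto_iff_norm_sub_tendsto_zero]
  refine squeeze_zero' (Eventually.of_forall fun _ => norm_nonneg _) ?_
    (tendsto_integral_min h₁ hc₁ hc₂ h0 ζ₀)
  filter_upwards [hκ] with ζ hζ
  rw [← op_sub]
  exact norm_op_le ⟨hζ, integrableOn_min h₁ hc₁ hc₂ h0 (abs_nonneg _)⟩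

/-- The operator is linear in its kernel, so its Taylor remainder is the operator of the remainder
kernel, and the norm of the latter is o(|ζ - ζ₀|) by `tendsto_integral_min`. -/
theorem hasDerivAt_op {κ : ℝ → D.goodKernel} {κ' : D.goodKernel} {w₁ w₂ : ℝ → ℝ} {ζ₀ : ℝ}
    (h₁ : IntegrableOn (fun y => w₁ y * ‖D.V y‖) (Set.Ioi 0))
    (hc₁ : Continuous w₁) (hc₂ : Continuous w₂) (h0 : ∀ y, 0 < y → 0 ≤ w₁ y ∧ 0 ≤ w₂ y)
    (hκ : ∀ᶠ ζ in 𝓝 ζ₀, ∀ s y, 0 ≤ s → s ≤ y →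
      ‖(κ ζ : ℝ → ℂ) s - (κ ζ₀ : ℝ → ℂ) s - ((ζ - ζ₀ : ℝ) : ℂ) * (κ' : ℝ → ℂ) s‖ ≤
        |ζ - ζ₀| * min (w₁ y) (|ζ - ζ₀| * w₂ y)) :
    HasDerivAt (fun ζ => op (κ ζ)) (op κ') ζ₀ := by
  rw [hasDerivAt_iff_isLittleO, Asymptotics.isLittleO_iff]
  intro c hc
  filter_upwards [hκ, (tendsto_integral_min h₁ hc₁ hc₂ h0 ζ₀).eventually_lt_const hc] with ζ hζ hc'
  have e : op (κ ζ) - op (κ ζ₀) - (ζ - ζ₀) • op κ' =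
      op (κ ζ - κ ζ₀ - ((ζ - ζ₀ : ℝ) : ℂ) • κ') := by
    rw [op_sub, op_sub, op_smul]
    rfl
  rw [e]
  have hint := integrableOn_min h₁ hc₁ hc₂ h0 (abs_nonneg (ζ - ζ₀))
  have := norm_op_le (κ := κ ζ - κ ζ₀ - ((ζ - ζ₀ : ℝ) : ℂ) • κ')
    (w := fun y => |ζ - ζ₀| * min (w₁ y) (|ζ - ζ₀| * w₂ y)) ⟨hζ, by
      simpa only [mul_assoc] using! hint.const_mul |ζ - ζ₀|⟩
  refine this.trans ?_
  simp only [mul_assoc]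
  rw [integral_const_mul, Real.norm_eq_abs, mul_comm]
  exact mul_le_mul_of_nonneg_right hc'.le (abs_nonneg _)

end VolterraData

/-! ### The oscillatory kernels -/

/-- The kernel `-∫₀ˢ e^{-2iζt} dt` and its derivatives of order `j` in `ζ`. -/
def phi (j : ℕ) (ζ s : ℝ) : ℂ :=
  -∫ t in (0 : ℝ)..s, (-2 * Complex.I * t) ^ j * Complex.exp (-2 * Complex.I * ζ * t)

theorem norm_exp_two_I (ζ t : ℝ) : ‖Complex.exp (-2 * Complex.I * ζ * t)‖ = 1 := by
  have : (-2 * Complex.I * ζ * t : ℂ) = ((-2 * ζ * t : ℝ) : ℂ) * Complex.I := by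
    push_cast; ring
  rw [this, Complex.norm_exp_ofReal_mul_I]

theorem norm_two_I_pow (j : ℕ) {s t : ℝ} (h0 : 0 ≤ t) (h : t ≤ s) :
    ‖(-2 * Complex.I * t : ℂ) ^ j‖ ≤ (2 * s) ^ j := by
  rw [norm_pow]
  refine pow_le_pow_left₀ (norm_nonneg _) ?_ j
  simp only [norm_mul, norm_neg, Complex.norm_ofNat, Complex.norm_I, mul_one, Complex.norm_real,
    Real.norm_eq_abs, abs_of_nonneg h0]
  linarith

theorem continuous_phi (j : ℕ) (ζ : ℝ) : Continuous (phi j ζ) := by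
  unfold phi
  refine Continuous.neg (intervalIntegral.continuous_primitive (fun a b => ?_) 0)
  exact Continuous.intervalIntegrable (by fun_prop) a b

theorem norm_integral_zero_le {f : ℝ → ℂ} {s C : ℝ} (hs : 0 ≤ s)
    (h : ∀ t, 0 ≤ t → t ≤ s → ‖f t‖ ≤ C) : ‖∫ t in (0 : ℝ)..s, f t‖ ≤ C * s := by
  have := intervalIntegral.norm_integral_le_of_norm_le_const (a := 0) (b := s) (C := C) (f := f) ?_
  · rwa [sub_zero, abs_of_nonneg hs] at this
  · intro t ht
    rw [Set.uIoc_of_le hs] at ht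
    exact h t ht.1.le ht.2

theorem norm_phi_le (j : ℕ) (ζ : ℝ) {s : ℝ} (hs : 0 ≤ s) : ‖phi j ζ s‖ ≤ 2 ^ j * s ^ (j + 1) := by
  unfold phi
  rw [norm_neg]
  refine (norm_integral_zero_le hs (C := (2 * s) ^ j) fun t h0 ht => ?_).trans_eq (by ring)
  rw [norm_mul, norm_exp_two_I, mul_one]
  exact norm_two_I_pow j h0 ht

/-- Oscillation trades one power of s for 1/|ζ|: integrate by parts against the antiderivative of
e^{-2iζt}. Together with `norm_phi_le` this gives the minimum on which the L² estimates near ζ = 0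
rest. -/
theorem norm_phi_le_div (j : ℕ) {ζ : ℝ} (hζ : ζ ≠ 0) {s : ℝ} (hs : 0 ≤ s) :
    ‖phi j ζ s‖ ≤ 2 ^ j * (j + 1) * s ^ j / |ζ| := by
  have hζ' : 0 < |ζ| := abs_pos.2 hζ
  have hc : (-2 * Complex.I * ζ : ℂ) ≠ 0 := by simp [hζ]
  have hnc : ‖(-2 * Complex.I * ζ : ℂ)‖ = 2 * |ζ| := by simp
  have hE : ∀ t : ℝ, HasDerivAt (fun t : ℝ => Complex.exp (-2 * Complex.I * ζ * t) / (-2 * Complex.I * ζ))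
      (Complex.exp (-2 * Complex.I * ζ * t)) t := by
    intro t
    have h1 : HasDerivAt (fun t : ℝ => (-2 * Complex.I * ζ * t : ℂ)) (-2 * Complex.I * ζ) t := by
      simpa using (Complex.ofRealCLM.hasDerivAt (x := t)).const_mul (-2 * Complex.I * ζ : ℂ)
    have := h1.cexp.div_const (-2 * Complex.I * ζ : ℂ)
    rwa [mul_div_assoc, div_self hc, mul_one] at this
  cases j with
  | zero =>
    unfold phi
    simp only [pow_zero, one_mul, norm_neg]
    rw [intervalIntegral.integral_eq_sub_of_hasDerivAt (fun t _ => hE t)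
      (Continuous.intervalIntegrable (by fun_prop) _ _), ← sub_div, norm_div, hnc]
    have : ‖Complex.exp (-2 * Complex.I * ζ * s) - Complex.exp (-2 * Complex.I * ζ * (0 : ℝ))‖ ≤ 1 + 1 :=
      (norm_sub_le _ _).trans (by rw [norm_exp_two_I, norm_exp_two_I])
    rw [div_le_div_iff₀ (by positivity) hζ', Nat.cast_zero, zero_add, one_mul, one_mul]
    have h2 := mul_le_mul_of_nonneg_right this hζ'.le
    linarith
  | succ j =>
    have hP : ∀ t : ℝ, HasDerivAt (fun t : ℝ => (-2 * Complex.I * t : ℂ) ^ (j + 1))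
        ((j + 1) * (-2 * Complex.I * t) ^ j * (-2 * Complex.I)) t := by
      intro t
      have h1 : HasDerivAt (fun t : ℝ => (-2 * Complex.I * t : ℂ)) (-2 * Complex.I) t := by
        simpa using (Complex.ofRealCLM.hasDerivAt (x := t)).const_mul (-2 * Complex.I : ℂ)
      have := h1.fun_pow (j + 1)
      simpa using! this
    have hibp := intervalIntegral.integral_mul_deriv_eq_deriv_mul (a := 0) (b := s)
      (fun t _ => hP t) (fun t _ => hE t)
      (Continuous.intervalIntegrable (by fun_prop) _ _) (Continuous.intervalIntegrable (by fun_prop) _ _)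
    -- The integral left after the integration by parts is a multiple of the kernel of order j, for
    -- which the trivial bound suffices.
    have e : ∫ t in (0 : ℝ)..s, ((j + 1) * (-2 * Complex.I * t) ^ j * (-2 * Complex.I)) *
        (Complex.exp (-2 * Complex.I * ζ * t) / (-2 * Complex.I * ζ)) =
        -((j + 1) / ζ) * phi j ζ s := by
      unfold phi
      rw [neg_mul_neg, ← intervalIntegral.integral_const_mul]
      refine intervalIntegral.integral_congr fun t _ => ?_
      have hI := Complex.I_ne_zero
      have hζc : (ζ : ℂ) ≠ 0 := by exact_mod_cast hζ
      field_simp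
    rw [e] at hibp
    have e2 : ‖phi (j + 1) ζ s‖ = ‖∫ t in (0 : ℝ)..s, (-2 * Complex.I * t : ℂ) ^ (j + 1) *
        Complex.exp (-2 * Complex.I * ζ * t)‖ := by
      unfold phi; rw [norm_neg]
    rw [e2, hibp]
    have h1 : ‖(-2 * Complex.I * s : ℂ) ^ (j + 1) *
        (Complex.exp (-2 * Complex.I * ζ * s) / (-2 * Complex.I * ζ))‖ ≤ (2 * s) ^ (j + 1) / (2 * |ζ|) := by
      rw [norm_mul, norm_div, norm_exp_two_I, hnc, mul_one_div]
      exact div_le_div_of_nonneg_right (norm_two_I_pow (j + 1) hs le_rfl) (by positivity)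
    have h2 : ‖-(((j : ℂ) + 1) / ζ) * phi j ζ s‖ ≤ (j + 1) / |ζ| * (2 ^ j * s ^ (j + 1)) := by
      rw [norm_mul, norm_neg, norm_div]
      have : ‖((j : ℂ) + 1)‖ = j + 1 := by
        have : ((j : ℂ) + 1) = ((j + 1 : ℕ) : ℂ) := by push_cast; ring
        rw [this, Complex.norm_natCast]; push_cast; ring
      rw [this, Complex.norm_real, Real.norm_eq_abs]
      exact mul_le_mul_of_nonneg_left (norm_phi_le j ζ hs) (by positivity)
    refine (norm_sub_le _ _).trans ?_
    refine (add_le_add ((norm_sub_le _ _).trans (add_le_add h1 le_rfl)) h2).trans ?_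
    simp only [Complex.ofReal_zero, mul_zero, ne_eq, Nat.succ_ne_zero, not_false_eq_true, zero_pow,
      zero_mul, norm_zero, add_zero]
    rw [div_add' _ _ _ (by positivity), div_le_div_iff₀ (by positivity) hζ']
    have e3 : ((j : ℝ) + 1) / |ζ| * (2 ^ j * s ^ (j + 1)) * (2 * |ζ|) =
        2 ^ (j + 1) * (j + 1) * s ^ (j + 1) := by
      field_simp
      ring
    rw [e3, mul_pow]
    push_cast
    have h3 : 0 ≤ (2 : ℝ) ^ (j + 1) * s ^ (j + 1) * |ζ| := by positivity
    have h4 : (0 : ℝ) ≤ j := by positivity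
    nlinarith [mul_nonneg h3 h4]

theorem norm_exp_sub_one_sub_le (x : ℝ) :
    ‖Complex.exp (Complex.I * x) - 1 - Complex.I * x‖ ≤ 2 * x ^ 2 := by
  have hx : ‖Complex.I * x‖ = |x| := by simp
  rcases le_or_gt |x| 1 with h | h
  · refine (Complex.norm_exp_sub_one_sub_id_le (hx.trans_le h)).trans ?_
    rw [hx, sq_abs]
    nlinarith [sq_nonneg x]
  · refine (norm_sub_le _ _).trans ?_
    have := Real.norm_exp_I_mul_ofReal_sub_one_le (x := x)
    rw [Real.norm_eq_abs] at this
    rw [hx, ← sq_abs]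
    nlinarith

theorem norm_phi_sub_le (j : ℕ) (ζ ζ₀ : ℝ) {s : ℝ} (hs : 0 ≤ s) :
    ‖phi j ζ s - phi j ζ₀ s‖ ≤ |ζ - ζ₀| * (2 ^ (j + 1) * s ^ (j + 2)) := by
  unfold phi
  rw [neg_sub_neg, ← intervalIntegral.integral_sub (Continuous.intervalIntegrable (by fun_prop) _ _)
    (Continuous.intervalIntegrable (by fun_prop) _ _)]
  refine (norm_integral_zero_le hs (C := (2 * s) ^ j * (2 * |ζ - ζ₀| * s)) fun t h0 ht => ?_).trans_eq
    (by ring)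
  rw [← mul_sub, norm_mul]
  refine mul_le_mul (norm_two_I_pow j h0 ht) ?_ (norm_nonneg _) (by positivity)
  have e : Complex.exp (-2 * Complex.I * ζ₀ * t) - Complex.exp (-2 * Complex.I * ζ * t) =
      -(Complex.exp (-2 * Complex.I * ζ₀ * t) *
        (Complex.exp (Complex.I * ((-2 * (ζ - ζ₀) * t : ℝ) : ℂ)) - 1)) := by
    rw [mul_sub, ← Complex.exp_add]
    push_cast
    ring_nf
  rw [e, norm_neg, norm_mul, norm_exp_two_I, one_mul]
  refine (Real.norm_exp_I_mul_ofReal_sub_one_le).trans ?_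
  rw [Real.norm_eq_abs, abs_mul, abs_mul, abs_of_nonneg h0]
  norm_num
  gcongr

/-- Follows from e^{iθ} - 1 - iθ = O(θ²). The high power of s is harmless for the operators, since
there the estimate enters only as the non-integrable entry of the minimum in `hasDerivAt_op`. -/
theorem norm_phi_sub_sub_le (j : ℕ) (ζ ζ₀ : ℝ) {s : ℝ} (hs : 0 ≤ s) :
    ‖phi j ζ s - phi j ζ₀ s - ((ζ - ζ₀ : ℝ) : ℂ) * phi (j + 1) ζ₀ s‖ ≤
      |ζ - ζ₀| * (|ζ - ζ₀| * (2 ^ (j + 3) * s ^ (j + 3))) := by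
  unfold phi
  rw [neg_sub_neg, ← intervalIntegral.integral_sub (Continuous.intervalIntegrable (by fun_prop) _ _)
    (Continuous.intervalIntegrable (by fun_prop) _ _), mul_neg, sub_neg_eq_add,
    ← intervalIntegral.integral_const_mul,
    ← intervalIntegral.integral_add (Continuous.intervalIntegrable (by fun_prop) _ _)
    (Continuous.intervalIntegrable (by fun_prop) _ _)]
  refine (norm_integral_zero_le hs (C := (2 * s) ^ j * (8 * |ζ - ζ₀| ^ 2 * s ^ 2))
    fun t h0 ht => ?_).trans_eq (by ring)
  have e : (-2 * Complex.I * t) ^ j * Complex.exp (-2 * Complex.I * ζ₀ * t) -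
      (-2 * Complex.I * t) ^ j * Complex.exp (-2 * Complex.I * ζ * t) +
      ((ζ - ζ₀ : ℝ) : ℂ) * ((-2 * Complex.I * t) ^ (j + 1) * Complex.exp (-2 * Complex.I * ζ₀ * t)) =
      -((-2 * Complex.I * t) ^ j * (Complex.exp (-2 * Complex.I * ζ₀ * t) *
        (Complex.exp (Complex.I * ((-2 * (ζ - ζ₀) * t : ℝ) : ℂ)) - 1 -
          Complex.I * ((-2 * (ζ - ζ₀) * t : ℝ) : ℂ)))) := by
    have e1 : Complex.exp (-2 * Complex.I * ζ * t) = Complex.exp (-2 * Complex.I * ζ₀ * t) *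
        Complex.exp (Complex.I * ((-2 * (ζ - ζ₀) * t : ℝ) : ℂ)) := by
      rw [← Complex.exp_add]
      push_cast
      ring_nf
    rw [e1]
    push_cast
    ring
  rw [e, norm_neg, norm_mul, norm_mul, norm_exp_two_I, one_mul]
  refine mul_le_mul (norm_two_I_pow j h0 ht) ?_ (norm_nonneg _) (by positivity)
  refine (norm_exp_sub_one_sub_le _).trans ?_
  rw [sq_abs, show 2 * (-2 * (ζ - ζ₀) * t) ^ 2 = 8 * (ζ - ζ₀) ^ 2 * t ^ 2 by ring]
  gcongr

theorem hasDerivAt_phi (j : ℕ) (ζ₀ : ℝ) {s : ℝ} (hs : 0 ≤ s) :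
    HasDerivAt (fun ζ => phi j ζ s) (phi (j + 1) ζ₀ s) ζ₀ := by
  rw [hasDerivAt_iff_isLittleO]
  have h1 : (fun ζ => phi j ζ s - phi j ζ₀ s - (ζ - ζ₀) • phi (j + 1) ζ₀ s) =O[𝓝 ζ₀]
      fun ζ => (ζ - ζ₀) ^ 2 := by
    refine Asymptotics.IsBigO.of_bound (2 ^ (j + 3) * s ^ (j + 3)) (Eventually.of_forall fun ζ => ?_)
    rw [Complex.real_smul]
    refine (norm_phi_sub_sub_le j ζ ζ₀ hs).trans_eq ?_
    rw [norm_pow, Real.norm_eq_abs]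
    ring
  refine h1.trans_isLittleO ?_
  have h2 : (fun ζ : ℝ => (ζ - ζ₀) ^ 2) = fun ζ => (ζ - ζ₀) * (ζ - ζ₀) := by ext; ring
  rw [h2]
  have h3 : Tendsto (fun ζ : ℝ => ζ - ζ₀) (𝓝 ζ₀) (𝓝 0) := by
    have : Continuous fun ζ : ℝ => ζ - ζ₀ := by fun_prop
    simpa using this.tendsto ζ₀
  simpa using ((Asymptotics.isLittleO_one_iff ℝ).2 h3).mul_isBigO
    (Asymptotics.isBigO_refl (fun ζ : ℝ => ζ - ζ₀) (𝓝 ζ₀))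

/-- A first-order Taylor estimate from a bound on the derivative kernel near `ζ₀`. -/
theorem norm_phi_sub_sub_le_of_bound (j : ℕ) {ζ ζ₀ δ s C : ℝ} (hs : 0 ≤ s) (hζ : |ζ - ζ₀| < δ)
    (hC : ∀ ξ, |ξ - ζ₀| < δ → ‖phi (j + 1) ξ s‖ ≤ C) :
    ‖phi j ζ s - phi j ζ₀ s - ((ζ - ζ₀ : ℝ) : ℂ) * phi (j + 1) ζ₀ s‖ ≤ |ζ - ζ₀| * (2 * C) := by
  have hδ : 0 < δ := (abs_nonneg _).trans_lt hζ
  have h1 : ‖phi j ζ s - phi j ζ₀ s‖ ≤ C * ‖ζ - ζ₀‖ := by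
    refine (convex_ball ζ₀ δ).norm_image_sub_le_of_norm_hasDerivWithin_le
      (f := fun ζ => phi j ζ s) (f' := fun ζ => phi (j + 1) ζ s)
      (fun ξ _ => (hasDerivAt_phi j ξ hs).hasDerivWithinAt) (fun ξ hξ => hC ξ ?_)
      (Metric.mem_ball_self hδ) ?_
    · simpa [Real.dist_eq] using hξ
    · simpa [Real.dist_eq] using hζ
  have h2 : ‖((ζ - ζ₀ : ℝ) : ℂ) * phi (j + 1) ζ₀ s‖ ≤ |ζ - ζ₀| * C := by
    rw [norm_mul, Complex.norm_real, Real.norm_eq_abs]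
    exact mul_le_mul_of_nonneg_left (hC ζ₀ (by simpa using hδ)) (abs_nonneg _)
  rw [Real.norm_eq_abs] at h1
  refine (norm_sub_le _ _).trans ((add_le_add h1 h2).trans_eq (by ring))

namespace VolterraData

variable {E : Type*} [NormedAddCommGroup E] [NormedSpace ℂ E] (D : VolterraData E)

/-- `(1 + y)ⁿ V` is integrable on the half line. -/
def Moment (n : ℕ) : Prop := IntegrableOn (fun y => (1 + y) ^ n * ‖D.V y‖) (Set.Ioi 0)

variable {D}

theorem Moment.of_le {n : ℕ} (h : D.Moment n) {w : ℝ → ℝ} (hw : Continuous w) {C : ℝ}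
    (hC : ∀ y, 0 ≤ y → |w y| ≤ C * (1 + y) ^ n) :
    IntegrableOn (fun y => w y * ‖D.V y‖) (Set.Ioi 0) := by
  have hV := D.continuous_V
  refine Integrable.mono' (h.const_mul C) (Continuous.aestronglyMeasurable (by fun_prop)) ?_
  filter_upwards [ae_restrict_mem measurableSet_Ioi] with y hy
  rw [norm_mul, norm_norm, Real.norm_eq_abs, ← mul_assoc]
  exact mul_le_mul_of_nonneg_right (hC y (le_of_lt hy)) (norm_nonneg _)

theorem Moment.pow {n k : ℕ} (h : D.Moment n) (hk : k ≤ n) (c : ℝ) :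
    IntegrableOn (fun y => c * y ^ k * ‖D.V y‖) (Set.Ioi 0) := by
  refine h.of_le (by fun_prop) (C := |c|) fun y hy => ?_
  rw [abs_mul, abs_of_nonneg (pow_nonneg hy k)]
  refine mul_le_mul_of_nonneg_left ?_ (abs_nonneg _)
  calc y ^ k ≤ (1 + y) ^ k := by gcongr; linarith
    _ ≤ (1 + y) ^ n := pow_le_pow_right₀ (by linarith) hk

theorem phi_dominates {n j : ℕ} (h : D.Moment n) (hj : j + 1 ≤ n) (ζ : ℝ) :
    D.Dominates (fun y => 2 ^ j * y ^ (j + 1)) (phi j ζ) :=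
  ⟨fun s y hs hy => (norm_phi_le j ζ hs).trans (by dsimp only; gcongr), h.pow hj _⟩

theorem phi_mem {n j : ℕ} (h : D.Moment n) (hj : j + 1 ≤ n) (ζ : ℝ) : phi j ζ ∈ D.goodKernel :=
  ⟨continuous_phi j ζ, _, phi_dominates h hj ζ⟩

theorem phi_dominates_div {n j : ℕ} (h : D.Moment n) (hj : j ≤ n) {ζ : ℝ} (hζ : ζ ≠ 0) :
    D.Dominates (fun y => 2 ^ j * (j + 1) / |ζ| * y ^ j) (phi j ζ) :=
  ⟨fun s y hs hy => (norm_phi_le_div j hζ hs).trans (by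
    have : s ^ j ≤ y ^ j := pow_le_pow_left₀ hs hy j
    dsimp only
    rw [mul_div_right_comm]
    gcongr), h.pow hj _⟩

theorem phi_mem_of_ne {n j : ℕ} (h : D.Moment n) (hj : j ≤ n) {ζ : ℝ} (hζ : ζ ≠ 0) :
    phi j ζ ∈ D.goodKernel :=
  ⟨continuous_phi j ζ, _, phi_dominates_div h hj hζ⟩

theorem phi_dominates_min {n j : ℕ} (h : D.Moment n) (hj : j ≤ n) {ζ : ℝ} (hζ : ζ ≠ 0) :
    D.Dominates (fun y => 2 ^ j * (j + 1) * min (y ^ (j + 1)) (y ^ j / |ζ|)) (phi j ζ) := by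
  have hζ' : 0 < |ζ| := abs_pos.2 hζ
  refine ⟨fun s y hs hy => ?_, ?_⟩
  · have hy0 := hs.trans hy
    have hp : s ^ j ≤ y ^ j := pow_le_pow_left₀ hs hy j
    have hp1 : s ^ (j + 1) ≤ y ^ (j + 1) := pow_le_pow_left₀ hs hy _
    dsimp only
    rw [mul_min_of_nonneg _ _ (by positivity)]
    refine le_min ((norm_phi_le j ζ hs).trans ?_) ((norm_phi_le_div j hζ hs).trans ?_)
    · have : (2 : ℝ) ^ j * 1 ≤ 2 ^ j * (j + 1) := by gcongr; linarith [(Nat.cast_nonneg j : (0:ℝ) ≤ j)]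
      rw [mul_one] at this
      gcongr
    · rw [mul_div_assoc]
      gcongr
  · refine h.of_le (by fun_prop) (C := 2 ^ j * (j + 1) / |ζ|) fun y hy => ?_
    rw [abs_of_nonneg (by positivity), div_mul_eq_mul_div, mul_div_assoc]
    refine mul_le_mul_of_nonneg_left ((min_le_right _ _).trans ?_) (by positivity)
    gcongr
    calc y ^ j ≤ (1 + y) ^ j := by gcongr; linarith
      _ ≤ (1 + y) ^ n := pow_le_pow_right₀ (by linarith) hj

open Classical in
/-- A kernel as an element of the space of admissible kernels (zero if it is not admissible). -/
def lift (κ : ℝ → ℂ) : D.goodKernel := if h : κ ∈ D.goodKernel then ⟨κ, h⟩ else 0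

theorem coe_lift {κ : ℝ → ℂ} (h : κ ∈ D.goodKernel) : ((lift κ : D.goodKernel) : ℝ → ℂ) = κ := by
  simp [lift, h]

variable (D) in
/-- The Volterra operator with kernel `phi j ζ`. -/
def phiOp (j : ℕ) (ζ : ℝ) : (ℝ →ᵇ E) →L[ℂ] (ℝ →ᵇ E) := op (lift (phi j ζ) : D.goodKernel)

theorem norm_phiOp_le {j : ℕ} {ζ : ℝ} {w : ℝ → ℝ} (h : D.Dominates w (phi j ζ)) :
    ‖D.phiOp j ζ‖ ≤ ∫ y in Set.Ioi 0, w y * ‖D.V y‖ := by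
  refine norm_op_le ?_
  rwa [coe_lift ⟨continuous_phi j ζ, w, h⟩]

theorem continuous_phiOp {n j : ℕ} (h : D.Moment n) (hj : j + 1 ≤ n) : Continuous (D.phiOp j) := by
  rw [continuous_iff_continuousAt]
  intro ζ₀
  refine continuousAt_op (w₁ := fun y => 2 * 2 ^ j * y ^ (j + 1))
    (w₂ := fun y => 2 ^ (j + 1) * y ^ (j + 2)) (h.pow hj _) (by fun_prop) (by fun_prop)
    (fun y hy => ⟨by positivity, by positivity⟩) (Eventually.of_forall fun ζ s y hs hy => ?_)
  rw [coe_lift (phi_mem h hj ζ), coe_lift (phi_mem h hj ζ₀)]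
  have hy0 := hs.trans hy
  refine le_min ?_ ((norm_phi_sub_le j ζ ζ₀ hs).trans (by gcongr))
  refine ((norm_sub_le _ _).trans (add_le_add (norm_phi_le j ζ hs) (norm_phi_le j ζ₀ hs))).trans ?_
  have : s ^ (j + 1) ≤ y ^ (j + 1) := pow_le_pow_left₀ hs hy _
  have := mul_le_mul_of_nonneg_left this (show (0 : ℝ) ≤ 2 ^ j by positivity)
  linarith

/-- The derivative kernel of order j + 1 is bounded by a multiple of y^{j+2}, which is the moment
used; the estimate holds at ζ₀ = 0 as well. -/
theorem hasDerivAt_phiOp {n j : ℕ} (h : D.Moment n) (hj : j + 2 ≤ n) (ζ₀ : ℝ) :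
    HasDerivAt (D.phiOp j) (D.phiOp (j + 1) ζ₀) ζ₀ := by
  refine hasDerivAt_op (w₁ := fun y => 2 * 2 ^ (j + 1) * y ^ (j + 2))
    (w₂ := fun y => 2 ^ (j + 3) * y ^ (j + 3)) (h.pow hj _) (by fun_prop) (by fun_prop)
    (fun y hy => ⟨by positivity, by positivity⟩) (Eventually.of_forall fun ζ s y hs hy => ?_)
  rw [coe_lift (phi_mem h (by omega) ζ), coe_lift (phi_mem h (by omega) ζ₀),
    coe_lift (phi_mem h hj ζ₀)]
  have hy0 := hs.trans hy
  rw [mul_min_of_nonneg _ _ (abs_nonneg _)]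
  refine le_min ?_ ((norm_phi_sub_sub_le j ζ ζ₀ hs).trans (by gcongr))
  rw [mul_assoc 2]
  refine norm_phi_sub_sub_le_of_bound j (δ := |ζ - ζ₀| + 1) hs (by linarith) fun ξ _ => ?_
  exact (norm_phi_le (j + 1) ξ hs).trans (by gcongr)

/-- Away from ζ = 0 the derivative kernel is bounded by a multiple of y^{j+1}/|ζ|, so one moment
fewer is needed than in `hasDerivAt_phiOp`. This is the source of the last derivative, which exists
only off |z| = 1. -/
theorem hasDerivAt_phiOp_of_ne {n j : ℕ} (h : D.Moment n) (hj : j + 1 ≤ n) {ζ₀ : ℝ} (hζ₀ : ζ₀ ≠ 0) :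
    HasDerivAt (D.phiOp j) (D.phiOp (j + 1) ζ₀) ζ₀ := by
  have hpos : 0 < |ζ₀| := abs_pos.2 hζ₀
  refine hasDerivAt_op (w₁ := fun y => 2 * (2 ^ (j + 1) * (j + 2) / (|ζ₀| / 2)) * y ^ (j + 1))
    (w₂ := fun y => 2 ^ (j + 3) * y ^ (j + 3)) (h.pow hj _) (by fun_prop) (by fun_prop)
    (fun y hy => ⟨by positivity, by positivity⟩) ?_
  -- On the ball of radius |ζ₀|/2 every ξ satisfies |ξ| ≥ |ζ₀|/2, so the bound by 1/|ξ| is uniform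
  -- there.
  filter_upwards [Metric.ball_mem_nhds ζ₀ (half_pos hpos)] with ζ hζ s y hs hy
  rw [Metric.mem_ball, Real.dist_eq] at hζ
  have hbd : ∀ ξ, |ξ - ζ₀| < |ζ₀| / 2 → |ζ₀| / 2 ≤ |ξ| := by
    intro ξ hξ
    have := abs_sub_abs_le_abs_sub ζ₀ ξ
    rw [abs_sub_comm] at this
    linarith
  rw [coe_lift (phi_mem h (by omega) ζ), coe_lift (phi_mem h (by omega) ζ₀),
    coe_lift (phi_mem_of_ne h hj hζ₀)]
  have hy0 := hs.trans hy
  rw [mul_min_of_nonneg _ _ (abs_nonneg _)]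
  refine le_min ?_ ((norm_phi_sub_sub_le j ζ ζ₀ hs).trans (by gcongr))
  rw [mul_assoc 2]
  refine norm_phi_sub_sub_le_of_bound j hs hζ fun ξ hξ => ?_
  have hξ' := hbd ξ hξ
  have hξ0 : ξ ≠ 0 := by
    rintro rfl
    rw [abs_zero] at hξ'
    linarith
  refine (norm_phi_le_div (j + 1) hξ0 hs).trans ?_
  have hp : s ^ (j + 1) ≤ y ^ (j + 1) := pow_le_pow_left₀ hs hy _
  rw [div_mul_eq_mul_div]
  push_cast
  rw [show (j : ℝ) + 1 + 1 = j + 2 by ring]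
  gcongr

end VolterraData

/-! ### The Volterra equation of the Jost solution -/

/-- A `2 × 2` matrix acting on `ℂ²`. -/
def matCLM (M : Matrix (Fin 2) (Fin 2) ℂ) : (Fin 2 → ℂ) →L[ℂ] (Fin 2 → ℂ) :=
  LinearMap.toContinuousLinearMap (Matrix.toLin' M)

theorem matCLM_apply (M : Matrix (Fin 2) (Fin 2) ℂ) (v : Fin 2 → ℂ) : matCLM M v = M.mulVec v := by
  simp [matCLM]

theorem norm_matCLM_le {M : Matrix (Fin 2) (Fin 2) ℂ} (hM : ∀ i, ‖M i 0‖ + ‖M i 1‖ ≤ 1) :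
    ‖matCLM M‖ ≤ 1 := by
  refine ContinuousLinearMap.opNorm_le_bound _ zero_le_one fun v => ?_
  rw [one_mul, matCLM_apply]
  refine (pi_norm_le_iff_of_nonneg (norm_nonneg _)).2 fun i => ?_
  simp only [Matrix.mulVec, dotProduct, Fin.sum_univ_two]
  calc ‖M i 0 * v 0 + M i 1 * v 1‖ ≤ ‖M i 0‖ * ‖v‖ + ‖M i 1‖ * ‖v‖ := by
        refine (norm_add_le _ _).trans ?_
        rw [norm_mul, norm_mul]
        gcongr <;> exact norm_le_pi_norm v _
    _ = (‖M i 0‖ + ‖M i 1‖) * ‖v‖ := by ring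
    _ ≤ 1 * ‖v‖ := by gcongr; exact hM i
    _ = ‖v‖ := one_mul _

/-- The perturbation `i σ₃ (Q - σ₁)` for `q = 1 + p`. -/
def pertV (p : ℝ → ℂ) (y : ℝ) : (Fin 2 → ℂ) →L[ℂ] (Fin 2 → ℂ) :=
  conj (p y) • matCLM !![0, Complex.I; 0, 0] + p y • matCLM !![0, 0; -Complex.I, 0]

theorem pertV_apply (p : ℝ → ℂ) (y : ℝ) (v : Fin 2 → ℂ) :
    pertV p y v = ![Complex.I * conj (p y) * v 1, -Complex.I * p y * v 0] := by
  ext i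
  fin_cases i <;> simp [pertV, matCLM_apply, dotProduct, Fin.sum_univ_two] <;> ring

theorem continuous_pertV {p : ℝ → ℂ} (hp : Continuous p) : Continuous (pertV p) := by
  unfold pertV
  have : Continuous fun y => conj (p y) := Complex.continuous_conj.comp hp
  fun_prop

theorem norm_pertV_le (p : ℝ → ℂ) (y : ℝ) : ‖pertV p y‖ ≤ 2 * ‖p y‖ := by
  have h1 : ‖matCLM !![0, Complex.I; 0, 0]‖ ≤ 1 :=
    norm_matCLM_le fun i => by fin_cases i <;> simp
  have h2 : ‖matCLM !![0, 0; -Complex.I, 0]‖ ≤ 1 :=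
    norm_matCLM_le fun i => by fin_cases i <;> simp
  calc ‖pertV p y‖ ≤ ‖conj (p y) • matCLM !![0, Complex.I; 0, 0]‖ +
        ‖p y • matCLM !![0, 0; -Complex.I, 0]‖ := norm_add_le _ _
    _ ≤ ‖p y‖ * 1 + ‖p y‖ * 1 := by
        rw [norm_smul, norm_smul, RCLike.norm_conj]
        gcongr
    _ = 2 * ‖p y‖ := by ring

/-- The weight exponent making the Volterra operators contractive. -/
def weightExp (p : ℝ → ℂ) (x : ℝ) : ℝ := -(16 * ∫ y in (0 : ℝ)..x, (1 + |y|) * ‖pertV p y‖)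

theorem hasDerivAt_weightExp {p : ℝ → ℂ} (hp : Continuous p) (x : ℝ) :
    HasDerivAt (weightExp p) (-(16 * ((1 + |x|) * ‖pertV p x‖))) x := by
  have hV := continuous_pertV hp
  have hc : Continuous fun y => (1 + |y|) * ‖pertV p y‖ := by fun_prop
  exact ((hc.integral_hasStrictDerivAt 0 x).hasDerivAt.const_mul 16).neg

theorem weightExp_zero (p : ℝ → ℂ) : weightExp p 0 = 0 := by simp [weightExp]

/-- The Volterra data of the Jost solution for the potential `1 + p`. -/
def jostData (p : ℝ → ℂ) (hp : Continuous p) : VolterraData (Fin 2 → ℂ) where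
  V := pertV p
  γ := weightExp p
  continuous_V := continuous_pertV hp
  continuous_γ := continuous_iff_continuousAt.2 fun x => (hasDerivAt_weightExp hp x).continuousAt
  anti := by
    intro x y _ hxy
    refine antitone_of_hasDerivAt_nonpos (fun x => hasDerivAt_weightExp hp x) (fun x => ?_) hxy
    have : 0 ≤ (1 + |x|) * ‖pertV p x‖ := by positivity
    change -(16 * ((1 + |x|) * ‖pertV p x‖)) ≤ 0
    linarith

section

variable {p : ℝ → ℂ} {hp : Continuous p}

theorem integrableOn_weighted (h : (jostData p hp).Moment 1) {x : ℝ} (hx : 0 ≤ x) :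
    IntegrableOn (fun y => (1 + y) * ‖pertV p y‖ * Real.exp (weightExp p y - weightExp p x))
      (Set.Ioi x) := by
  have hV := continuous_pertV hp
  have hγ : Continuous (weightExp p) := (jostData p hp).continuous_γ
  have h1 : IntegrableOn (fun y => (1 + y) * ‖pertV p y‖) (Set.Ioi x) := by
    have : IntegrableOn (fun y => (1 + y) ^ 1 * ‖pertV p y‖) (Set.Ioi 0) := h
    simp only [pow_one] at this
    exact this.mono_set (Set.Ioi_subset_Ioi hx)
  refine Integrable.mono' h1 (Continuous.aestronglyMeasurable (by fun_prop)) ?_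
  filter_upwards [ae_restrict_mem measurableSet_Ioi] with y hy
  have hy' : x < y := hy
  have h0 : 0 ≤ 1 + y := by linarith
  rw [Real.norm_of_nonneg (by positivity)]
  refine mul_le_of_le_one_right (by positivity) ?_
  rw [Real.exp_le_one_iff]
  have h2 : weightExp p y ≤ weightExp p x := (jostData p hp).anti x y hx hy'.le
  linarith

theorem tendsto_weightExp (h : (jostData p hp).Moment 1) :
    ∃ L, Tendsto (weightExp p) atTop (𝓝 L) := by
  have h1 : IntegrableOn (fun y => (1 + |y|) * ‖pertV p y‖) (Set.Ioi 0) := by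
    have : IntegrableOn (fun y => (1 + y) ^ 1 * ‖pertV p y‖) (Set.Ioi 0) := h
    refine this.congr_fun (fun y hy => ?_) measurableSet_Ioi
    simp only [pow_one, abs_of_pos (Set.mem_Ioi.1 hy)]
  exact ⟨_, ((intervalIntegral_tendsto_integral_Ioi 0 h1 tendsto_id).const_mul 16).neg⟩

/-- Since γ' = -16(1 + y)‖V‖ for y ≥ 0, the integrand is the derivative of -e^{γ(y)-γ(x)}/16. The
bound is therefore independent of the size of V. -/
theorem integral_weighted_le (h : (jostData p hp).Moment 1) {x : ℝ} (hx : 0 ≤ x) :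
    ∫ y in Set.Ioi x, (1 + y) * ‖pertV p y‖ * Real.exp (weightExp p y - weightExp p x) ≤ 1 / 16 := by
  obtain ⟨L, hL⟩ := tendsto_weightExp h
  have hd : ∀ y ∈ Set.Ici x, HasDerivAt (fun y => -(1 / 16) * Real.exp (weightExp p y - weightExp p x))
      ((1 + y) * ‖pertV p y‖ * Real.exp (weightExp p y - weightExp p x)) y := by
    intro y hy
    have h1 := (((hasDerivAt_weightExp hp y).sub_const (weightExp p x)).exp).const_mul (-(1 / 16) : ℝ)
    rw [abs_of_nonneg (hx.trans hy)] at h1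
    refine h1.congr_deriv ?_
    ring
  have ht : Tendsto (fun y => -(1 / 16) * Real.exp (weightExp p y - weightExp p x)) atTop
      (𝓝 (-(1 / 16) * Real.exp (L - weightExp p x))) :=
    ((Real.continuous_exp.tendsto _).comp (hL.sub_const _)).const_mul _
  rw [integral_Ioi_of_hasDerivAt_of_tendsto' hd (integrableOn_weighted h hx) ht]
  simp only [sub_self, Real.exp_zero]
  have := Real.exp_nonneg (L - weightExp p x)
  linarith

/-- Linear growth of the kernel is exactly what the weight can absorb; it is the growth of φ₀ at ζ =
0. -/
theorem norm_op_le_weighted (h : (jostData p hp).Moment 1) {κ : (jostData p hp).goodKernel} {A : ℝ}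
    (hA : 0 ≤ A) (hκ : ∀ s, 0 ≤ s → ‖(κ : ℝ → ℂ) s‖ ≤ A * (1 + s)) :
    ‖VolterraData.op κ‖ ≤ A / 16 := by
  refine VolterraData.norm_op_le_of_forall (w := fun y => A * ((1 + y) * ‖pertV p y‖)) (by positivity)
    (fun x y hx hy => ?_) (fun x hx => ?_) (fun x hx => ?_)
  · have h1 := hκ (y - x) (by linarith)
    have h2 : A * (1 + (y - x)) ≤ A * (1 + y) := by gcongr; linarith
    calc _ ≤ A * (1 + y) * ‖pertV p y‖ := mul_le_mul_of_nonneg_right (h1.trans h2) (norm_nonneg _)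
      _ = _ := by ring
  · simpa only [mul_assoc] using! (integrableOn_weighted h hx).const_mul A
  · have := mul_le_mul_of_nonneg_left (integral_weighted_le h hx) hA
    rw [← integral_const_mul] at this
    simp only [← mul_assoc] at this ⊢
    exact this.trans_eq (by ring)

end

/-! The nilpotent part of the unperturbed system. -/

/-- `N(z) = i [[-1/z, 1], [-1, z]]`. -/
def matN (z : ℝ) : (Fin 2 → ℂ) →L[ℂ] (Fin 2 → ℂ) :=
  z⁻¹ • matCLM !![-Complex.I, 0; 0, 0] + matCLM !![0, Complex.I; -Complex.I, 0] +
    z • matCLM !![0, 0; 0, Complex.I]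

theorem matN_apply (z : ℝ) (v : Fin 2 → ℂ) :
    matN z v = ![-Complex.I * (z : ℂ)⁻¹ * v 0 + Complex.I * v 1,
      -Complex.I * v 0 + Complex.I * z * v 1] := by
  ext i
  fin_cases i <;> simp [matN, matCLM_apply, dotProduct, Fin.sum_univ_two] <;> ring

/-- N has determinant zero and trace 2iζ, so this is Cayley–Hamilton. It makes exp(-sN) affine in N,
and N nilpotent at z = ±1. -/
theorem matN_matN {z : ℝ} (hz : z ≠ 0) (v : Fin 2 → ℂ) :
    matN z (matN z v) = (2 * Complex.I * spectralZeta z) • matN z v := by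
  have hz' : (z : ℂ) ≠ 0 := by exact_mod_cast hz
  ext i
  have hI := Complex.I_sq
  fin_cases i
  · simp [matN_apply, spectralZeta]
    field_simp
    ring_nf
  · simp [matN_apply, spectralZeta]
    field_simp
    ring_nf

/-- The boundary value `(1, 1/z)`. -/
def vecE (z : ℝ) : Fin 2 → ℂ := ![1, (z : ℂ)⁻¹]

theorem matN_vecE {z : ℝ} (hz : z ≠ 0) : matN z (vecE z) = 0 := by
  have hz' : (z : ℂ) ≠ 0 := by exact_mod_cast hz
  ext i
  fin_cases i
  · simp [matN_apply, vecE]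
  · simp [matN_apply, vecE, hz']

/-- The evolution `exp(-s N(z))`. -/
def evol (z s : ℝ) : (Fin 2 → ℂ) →L[ℂ] (Fin 2 → ℂ) :=
  ContinuousLinearMap.id ℂ _ + phi 0 (spectralZeta z) s • matN z

theorem evol_apply (z s : ℝ) (v : Fin 2 → ℂ) :
    evol z s v = v + phi 0 (spectralZeta z) s • matN z v := rfl

theorem hasDerivAt_phi_zero (ζ s : ℝ) :
    HasDerivAt (phi 0 ζ) (-Complex.exp (-2 * Complex.I * ζ * s)) s := by
  have hc : Continuous fun t : ℝ => Complex.exp (-2 * Complex.I * ζ * t) := by fun_prop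
  have := (hc.integral_hasStrictDerivAt 0 s).hasDerivAt.neg
  unfold phi
  simpa using! this

theorem phi_zero_zero (j : ℕ) (ζ : ℝ) : phi j ζ 0 = 0 := by simp [phi]

theorem two_I_mul_phi_zero (ζ s : ℝ) :
    2 * Complex.I * ζ * phi 0 ζ s = Complex.exp (-2 * Complex.I * ζ * s) - 1 := by
  have h : ∀ t ∈ Set.uIcc 0 s, HasDerivAt (fun t : ℝ => Complex.exp (-2 * Complex.I * ζ * t))
      (Complex.exp (-2 * Complex.I * ζ * t) * (-2 * Complex.I * ζ)) t := by
    intro t _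
    have h1 : HasDerivAt (fun t : ℝ => (-2 * Complex.I * ζ * t : ℂ)) (-2 * Complex.I * ζ) t := by
      simpa using (Complex.ofRealCLM.hasDerivAt (x := t)).const_mul (-2 * Complex.I * ζ : ℂ)
    exact h1.cexp
  have := intervalIntegral.integral_eq_sub_of_hasDerivAt h
    (Continuous.intervalIntegrable (by fun_prop) _ _)
  rw [intervalIntegral.integral_mul_const] at this
  simp only [Complex.ofReal_zero, mul_zero, Complex.exp_zero] at this
  rw [← this]
  simp only [phi, pow_zero, one_mul]
  ring

theorem phi_zero_add (ζ s t : ℝ) :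
    phi 0 ζ (s + t) = phi 0 ζ s + Complex.exp (-2 * Complex.I * ζ * s) * phi 0 ζ t := by
  unfold phi
  simp only [pow_zero, one_mul]
  rw [mul_neg, ← neg_add, neg_inj, ← intervalIntegral.integral_const_mul]
  have h1 : ∫ x in (0 : ℝ)..t, Complex.exp (-2 * Complex.I * ζ * s) * Complex.exp (-2 * Complex.I * ζ * x)
      = ∫ x in s..s + t, Complex.exp (-2 * Complex.I * ζ * x) := by
    have := intervalIntegral.integral_comp_add_left (a := 0) (b := t)
      (fun x : ℝ => Complex.exp (-2 * Complex.I * ζ * x)) s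
    rw [add_zero] at this
    rw [← this]
    refine intervalIntegral.integral_congr fun x _ => ?_
    rw [← Complex.exp_add]
    push_cast
    ring_nf
  rw [h1, intervalIntegral.integral_add_adjacent_intervals
    (Continuous.intervalIntegrable (by fun_prop) _ _) (Continuous.intervalIntegrable (by fun_prop) _ _)]

/-- On the range of N the evolution is multiplication by e^{-2iζs}, because N² = 2iζN and 2iζφ₀ =
e^{-2iζs} - 1. -/
theorem matN_evol {z : ℝ} (hz : z ≠ 0) (s : ℝ) (v : Fin 2 → ℂ) :
    matN z (evol z s v) = Complex.exp (-2 * Complex.I * spectralZeta z * s) • matN z v := by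
  rw [evol_apply, map_add, map_smul, matN_matN hz, smul_smul]
  have h := two_I_mul_phi_zero (spectralZeta z) s
  rw [show phi 0 (spectralZeta z) s * (2 * Complex.I * spectralZeta z) =
    Complex.exp (-2 * Complex.I * spectralZeta z * s) - 1 by rw [← h]; ring, sub_smul, one_smul]
  abel

/-- The group law separates x from y in the Volterra kernel, which turns the integral equation into
a statement about a tail integral with fixed integrand. -/
theorem evol_add {z : ℝ} (hz : z ≠ 0) (s t : ℝ) (v : Fin 2 → ℂ) :
    evol z (s + t) v = evol z s (evol z t v) := by
  rw [evol_apply z s, matN_evol hz, evol_apply, evol_apply, add_comm s t, phi_zero_add, add_smul,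
    smul_smul, add_assoc, mul_comm (phi 0 (spectralZeta z) s)]

theorem evol_zero (z : ℝ) (v : Fin 2 → ℂ) : evol z 0 v = v := by
  rw [evol_apply, phi_zero_zero, zero_smul, add_zero]

theorem evol_vecE {z : ℝ} (hz : z ≠ 0) (s : ℝ) : evol z s (vecE z) = vecE z := by
  rw [evol_apply, matN_vecE hz, smul_zero, add_zero]

theorem continuous_evol (z : ℝ) : Continuous (evol z) := by
  unfold evol
  have := continuous_phi 0 (spectralZeta z)
  fun_prop

/-! ### Inversion of the Volterra operator, uniformly for |z| ≥ 1/4 -/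

theorem isUnit_one_add_of_norm_le {A : Type*} [NormedRing A] [HasSummableGeomSeries A] {x : A}
    (hx : ‖x‖ ≤ 1 / 2) : IsUnit (1 + x) := by
  have := isUnit_one_sub_of_norm_lt_one (x := -x) (by rw [norm_neg]; linarith)
  rwa [sub_neg_eq_add] at this

theorem norm_inverse_one_add_le {A : Type*} [NormedRing A] [HasSummableGeomSeries A] {x : A}
    (h1 : ‖(1 : A)‖ ≤ 1) (hx : ‖x‖ ≤ 1 / 2) : ‖Ring.inverse (1 + x)‖ ≤ 2 := by
  have e := Ring.inverse_mul_cancel _ (isUnit_one_add_of_norm_le hx)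
  rw [mul_add, mul_one] at e
  set R := Ring.inverse (1 + x)
  have e2 : R = 1 - R * x := eq_sub_of_add_eq e
  have h2 : ‖R‖ ≤ 1 + ‖R‖ * (1 / 2) := by
    calc ‖R‖ = ‖1 - R * x‖ := by rw [← e2]
      _ ≤ ‖(1 : A)‖ + ‖R * x‖ := norm_sub_le _ _
      _ ≤ 1 + ‖R‖ * (1 / 2) := by
          refine add_le_add h1 ((norm_mul_le _ _).trans ?_)
          gcongr
  linarith

theorem norm_compLeft_le {M : Matrix (Fin 2) (Fin 2) ℂ} (hM : ∀ i, ‖M i 0‖ + ‖M i 1‖ ≤ 1) :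
    ‖(matCLM M).compLeftContinuousBounded ℝ‖ ≤ 1 := by
  refine ContinuousLinearMap.opNorm_le_bound _ zero_le_one fun f => ?_
  rw [one_mul]
  refine (BoundedContinuousFunction.norm_le (norm_nonneg _)).2 fun x => ?_
  refine ((matCLM M).le_of_opNorm_le_of_le (norm_matCLM_le hM) (f.norm_coe_le_norm x)).trans_eq
    (one_mul _)

/-- Pointwise application of `N(z)`. -/
def opN (z : ℝ) : (ℝ →ᵇ (Fin 2 → ℂ)) →L[ℂ] (ℝ →ᵇ (Fin 2 → ℂ)) :=
  z⁻¹ • (matCLM !![-Complex.I, 0; 0, 0]).compLeftContinuousBounded ℝ +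
    (matCLM !![0, Complex.I; -Complex.I, 0]).compLeftContinuousBounded ℝ +
    z • (matCLM !![0, 0; 0, Complex.I]).compLeftContinuousBounded ℝ

theorem norm_opN_le (z : ℝ) : ‖opN z‖ ≤ |z|⁻¹ + 1 + |z| := by
  set A₁ := (matCLM !![-Complex.I, 0; 0, 0]).compLeftContinuousBounded ℝ with hA₁
  set A₂ := (matCLM !![0, Complex.I; -Complex.I, 0]).compLeftContinuousBounded ℝ with hA₂
  set A₃ := (matCLM !![0, 0; 0, Complex.I]).compLeftContinuousBounded ℝ with hA₃
  have h0 : ‖opN z‖ ≤ ‖z⁻¹ • A₁‖ + ‖A₂‖ + ‖z • A₃‖ :=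
    (norm_add_le (z⁻¹ • A₁ + A₂) (z • A₃)).trans
      (add_le_add (norm_add_le (z⁻¹ • A₁) A₂) le_rfl)
  have h0' : ‖z⁻¹ • A₁‖ ≤ |z|⁻¹ * ‖A₁‖ := by
    have := norm_smul_le z⁻¹ A₁
    rwa [norm_inv, Real.norm_eq_abs] at this
  have h0'' : ‖z • A₃‖ ≤ |z| * ‖A₃‖ := norm_smul_le z A₃
  have h1 := norm_compLeft_le (M := !![-Complex.I, 0; 0, 0]) fun i => by fin_cases i <;> simp
  have h2 := norm_compLeft_le (M := !![0, Complex.I; -Complex.I, 0]) fun i => by fin_cases i <;> simp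
  have h3 := norm_compLeft_le (M := !![0, 0; 0, Complex.I]) fun i => by fin_cases i <;> simp
  have h4 := mul_le_mul_of_nonneg_left h1 (inv_nonneg.2 (abs_nonneg z))
  have h5 := mul_le_mul_of_nonneg_left h3 (abs_nonneg z)
  linarith

theorem abs_spectralZeta_ge {z : ℝ} (hz : 2 ≤ |z|) : 3 / 8 * |z| ≤ |spectralZeta z| := by
  have hz0 : 0 < |z| := by linarith
  have h1 : |z|⁻¹ ≤ |z| / 4 := by
    rw [inv_le_comm₀ hz0 (by positivity), inv_div, div_le_iff₀ hz0]
    nlinarith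
  have h2 := abs_sub_abs_le_abs_sub z z⁻¹
  rw [abs_inv] at h2
  unfold spectralZeta
  rw [abs_div, abs_two]
  linarith

section

variable {p : ℝ → ℂ} {hp : Continuous p}

theorem one_mem_goodKernel {n : ℕ} (h : (jostData p hp).Moment n) :
    (fun _ => (1 : ℂ)) ∈ (jostData p hp).goodKernel := by
  refine ⟨continuous_const, fun _ => 1, fun s y _ _ => by simp, ?_⟩
  simpa using h.pow (Nat.zero_le n) 1

variable (p hp) in
/-- The Volterra operator of the Jost solution. -/
def jostOp (z : ℝ) : (ℝ →ᵇ (Fin 2 → ℂ)) →L[ℂ] (ℝ →ᵇ (Fin 2 → ℂ)) :=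
  VolterraData.op (VolterraData.lift (fun _ => (1 : ℂ)) : (jostData p hp).goodKernel) +
    opN z * (jostData p hp).phiOp 0 (spectralZeta z)

/-- The identity part of the evolution contributes 1/16. For |z| ≤ 2 the bound |φ₀| ≤ s suffices, as
‖N‖ ≤ 7. For |z| ≥ 2 the norm of N grows like |z|, and |φ₀| ≤ 1/|ζ| compensates this. The threshold
1/4 leaves an open neighbourhood around the annulus 1/2 ≤ |z| ≤ 2. -/
theorem norm_jostOp_le (h : (jostData p hp).Moment 1) {z : ℝ} (hz : 1 / 4 ≤ |z|) :
    ‖jostOp p hp z‖ ≤ 1 / 2 := by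
  have hz0 : 0 < |z| := by linarith
  have h1 : ‖VolterraData.op (VolterraData.lift (fun _ => (1 : ℂ)) : (jostData p hp).goodKernel)‖
      ≤ 1 / 16 := by
    refine norm_op_le_weighted h zero_le_one fun s hs => ?_
    rw [VolterraData.coe_lift (one_mem_goodKernel h), norm_one]
    linarith
  have hmem := VolterraData.phi_mem h (le_refl _) (spectralZeta z) (j := 0)
  have h2 : ‖opN z‖ * ‖(jostData p hp).phiOp 0 (spectralZeta z)‖ ≤ 7 / 16 := by
    rcases le_total |z| 2 with hz2 | hz2
    · have h3 : ‖(jostData p hp).phiOp 0 (spectralZeta z)‖ ≤ 1 / 16 := by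
        refine norm_op_le_weighted h zero_le_one fun s hs => ?_
        rw [VolterraData.coe_lift hmem]
        refine (norm_phi_le 0 _ hs).trans ?_
        simp
      have h4 : ‖opN z‖ ≤ 7 := by
        refine (norm_opN_le z).trans ?_
        have : |z|⁻¹ ≤ 4 := by
          rw [inv_le_comm₀ hz0 (by norm_num)]
          linarith
        linarith
      calc _ ≤ 7 * (1 / 16 : ℝ) := by gcongr
        _ = _ := by norm_num
    · have hge := abs_spectralZeta_ge hz2
      have hpos : 0 < |spectralZeta z| := by linarith
      have hne : spectralZeta z ≠ 0 := abs_pos.1 hpos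
      have h3 : ‖(jostData p hp).phiOp 0 (spectralZeta z)‖ ≤ (8 / 3 * |z|⁻¹) / 16 := by
        refine norm_op_le_weighted h (by positivity) fun s hs => ?_
        rw [VolterraData.coe_lift hmem]
        refine (norm_phi_le_div 0 hne hs).trans ?_
        simp only [pow_zero, CharP.cast_eq_zero, zero_add, mul_one]
        calc 1 / |spectralZeta z| ≤ 1 / (3 / 8 * |z|) := by gcongr
          _ = 8 / 3 * |z|⁻¹ := by field_simp
          _ ≤ 8 / 3 * |z|⁻¹ * (1 + s) := le_mul_of_one_le_right (by positivity) (by linarith)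
      have h4 : ‖opN z‖ ≤ 7 / 4 * |z| := by
        refine (norm_opN_le z).trans ?_
        have : |z|⁻¹ ≤ 1 / 2 := by
          rw [inv_le_comm₀ hz0 (by norm_num)]
          linarith
        linarith
      calc _ ≤ 7 / 4 * |z| * ((8 / 3 * |z|⁻¹) / 16) := by gcongr
        _ = 7 / 24 := by field_simp; norm_num
        _ ≤ _ := by norm_num
  unfold jostOp
  refine (norm_add_le _ _).trans ((add_le_add h1 ((norm_mul_le _ _).trans h2)).trans_eq (by norm_num))

theorem isUnit_one_add_jostOp (h : (jostData p hp).Moment 1) {z : ℝ} (hz : 1 / 4 ≤ |z|) :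
    IsUnit (1 + jostOp p hp z) :=
  isUnit_one_add_of_norm_le (A := (ℝ →ᵇ (Fin 2 → ℂ)) →L[ℂ] (ℝ →ᵇ (Fin 2 → ℂ)))
    (x := jostOp p hp z) (norm_jostOp_le h hz)

variable (p hp) in
/-- The resolvent `(1 + K_z)⁻¹`. -/
def jostRes (z : ℝ) : (ℝ →ᵇ (Fin 2 → ℂ)) →L[ℂ] (ℝ →ᵇ (Fin 2 → ℂ)) :=
  Ring.inverse (1 + jostOp p hp z)

theorem norm_jostRes_le (h : (jostData p hp).Moment 1) {z : ℝ} (hz : 1 / 4 ≤ |z|) :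
    ‖jostRes p hp z‖ ≤ 2 :=
  norm_inverse_one_add_le (A := (ℝ →ᵇ (Fin 2 → ℂ)) →L[ℂ] (ℝ →ᵇ (Fin 2 → ℂ)))
    (x := jostOp p hp z) ContinuousLinearMap.norm_id_le (norm_jostOp_le h hz)

theorem exists_exp_neg_weight_le (h : (jostData p hp).Moment 1) :
    ∃ C, ∀ x, 0 ≤ x → Real.exp (-weightExp p x) ≤ C := by
  obtain ⟨L, hL⟩ := tendsto_weightExp h
  refine ⟨Real.exp (-L), fun x hx => ?_⟩
  rw [Real.exp_le_exp, neg_le_neg_iff]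
  refine le_of_tendsto hL ?_
  filter_upwards [eventually_ge_atTop x] with y hy
  exact (jostData p hp).anti x y hx hy

/-- The function `e^{-γ} f` on the half line, extended by a constant. -/
def weighted (h : (jostData p hp).Moment 1) (f : ℝ → Fin 2 → ℂ) (hf : ContinuousOn f (Set.Ici 0))
    (hb : ∃ C, ∀ x, 0 ≤ x → ‖f x‖ ≤ C) : ℝ →ᵇ (Fin 2 → ℂ) :=
  BoundedContinuousFunction.ofNormedAddCommGroup
    (fun x => Real.exp (-weightExp p (max x 0)) • f (max x 0))
    (by
      have h1 : Continuous (weightExp p) := (jostData p hp).continuous_γ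
      have h2 : Continuous fun x : ℝ => max x 0 := by fun_prop
      have h3 : Continuous fun x : ℝ => f (max x 0) :=
        hf.comp_continuous h2 fun x => le_max_right x 0
      exact (Real.continuous_exp.comp (h1.comp h2).neg).smul h3)
    ((exists_exp_neg_weight_le h).choose * hb.choose)
    (fun x => by
      have h1 := (exists_exp_neg_weight_le h).choose_spec (max x 0) (le_max_right _ _)
      have h2 := hb.choose_spec (max x 0) (le_max_right _ _)
      rw [norm_smul, Real.norm_of_nonneg (Real.exp_nonneg _)]
      exact mul_le_mul h1 h2 (norm_nonneg _) ((Real.exp_nonneg _).trans h1))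

theorem weighted_apply (h : (jostData p hp).Moment 1) (f : ℝ → Fin 2 → ℂ)
    (hf : ContinuousOn f (Set.Ici 0)) (hb : ∃ C, ∀ x, 0 ≤ x → ‖f x‖ ≤ C) (x : ℝ) :
    weighted h f hf hb x = Real.exp (-weightExp p (max x 0)) • f (max x 0) := rfl

/-- The weighted constant vector. -/
def weightedConst (h : (jostData p hp).Moment 1) (v : Fin 2 → ℂ) : ℝ →ᵇ (Fin 2 → ℂ) :=
  weighted h (fun _ => v) continuousOn_const ⟨‖v‖, fun _ _ => le_rfl⟩

/-- The weighted boundary value. -/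
def jostRhs (h : (jostData p hp).Moment 1) (z : ℝ) : ℝ →ᵇ (Fin 2 → ℂ) :=
  weightedConst h ![1, 0] + z⁻¹ • weightedConst h ![0, 1]

theorem jostRhs_apply (h : (jostData p hp).Moment 1) (z x : ℝ) :
    jostRhs h z x = Real.exp (-weightExp p (max x 0)) • vecE z := by
  ext i
  fin_cases i <;> simp [jostRhs, weightedConst, weighted_apply, vecE, mul_comm]

/-- The weighted Jost solution. -/
def jostM (h : (jostData p hp).Moment 1) (z : ℝ) : ℝ →ᵇ (Fin 2 → ℂ) :=
  jostRes p hp z (jostRhs h z)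

/-- The normalized Jost solution `e^{iζx} ψ₁⁽⁺⁾(x; z)` on the half line. -/
def jostFun (h : (jostData p hp).Moment 1) (z x : ℝ) : Fin 2 → ℂ :=
  Real.exp (weightExp p x) • jostM h z x

theorem jostM_eq (h : (jostData p hp).Moment 1) {z : ℝ} (hz : 1 / 4 ≤ |z|) :
    jostM h z + jostOp p hp z (jostM h z) = jostRhs h z := by
  have e := Ring.mul_inverse_cancel _ (isUnit_one_add_jostOp h hz)
  have := congrArg (fun A : (ℝ →ᵇ (Fin 2 → ℂ)) →L[ℂ] (ℝ →ᵇ (Fin 2 → ℂ)) => A (jostRhs h z)) e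
  exact this

theorem eq_jostM (h : (jostData p hp).Moment 1) {z : ℝ} (hz : 1 / 4 ≤ |z|)
    {f : ℝ →ᵇ (Fin 2 → ℂ)} (hf : f + jostOp p hp z f = jostRhs h z) : f = jostM h z := by
  have e := Ring.inverse_mul_cancel _ (isUnit_one_add_jostOp h hz)
  have := congrArg (fun A : (ℝ →ᵇ (Fin 2 → ℂ)) →L[ℂ] (ℝ →ᵇ (Fin 2 → ℂ)) => A f) e
  simp only [mul_apply_eq_comp, add_apply,
    one_apply_eq_self] at this
  rw [hf] at this
  exact this.symm

theorem jostOp_apply (h : (jostData p hp).Moment 1) (z : ℝ) (f : ℝ →ᵇ (Fin 2 → ℂ)) {x : ℝ}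
    (hx : 0 ≤ x) : jostOp p hp z f x =
      ∫ y in Set.Ioi x, Real.exp (weightExp p y - weightExp p x) • evol z (y - x) (pertV p y (f y)) := by
  have hm1 := one_mem_goodKernel h
  have hm2 := VolterraData.phi_mem h (le_refl _) (spectralZeta z) (j := 0)
  have hi1 := VolterraData.integrableOn_integrand hm1 f hx
  have hi2 := VolterraData.integrableOn_integrand hm2 f hx
  have e : jostOp p hp z f x =
      (VolterraData.op (VolterraData.lift (fun _ => (1 : ℂ)) : (jostData p hp).goodKernel) f) x +
      matN z ((jostData p hp).phiOp 0 (spectralZeta z) f x) := rfl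
  rw [e, VolterraData.phiOp, VolterraData.op_apply, VolterraData.op_apply, max_eq_left hx,
    VolterraData.coe_lift hm1, VolterraData.coe_lift hm2,
    ← ContinuousLinearMap.integral_comp_comm (matN z) hi2,
    ← integral_add hi1 (ContinuousLinearMap.integrable_comp (matN z) hi2)]
  refine integral_congr_ae (Eventually.of_forall fun y => ?_)
  simp only [VolterraData.integrand, evol_apply, one_mul, map_smul]
  change (Real.exp (weightExp p y - weightExp p x) : ℂ) • pertV p y (f y) +
    (phi 0 (spectralZeta z) (y - x) * (Real.exp (weightExp p y - weightExp p x) : ℂ)) •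
      matN z (pertV p y (f y)) = _
  rw [smul_add, mul_comm, mul_smul]
  rfl

theorem continuous_jostFun (h : (jostData p hp).Moment 1) (z : ℝ) : Continuous (jostFun h z) := by
  have h1 : Continuous (weightExp p) := (jostData p hp).continuous_γ
  unfold jostFun
  fun_prop

theorem norm_jostFun_le (h : (jostData p hp).Moment 1) (z : ℝ) {x : ℝ} (hx : 0 ≤ x) :
    ‖jostFun h z x‖ ≤ ‖jostM h z‖ := by
  have h1 : weightExp p x ≤ weightExp p 0 := (jostData p hp).anti 0 x le_rfl hx
  rw [weightExp_zero] at h1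
  unfold jostFun
  rw [norm_smul, Real.norm_of_nonneg (Real.exp_nonneg _)]
  exact (mul_le_of_le_one_left (norm_nonneg _) (Real.exp_le_one_iff.2 h1)).trans
    ((jostM h z).norm_coe_le_norm x)

/-- The Volterra equation of the normalized Jost solution. -/
def IsVolterraSol (p : ℝ → ℂ) (z : ℝ) (m : ℝ → Fin 2 → ℂ) : Prop :=
  ∀ x, 0 ≤ x → m x = vecE z - ∫ y in Set.Ioi x, evol z (y - x) (pertV p y (m y))

theorem isVolterraSol_jostFun (h : (jostData p hp).Moment 1) {z : ℝ} (hz : 1 / 4 ≤ |z|) :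
    IsVolterraSol p z (jostFun h z) := by
  intro x hx
  have e := congrArg (fun f : ℝ →ᵇ (Fin 2 → ℂ) => f x) (jostM_eq h hz)
  simp only [BoundedContinuousFunction.add_apply] at e
  rw [jostRhs_apply, jostOp_apply h z _ hx, max_eq_left hx] at e
  have e2 : jostM h z x = _ := eq_sub_of_add_eq e
  have e3 : jostFun h z x = Real.exp (weightExp p x) • jostM h z x := rfl
  rw [e3, e2, smul_sub, smul_smul, ← Real.exp_add, add_neg_cancel, Real.exp_zero, one_smul,
    ← integral_smul]
  congr 1
  refine integral_congr_ae (Eventually.of_forall fun y => ?_)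
  change Real.exp _ • Real.exp _ • evol z (y - x) (pertV p y (jostM h z y)) =
    evol z (y - x) (pertV p y (jostFun h z y))
  rw [smul_smul, ← Real.exp_add, add_sub_cancel, jostFun]
  rw [ContinuousLinearMap.map_smul_of_tower, ContinuousLinearMap.map_smul_of_tower]

/-- A bounded solution multiplied by e^{-γ} is still bounded, since γ converges at infinity, and it
solves the weighted equation, where 1 + K is invertible. -/
theorem IsVolterraSol.eq_jostFun (h : (jostData p hp).Moment 1) {z : ℝ} (hz : 1 / 4 ≤ |z|)
    {m : ℝ → Fin 2 → ℂ} (hm : IsVolterraSol p z m) (hc : ContinuousOn m (Set.Ici 0))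
    (hb : ∃ C, ∀ x, 0 ≤ x → ‖m x‖ ≤ C) {x : ℝ} (hx : 0 ≤ x) : m x = jostFun h z x := by
  have key : weighted h m hc hb = jostM h z := by
    refine eq_jostM h hz ?_
    ext1 x
    -- The weighted equation must hold on all of ℝ; for x < 0 both sides equal their values at 0.
    have e1 : jostOp p hp z (weighted h m hc hb) x = jostOp p hp z (weighted h m hc hb) (max x 0) := by
      have : ∀ f : ℝ →ᵇ (Fin 2 → ℂ), jostOp p hp z f x = jostOp p hp z f (max x 0) := by
        intro f
        have e : ∀ x, jostOp p hp z f x =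
          (VolterraData.op (VolterraData.lift (fun _ => (1 : ℂ)) : (jostData p hp).goodKernel) f) x +
          matN z ((jostData p hp).phiOp 0 (spectralZeta z) f x) := fun x => rfl
        rw [e, e, VolterraData.phiOp, VolterraData.op_apply, VolterraData.op_apply,
          VolterraData.op_apply, VolterraData.op_apply, max_eq_left (le_max_right x 0)]
      exact this _
    have hx0 : 0 ≤ max x 0 := le_max_right _ _
    rw [BoundedContinuousFunction.add_apply, e1, jostOp_apply h z _ hx0, jostRhs_apply,
      weighted_apply, hm _ hx0, smul_sub, ← integral_smul]
    have e2 : ∫ y in Set.Ioi (max x 0), Real.exp (weightExp p y - weightExp p (max x 0)) •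
        evol z (y - max x 0) (pertV p y (weighted h m hc hb y)) =
        ∫ y in Set.Ioi (max x 0), Real.exp (-weightExp p (max x 0)) •
        evol z (y - max x 0) (pertV p y (m y)) := by
      refine setIntegral_congr_fun measurableSet_Ioi fun y hy => ?_
      have hy0 : 0 ≤ y := hx0.trans (le_of_lt hy)
      rw [weighted_apply, max_eq_left hy0, ContinuousLinearMap.map_smul_of_tower, ContinuousLinearMap.map_smul_of_tower, smul_smul,
        ← Real.exp_add]
      congr 2
      ring
    rw [e2, sub_add_cancel]
  have : weighted h m hc hb x = jostM h z x := by rw [key]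
  rw [weighted_apply, max_eq_left hx] at this
  rw [jostFun, ← this, smul_smul, ← Real.exp_add, add_neg_cancel, Real.exp_zero, one_smul]

end

/-! ### From the Volterra equation to the differential equation and back -/

theorem hasDerivAt_matN {z : ℝ} {u : ℝ → Fin 2 → ℂ} {u' : Fin 2 → ℂ} {x : ℝ} (hu : HasDerivAt u u' x) :
    HasDerivAt (fun x => matN z (u x)) (matN z u') x :=
  ((matN z).restrictScalars ℝ).hasFDerivAt.comp_hasDerivAt x hu

theorem hasDerivAt_evol_apply {z : ℝ} {s : ℝ → ℝ} {s' x : ℝ} {u : ℝ → Fin 2 → ℂ} {u' : Fin 2 → ℂ}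
    (hs : HasDerivAt s s' x) (hu : HasDerivAt u u' x) :
    HasDerivAt (fun x => evol z (s x) (u x))
      (evol z (s x) u' - (s' * Complex.exp (-2 * Complex.I * spectralZeta z * s x)) • matN z (u x)) x := by
  have h1 : HasDerivAt (fun x => phi 0 (spectralZeta z) (s x))
      (s' • -Complex.exp (-2 * Complex.I * spectralZeta z * s x)) x :=
    (hasDerivAt_phi_zero (spectralZeta z) (s x)).scomp x hs
  have h2 := hu.add (h1.smul (hasDerivAt_matN (z := z) hu))
  refine h2.congr_deriv ?_
  rw [evol_apply, Complex.real_smul, mul_neg, neg_smul]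
  abel

theorem norm_evol_le (z : ℝ) {s : ℝ} (hs : 0 ≤ s) (v : Fin 2 → ℂ) :
    ‖evol z s v‖ ≤ (1 + ‖matN z‖) * (1 + s) * ‖v‖ := by
  rw [evol_apply]
  have h1 := norm_phi_le 0 (spectralZeta z) hs
  simp only [pow_zero, zero_add, pow_one, one_mul] at h1
  have h2 := (matN z).le_opNorm v
  have h3 : ‖phi 0 (spectralZeta z) s • matN z v‖ ≤ s * (‖matN z‖ * ‖v‖) := by
    rw [norm_smul]
    exact mul_le_mul h1 h2 (norm_nonneg _) hs
  refine (norm_add_le _ _).trans ?_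
  nlinarith [norm_nonneg v, norm_nonneg (matN z), mul_nonneg (norm_nonneg (matN z)) (norm_nonneg v),
    mul_nonneg hs (norm_nonneg v)]

theorem tendsto_integral_Ioi_atTop {E : Type*} [NormedAddCommGroup E] [NormedSpace ℝ E]
    (f : ℝ → E) : Tendsto (fun x : ℝ => ∫ y in Set.Ioi x, f y) atTop (𝓝 0) :=
  tendsto_integral_Ioi_zero tendsto_id

section

variable {p : ℝ → ℂ} {hp : Continuous p}

theorem integrableOn_evol (h : (jostData p hp).Moment 1) (z : ℝ) {m : ℝ → Fin 2 → ℂ}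
    (hc : ContinuousOn m (Set.Ici 0)) (hb : ∃ C, ∀ x, 0 ≤ x → ‖m x‖ ≤ C) :
    IntegrableOn (fun y => evol z y (pertV p y (m y))) (Set.Ioi 0) := by
  obtain ⟨C, hC⟩ := hb
  have h' : IntegrableOn (fun y => (1 + y) ^ 1 * ‖pertV p y‖) (Set.Ioi 0) := h
  have hV := continuous_pertV hp
  have hE := continuous_evol z
  have hcont : ContinuousOn (fun y => evol z y (pertV p y (m y))) (Set.Ioi 0) :=
    hE.continuousOn.clm_apply (hV.continuousOn.clm_apply (hc.mono Set.Ioi_subset_Ici_self))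
  refine Integrable.mono' (h'.const_mul ((1 + ‖matN z‖) * C))
    (hcont.aestronglyMeasurable measurableSet_Ioi) ?_
  filter_upwards [ae_restrict_mem measurableSet_Ioi] with y hy
  have hy0 : 0 ≤ y := le_of_lt hy
  have h1 : ‖pertV p y (m y)‖ ≤ ‖pertV p y‖ * C :=
    (pertV p y).le_of_opNorm_le_of_le le_rfl (hC y hy0)
  refine (norm_evol_le z hy0 _).trans ?_
  calc (1 + ‖matN z‖) * (1 + y) * ‖pertV p y (m y)‖
      ≤ (1 + ‖matN z‖) * (1 + y) * (‖pertV p y‖ * C) := by gcongr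
    _ = _ := by ring

theorem integral_evol_sub (h : (jostData p hp).Moment 1) {z : ℝ} (hz : z ≠ 0) {m : ℝ → Fin 2 → ℂ}
    (hc : ContinuousOn m (Set.Ici 0)) (hb : ∃ C, ∀ x, 0 ≤ x → ‖m x‖ ≤ C) {x : ℝ} (hx : 0 ≤ x) :
    ∫ y in Set.Ioi x, evol z (y - x) (pertV p y (m y)) =
      evol z (-x) (∫ y in Set.Ioi x, evol z y (pertV p y (m y))) := by
  rw [← ContinuousLinearMap.integral_comp_comm (evol z (-x))
    ((integrableOn_evol h z hc hb).mono_set (Set.Ioi_subset_Ioi hx))]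
  refine integral_congr_ae (Eventually.of_forall fun y => ?_)
  change evol z (y - x) _ = evol z (-x) (evol z y _)
  rw [← evol_add hz, neg_add_eq_sub]

/-- By `integral_evol_sub` the integral is the evolution by -x applied to a tail integral whose
integrand does not involve x, so only the fundamental theorem and the derivative of the evolution
are needed. The term Nm appears because N annihilates the boundary vector. -/
theorem IsVolterraSol.hasDerivAt (h : (jostData p hp).Moment 1) {z : ℝ} (hz : z ≠ 0)
    {m : ℝ → Fin 2 → ℂ} (hm : IsVolterraSol p z m)
    (hc : ContinuousOn m (Set.Ici 0)) (hb : ∃ C, ∀ x, 0 ≤ x → ‖m x‖ ≤ C) {x : ℝ} (hx : 0 < x) :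
    HasDerivAt m (matN z (m x) + pertV p x (m x)) x := by
  set f : ℝ → Fin 2 → ℂ := fun y => evol z y (pertV p y (m y)) with hf
  have hfi := integrableOn_evol h z hc hb
  have hV := continuous_pertV hp
  have hE := continuous_evol z
  have hcont : ContinuousOn f (Set.Ici 0) :=
    hE.continuousOn.clm_apply (hV.continuousOn.clm_apply hc)
  have hfii : ∀ y, 0 ≤ y → IntervalIntegrable f volume 0 y := fun y hy =>
    (hcont.mono (by rw [Set.uIcc_of_le hy]; exact Set.Icc_subset_Ici_self)).intervalIntegrable
  have hH : HasDerivAt (fun x => ∫ y in Set.Ioi x, f y) (-f x) x := by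
    have h1 : HasDerivAt (fun x => ∫ y in (0 : ℝ)..x, f y) (f x) x :=
      intervalIntegral.integral_hasDerivAt_right (hfii x hx.le)
        (hcont.mono (Set.Ioi_subset_Ici_self) |>.stronglyMeasurableAtFilter isOpen_Ioi x hx)
        (hcont.continuousAt (Ici_mem_nhds hx))
    refine (h1.const_sub (∫ y in Set.Ioi 0, f y)).congr_of_eventuallyEq ?_
    filter_upwards [lt_mem_nhds hx] with y hy
    have := intervalIntegral.integral_Ioi_sub_Ioi hfi hy.le
    rw [← this]
    abel
  have h2 := (hasDerivAt_evol_apply (z := z) (hasDerivAt_neg x) hH).const_sub (vecE z)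
  have h3 : m =ᶠ[𝓝 x] fun x => vecE z - evol z (-x) (∫ y in Set.Ioi x, f y) := by
    filter_upwards [lt_mem_nhds hx] with y hy
    rw [hm y hy.le, integral_evol_sub h hz hc hb hy.le]
  refine (h2.congr_of_eventuallyEq h3).congr_deriv ?_
  have h4 : matN z (evol z (-x) (∫ y in Set.Ioi x, f y)) = - matN z (m x) := by
    have h5 : m x = vecE z - evol z (-x) (∫ y in Set.Ioi x, f y) := h3.self_of_nhds
    rw [h5, map_sub, matN_vecE hz, zero_sub, neg_neg]
  rw [matN_evol hz] at h4
  have h6 : evol z (-x) (f x) = pertV p x (m x) := by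
    rw [hf]
    simp only
    rw [← evol_add hz, neg_add_cancel, evol_zero]
  rw [map_neg, h6]
  have h7 : (((-1 : ℝ) : ℂ) * Complex.exp (-2 * Complex.I * spectralZeta z * (-x : ℝ))) •
      matN z (∫ y in Set.Ioi x, f y) = matN z (m x) := by
    rw [mul_smul, h4]
    simp
  rw [h7]
  abel

theorem norm_integral_Ioi_evol_le (h : (jostData p hp).Moment 1) (z : ℝ) {m : ℝ → Fin 2 → ℂ} {C : ℝ}
    (hb : ∀ x, 0 ≤ x → ‖m x‖ ≤ C) {x : ℝ} (hx : 0 ≤ x) :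
    ‖∫ y in Set.Ioi x, evol z (y - x) (pertV p y (m y))‖ ≤
      (1 + ‖matN z‖) * C * ∫ y in Set.Ioi x, (1 + y) * ‖pertV p y‖ := by
  have h' : IntegrableOn (fun y => (1 + y) ^ 1 * ‖pertV p y‖) (Set.Ioi 0) := h
  simp only [pow_one] at h'
  have hC0 : 0 ≤ C := (norm_nonneg _).trans (hb 0 le_rfl)
  rw [← integral_const_mul]
  refine norm_integral_le_of_norm_le ((h'.mono_set (Set.Ioi_subset_Ioi hx)).const_mul _) ?_
  filter_upwards [ae_restrict_mem measurableSet_Ioi] with y hy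
  have hy' : x < y := hy
  have h1 : ‖pertV p y (m y)‖ ≤ ‖pertV p y‖ * C :=
    (pertV p y).le_of_opNorm_le_of_le le_rfl (hb y (by linarith))
  refine (norm_evol_le z (by linarith : 0 ≤ y - x) _).trans ?_
  calc (1 + ‖matN z‖) * (1 + (y - x)) * ‖pertV p y (m y)‖
      ≤ (1 + ‖matN z‖) * (1 + y) * (‖pertV p y‖ * C) := by
        have : 1 + (y - x) ≤ 1 + y := by linarith
        have h0 : 0 ≤ 1 + y := by linarith
        gcongr
    _ = _ := by ring

theorem IsVolterraSol.tendsto (h : (jostData p hp).Moment 1) {z : ℝ}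
    {m : ℝ → Fin 2 → ℂ} (hm : IsVolterraSol p z m) (hb : ∃ C, ∀ x, 0 ≤ x → ‖m x‖ ≤ C) :
    Tendsto m atTop (𝓝 (vecE z)) := by
  obtain ⟨C, hC⟩ := hb
  have h1 : Tendsto (fun x : ℝ => (1 + ‖matN z‖) * C * ∫ y in Set.Ioi x, (1 + y) * ‖pertV p y‖) atTop
      (𝓝 0) := by
    simpa using (tendsto_integral_Ioi_atTop fun y => (1 + y) * ‖pertV p y‖).const_mul
      ((1 + ‖matN z‖) * C)
  rw [tendsto_iff_norm_sub_tendsto_zero]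
  refine squeeze_zero' (Eventually.of_forall fun _ => norm_nonneg _) ?_ h1
  filter_upwards [eventually_ge_atTop 0] with x hx
  rw [hm x hx, sub_sub_cancel_left, norm_neg]
  exact norm_integral_Ioi_evol_le h z hC hx

/-- Variation of constants on [x, Y] leaves the boundary term exp(YN)-type limit to be identified:
φ₀(Y)N m(Y) must tend to 0. If ζ ≠ 0, then φ₀ is bounded and Nm tends to 0. If ζ = 0, then φ₀ grows
linearly, but Nm(Y) is itself a tail integral of NVm, and the first moment of V beats the factor Y.
-/
theorem isVolterraSol_of_hasDerivAt (h : (jostData p hp).Moment 1) {z : ℝ} (hz : z ≠ 0)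
    {m : ℝ → Fin 2 → ℂ} (hc : ContinuousOn m (Set.Ici 0))
    (hd : ∀ x, 0 < x → HasDerivAt m (matN z (m x) + pertV p x (m x)) x)
    (ht : Tendsto m atTop (𝓝 (vecE z))) :
    (∃ C, ∀ x, 0 ≤ x → ‖m x‖ ≤ C) ∧ IsVolterraSol p z m := by
  have hb : ∃ C, ∀ x, 0 ≤ x → ‖m x‖ ≤ C := by
    obtain ⟨R, hR⟩ := (eventually_atTop.1 (ht.norm.eventually_lt_const (lt_add_one ‖vecE z‖)))
    obtain ⟨C, hC⟩ := (isCompact_Icc (a := (0 : ℝ)) (b := R)).exists_bound_of_continuousOn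
      (hc.mono Set.Icc_subset_Ici_self)
    refine ⟨max C (‖vecE z‖ + 1), fun x hx => ?_⟩
    rcases le_total x R with h1 | h1
    · exact (hC x ⟨hx, h1⟩).trans (le_max_left _ _)
    · exact (hR x h1).le.trans (le_max_right _ _)
  refine ⟨hb, ?_⟩
  set f : ℝ → Fin 2 → ℂ := fun y => evol z y (pertV p y (m y)) with hf
  have hfi := integrableOn_evol h z hc hb
  have hV := continuous_pertV hp
  have hE := continuous_evol z
  have hcont : ContinuousOn f (Set.Ici 0) :=
    hE.continuousOn.clm_apply (hV.continuousOn.clm_apply hc)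
  have hu : ∀ x, 0 < x → HasDerivAt (fun x => evol z x (m x)) (f x) x := by
    intro x hx
    refine (hasDerivAt_evol_apply (z := z) (hasDerivAt_id x) (hd x hx)).congr_deriv ?_
    have e : evol z x (matN z (m x)) = matN z (evol z x (m x)) := by
      rw [evol_apply, evol_apply, map_add, map_smul]
    simp only [id]
    rw [map_add, e, matN_evol hz]
    simp [hf]
  have hucont : ContinuousOn (fun x => evol z x (m x)) (Set.Ici 0) := hE.continuousOn.clm_apply hc
  have hFTC : ∀ x Y, 0 ≤ x → x ≤ Y → evol z Y (m Y) = evol z x (m x) + ∫ y in x..Y, f y := by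
    intro x Y hx hY
    rw [intervalIntegral.integral_eq_sub_of_hasDerivAt_of_le hY
      (hucont.mono fun y hy => hx.trans hy.1) (fun y hy => hu y (hx.trans_lt hy.1))
      ((hcont.mono (by rw [Set.uIcc_of_le hY]; exact fun y hy => hx.trans hy.1)).intervalIntegrable)]
    abel
  have hlim : ∀ x, 0 ≤ x → Tendsto (fun Y => evol z Y (m Y)) atTop
      (𝓝 (evol z x (m x) + ∫ y in Set.Ioi x, f y)) := by
    intro x hx
    have h1 := (intervalIntegral_tendsto_integral_Ioi x (hfi.mono_set (Set.Ioi_subset_Ioi hx))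
      tendsto_id).const_add (evol z x (m x))
    refine h1.congr' ?_
    filter_upwards [eventually_ge_atTop x] with Y hY
    exact (hFTC x Y hx hY).symm
  have hd0 : Tendsto (fun Y => m Y - vecE z) atTop (𝓝 0) := by
    simpa using ht.sub_const (vecE z)
  have hkey : Tendsto (fun Y => evol z Y (m Y)) atTop (𝓝 (vecE z)) := by
    suffices hs : Tendsto (fun Y => phi 0 (spectralZeta z) Y • matN z (m Y)) atTop (𝓝 0) by
      have := ht.add hs
      rw [add_zero] at this
      exact this
    by_cases hζ : spectralZeta z = 0
    · have hexp : ∀ y v, matN z (evol z y v) = matN z v := by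
        intro y v
        rw [matN_evol hz, hζ]
        simp
      set ℓ := evol z 0 (m 0) + ∫ y in Set.Ioi 0, f y with hℓ
      have hNm : Tendsto (fun Y => matN z (m Y)) atTop (𝓝 0) := by
        have := ((matN z).continuous.tendsto _).comp ht
        rwa [matN_vecE hz] at this
      have hNℓ : matN z ℓ = 0 := by
        have h1 := ((matN z).continuous.tendsto _).comp (hlim 0 le_rfl)
        refine tendsto_nhds_unique h1 (hNm.congr fun Y => ?_)
        exact (hexp Y (m Y)).symm
      have h' : IntegrableOn (fun y => (1 + y) ^ 1 * ‖pertV p y‖) (Set.Ioi 0) := h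
      simp only [pow_one] at h'
      obtain ⟨C, hC⟩ := hb
      have hC0 : 0 ≤ C := (norm_nonneg _).trans (hC 0 le_rfl)
      have hbound : ∀ Y, 0 ≤ Y → ‖phi 0 (spectralZeta z) Y • matN z (m Y)‖ ≤
          ‖matN z‖ * C * ∫ y in Set.Ioi Y, (1 + y) * ‖pertV p y‖ := by
        intro Y hY
        have e1 : matN z (m Y) = -∫ y in Set.Ioi Y, matN z (pertV p y (m y)) := by
          have h2 : evol z Y (m Y) = ℓ - ∫ y in Set.Ioi Y, f y :=
            eq_sub_of_add_eq (tendsto_nhds_unique (hlim Y hY) (hlim 0 le_rfl))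
          rw [← hexp Y, h2, map_sub, hNℓ, zero_sub,
            ← ContinuousLinearMap.integral_comp_comm (matN z) (hfi.mono_set (Set.Ioi_subset_Ioi hY))]
          congr 1
          refine integral_congr_ae (Eventually.of_forall fun y => ?_)
          exact hexp y _
        rw [e1, norm_smul, norm_neg]
        have h3 := norm_phi_le 0 (spectralZeta z) hY
        simp only [pow_zero, zero_add, pow_one, one_mul] at h3
        rw [← integral_const_mul]
        -- The factor Y is moved under the integral, where Y < y lets the weight 1 + y absorb it.
        calc ‖phi 0 (spectralZeta z) Y‖ * ‖∫ y in Set.Ioi Y, matN z (pertV p y (m y))‖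
            ≤ Y * ‖∫ y in Set.Ioi Y, matN z (pertV p y (m y))‖ := by gcongr
          _ = ‖∫ y in Set.Ioi Y, Y • matN z (pertV p y (m y))‖ := by
              rw [integral_smul, norm_smul, Real.norm_of_nonneg hY]
          _ ≤ _ := by
              refine norm_integral_le_of_norm_le
                ((h'.mono_set (Set.Ioi_subset_Ioi hY)).const_mul _) ?_
              filter_upwards [ae_restrict_mem measurableSet_Ioi] with y hy
              have hy' : Y < y := hy
              have h4 : ‖pertV p y (m y)‖ ≤ ‖pertV p y‖ * C :=
                (pertV p y).le_of_opNorm_le_of_le le_rfl (hC y (by linarith))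
              have h5 : ‖matN z (pertV p y (m y))‖ ≤ ‖matN z‖ * (‖pertV p y‖ * C) :=
                (matN z).le_of_opNorm_le_of_le le_rfl h4
              rw [norm_smul, Real.norm_of_nonneg hY]
              calc Y * ‖matN z (pertV p y (m y))‖ ≤ (1 + y) * (‖matN z‖ * (‖pertV p y‖ * C)) := by
                    gcongr
                    · linarith
                    · linarith
                _ = _ := by ring
      rw [tendsto_zero_iff_norm_tendsto_zero]
      have hT : Tendsto (fun Y : ℝ => ‖matN z‖ * C * ∫ y in Set.Ioi Y, (1 + y) * ‖pertV p y‖) atTop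
          (𝓝 0) := by
        simpa using (tendsto_integral_Ioi_atTop fun y => (1 + y) * ‖pertV p y‖).const_mul
          (‖matN z‖ * C)
      refine squeeze_zero' (Eventually.of_forall fun _ => norm_nonneg _) ?_ hT
      filter_upwards [eventually_ge_atTop 0] with Y hY using hbound Y hY
    · rw [tendsto_zero_iff_norm_tendsto_zero]
      have hT : Tendsto (fun Y : ℝ => 1 / |spectralZeta z| * (‖matN z‖ * ‖m Y - vecE z‖)) atTop (𝓝 0) := by
        simpa using ((hd0.norm).const_mul ‖matN z‖).const_mul (1 / |spectralZeta z|)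
      refine squeeze_zero' (Eventually.of_forall fun _ => norm_nonneg _) ?_ hT
      filter_upwards [eventually_ge_atTop 0] with Y hY
      have h1 := norm_phi_le_div 0 hζ hY
      simp only [pow_zero, CharP.cast_eq_zero, zero_add, mul_one] at h1
      have h2 : matN z (m Y) = matN z (m Y - vecE z) := by rw [map_sub, matN_vecE hz, sub_zero]
      rw [norm_smul, h2]
      exact mul_le_mul h1 ((matN z).le_opNorm _) (norm_nonneg _) (by positivity)
  intro x hx
  have h1 := tendsto_nhds_unique (hlim x hx) hkey
  rw [integral_evol_sub h hz hc hb hx]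
  have h2 := congrArg (evol z (-x)) h1
  rw [map_add, ← evol_add hz, neg_add_cancel, evol_zero, evol_vecE hz] at h2
  exact eq_sub_of_add_eq h2

end

/-! ### Jost solutions on the line -/

theorem laxMatrix_mulVec (q : ℝ → ℂ) (z x : ℝ) (v : Fin 2 → ℂ) :
    (laxMatrix q z x).mulVec v = ![Complex.I * (conj (q x) * v 1 - spectralLambda z * v 0),
      -Complex.I * (q x * v 0 - spectralLambda z * v 1)] := by
  have h : laxMatrix q z x = !![-Complex.I * spectralLambda z, Complex.I * conj (q x);
      -Complex.I * q x, Complex.I * spectralLambda z] := by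
    rw [laxMatrix, pauli3, potential, Matrix.one_fin_two]
    ext i j
    fin_cases i <;> fin_cases j <;> simp
  rw [h]
  ext i
  fin_cases i <;> simp [Matrix.mulVec, dotProduct, Fin.sum_univ_two] <;> ring

theorem hasDerivAt_fin_two {f : ℝ → Fin 2 → ℂ} {a b : ℂ} {x : ℝ} :
    HasDerivAt f ![a, b] x ↔ HasDerivAt (fun t => f t 0) a x ∧ HasDerivAt (fun t => f t 1) b x := by
  rw [hasDerivAt_pi]
  simp [Fin.forall_fin_two]

theorem tendsto_fin_two {α : Type*} {l : Filter α} {f : α → Fin 2 → ℂ} {a b : ℂ} :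
    Tendsto f l (𝓝 ![a, b]) ↔ Tendsto (fun t => f t 0) l (𝓝 a) ∧ Tendsto (fun t => f t 1) l (𝓝 b) := by
  rw [tendsto_pi_nhds]
  simp [Fin.forall_fin_two]

theorem isLaxSolution_iff {q : ℝ → ℂ} (hq : Continuous q) {z : ℝ} {ψ : ℝ → Fin 2 → ℂ} :
    IsLaxSolution q z ψ ↔ ∀ x, HasDerivAt ψ ((laxMatrix q z x).mulVec (ψ x)) x := by
  have hcont : ∀ {ψ : ℝ → Fin 2 → ℂ}, Continuous ψ →
      Continuous fun t => (laxMatrix q z t).mulVec (ψ t) := by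
    intro ψ hψ
    simp only [laxMatrix_mulVec]
    have h1 : Continuous fun t => conj (q t) := Complex.continuous_conj.comp hq
    refine continuous_pi fun i => ?_
    fin_cases i
    · change Continuous fun t => Complex.I * (conj (q t) * ψ t 1 - spectralLambda z * ψ t 0)
      fun_prop
    · change Continuous fun t => -Complex.I * (q t * ψ t 0 - spectralLambda z * ψ t 1)
      fun_prop
  constructor
  · rintro ⟨hψ, h⟩ x
    have h1 := ((hcont hψ).integral_hasStrictDerivAt x x).hasDerivAt.const_add (ψ x)
    refine h1.congr_of_eventuallyEq (Eventually.of_forall fun y => ?_)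
    change ψ y = ψ x + _
    rw [← (h x y).2]
    abel
  · intro h
    have hψ : Continuous ψ := continuous_iff_continuousAt.2 fun x => (h x).continuousAt
    refine ⟨hψ, fun x y => ⟨(hcont hψ).intervalIntegrable x y, ?_⟩⟩
    rw [intervalIntegral.integral_eq_sub_of_hasDerivAt (fun t _ => h t)
      ((hcont hψ).intervalIntegrable x y)]

theorem isJost_iff {q : ℝ → ℂ} (hq : Continuous q) {z κ : ℝ} {l : Filter ℝ} {v₀ v₁ : ℂ}
    {ψ : ℝ → Fin 2 → ℂ} : IsJost q z l ![v₀, v₁] κ ψ ↔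
      (∀ x, HasDerivAt (fun t => ψ t 0)
          (Complex.I * (conj (q x) * ψ x 1 - spectralLambda z * ψ x 0)) x ∧
        HasDerivAt (fun t => ψ t 1) (-Complex.I * (q x * ψ x 0 - spectralLambda z * ψ x 1)) x) ∧
      Tendsto (fun x : ℝ => Complex.exp (-(Complex.I * (κ * x))) * ψ x 0) l (𝓝 v₀) ∧
      Tendsto (fun x : ℝ => Complex.exp (-(Complex.I * (κ * x))) * ψ x 1) l (𝓝 v₁) := by
  unfold IsJost
  rw [isLaxSolution_iff hq, tendsto_fin_two]
  simp only [laxMatrix_mulVec, hasDerivAt_fin_two, Pi.smul_apply, smul_eq_mul, Complex.ofReal_mul]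

/-- The perturbation of the shifted potential. -/
def shiftPert (q : ℝ → ℂ) (X y : ℝ) : ℂ := q (y + X) - 1

/-- Continuous potentials for which `q - 1` has a first moment near `+∞`. -/
structure Decay (q : ℝ → ℂ) : Prop where
  continuous : Continuous q
  integrableOn : ∀ X, IntegrableOn (fun y => (1 + |y|) * ‖q y - 1‖) (Set.Ioi X)

theorem Decay.continuous_shift {q : ℝ → ℂ} (hq : Decay q) (X : ℝ) : Continuous (shiftPert q X) := by
  have := hq.continuous
  unfold shiftPert
  fun_prop

theorem setIntegral_Ioi_comp_add {E : Type*} [NormedAddCommGroup E] [NormedSpace ℝ E]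
    (g : ℝ → E) (x a : ℝ) : ∫ y in Set.Ioi x, g (y + a) = ∫ y in Set.Ioi (x + a), g y := by
  have := (measurePreserving_add_right volume a).setIntegral_preimage_emb
    (measurableEmbedding_addRight a) g (Set.Ioi (x + a))
  rw [Set.preimage_add_const_Ioi, add_sub_cancel_right] at this
  exact this

theorem integrableOn_Ioi_comp_add {E : Type*} [NormedAddCommGroup E]
    {g : ℝ → E} {x a : ℝ} (h : IntegrableOn g (Set.Ioi (x + a))) :
    IntegrableOn (fun y => g (y + a)) (Set.Ioi x) := by
  have := ((measurePreserving_add_right volume a).integrableOn_comp_preimage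
    (measurableEmbedding_addRight a) (f := g) (s := Set.Ioi (x + a))).2 h
  rw [Set.preimage_add_const_Ioi, add_sub_cancel_right] at this
  exact this

theorem moment_of_integrableOn {p : ℝ → ℂ} (hp : Continuous p) {n : ℕ}
    (h : IntegrableOn (fun y => (1 + |y|) ^ n * ‖p y‖) (Set.Ioi 0)) : (jostData p hp).Moment n := by
  have hV := continuous_pertV hp
  refine Integrable.mono' (h.const_mul 2) (Continuous.aestronglyMeasurable
    (by change Continuous fun y => (1 + y) ^ n * ‖pertV p y‖; fun_prop)) ?_
  filter_upwards [ae_restrict_mem measurableSet_Ioi] with y hy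
  have hy0 : 0 ≤ y := le_of_lt hy
  change ‖(1 + y) ^ n * ‖pertV p y‖‖ ≤ _
  rw [Real.norm_of_nonneg (by positivity), abs_of_nonneg hy0]
  calc (1 + y) ^ n * ‖pertV p y‖ ≤ (1 + y) ^ n * (2 * ‖p y‖) := by
        gcongr
        exact norm_pertV_le p y
    _ = _ := by ring

theorem Decay.moment {q : ℝ → ℂ} (hq : Decay q) (X : ℝ) :
    (jostData (shiftPert q X) (hq.continuous_shift X)).Moment 1 := by
  refine moment_of_integrableOn _ ?_
  have h1 := integrableOn_Ioi_comp_add (x := 0) (a := X)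
    (by simpa using! (hq.integrableOn X).const_mul (1 + |X|))
  have hc := hq.continuous
  refine Integrable.mono' h1 (Continuous.aestronglyMeasurable (by unfold shiftPert; fun_prop)) ?_
  refine Eventually.of_forall fun y => ?_
  rw [Real.norm_of_nonneg (by positivity), pow_one, ← mul_assoc]
  refine mul_le_mul_of_nonneg_right ?_ (norm_nonneg _)
  have h2 : |y| ≤ |y + X| + |X| := by
    have := abs_sub (y + X) X
    rwa [add_sub_cancel_right] at this
  nlinarith [abs_nonneg X, abs_nonneg (y + X), mul_nonneg (abs_nonneg X) (abs_nonneg (y + X))]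

theorem pertV_shift (q : ℝ → ℂ) (X a y : ℝ) :
    pertV (shiftPert q X) (y + a) = pertV (shiftPert q (X + a)) y := by
  simp only [pertV, shiftPert]
  rw [show y + a + X = y + (X + a) by ring]

/-- Uniqueness of the Volterra solution on a translated half line. It makes the half line solutions
for different left ends restrictions of one function on ℝ. -/
theorem jostFun_shift {q : ℝ → ℂ} (hq : Decay q) {z : ℝ} (hz : 1 / 4 ≤ |z|) (X : ℝ) {a : ℝ}
    (ha : 0 ≤ a) : jostFun (hq.moment X) z a = jostFun (hq.moment (X + a)) z 0 := by
  have key : IsVolterraSol (shiftPert q (X + a)) z (fun y => jostFun (hq.moment X) z (y + a)) := by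
    intro x hx
    change jostFun (hq.moment X) z (x + a) = _
    rw [isVolterraSol_jostFun (hq.moment X) hz (x + a) (by linarith), ← setIntegral_Ioi_comp_add]
    congr 1
    refine integral_congr_ae (Eventually.of_forall fun y => ?_)
    change evol z (y + a - (x + a)) (pertV (shiftPert q X) (y + a) _) = _
    rw [pertV_shift, add_sub_add_right_eq_sub]
  have := key.eq_jostFun (hq.moment (X + a)) hz
    ((continuous_jostFun (hq.moment X) z).comp (continuous_add_const a)).continuousOn
    ⟨‖jostM (hq.moment X) z‖, fun x hx => norm_jostFun_le (hq.moment X) z (by linarith)⟩ (le_refl 0)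
  simpa using this

/-- The phase `e^{iζx}`. -/
def phase (z x : ℝ) : ℂ := Complex.exp (Complex.I * (spectralZeta z * x))

theorem phase_ne_zero (z x : ℝ) : phase z x ≠ 0 := Complex.exp_ne_zero _

theorem hasDerivAt_phase (z x : ℝ) :
    HasDerivAt (phase z) (Complex.I * spectralZeta z * phase z x) x := by
  have h1 : HasDerivAt (fun x : ℝ => Complex.I * (spectralZeta z * x)) (Complex.I * spectralZeta z) x := by
    simpa [mul_assoc] using (Complex.ofRealCLM.hasDerivAt (x := x)).const_mul
      (Complex.I * spectralZeta z)
  have := h1.cexp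
  rwa [mul_comm] at this

theorem laxMatrix_mulVec_eq (q : ℝ → ℂ) (z x : ℝ) (v : Fin 2 → ℂ) :
    matN z v + pertV (fun y => q y - 1) x v =
      (laxMatrix q z x).mulVec v + (Complex.I * spectralZeta z) • v := by
  rw [laxMatrix_mulVec, matN_apply, pertV_apply]
  ext i
  fin_cases i <;> simp [spectralLambda, spectralZeta] <;> ring

/-- The Jost solution `ψ₁⁽⁺⁾(·; z)` in terms of the normalized half line solutions. -/
def jostSol {q : ℝ → ℂ} (hq : Decay q) (z x : ℝ) : Fin 2 → ℂ :=
  (phase z x)⁻¹ • jostFun (hq.moment x) z 0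

theorem isJostPlus1_iff_phase {q : ℝ → ℂ} (hq : Continuous q) {z : ℝ} {ψ : ℝ → Fin 2 → ℂ} :
    IsJostPlus1 q z ψ ↔ (∀ x, HasDerivAt ψ ((laxMatrix q z x).mulVec (ψ x)) x) ∧
      Tendsto (fun x => phase z x • ψ x) atTop (𝓝 (vecE z)) := by
  unfold IsJostPlus1 IsJost phase vecE
  rw [isLaxSolution_iff hq]
  simp

/-- Given a solution, its translate by X satisfies the Volterra equation, so its value at X is
forced. Conversely, the values at the left ends glue to one function by `jostFun_shift`, and the
equation and the limit are inherited from the half line. -/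
theorem isJostPlus1_iff {q : ℝ → ℂ} (hq : Decay q) {z : ℝ} (hz : 1 / 4 ≤ |z|) {ψ : ℝ → Fin 2 → ℂ} :
    IsJostPlus1 q z ψ ↔ ψ = jostSol hq z := by
  have hz0 : z ≠ 0 := by
    rintro rfl
    norm_num at hz
  rw [isJostPlus1_iff_phase hq.continuous]
  constructor
  · rintro ⟨hd, ht⟩
    ext1 X
    set m : ℝ → Fin 2 → ℂ := fun y => phase z (y + X) • ψ (y + X) with hm
    have hmd : ∀ x, HasDerivAt m (matN z (m x) + pertV (shiftPert q X) x (m x)) x := by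
      intro x
      have h1 := ((hasDerivAt_phase z (x + X)).smul (hd (x + X))).comp_add_const x X
      refine h1.congr_deriv ?_
      have h2 := laxMatrix_mulVec_eq q z (x + X) (m x)
      have h3 : pertV (fun y => q y - 1) (x + X) = pertV (shiftPert q X) x := rfl
      rw [h3] at h2
      rw [h2, hm]
      simp only [Matrix.mulVec_smul]
      rw [smul_smul, mul_comm (Complex.I * _)]
    have hmt : Tendsto m atTop (𝓝 (vecE z)) := ht.comp (tendsto_atTop_add_const_right _ X tendsto_id)
    have hmc : ContinuousOn m (Set.Ici 0) := fun x _ => (hmd x).continuousAt.continuousWithinAt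
    obtain ⟨hb, hV⟩ := isVolterraSol_of_hasDerivAt (hq.moment X) hz0 hmc (fun x _ => hmd x) hmt
    have h0 := hV.eq_jostFun (hq.moment X) hz hmc hb (le_refl 0)
    rw [jostSol, ← h0, hm]
    simp only [zero_add]
    rw [smul_smul, inv_mul_cancel₀ (phase_ne_zero z X), one_smul]
  · rintro rfl
    have hrep : ∀ X x, X ≤ x → jostSol hq z x = (phase z x)⁻¹ • jostFun (hq.moment X) z (x - X) := by
      intro X x hx
      rw [jostFun_shift hq hz X (by linarith : 0 ≤ x - X), jostSol]
      congr 2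
      simp
    constructor
    · intro x
      -- Starting the half line at x - 1 makes x an interior point, where the half line solution is
      -- differentiable.
      set X := x - 1 with hX
      have hV := isVolterraSol_jostFun (hq.moment X) hz
      have h1 := hV.hasDerivAt (hq.moment X) hz0 (continuous_jostFun _ z).continuousOn
        ⟨_, fun x hx => norm_jostFun_le (hq.moment X) z hx⟩ (x := x - X) (by simp [hX])
      have h2 := h1.comp_sub_const x X
      have h3 := ((hasDerivAt_phase z x).inv (phase_ne_zero z x)).smul h2
      have hev : jostSol hq z =ᶠ[𝓝 x] fun x => (phase z x)⁻¹ • jostFun (hq.moment X) z (x - X) := by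
        filter_upwards [lt_mem_nhds (show X < x by simp [hX])] with y hy
        exact hrep X y hy.le
      refine (h3.congr_of_eventuallyEq hev).congr_deriv ?_
      have h4 := laxMatrix_mulVec_eq q z x (jostFun (hq.moment X) z (x - X))
      have h5 : pertV (shiftPert q X) (x - X) = pertV (fun y => q y - 1) x := by
        simp [pertV, shiftPert]
      rw [h5, h4, hrep X x (by simp [hX]), Matrix.mulVec_smul, smul_add, smul_smul, add_assoc,
        ← add_smul]
      have h6 := phase_ne_zero z x
      have h7 : (phase z x)⁻¹ * (Complex.I * spectralZeta z) +
          -(Complex.I * spectralZeta z * phase z x) / phase z x ^ 2 = 0 := by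
        field_simp
        ring
      rw [Pi.inv_apply, h7, zero_smul, add_zero]
    · have hV := isVolterraSol_jostFun (hq.moment 0) hz
      have h1 := hV.tendsto (hq.moment 0) ⟨_, fun x hx => norm_jostFun_le (hq.moment 0) z hx⟩
      refine h1.congr' ?_
      filter_upwards [eventually_ge_atTop 0] with x hx
      rw [hrep 0 x hx, smul_smul, mul_inv_cancel₀ (phase_ne_zero z x), one_smul, sub_zero]

theorem phase_zero (z : ℝ) : phase z 0 = 1 := by simp [phase]

theorem jostSol_zero {q : ℝ → ℂ} (hq : Decay q) (z : ℝ) :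
    jostSol hq z 0 = jostFun (hq.moment 0) z 0 := by
  rw [jostSol, phase_zero, inv_one, one_smul]

/-! ### Symmetries of the Jost solutions -/

/-- The involution `v ↦ σ₁ v̄`. -/
def swapConj (v : Fin 2 → ℂ) : Fin 2 → ℂ := ![conj (v 1), conj (v 0)]

/-- The involution `v ↦ σ₃ v̄`. -/
def signConj (v : Fin 2 → ℂ) : Fin 2 → ℂ := ![conj (v 0), -conj (v 1)]

/-- The potential seen from `-∞`. -/
def reflectPot (q : ℝ → ℂ) (x : ℝ) : ℂ := -conj (q (-x))

theorem swapConj_swapConj (v : Fin 2 → ℂ) : swapConj (swapConj v) = v := by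
  ext i
  fin_cases i <;> simp [swapConj]

theorem signConj_signConj (v : Fin 2 → ℂ) : signConj (signConj v) = v := by
  ext i
  fin_cases i <;> simp [signConj]

theorem reflectPot_reflectPot (q : ℝ → ℂ) : reflectPot (reflectPot q) = q := by
  ext x
  simp [reflectPot]

theorem continuous_reflectPot {q : ℝ → ℂ} (hq : Continuous q) : Continuous (reflectPot q) :=
  (Complex.continuous_conj.comp (hq.comp continuous_neg)).neg

theorem hasDerivAt_conj {f : ℝ → ℂ} {f' : ℂ} {x : ℝ} (h : HasDerivAt f f' x) :
    HasDerivAt (fun t => conj (f t)) (conj f') x := h.star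

/-- For real λ the equation is preserved by conjugation followed by exchanging components; this
carries the first Jost solution to the second. -/
theorem IsJost.swap {q : ℝ → ℂ} (hq : Continuous q) {z κ : ℝ} {l : Filter ℝ} {v₀ v₁ : ℂ}
    {ψ : ℝ → Fin 2 → ℂ} (h : IsJost q z l ![v₀, v₁] κ ψ) :
    IsJost q z l ![conj v₁, conj v₀] (-κ) (fun x => swapConj (ψ x)) := by
  rw [isJost_iff hq] at h ⊢
  obtain ⟨hd, h0, h1⟩ := h
  refine ⟨fun x => ⟨?_, ?_⟩, ?_, ?_⟩
  · refine (hasDerivAt_conj (hd x).2).congr_deriv ?_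
    simp [swapConj]
  · refine (hasDerivAt_conj (hd x).1).congr_deriv ?_
    simp [swapConj]
  · refine ((Complex.continuous_conj.tendsto _).comp h1).congr fun x => ?_
    simp [swapConj, ← Complex.exp_conj]
  · refine ((Complex.continuous_conj.tendsto _).comp h0).congr fun x => ?_
    simp [swapConj, ← Complex.exp_conj]

/-- Reversing x and applying σ₃ with conjugation turns the equation for q into that for -conj q(-x).
A potential with limit -1 at -∞ becomes one with limit 1 at +∞, so only +∞ has to be analysed. -/
theorem IsJost.reflect {q : ℝ → ℂ} (hq : Continuous q) {z κ : ℝ} {l l' : Filter ℝ} {v₀ v₁ : ℂ}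
    {ψ : ℝ → Fin 2 → ℂ} (hl : Tendsto (fun x : ℝ => -x) l' l) (h : IsJost q z l ![v₀, v₁] κ ψ) :
    IsJost (reflectPot q) z l' ![conj v₀, -conj v₁] κ (fun x => signConj (ψ (-x))) := by
  rw [isJost_iff hq] at h
  rw [isJost_iff (continuous_reflectPot hq)]
  obtain ⟨hd, h0, h1⟩ := h
  refine ⟨fun x => ⟨?_, ?_⟩, ?_, ?_⟩
  · refine (hasDerivAt_conj ((hd (-x)).1.scomp x (hasDerivAt_neg x))).congr_deriv ?_
    simp [signConj, reflectPot]
  · refine (hasDerivAt_conj ((hd (-x)).2.scomp x (hasDerivAt_neg x))).neg.congr_deriv ?_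
    simp [signConj, reflectPot]
    ring
  · refine (((Complex.continuous_conj.tendsto _).comp h0).comp hl).congr fun x => ?_
    simp [signConj, ← Complex.exp_conj]
  · refine (((Complex.continuous_conj.tendsto _).comp h1).comp hl).neg.congr fun x => ?_
    simp [signConj, ← Complex.exp_conj]

/-- The equation sees z only through λ, so z may be replaced by any point with the same λ, in
particular by 1/z. -/
theorem IsJost.smul {q : ℝ → ℂ} (hq : Continuous q) {z z' κ : ℝ} {l : Filter ℝ} {v₀ v₁ : ℂ}
    {ψ : ℝ → Fin 2 → ℂ} (hz : spectralLambda z' = spectralLambda z) (c : ℂ)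
    (h : IsJost q z l ![v₀, v₁] κ ψ) :
    IsJost q z' l ![c * v₀, c * v₁] κ (fun x => c • ψ x) := by
  rw [isJost_iff hq] at h ⊢
  obtain ⟨hd, h0, h1⟩ := h
  rw [hz]
  refine ⟨fun x => ⟨?_, ?_⟩, ?_, ?_⟩
  · refine ((hd x).1.const_mul c).congr_deriv ?_
    simp only [Pi.smul_apply, smul_eq_mul]
    ring
  · refine ((hd x).2.const_mul c).congr_deriv ?_
    simp only [Pi.smul_apply, smul_eq_mul]
    ring
  · refine (h0.const_mul c).congr fun x => ?_
    simp only [Pi.smul_apply, smul_eq_mul]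
    ring
  · refine (h1.const_mul c).congr fun x => ?_
    simp only [Pi.smul_apply, smul_eq_mul]
    ring

theorem isJostPlus2_iff {q : ℝ → ℂ} (hq : Continuous q) {z : ℝ} {ψ : ℝ → Fin 2 → ℂ} :
    IsJostPlus2 q z ψ ↔ IsJostPlus1 q z (fun x => swapConj (ψ x)) := by
  constructor
  · intro h
    simpa [IsJostPlus1] using IsJost.swap hq h
  · intro h
    simpa [IsJostPlus2, swapConj_swapConj] using IsJost.swap hq h

theorem isJostMinus2_iff {q : ℝ → ℂ} (hq : Continuous q) {z : ℝ} {ψ : ℝ → Fin 2 → ℂ} :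
    IsJostMinus2 q z ψ ↔ IsJostMinus1 q z (fun x => swapConj (ψ x)) := by
  constructor
  · intro h
    simpa [IsJostMinus1] using IsJost.swap hq h
  · intro h
    simpa [IsJostMinus2, swapConj_swapConj] using IsJost.swap hq h

theorem isJostMinus1_iff {q : ℝ → ℂ} (hq : Continuous q) {z : ℝ} {ψ : ℝ → Fin 2 → ℂ} :
    IsJostMinus1 q z ψ ↔ IsJostPlus1 (reflectPot q) z (fun x => signConj (ψ (-x))) := by
  constructor
  · intro h
    simpa [IsJostPlus1] using IsJost.reflect hq tendsto_neg_atTop_atBot h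
  · intro h
    simpa [IsJostMinus1, signConj_signConj, reflectPot_reflectPot] using
      IsJost.reflect (continuous_reflectPot hq) tendsto_neg_atBot_atTop h

theorem spectralLambda_inv (z : ℝ) : spectralLambda z⁻¹ = spectralLambda z := by
  simp [spectralLambda, add_comm]

theorem spectralZeta_inv (z : ℝ) : spectralZeta z⁻¹ = -spectralZeta z := by
  simp [spectralZeta]
  ring

theorem IsJostPlus1.inv {q : ℝ → ℂ} (hq : Continuous q) {z : ℝ} (hz : z ≠ 0) {ψ : ℝ → Fin 2 → ℂ}
    (h : IsJostPlus1 q z ψ) : IsJostPlus1 q z⁻¹ (fun x => (z : ℂ) • swapConj (ψ x)) := by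
  have := (IsJost.swap hq h).smul hq (spectralLambda_inv z) z
  simpa [IsJostPlus1, spectralZeta_inv, hz] using this

/-- If |z| < 1/4 then |1/z| > 4, and the inversion symmetry transports existence and uniqueness. -/
theorem existsUnique_isJostPlus1 {q : ℝ → ℂ} (hq : Decay q) {z : ℝ} (hz : z ≠ 0) :
    ∃! ψ, IsJostPlus1 q z ψ := by
  have main : ∀ w : ℝ, 1 / 4 ≤ |w| → ∃! ψ, IsJostPlus1 q w ψ := fun w hw =>
    ⟨jostSol hq w, (isJostPlus1_iff hq hw).2 rfl, fun ψ h => (isJostPlus1_iff hq hw).1 h⟩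
  rcases le_or_gt (1 / 4) |z| with h | h
  · exact main z h
  · have h1 : 1 / 4 ≤ |z⁻¹| := by
      rw [abs_inv]
      have h2 : 0 < |z| := abs_pos.2 hz
      rw [le_inv_comm₀ (by norm_num) h2]
      linarith
    obtain ⟨ψ, hψ, huniq⟩ := main _ h1
    have h3 := hψ.inv hq.continuous (inv_ne_zero hz)
    rw [inv_inv] at h3
    refine ⟨_, h3, fun χ hχ => ?_⟩
    have h4 := huniq _ (hχ.inv hq.continuous hz)
    rw [← h4]
    ext x i
    fin_cases i <;> simp [swapConj, hz]

theorem existsUnique_comp_involutive {α : Type*} {P Q : α → Prop} {T S : α → α}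
    (h : ∀ a, P a ↔ Q (T a)) (hST : ∀ a, S (T a) = a) (hTS : ∀ a, T (S a) = a)
    (hQ : ∃! a, Q a) : ∃! a, P a := by
  obtain ⟨a, ha, hu⟩ := hQ
  refine ⟨S a, (h _).2 (by rwa [hTS]), fun b hb => ?_⟩
  rw [← hST b, hu _ ((h b).1 hb)]

theorem jostWellDefined {q : ℝ → ℂ} (hq : Decay q) (hr : Decay (reflectPot q)) {z : ℝ}
    (hz : z ≠ 0) : JostWellDefined q z := by
  have hm : ∃! ψ, IsJostMinus1 q z ψ :=
    existsUnique_comp_involutive (fun ψ => isJostMinus1_iff hq.continuous)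
      (S := fun ψ x => signConj (ψ (-x)))
      (fun ψ => by ext1 x; simp [signConj_signConj]) (fun ψ => by ext1 x; simp [signConj_signConj])
      (existsUnique_isJostPlus1 hr hz)
  refine ⟨hm, ?_, existsUnique_isJostPlus1 hq hz, ?_⟩
  · exact existsUnique_comp_involutive (fun ψ => isJostMinus2_iff hq.continuous)
      (S := fun ψ x => swapConj (ψ x)) (fun ψ => by ext1 x; simp [swapConj_swapConj])
      (fun ψ => by ext1 x; simp [swapConj_swapConj]) hm
  · exact existsUnique_comp_involutive (fun ψ => isJostPlus2_iff hq.continuous)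
      (S := fun ψ x => swapConj (ψ x)) (fun ψ => by ext1 x; simp [swapConj_swapConj])
      (fun ψ => by ext1 x; simp [swapConj_swapConj]) (existsUnique_isJostPlus1 hq hz)

/-! ### Values at the origin and the scattering determinants -/

theorem chosen_eq {P : (ℝ → Fin 2 → ℂ) → Prop} (h : ∃! ψ, P ψ) {ψ : ℝ → Fin 2 → ℂ} (hψ : P ψ) :
    chosen P = ψ := by
  have h1 : ∃ ψ, P ψ := ⟨ψ, hψ⟩
  rw [chosen, dif_pos h1]
  exact h.unique h1.choose_spec hψ

/-- The value at `0` of the Jost solution `ψ₁⁽⁺⁾(·; z)`, for `|z| ≥ 1/4`. -/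
def jostZero {q : ℝ → ℂ} (hq : Decay q) (z : ℝ) : Fin 2 → ℂ := jostFun (hq.moment 0) z 0

theorem ne_zero_of_quarter_le {z : ℝ} (hz : 1 / 4 ≤ |z|) : z ≠ 0 := by
  rintro rfl
  norm_num at hz

theorem jostPlus1_zero {q : ℝ → ℂ} (hq : Decay q) {z : ℝ} (hz : 1 / 4 ≤ |z|) : jostPlus1 q z 0 = jostZero hq z := by
  rw [jostPlus1, chosen_eq (existsUnique_isJostPlus1 hq (ne_zero_of_quarter_le hz))
    ((isJostPlus1_iff hq hz).2 rfl), jostSol_zero]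
  rfl

theorem jostPlus2_eq {q : ℝ → ℂ} (hq : Decay q) {z : ℝ} (hz : z ≠ 0) : jostPlus2 q z = fun x => swapConj (jostPlus1 q z x) := by
  obtain ⟨ψ, hψ⟩ := (existsUnique_isJostPlus1 hq hz).exists
  have h1 : jostPlus1 q z = ψ := chosen_eq (existsUnique_isJostPlus1 hq hz) hψ
  rw [h1, jostPlus2]
  refine chosen_eq (existsUnique_comp_involutive (fun ψ => isJostPlus2_iff hq.continuous)
      (S := fun ψ x => swapConj (ψ x)) (fun ψ => by ext1 x; simp [swapConj_swapConj])
      (fun ψ => by ext1 x; simp [swapConj_swapConj]) (existsUnique_isJostPlus1 hq hz)) ?_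
  rw [isJostPlus2_iff hq.continuous]
  simpa [swapConj_swapConj] using hψ

theorem jostMinus1_eq {q : ℝ → ℂ} (hq : Decay q) (hr : Decay (reflectPot q)) {z : ℝ} (hz : z ≠ 0) :
    jostMinus1 q z = fun x => signConj (jostPlus1 (reflectPot q) z (-x)) := by
  obtain ⟨ψ, hψ⟩ := (existsUnique_isJostPlus1 hr hz).exists
  have h1 : jostPlus1 (reflectPot q) z = ψ := chosen_eq (existsUnique_isJostPlus1 hr hz) hψ
  rw [h1, jostMinus1]
  refine chosen_eq (jostWellDefined hq hr hz).1 ?_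
  rw [isJostMinus1_iff hq.continuous]
  simpa [signConj_signConj] using hψ

theorem jostPlus1_inv {q : ℝ → ℂ} (hq : Decay q) {z : ℝ} (hz : z ≠ 0) :
    jostPlus1 q z⁻¹ = fun x => (z : ℂ) • swapConj (jostPlus1 q z x) := by
  obtain ⟨ψ, hψ⟩ := (existsUnique_isJostPlus1 hq hz).exists
  have h1 : jostPlus1 q z = ψ := chosen_eq (existsUnique_isJostPlus1 hq hz) hψ
  rw [h1]
  exact chosen_eq (existsUnique_isJostPlus1 hq (inv_ne_zero hz)) (hψ.inv hq.continuous hz)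

theorem jostMinus1_inv {q : ℝ → ℂ} (hq : Decay q) (hr : Decay (reflectPot q)) {z : ℝ}
    (hz : z ≠ 0) : jostMinus1 q z⁻¹ = fun x => (-z : ℂ) • swapConj (jostMinus1 q z x) := by
  rw [jostMinus1_eq hq hr hz, jostMinus1_eq hq hr (inv_ne_zero hz), jostPlus1_inv hr hz]
  ext x i
  fin_cases i <;> simp [swapConj, signConj]

theorem colDet_eq (u v : Fin 2 → ℂ) : colDet u v = u 0 * v 1 - v 0 * u 1 := by
  simp [colDet, Matrix.det_fin_two]

/-- Both determinants acquire the same factor z² under inversion, so it cancels in their quotient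
and the reflection coefficient satisfies r(1/z) = conj r(z). -/
theorem detA_inv {q : ℝ → ℂ} (hq : Decay q) (hr : Decay (reflectPot q)) {z : ℝ} (hz : z ≠ 0) :
    detA q z⁻¹ = z ^ 2 * conj (detA q z) := by
  rw [detA, detA, jostMinus1_inv hq hr hz, jostPlus2_eq hq hz, jostPlus2_eq hq (inv_ne_zero hz),
    jostPlus1_inv hq hz, colDet_eq, colDet_eq]
  simp [swapConj]
  ring

theorem detB_inv {q : ℝ → ℂ} (hq : Decay q) (hr : Decay (reflectPot q)) {z : ℝ} (hz : z ≠ 0) :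
    detB q z⁻¹ = z ^ 2 * conj (detB q z) := by
  rw [detB, detB, jostMinus1_inv hq hr hz, jostPlus1_inv hq hz, colDet_eq, colDet_eq]
  simp [swapConj]
  ring

theorem one_sub_inv_sq_ne_zero {z : ℝ} (hz : |z| ≠ 1) : (1 - ((z : ℂ) ^ 2)⁻¹) ≠ 0 := by
  intro h
  have h1 : ((z : ℂ) ^ 2)⁻¹ = 1 := (sub_eq_zero.1 h).symm
  rw [inv_eq_one] at h1
  have h2 : z ^ 2 = 1 := by exact_mod_cast h1
  exact hz (by rw [← sq_eq_sq₀ (abs_nonneg _) zero_le_one, sq_abs, h2, one_pow])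

theorem reflection_eq (q : ℝ → ℂ) {z : ℝ} (hz : |z| ≠ 1) :
    reflection q z = detB q z / detA q z := by
  rw [reflection, scatA, scatB, div_div_div_cancel_right₀ (one_sub_inv_sq_ne_zero hz)]

/-- This and `detB_eq` reduce the analysis of the determinants to the values at x = 0 of two half
line problems, one for q and one for its reflection. -/
theorem detA_eq {q : ℝ → ℂ} (hq : Decay q) (hr : Decay (reflectPot q)) {z : ℝ}
    (hz : 1 / 4 ≤ |z|) : detA q z =
      conj (jostZero hq z 0 * jostZero hr z 0 + jostZero hq z 1 * jostZero hr z 1) := by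
  have hz0 := ne_zero_of_quarter_le hz
  rw [detA, jostMinus1_eq hq hr hz0, jostPlus2_eq hq hz0, colDet_eq]
  simp only [neg_zero]
  rw [jostPlus1_zero hq hz, jostPlus1_zero hr hz]
  simp [swapConj, signConj]
  ring

theorem detB_eq {q : ℝ → ℂ} (hq : Decay q) (hr : Decay (reflectPot q)) {z : ℝ}
    (hz : 1 / 4 ≤ |z|) : detB q z =
      -(jostZero hq z 0 * conj (jostZero hr z 1) + jostZero hq z 1 * conj (jostZero hr z 0)) := by
  have hz0 := ne_zero_of_quarter_le hz
  rw [detB, jostMinus1_eq hq hr hz0, colDet_eq]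
  simp only [neg_zero]
  rw [jostPlus1_zero hq hz, jostPlus1_zero hr hz]
  simp [signConj]
  ring

/-- For real λ the coefficient matrix lies in su(1,1), so the indefinite form |ψ₀|² - |ψ₁|² is
constant in x. Its value is found at +∞, where the phase has modulus one. -/
theorem IsJostPlus1.conserved {q : ℝ → ℂ} (hq : Continuous q) {z : ℝ} {ψ : ℝ → Fin 2 → ℂ}
    (h : IsJostPlus1 q z ψ) (x : ℝ) :
    ψ x 0 * conj (ψ x 0) - ψ x 1 * conj (ψ x 1) = 1 - ((z : ℂ) ^ 2)⁻¹ := by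
  unfold IsJostPlus1 at h
  rw [isJost_iff hq] at h
  obtain ⟨hd, h0, h1⟩ := h
  set f : ℝ → ℂ := fun x => ψ x 0 * conj (ψ x 0) - ψ x 1 * conj (ψ x 1) with hf
  have hder : ∀ x, HasDerivAt f 0 x := by
    intro x
    refine (((hd x).1.mul (hasDerivAt_conj (hd x).1)).sub
      ((hd x).2.mul (hasDerivAt_conj (hd x).2))).congr_deriv ?_
    simp
    ring
  have hconst : ∀ y, f y = f x := fun y =>
    is_const_of_deriv_eq_zero (fun x => (hder x).differentiableAt) (fun x => (hder x).deriv) y x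
  have hphase : ∀ x : ℝ, Complex.exp (-(Complex.I * ((-spectralZeta z : ℝ) * x))) *
      conj (Complex.exp (-(Complex.I * ((-spectralZeta z : ℝ) * x)))) = 1 := by
    intro x
    rw [← Complex.exp_conj, ← Complex.exp_add]
    simp
  have hc := fun a : ℂ => Complex.continuous_conj.tendsto a
  have hlim : Tendsto f atTop (𝓝 (1 * conj 1 - (z : ℂ)⁻¹ * conj (z : ℂ)⁻¹)) := by
    refine ((h0.mul ((hc _).comp h0)).sub (h1.mul ((hc _).comp h1))).congr fun x => ?_
    simp only [Function.comp_apply, map_mul, hf]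
    linear_combination (ψ x 0 * conj (ψ x 0) - ψ x 1 * conj (ψ x 1)) * hphase x
  have := tendsto_nhds_unique hlim ((tendsto_congr hconst).2 tendsto_const_nhds)
  change f x = _
  rw [← this]
  simp
  ring

theorem jostZero_conserved {q : ℝ → ℂ} (hq : Decay q) {z : ℝ} (hz : 1 / 4 ≤ |z|) :
    jostZero hq z 0 * conj (jostZero hq z 0) - jostZero hq z 1 * conj (jostZero hq z 1) =
      1 - ((z : ℂ) ^ 2)⁻¹ := by
  have := ((isJostPlus1_iff hq hz).2 rfl).conserved hq.continuous 0
  rwa [jostSol_zero] at this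

/-- The left side factors algebraically into the product of the conserved forms of the two half line
solutions, each equal to 1 - z⁻². -/
theorem normSq_detA_sub {q : ℝ → ℂ} (hq : Decay q) (hr : Decay (reflectPot q)) {z : ℝ}
    (hz : 1 / 4 ≤ |z|) : Complex.normSq (detA q z) - Complex.normSq (detB q z) =
      (1 - (z ^ 2)⁻¹) ^ 2 := by
  have h1 := jostZero_conserved hq hz
  have h2 := jostZero_conserved hr hz
  have : (Complex.normSq (detA q z) : ℂ) - Complex.normSq (detB q z) = (1 - ((z : ℂ) ^ 2)⁻¹) ^ 2 := by
    rw [← Complex.mul_conj, ← Complex.mul_conj, detA_eq hq hr hz, detB_eq hq hr hz]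
    simp only [map_add, map_mul, Complex.conj_conj, map_neg]
    linear_combination (jostZero hr z 0 * conj (jostZero hr z 0) -
      jostZero hr z 1 * conj (jostZero hr z 1)) * h1 + (1 - ((z : ℂ) ^ 2)⁻¹) * h2
  exact_mod_cast this

/-- A zero of det_A would give -|det_B|² = (1 - z⁻²)², hence det_B = 0 and z = ±1, which genericity
excludes. -/
theorem detA_ne_zero {q : ℝ → ℂ} (hq : Decay q) (hr : Decay (reflectPot q)) (hg : IsGeneric q)
    {z : ℝ} (hz : 1 / 4 ≤ |z|) : detA q z ≠ 0 := by
  intro h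
  have h1 := normSq_detA_sub hq hr hz
  rw [h, map_zero] at h1
  have h2 := Complex.normSq_nonneg (detB q z)
  have h3 : detB q z = 0 := by
    rw [← Complex.normSq_eq_zero]
    nlinarith [sq_nonneg (1 - (z ^ 2)⁻¹)]
  rw [h3, map_zero] at h1
  have h4 : (z ^ 2)⁻¹ = 1 := by
    have : 1 - (z ^ 2)⁻¹ = 0 := by
      rw [← sq_eq_zero_iff]
      linarith
    linarith
  rw [inv_eq_one] at h4
  rcases sq_eq_one_iff.1 h4 with rfl | rfl
  · exact hg.1 h3
  · exact hg.2 h3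

/-! ### Independence of the representative of q -/

theorem IsLaxSolution.congr {q q' : ℝ → ℂ} (h : q =ᵐ[volume] q') {z : ℝ} {ψ : ℝ → Fin 2 → ℂ}
    (hψ : IsLaxSolution q z ψ) : IsLaxSolution q' z ψ := by
  have hae : (fun t => (laxMatrix q z t).mulVec (ψ t)) =ᵐ[volume]
      fun t => (laxMatrix q' z t).mulVec (ψ t) := by
    filter_upwards [h] with t ht
    rw [laxMatrix_mulVec, laxMatrix_mulVec, ht]
  refine ⟨hψ.1, fun x y => ⟨(hψ.2 x y).1.congr_ae (ae_restrict_of_ae hae), ?_⟩⟩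
  rw [(hψ.2 x y).2]
  exact intervalIntegral.integral_congr_ae (hae.mono fun t ht _ => ht)

theorem isJost_congr {q q' : ℝ → ℂ} (h : q =ᵐ[volume] q') : IsJost q = IsJost q' := by
  ext z l v κ ψ
  exact ⟨fun h1 => ⟨h1.1.congr h, h1.2⟩, fun h1 => ⟨h1.1.congr h.symm, h1.2⟩⟩

theorem jostWellDefined_congr {q q' : ℝ → ℂ} (h : q =ᵐ[volume] q') :
    JostWellDefined q = JostWellDefined q' := by
  unfold JostWellDefined IsJostMinus1 IsJostMinus2 IsJostPlus1 IsJostPlus2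
  rw [isJost_congr h]

theorem detA_congr {q q' : ℝ → ℂ} (h : q =ᵐ[volume] q') : detA q = detA q' := by
  unfold detA jostMinus1 jostPlus2 IsJostMinus1 IsJostPlus2
  rw [isJost_congr h]

theorem detB_congr {q q' : ℝ → ℂ} (h : q =ᵐ[volume] q') : detB q = detB q' := by
  unfold detB jostMinus1 jostPlus1 IsJostMinus1 IsJostPlus1
  rw [isJost_congr h]

theorem reflection_congr {q q' : ℝ → ℂ} (h : q =ᵐ[volume] q') : reflection q = reflection q' := by
  unfold reflection scatA scatB
  rw [detA_congr h, detB_congr h]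

theorem isGeneric_congr {q q' : ℝ → ℂ} (h : q =ᵐ[volume] q') : IsGeneric q = IsGeneric q' := by
  unfold IsGeneric
  rw [detB_congr h]

/-! ### Square integrability of the low frequency bounds -/

theorem memLp_two_iff_lintegral_sq {α F : Type*} [MeasurableSpace α] {μ : Measure α}
    [NormedAddCommGroup F] {f : α → F} (hf : AEStronglyMeasurable f μ) :
    MemLp f 2 μ ↔ ∫⁻ a, ‖f a‖ₑ ^ 2 ∂μ < ⊤ := by
  rw [MemLp, and_iff_right hf,
    eLpNorm_lt_top_iff_lintegral_rpow_enorm_lt_top two_ne_zero ENNReal.ofNat_ne_top]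
  simp

theorem lintegral_comp_abs_le (f : ℝ → ℝ≥0∞) :
    ∫⁻ t, f |t| ≤ 2 * ∫⁻ t in Set.Ioi 0, f t := by
  have h1 : ∫⁻ t, f |t| = ∫⁻ t in Set.Iio 0 ∪ Set.Ioi 0, f |t| := by
    rw [← setLIntegral_univ]
    refine setLIntegral_congr ?_
    rw [Set.Iio_union_Ioi]
    exact (eventuallyEq_univ.2 (compl_mem_ae_iff.2 (by simp : volume ({0} : Set ℝ) = 0))).symm
  have h2 : ∫⁻ t in Set.Iio (0 : ℝ), f |t| = ∫⁻ t in Set.Ioi (0 : ℝ), f t := by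
    have := (Measure.measurePreserving_neg (volume : Measure ℝ)).setLIntegral_comp_preimage_emb
      (MeasurableEquiv.neg ℝ).measurableEmbedding f (Set.Ioi 0)
    rw [← this]
    have h3 : (Neg.neg : ℝ → ℝ) ⁻¹' Set.Ioi 0 = Set.Iio 0 := by
      ext x
      simp
    rw [h3]
    refine setLIntegral_congr_fun measurableSet_Iio fun x hx => ?_
    simp only [abs_of_neg (Set.mem_Iio.1 hx)]
  have h3 : ∫⁻ t in Set.Ioi (0 : ℝ), f |t| = ∫⁻ t in Set.Ioi (0 : ℝ), f t :=
    setLIntegral_congr_fun measurableSet_Ioi fun x hx => by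
      simp only [abs_of_pos (Set.mem_Ioi.1 hx)]
  rw [h1]
  refine (lintegral_union_le _ _ _).trans_eq ?_
  rw [h2, h3, two_mul]

/-- The map z to ||z| - 1| is piecewise isometric and at most four to one over t > 0. -/
theorem lintegral_comp_abs_sub_one_le (f : ℝ → ℝ≥0∞) :
    ∫⁻ z, f |(|z| - 1)| ≤ 4 * ∫⁻ t in Set.Ioi 0, f t := by
  calc ∫⁻ z, f |(|z| - 1)| ≤ 2 * ∫⁻ t in Set.Ioi 0, f |t - 1| :=
        lintegral_comp_abs_le fun t => f |t - 1|
    _ ≤ 2 * ∫⁻ t, f |t - 1| := by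
        gcongr
        exact Measure.restrict_le_self
    _ = 2 * ∫⁻ t, f |t| := by
        rw [lintegral_sub_right_eq_self (fun t => f |t|) 1]
    _ ≤ 2 * (2 * ∫⁻ t in Set.Ioi 0, f t) := by
        gcongr
        exact lintegral_comp_abs_le f
    _ = _ := by
        rw [← mul_assoc]
        norm_num

theorem lintegral_rpow_Ioc {a : ℝ} (ha : 0 < a) :
    ∫⁻ t in Set.Ioc 0 a, ENNReal.ofReal (t ^ (-(1 / 2) : ℝ)) =
      ENNReal.ofReal (2 * a ^ (1 / 2 : ℝ)) := by
  rw [← ofReal_integral_eq_lintegral_ofReal]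
  · rw [← intervalIntegral.integral_of_le ha.le, integral_rpow (Or.inl (by norm_num)),
      show (-(1 / 2) + 1 : ℝ) = 1 / 2 by norm_num, Real.zero_rpow (by norm_num)]
    congr 1
    ring
  · exact (intervalIntegrable_iff_integrableOn_Ioc_of_le ha.le).1
      (intervalIntegral.intervalIntegrable_rpow' (by norm_num))
  · filter_upwards [ae_restrict_mem measurableSet_Ioc] with t ht
    exact Real.rpow_nonneg ht.1.le _

theorem lintegral_rpow_Ioi {a : ℝ} (ha : 0 < a) :
    ∫⁻ t in Set.Ioi a, ENNReal.ofReal (t ^ (-(3 / 2) : ℝ)) =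
      ENNReal.ofReal (2 * a ^ (-(1 / 2) : ℝ)) := by
  rw [← ofReal_integral_eq_lintegral_ofReal]
  · rw [integral_Ioi_rpow_of_lt (by norm_num) ha,
      show (-(3 / 2) + 1 : ℝ) = -(1 / 2) by norm_num]
    congr 1
    ring
  · exact integrableOn_Ioi_rpow_of_lt (by norm_num) ha
  · filter_upwards [ae_restrict_mem measurableSet_Ioi] with t ht
    exact Real.rpow_nonneg (ha.trans ht).le _

/-- The kernel depends on the product st only, so the power t^{-1/2} is reproduced up to a constant.
The integral is split at t = 2/s, where the two entries of the minimum coincide. -/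
theorem lintegral_min_le {s : ℝ} (hs : 0 < s) :
    ∫⁻ t in Set.Ioi 0, ENNReal.ofReal (min 1 (2 / (s * t))) * ENNReal.ofReal (t ^ (-(1 / 2) : ℝ)) ≤
      8 * ENNReal.ofReal (s ^ (-(1 / 2) : ℝ)) := by
  set a := 2 / s with ha
  have ha0 : 0 < a := by positivity
  rw [← Set.Ioc_union_Ioi_eq_Ioi ha0.le]
  refine (lintegral_union_le _ _ _).trans ?_
  have h1 : ∫⁻ t in Set.Ioc 0 a, ENNReal.ofReal (min 1 (2 / (s * t))) *
      ENNReal.ofReal (t ^ (-(1 / 2) : ℝ)) ≤ ENNReal.ofReal (2 * a ^ (1 / 2 : ℝ)) := by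
    rw [← lintegral_rpow_Ioc ha0]
    refine lintegral_mono fun t => ?_
    refine mul_le_of_le_one_left' ?_
    rw [← ENNReal.ofReal_one]
    exact ENNReal.ofReal_le_ofReal (min_le_left _ _)
  have h2 : ∫⁻ t in Set.Ioi a, ENNReal.ofReal (min 1 (2 / (s * t))) *
      ENNReal.ofReal (t ^ (-(1 / 2) : ℝ)) ≤ ENNReal.ofReal a * ENNReal.ofReal (2 * a ^ (-(1 / 2) : ℝ)) := by
    rw [← lintegral_rpow_Ioi ha0, ← lintegral_const_mul _ (by fun_prop)]
    refine setLIntegral_mono (by fun_prop) fun t ht => ?_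
    have ht0 : 0 < t := ha0.trans ht
    rw [← ENNReal.ofReal_mul (by positivity), ← ENNReal.ofReal_mul ha0.le]
    refine ENNReal.ofReal_le_ofReal ?_
    calc min 1 (2 / (s * t)) * t ^ (-(1 / 2) : ℝ) ≤ 2 / (s * t) * t ^ (-(1 / 2) : ℝ) := by
          gcongr
          exact min_le_right _ _
      _ = a * t ^ (-(3 / 2) : ℝ) := by
          rw [show (-(3 / 2) : ℝ) = -(1 / 2) + -1 by norm_num, Real.rpow_add ht0, Real.rpow_neg_one, ha]
          field_simp
  refine (add_le_add h1 h2).trans ?_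
  have h8 : (8 : ℝ≥0∞) = ENNReal.ofReal 8 := by simp
  rw [← ENNReal.ofReal_mul ha0.le, ← ENNReal.ofReal_add (by positivity) (by positivity), h8,
    ← ENNReal.ofReal_mul (by norm_num)]
  refine ENNReal.ofReal_le_ofReal ?_
  have h3 : a * (2 * a ^ (-(1 / 2) : ℝ)) = 2 * a ^ (1 / 2 : ℝ) := by
    have : a ^ (1 / 2 : ℝ) = a * a ^ (-(1 / 2) : ℝ) := by
      rw [show (1 / 2 : ℝ) = 1 + -(1 / 2) by norm_num, Real.rpow_add ha0, Real.rpow_one]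
      norm_num
    rw [this]
    ring
  have h4 : a ^ (1 / 2 : ℝ) ≤ 2 * s ^ (-(1 / 2) : ℝ) := by
    rw [ha, Real.div_rpow (by norm_num) hs.le, Real.rpow_neg hs.le, div_eq_mul_inv]
    gcongr
    calc (2 : ℝ) ^ (1 / 2 : ℝ) ≤ 2 ^ (1 : ℝ) :=
          Real.rpow_le_rpow_of_exponent_le (by norm_num) (by norm_num)
      _ = 2 := Real.rpow_one 2
  rw [h3]
  linarith

/-- Schur's test with the weight y^{-1/2} in both variables; the kernel is symmetric, so one
computation serves twice. -/
theorem lintegral_min_sq_le {h : ℝ → ℝ≥0∞} (hh : Measurable h) :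
    ∫⁻ t in Set.Ioi 0, (∫⁻ y in Set.Ioi 0, ENNReal.ofReal (min 1 (2 / (t * y))) * h y) ^ 2 ≤
      8 * 8 * ∫⁻ y in Set.Ioi 0, h y ^ 2 := by
  refine lintegral_schur (u := fun y => ENNReal.ofReal (y ^ (-(1 / 2) : ℝ)))
    (v := fun y => ENNReal.ofReal (y ^ (-(1 / 2) : ℝ))) ?_ hh (by fun_prop) (by fun_prop) ?_ ?_ ?_
  · unfold Function.uncurry
    fun_prop
  · filter_upwards [ae_restrict_mem measurableSet_Ioi] with y hy
    exact ⟨by simpa using Real.rpow_pos_of_pos hy _, ENNReal.ofReal_ne_top⟩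
  · filter_upwards [ae_restrict_mem measurableSet_Ioi] with t ht
    exact lintegral_min_le ht
  · filter_upwards [ae_restrict_mem measurableSet_Ioi] with y hy
    simp only [mul_comm _ y]
    exact lintegral_min_le hy

theorem abs_sub_one_le_spectralZeta (z : ℝ) (hz : z ≠ 0) : |(|z| - 1)| ≤ 2 * |spectralZeta z| := by
  have h0 : 0 < |z| := abs_pos.2 hz
  have h1 : |z| * (2 * |spectralZeta z|) = |(|z| - 1)| * (|z| + 1) := by
    rw [← abs_of_pos (show (0 : ℝ) < |z| + 1 by positivity), ← abs_mul,
      show (2 : ℝ) = |2| by norm_num, ← abs_mul, ← abs_mul]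
    have h2 : z * (2 * spectralZeta z) = (|z| - 1) * (|z| + 1) := by
      rw [spectralZeta]
      have := sq_abs z
      field_simp
      nlinarith
    rw [h2]
  have h3 := abs_nonneg (|z| - 1)
  nlinarith

/-- Because ||z| - 1| ≤ 2|ζ|, the integral is dominated by the operator with kernel min(1, 2/(ty))
applied to y^{j+1}n at t = ||z| - 1|. Boundedness of that operator on L² then needs only L² control
of y^{j+1}n. -/
theorem memLp_min_moment {j : ℕ} {n : ℝ → ℝ} (hn : Measurable n)
    (hL : MemLp (fun y => y ^ (j + 1) * n y) 2 (volume.restrict (Set.Ioi 0))) (c : ℝ) :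
    MemLp (fun z => ∫ y in Set.Ioi 0, c * min (y ^ (j + 1)) (y ^ j / |spectralZeta z|) * n y) 2
      volume := by
  have hmeas : Measurable fun z : ℝ × ℝ =>
      c * min (z.2 ^ (j + 1)) (z.2 ^ j / |spectralZeta z.1|) * n z.2 := by
    unfold spectralZeta
    fun_prop
  have hsm : StronglyMeasurable
      fun z => ∫ y in Set.Ioi 0, c * min (y ^ (j + 1)) (y ^ j / |spectralZeta z|) * n y :=
    hmeas.stronglyMeasurable.integral_prod_right'
  rw [memLp_two_iff_lintegral_sq hsm.aestronglyMeasurable]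
  rw [memLp_two_iff_lintegral_sq hL.1] at hL
  set h : ℝ → ℝ≥0∞ := fun y => ‖c‖ₑ * ‖y ^ (j + 1) * n y‖ₑ with hh
  have hhm : Measurable h := by fun_prop
  have key : ∀ᵐ z : ℝ, ‖∫ y in Set.Ioi 0, c * min (y ^ (j + 1)) (y ^ j / |spectralZeta z|) * n y‖ₑ ^ 2 ≤
      (fun t => (∫⁻ y in Set.Ioi 0, ENNReal.ofReal (min 1 (2 / (t * y))) * h y) ^ 2) |(|z| - 1)| := by
    have h0 : ∀ᵐ z : ℝ, z ∉ ({0, 1, -1} : Set ℝ) :=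
      compl_mem_ae_iff.2 ((Set.toFinite _).measure_zero _)
    filter_upwards [h0] with z hz
    simp only [Set.mem_insert_iff, Set.mem_singleton_iff, not_or] at hz
    have ht : 0 < |(|z| - 1)| := by
      rw [abs_pos, sub_ne_zero]
      intro h1
      rcases eq_or_eq_neg_of_abs_eq h1 with h2 | h2
      · exact hz.2.1 h2
      · exact hz.2.2 h2
    have hζ := abs_sub_one_le_spectralZeta z hz.1
    have hζ0 : 0 < |spectralZeta z| := by linarith
    gcongr
    refine (enorm_integral_le_lintegral_enorm _).trans ?_
    refine setLIntegral_mono' measurableSet_Ioi fun y hy => ?_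
    have hy0 : 0 < y := hy
    have hmin : min (y ^ (j + 1)) (y ^ j / |spectralZeta z|) ≤
        min 1 (2 / (|(|z| - 1)| * y)) * y ^ (j + 1) := by
      rw [min_mul_of_nonneg _ _ (by positivity), one_mul]
      refine min_le_min le_rfl ?_
      rw [div_mul_eq_mul_div, div_le_div_iff₀ hζ0 (by positivity)]
      calc y ^ j * (|(|z| - 1)| * y) = |(|z| - 1)| * y ^ (j + 1) := by ring
        _ ≤ 2 * |spectralZeta z| * y ^ (j + 1) := by gcongr
        _ = _ := by ring
    have e1 : ‖min (y ^ (j + 1)) (y ^ j / |spectralZeta z|)‖ₑ ≤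
        ENNReal.ofReal (min 1 (2 / (|(|z| - 1)| * y))) * ‖y ^ (j + 1)‖ₑ := by
      rw [Real.enorm_of_nonneg (by positivity), Real.enorm_of_nonneg (by positivity),
        ← ENNReal.ofReal_mul (by positivity)]
      exact ENNReal.ofReal_le_ofReal hmin
    rw [enorm_mul, enorm_mul, hh]
    simp only [enorm_mul]
    calc ‖c‖ₑ * ‖min (y ^ (j + 1)) (y ^ j / |spectralZeta z|)‖ₑ * ‖n y‖ₑ
        ≤ ‖c‖ₑ * (ENNReal.ofReal (min 1 (2 / (|(|z| - 1)| * y))) * ‖y ^ (j + 1)‖ₑ) * ‖n y‖ₑ := by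
          gcongr
      _ = _ := by ring
  refine (lintegral_mono_ae key).trans_lt ?_
  refine (lintegral_comp_abs_sub_one_le fun t =>
    (∫⁻ y in Set.Ioi 0, ENNReal.ofReal (min 1 (2 / (t * y))) * h y) ^ 2).trans_lt ?_
  refine ENNReal.mul_lt_top (by simp) ((lintegral_min_sq_le hhm).trans_lt ?_)
  refine ENNReal.mul_lt_top (by norm_num) ?_
  simp only [hh, mul_pow]
  rw [lintegral_const_mul' _ _ (by simp)]
  exact ENNReal.mul_lt_top (by simp) (by simpa only [mul_pow, enorm_mul] using hL)

/-! ### A regularity class near the points `z = ±1` -/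

/-- The annulus `1/2 ≤ |z| ≤ 2`. -/
def annulus : Set ℝ := {z | 1 / 2 ≤ |z| ∧ |z| ≤ 2}

theorem isCompact_annulus : IsCompact annulus := by
  refine Metric.isCompact_of_isClosed_isBounded ?_ ?_
  · exact (isClosed_le continuous_const continuous_abs).inter
      (isClosed_le continuous_abs continuous_const)
  · refine (Metric.isBounded_closedBall (x := (0 : ℝ)) (r := 2)).subset fun z hz => ?_
    rw [mem_closedBall_zero_iff]
    exact hz.2

instance : IsFiniteMeasure (volume.restrict annulus) :=
  ⟨by rw [Measure.restrict_apply_univ]; exact isCompact_annulus.measure_lt_top⟩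

/-- `SobolevReg k f`: on `|z| > 1/4`, `f` is `k` times differentiable, the `k`-th derivative is
continuous and differentiable off `|z| = 1`, with a derivative that is square integrable on the
annulus `1/2 ≤ |z| ≤ 2`. -/
def SobolevReg {X : Type*} [NormedAddCommGroup X] [NormedSpace ℝ X] : ℕ → (ℝ → X) → Prop
  | 0, f => (∀ z, 1 / 4 < |z| → ContinuousAt f z) ∧ ∃ f' : ℝ → X,
      (∀ z, 1 / 4 < |z| → |z| ≠ 1 → HasDerivAt f (f' z) z) ∧
      ∃ b : ℝ → ℝ, MemLp b 2 (volume.restrict annulus) ∧ ∀ z ∈ annulus, |z| ≠ 1 → ‖f' z‖ ≤ b z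
  | k + 1, f => ∃ f' : ℝ → X, (∀ z, 1 / 4 < |z| → HasDerivAt f (f' z) z) ∧ SobolevReg k f'

namespace SobolevReg

variable {X Y Z : Type*} [NormedAddCommGroup X] [NormedSpace ℝ X] [NormedAddCommGroup Y]
  [NormedSpace ℝ Y] [NormedAddCommGroup Z] [NormedSpace ℝ Z]

theorem continuousAt {k : ℕ} {f : ℝ → X} (h : SobolevReg k f) {z : ℝ} (hz : 1 / 4 < |z|) :
    ContinuousAt f z := by
  cases k with
  | zero => exact h.1 z hz
  | succ k =>
    obtain ⟨f', hf, -⟩ := h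
    exact (hf z hz).continuousAt

theorem exists_bound {k : ℕ} {f : ℝ → X} (h : SobolevReg k f) : ∃ C, ∀ z ∈ annulus, ‖f z‖ ≤ C :=
  isCompact_annulus.exists_bound_of_continuousOn fun z hz =>
    (h.continuousAt (by linarith [hz.1])).continuousWithinAt

theorem of_hasDerivAt {f f' : ℝ → X} (h : ∀ z, 1 / 4 < |z| → HasDerivAt f (f' z) z)
    {C : ℝ} (hf' : ∀ z ∈ annulus, ‖f' z‖ ≤ C) : SobolevReg 0 f :=
  ⟨fun z hz => (h z hz).continuousAt, f', fun z hz _ => h z hz, fun _ => C, memLp_const C,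
    fun z hz _ => hf' z hz⟩

theorem of_succ {k : ℕ} {f : ℝ → X} (h : SobolevReg (k + 1) f) : SobolevReg k f := by
  induction k generalizing f with
  | zero =>
    obtain ⟨f', hf, hf'⟩ := h
    obtain ⟨C, hC⟩ := hf'.exists_bound
    exact of_hasDerivAt hf hC
  | succ k ih =>
    obtain ⟨f', hf, hf'⟩ := h
    exact ⟨f', hf, ih hf'⟩

theorem const (k : ℕ) (c : X) : SobolevReg k (fun _ => c) := by
  induction k generalizing c with
  | zero => exact of_hasDerivAt (fun z _ => hasDerivAt_const z c) (C := 0) (by simp)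
  | succ k ih => exact ⟨fun _ => 0, fun z _ => hasDerivAt_const z c, ih 0⟩

theorem id (k : ℕ) : SobolevReg k (fun z : ℝ => z) := by
  cases k with
  | zero => exact of_hasDerivAt (fun z _ => hasDerivAt_id z) (C := 1) (by simp)
  | succ k => exact ⟨fun _ => 1, fun z _ => hasDerivAt_id z, const k 1⟩

theorem add {k : ℕ} {f g : ℝ → X} (hf : SobolevReg k f) (hg : SobolevReg k g) :
    SobolevReg k (fun z => f z + g z) := by
  induction k generalizing f g with
  | zero =>
    obtain ⟨cf, f', hf', b, hb, hb'⟩ := hf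
    obtain ⟨cg, g', hg', c, hc, hc'⟩ := hg
    refine ⟨fun z hz => (cf z hz).add (cg z hz), fun z => f' z + g' z,
      fun z hz h1 => (hf' z hz h1).add (hg' z hz h1), fun z => b z + c z, hb.add hc,
      fun z hz h1 => (norm_add_le _ _).trans (add_le_add (hb' z hz h1) (hc' z hz h1))⟩
  | succ k ih =>
    obtain ⟨f', hf', hf⟩ := hf
    obtain ⟨g', hg', hg⟩ := hg
    exact ⟨_, fun z hz => (hf' z hz).add (hg' z hz), ih hf hg⟩

/-- The Leibniz rule. Functions in the class are continuous, hence bounded on the compact annulus,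
so multiplying the L² bound of one top derivative by the other factor keeps it in L². -/
theorem bilin {k : ℕ} (B : X →L[ℝ] Y →L[ℝ] Z) {f : ℝ → X} {g : ℝ → Y} (hf : SobolevReg k f)
    (hg : SobolevReg k g) : SobolevReg k (fun z => B (f z) (g z)) := by
  have hd : ∀ {f f' : ℝ → X} {g g' : ℝ → Y} {z : ℝ}, HasDerivAt f (f' z) z →
      HasDerivAt g (g' z) z →
      HasDerivAt (fun z => B (f z) (g z)) (B (f' z) (g z) + B (f z) (g' z)) z :=
    fun h1 h2 => (B.hasFDerivAt.comp_hasDerivAt _ h1).clm_apply h2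
  induction k generalizing f g with
  | zero =>
    obtain ⟨C, hC⟩ := hf.exists_bound
    obtain ⟨D, hD⟩ := hg.exists_bound
    obtain ⟨cf, f', hf', b, hb, hb'⟩ := hf
    obtain ⟨cg, g', hg', c, hc, hc'⟩ := hg
    refine ⟨fun z hz => ((B.continuous.continuousAt).comp (cf z hz)).clm_apply (cg z hz), _,
      fun z hz h1 => hd (hf' z hz h1) (hg' z hz h1),
      fun z => ‖B‖ * D * b z + ‖B‖ * C * c z, (hb.const_mul _).add (hc.const_mul _), ?_⟩
    intro z hz h1
    refine (norm_add_le _ _).trans (add_le_add ?_ ?_)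
    · calc ‖B (f' z) (g z)‖ ≤ ‖B‖ * ‖f' z‖ * ‖g z‖ := B.le_opNorm₂ _ _
        _ ≤ ‖B‖ * b z * D := by
          have := (norm_nonneg _).trans (hb' z hz h1)
          gcongr
          · exact hb' z hz h1
          · exact hD z hz
        _ = _ := by ring
    · calc ‖B (f z) (g' z)‖ ≤ ‖B‖ * ‖f z‖ * ‖g' z‖ := B.le_opNorm₂ _ _
        _ ≤ ‖B‖ * C * c z := by
          have := (norm_nonneg _).trans (hC z hz)
          gcongr
          · exact hC z hz
          · exact hc' z hz h1
  | succ k ih =>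
    have hf0 := hf.of_succ
    have hg0 := hg.of_succ
    obtain ⟨f', hf', hf⟩ := hf
    obtain ⟨g', hg', hg⟩ := hg
    exact ⟨_, fun z hz => hd (hf' z hz) (hg' z hz), (ih hf hg0).add (ih hf0 hg)⟩

theorem clm {k : ℕ} (L : X →L[ℝ] Y) {f : ℝ → X} (hf : SobolevReg k f) :
    SobolevReg k (fun z => L (f z)) :=
  bilin (ContinuousLinearMap.id ℝ (X →L[ℝ] Y)) (const k L) hf

theorem smul {k : ℕ} {c : ℝ → ℝ} {f : ℝ → X} (hc : SobolevReg k c) (hf : SobolevReg k f) :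
    SobolevReg k (fun z => c z • f z) :=
  bilin (ContinuousLinearMap.lsmul ℝ ℝ) hc hf

theorem mul {k : ℕ} {A : Type*} [NormedRing A] [NormedAlgebra ℝ A] {f g : ℝ → A}
    (hf : SobolevReg k f) (hg : SobolevReg k g) : SobolevReg k (fun z => f z * g z) :=
  bilin (ContinuousLinearMap.mul ℝ A) hf hg

/-- The derivative of the inverse is -f⁻¹f'f⁻¹, so the class at level k + 1 follows from stability
under products at level k. -/
theorem inverse {k : ℕ} {A : Type*} [NormedRing A] [NormedAlgebra ℝ A] [CompleteSpace A] {f : ℝ → A}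
    (hf : SobolevReg k f) (hu : ∀ z, 1 / 4 < |z| → IsUnit (f z)) :
    SobolevReg k (fun z => Ring.inverse (f z)) := by
  have hd : ∀ {f' : ℝ → A} {z : ℝ}, 1 / 4 < |z| → HasDerivAt f (f' z) z →
      HasDerivAt (fun z => Ring.inverse (f z))
        ((-1 : ℝ) • (Ring.inverse (f z) * f' z * Ring.inverse (f z))) z := by
    intro f' z hz h
    obtain ⟨u, hu⟩ := hu z hz
    have h1 := hasFDerivAt_ringInverse (𝕜 := ℝ) u
    rw [hu] at h1
    refine (h1.comp_hasDerivAt z h).congr_deriv ?_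
    rw [← hu, Ring.inverse_unit]
    simp
  have hc : ∀ z, 1 / 4 < |z| → ContinuousAt (fun z => Ring.inverse (f z)) z := by
    intro z hz
    obtain ⟨u, hu⟩ := hu z hz
    refine ContinuousAt.comp (g := Ring.inverse) ?_ (hf.continuousAt hz)
    rw [← hu]
    exact NormedRing.inverse_continuousAt u
  induction k generalizing f with
  | zero =>
    obtain ⟨C, hC⟩ := isCompact_annulus.exists_bound_of_continuousOn (f := fun z => Ring.inverse (f z))
      fun z hz => (hc z (by linarith [hz.1])).continuousWithinAt
    obtain ⟨cf, f', hf', b, hb, hb'⟩ := hf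
    refine ⟨hc, _, fun z hz h1 => hd hz (hf' z hz h1), fun z => C * C * b z, hb.const_mul _, ?_⟩
    intro z hz h1
    have hC0 := (norm_nonneg _).trans (hC z hz)
    have hb0 := (norm_nonneg _).trans (hb' z hz h1)
    rw [neg_one_smul, norm_neg]
    calc _ ≤ ‖Ring.inverse (f z)‖ * ‖f' z‖ * ‖Ring.inverse (f z)‖ :=
          (norm_mul_le _ _).trans (by gcongr; exact norm_mul_le _ _)
      _ ≤ C * b z * C := by
          gcongr
          · exact hC z hz
          · exact hb' z hz h1
          · exact hC z hz
      _ = _ := by ring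
  | succ k ih =>
    have hi := ih hf.of_succ hu hd hc
    obtain ⟨f', hf', hf⟩ := hf
    exact ⟨_, fun z hz => hd hz (hf' z hz), (const k (-1 : ℝ)).smul ((hi.mul hf).mul hi)⟩

theorem congr {k : ℕ} {f g : ℝ → X} (hf : SobolevReg k f) (h : ∀ z, 1 / 4 < |z| → f z = g z) :
    SobolevReg k g := by
  have hev : ∀ z, 1 / 4 < |z| → g =ᶠ[𝓝 z] f := fun z hz => by
    filter_upwards [(isOpen_lt continuous_const continuous_abs).mem_nhds hz] with w hw
    exact (h w hw).symm
  cases k with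
  | zero =>
    obtain ⟨cf, f', hf', hb⟩ := hf
    exact ⟨fun z hz => (cf z hz).congr (hev z hz).symm, f',
      fun z hz h1 => (hf' z hz h1).congr_of_eventuallyEq (hev z hz), hb⟩
  | succ k =>
    obtain ⟨f', hf', hf⟩ := hf
    exact ⟨f', fun z hz => (hf' z hz).congr_of_eventuallyEq (hev z hz), hf⟩

theorem inv (k : ℕ) : SobolevReg k (fun z : ℝ => z⁻¹) := by
  refine ((id k).inverse fun z hz => ?_).congr fun z _ => Ring.inverse_eq_inv z
  rw [isUnit_iff_ne_zero]
  rintro rfl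
  norm_num at hz

end SobolevReg

/-! ### Regularity of the Jost solutions in the spectral parameter -/

theorem hasDerivAt_spectralZeta {z : ℝ} (hz : z ≠ 0) :
    HasDerivAt spectralZeta ((1 + z⁻¹ * z⁻¹) / 2) z := by
  refine (((hasDerivAt_id z).sub (hasDerivAt_inv hz)).div_const 2).congr_deriv ?_
  field_simp
  ring

theorem ne_zero_of_quarter_lt {z : ℝ} (hz : 1 / 4 < |z|) : z ≠ 0 := ne_zero_of_quarter_le hz.le

theorem spectralZeta_ne_zero {z : ℝ} (hz : z ≠ 0) (h1 : |z| ≠ 1) : spectralZeta z ≠ 0 := by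
  intro h
  have := abs_sub_one_le_spectralZeta z hz
  rw [h, abs_zero, mul_zero] at this
  exact h1 (sub_eq_zero.1 (abs_eq_zero.1 (le_antisymm this (abs_nonneg _))))

theorem abs_spectralZeta_deriv_le {z : ℝ} (hz : 1 / 2 ≤ |z|) : |(1 + z⁻¹ * z⁻¹) / 2| ≤ 5 / 2 := by
  have h1 : z⁻¹ * z⁻¹ ≤ 4 := by
    rw [← abs_mul_abs_self, abs_inv]
    have : |z|⁻¹ ≤ 2 := by
      rw [inv_le_comm₀ (by linarith) (by norm_num)]
      linarith
    nlinarith [inv_nonneg.2 (abs_nonneg z)]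
  have h2 := mul_self_nonneg z⁻¹
  rw [abs_of_nonneg (by positivity)]
  linarith

theorem SobolevReg.spectralZeta_deriv (k : ℕ) :
    SobolevReg k (fun z : ℝ => (1 + z⁻¹ * z⁻¹) / 2) := by
  refine (((SobolevReg.const k (1 : ℝ)).add ((SobolevReg.inv k).mul (SobolevReg.inv k))).mul
    (SobolevReg.const k (1 / 2 : ℝ))).congr fun z _ => by ring

/-- Differentiation raises j by one and lowers k by one, so j + k and both hypotheses are unchanged
along the induction. At k = 0 the derivative exists only off |z| = 1, and `memLp_min_moment` makes
its bound square integrable. -/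
theorem VolterraData.sobolevReg_phiOp {E : Type*} [NormedAddCommGroup E] [NormedSpace ℂ E]
    {D : VolterraData E} {j k : ℕ} (h : D.Moment (j + k + 1))
    (hL : MemLp (fun y => y ^ (j + k + 2) * ‖D.V y‖) 2 (volume.restrict (Set.Ioi 0))) :
    SobolevReg k (fun z => D.phiOp j (spectralZeta z)) := by
  induction k generalizing j with
  | zero =>
    refine ⟨fun z hz => ?_, fun z => ((1 + z⁻¹ * z⁻¹) / 2) • D.phiOp (j + 1) (spectralZeta z), ?_,
      ?_⟩
    · exact (VolterraData.continuous_phiOp h le_rfl).continuousAt.comp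
        (hasDerivAt_spectralZeta (ne_zero_of_quarter_lt hz)).continuousAt
    · intro z hz h1
      have hz0 := ne_zero_of_quarter_lt hz
      exact (VolterraData.hasDerivAt_phiOp_of_ne h le_rfl (spectralZeta_ne_zero hz0 h1)).scomp z
        (hasDerivAt_spectralZeta hz0)
    · have hb := memLp_min_moment (j := j + 1) (D.continuous_V.norm.measurable) hL
        (2 ^ (j + 1) * ((j + 1 : ℕ) + 1))
      refine ⟨_, (hb.restrict annulus).const_mul (5 / 2), fun z hz h1 => ?_⟩
      have hz0 : z ≠ 0 := ne_zero_of_quarter_le (by linarith [hz.1])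
      rw [norm_smul]
      have h2 := VolterraData.norm_phiOp_le
        (VolterraData.phi_dominates_min h (j := j + 1) le_rfl (spectralZeta_ne_zero hz0 h1))
      exact mul_le_mul (abs_spectralZeta_deriv_le hz.1) h2 (norm_nonneg _) (by norm_num)
  | succ k ih =>
    refine ⟨fun z => ((1 + z⁻¹ * z⁻¹) / 2) • D.phiOp (j + 1) (spectralZeta z), fun z hz => ?_,
      (SobolevReg.spectralZeta_deriv k).smul (ih (j := j + 1) ?_ ?_)⟩
    · exact (VolterraData.hasDerivAt_phiOp h (by omega) _).scomp z
        (hasDerivAt_spectralZeta (ne_zero_of_quarter_lt hz))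
    · rwa [show j + 1 + k + 1 = j + (k + 1) + 1 by ring]
    · rwa [show j + 1 + k + 2 = j + (k + 1) + 2 by ring]

theorem SobolevReg.clm_apply {E : Type*} [NormedAddCommGroup E] [NormedSpace ℂ E] {k : ℕ}
    {f : ℝ → E →L[ℂ] E} {g : ℝ → E} (hf : SobolevReg k f) (hg : SobolevReg k g) :
    SobolevReg k (fun z => f z (g z)) :=
  SobolevReg.bilin (ContinuousLinearMap.bilinearRestrictScalars ℝ (𝕜' := ℂ) (E := E →L[ℂ] E)
    (ContinuousLinearMap.id ℂ (E →L[ℂ] E))) hf hg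

section

variable {p : ℝ → ℂ} {hp : Continuous p}

/-- All dependence on z sits in the Laurent polynomial N(z) and in the oscillatory operator, each of
which belongs to the class. -/
theorem sobolevReg_jostOp {k : ℕ} (h : (jostData p hp).Moment (k + 1))
    (hL : MemLp (fun y => y ^ (k + 2) * ‖pertV p y‖) 2 (volume.restrict (Set.Ioi 0))) :
    SobolevReg k (jostOp p hp) := by
  have h1 : SobolevReg k fun z => (jostData p hp).phiOp 0 (spectralZeta z) :=
    VolterraData.sobolevReg_phiOp (by rwa [Nat.zero_add]) (by rwa [Nat.zero_add])
  have h2 : SobolevReg k opN :=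
    (((SobolevReg.inv k).smul (SobolevReg.const k _)).add (SobolevReg.const k _)).add
      ((SobolevReg.id k).smul (SobolevReg.const k _))
  exact (SobolevReg.const k _).add (h2.mul h1)

theorem sobolevReg_jostRes {k : ℕ} (h1 : (jostData p hp).Moment 1)
    (h : (jostData p hp).Moment (k + 1))
    (hL : MemLp (fun y => y ^ (k + 2) * ‖pertV p y‖) 2 (volume.restrict (Set.Ioi 0))) :
    SobolevReg k (jostRes p hp) :=
  SobolevReg.inverse (f := fun z => 1 + jostOp p hp z)
    ((SobolevReg.const k _).add (sobolevReg_jostOp h hL)) fun _ hz => isUnit_one_add_jostOp h1 hz.le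

theorem sobolevReg_jostM {k : ℕ} (h1 : (jostData p hp).Moment 1)
    (h : (jostData p hp).Moment (k + 1))
    (hL : MemLp (fun y => y ^ (k + 2) * ‖pertV p y‖) 2 (volume.restrict (Set.Ioi 0))) :
    SobolevReg k (jostM h1) := by
  have h2 : SobolevReg k (jostRhs h1) :=
    (SobolevReg.const k _).add ((SobolevReg.inv k).smul (SobolevReg.const k _))
  exact SobolevReg.clm_apply (sobolevReg_jostRes h1 h hL) h2

theorem jostFun_zero_eq (h1 : (jostData p hp).Moment 1) (z : ℝ) : jostFun h1 z 0 = jostM h1 z 0 := by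
  rw [jostFun, weightExp_zero, Real.exp_zero, one_smul]

theorem sobolevReg_jostFun_zero {k : ℕ} (h1 : (jostData p hp).Moment 1)
    (h : (jostData p hp).Moment (k + 1))
    (hL : MemLp (fun y => y ^ (k + 2) * ‖pertV p y‖) 2 (volume.restrict (Set.Ioi 0))) (i : Fin 2) :
    SobolevReg k (fun z => jostFun h1 z 0 i) := by
  have h2 := ((sobolevReg_jostM h1 h hL).clm (BoundedContinuousFunction.evalCLM ℝ (0 : ℝ))).clm
    (ContinuousLinearMap.proj (R := ℝ) (φ := fun _ : Fin 2 => ℂ) i)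
  refine h2.congr fun z _ => ?_
  rw [jostFun_zero_eq]
  rfl

end

/-- Weighted integrability of `q - 1` on the half line, as it is used for regularity near `z = ±1`. -/
structure MomentReg (k : ℕ) (q : ℝ → ℂ) : Prop extends Decay q where
  moment_succ : (jostData (shiftPert q 0) (toDecay.continuous_shift 0)).Moment (k + 1)
  memLp : MemLp (fun y => y ^ (k + 2) * ‖pertV (shiftPert q 0) y‖) 2 (volume.restrict (Set.Ioi 0))

theorem MomentReg.sobolevReg {k : ℕ} {q : ℝ → ℂ} (h : MomentReg k q) (i : Fin 2) :
    SobolevReg k (fun z => jostZero h.toDecay z i) :=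
  sobolevReg_jostFun_zero (h.toDecay.moment 0) h.moment_succ h.memLp i

theorem SobolevReg.conj {k : ℕ} {f : ℝ → ℂ} (h : SobolevReg k f) :
    SobolevReg k (fun z => conj (f z)) :=
  h.clm Complex.conjCLE.toContinuousLinearMap

theorem sobolevReg_detA {k : ℕ} {q : ℝ → ℂ} (hq : MomentReg k q) (hr : MomentReg k (reflectPot q)) :
    SobolevReg k (detA q) :=
  (((hq.sobolevReg 0).mul (hr.sobolevReg 0)).add
    ((hq.sobolevReg 1).mul (hr.sobolevReg 1))).conj.congr fun _ hz =>
      (detA_eq hq.toDecay hr.toDecay hz.le).symm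

theorem sobolevReg_detB {k : ℕ} {q : ℝ → ℂ} (hq : MomentReg k q) (hr : MomentReg k (reflectPot q)) :
    SobolevReg k (detB q) := by
  refine ((SobolevReg.const k (-1 : ℝ)).smul (((hq.sobolevReg 0).mul (hr.sobolevReg 1).conj).add
    ((hq.sobolevReg 1).mul (hr.sobolevReg 0).conj))).congr fun z hz => ?_
  rw [detB_eq hq.toDecay hr.toDecay hz.le, neg_one_smul]

/-- Genericity enters here, as invertibility of the denominator across z = ±1. -/
theorem sobolevReg_quotient {k : ℕ} {q : ℝ → ℂ} (hq : MomentReg k q)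
    (hr : MomentReg k (reflectPot q)) (hg : IsGeneric q) :
    SobolevReg k (fun z => detB q z / detA q z) := by
  refine ((sobolevReg_detB hq hr).mul ((sobolevReg_detA hq hr).inverse fun z hz =>
    (detA_ne_zero hq.toDecay hr.toDecay hg hz.le).isUnit)).congr fun z _ => ?_
  rw [Ring.inverse_eq_inv, div_eq_mul_inv]

/-! ### Large spectral parameters -/

/-- Absolutely continuous potentials `q` with derivative `g`, with the decay on `[0, ∞)` used
for large spectral parameters. -/
structure EnergyPot (q g : ℝ → ℂ) : Prop extends Decay q where
  intervalIntegrable : ∀ a b, IntervalIntegrable g volume a b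
  eq_primitive : ∀ a x, q x = q a + ∫ t in a..x, g t
  integrableOn_deriv : IntegrableOn g (Set.Ioi 0)
  memLp_deriv : MemLp g 2 (volume.restrict (Set.Ioi 0))
  memLp_mul : MemLp (fun y : ℝ => (y : ℂ) * (q y - 1)) 2 (volume.restrict (Set.Ioi 0))
  memLp_mul_deriv : MemLp (fun y : ℝ => (y : ℂ) * g y) 2 (volume.restrict (Set.Ioi 0))

/-- The density `|q|² - 1`. -/
def excess (q : ℝ → ℂ) (x : ℝ) : ℂ := q x * conj (q x) - 1

/-- The components of the normalized Jost solution on the half line. -/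
def jostComp {q : ℝ → ℂ} (hq : Decay q) (z : ℝ) (i : Fin 2) (x : ℝ) : ℂ :=
  jostFun (hq.moment 0) z x i

@[fun_prop]
theorem continuous_jostComp {q : ℝ → ℂ} (hq : Decay q) (z : ℝ) (i : Fin 2) :
    Continuous (jostComp hq z i) :=
  (continuous_apply i).comp (continuous_jostFun (hq.moment 0) z)

theorem norm_jostComp_le {q : ℝ → ℂ} (hq : Decay q) (z : ℝ) (i : Fin 2) {x : ℝ} (hx : 0 ≤ x) :
    ‖jostComp hq z i x‖ ≤ ‖jostM (hq.moment 0) z‖ :=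
  (norm_le_pi_norm _ i).trans (norm_jostFun_le (hq.moment 0) z hx)

theorem hasDerivAt_jostComp {q : ℝ → ℂ} (hq : Decay q) {z : ℝ} (hz : 1 / 4 ≤ |z|) {x : ℝ}
    (hx : 0 < x) :
    HasDerivAt (jostComp hq z 0)
      (-Complex.I * (z : ℂ)⁻¹ * jostComp hq z 0 x + Complex.I * conj (q x) * jostComp hq z 1 x) x ∧
    HasDerivAt (jostComp hq z 1)
      (Complex.I * z * jostComp hq z 1 x - Complex.I * q x * jostComp hq z 0 x) x := by
  have h := (isVolterraSol_jostFun (hq.moment 0) hz).hasDerivAt (hq.moment 0)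
    (ne_zero_of_quarter_le hz) (continuous_jostFun (hq.moment 0) z).continuousOn
    ⟨_, fun x hx => norm_jostFun_le (hq.moment 0) z hx⟩ hx
  have h0 := (hasDerivAt_pi.1 h) 0
  have h1 := (hasDerivAt_pi.1 h) 1
  constructor
  · refine h0.congr_deriv ?_
    simp [matN_apply, pertV_apply, shiftPert, jostComp]
    ring
  · refine h1.congr_deriv ?_
    simp [matN_apply, pertV_apply, shiftPert, jostComp]
    ring

theorem tendsto_jostComp {q : ℝ → ℂ} (hq : Decay q) {z : ℝ} (hz : 1 / 4 ≤ |z|) :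
    Tendsto (jostComp hq z 0) atTop (𝓝 1) ∧ Tendsto (jostComp hq z 1) atTop (𝓝 (z : ℂ)⁻¹) := by
  have h := (isVolterraSol_jostFun (hq.moment 0) hz).tendsto (hq.moment 0)
    ⟨_, fun x hx => norm_jostFun_le (hq.moment 0) z hx⟩
  exact tendsto_fin_two.1 h

section

variable {q g : ℝ → ℂ}

/-- The limit exists because q' is integrable, and it equals 1 because q - 1 is integrable. -/
theorem EnergyPot.tendsto (H : EnergyPot q g) : Tendsto q atTop (𝓝 1) := by
  have h1 : Tendsto q atTop (𝓝 (q 0 + ∫ t in Set.Ioi 0, g t)) := by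
    refine ((intervalIntegral_tendsto_integral_Ioi 0 H.integrableOn_deriv tendsto_id).const_add
      (q 0)).congr fun x => (H.eq_primitive 0 x).symm
  set ℓ := q 0 + ∫ t in Set.Ioi 0, g t
  have h2 : Tendsto (fun y => q y - 1) atTop (𝓝 (ℓ - 1)) := h1.sub_const 1
  have h3 : IntegrableOn (fun y => q y - 1) (Set.Ioi 0) := by
    have hc := H.continuous
    refine Integrable.mono (H.integrableOn 0)
      (Continuous.aestronglyMeasurable (by fun_prop)) (Eventually.of_forall fun y => ?_)
    rw [norm_mul, norm_norm, Real.norm_of_nonneg (by positivity)]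
    exact le_mul_of_one_le_left (norm_nonneg _) (by linarith [abs_nonneg y])
  have h4 : ℓ - 1 = 0 := by
    refine IntegrableAtFilter.eq_zero_of_tendsto ⟨Set.Ioi 0, Ioi_mem_atTop 0, h3⟩ (fun s hs => ?_) h2
    obtain ⟨a, ha⟩ := mem_atTop_sets.1 hs
    exact measure_mono_top (fun x hx => ha x hx) (Real.volume_Ici (a := a))
  rwa [sub_eq_zero.1 h4] at h1

theorem EnergyPot.exists_bound (H : EnergyPot q g) : ∃ C, 0 ≤ C ∧ ∀ x, 0 ≤ x → ‖q x‖ ≤ C := by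
  have h1 := H.tendsto.norm
  obtain ⟨X, hX⟩ := eventually_atTop.1 (h1.eventually (gt_mem_nhds (show ‖(1 : ℂ)‖ < 2 by norm_num)))
  obtain ⟨C, hC⟩ := (isCompact_Icc (a := (0 : ℝ)) (b := X)).exists_bound_of_continuousOn
    H.continuous.continuousOn
  refine ⟨max 2 C, le_max_of_le_left (by norm_num), fun x hx => ?_⟩
  rcases le_total X x with h | h
  · exact (hX x h).le.trans (le_max_left _ _)
  · exact (hC x ⟨hx, h⟩).trans (le_max_right _ _)

theorem EnergyPot.integrableOn_excess (H : EnergyPot q g) : IntegrableOn (excess q) (Set.Ioi 0) := by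
  obtain ⟨C, hC0, hC⟩ := H.exists_bound
  have hc := H.continuous
  have hc' : Continuous fun x => conj (q x) := Complex.continuous_conj.comp hc
  refine Integrable.mono' ((H.integrableOn 0).const_mul (C + 1))
    (Continuous.aestronglyMeasurable (by unfold excess; fun_prop)) ?_
  filter_upwards [ae_restrict_mem measurableSet_Ioi] with y hy
  have e : excess q y = (q y - 1) * conj (q y) + conj (q y - 1) := by
    rw [excess, map_sub, map_one]
    ring
  rw [e]
  calc _ ≤ ‖q y - 1‖ * ‖q y‖ + ‖q y - 1‖ := by
        refine (norm_add_le _ _).trans_eq ?_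
        rw [norm_mul, RCLike.norm_conj, RCLike.norm_conj]
    _ ≤ ‖q y - 1‖ * C + ‖q y - 1‖ := by
        gcongr
        exact hC y (le_of_lt hy)
    _ = (C + 1) * (1 * ‖q y - 1‖) := by ring
    _ ≤ _ := by
        gcongr
        linarith [abs_nonneg y]

theorem EnergyPot.conj_primitive (H : EnergyPot q g) (a x : ℝ) :
    conj (q x) = conj (q a) + ∫ t in a..x, conj (g t) := by
  rw [H.eq_primitive a x, map_add, intervalIntegral, intervalIntegral, map_sub, integral_conj, integral_conj]

theorem IntegrableOn.mul_jostComp {a : ℝ → ℂ} (ha : IntegrableOn a (Set.Ioi 0)) {q : ℝ → ℂ}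
    (hq : Decay q) (z : ℝ) (i : Fin 2) :
    IntegrableOn (fun y => a y * jostComp hq z i y) (Set.Ioi 0) := by
  refine Integrable.mul_bdd (c := ‖jostM (hq.moment 0) z‖) ha
    (continuous_jostComp hq z i).aestronglyMeasurable ?_
  filter_upwards [ae_restrict_mem measurableSet_Ioi] with y hy
  exact norm_jostComp_le hq z i (le_of_lt hy)

theorem integrableOn_conj {a : ℝ → ℂ} {s : Set ℝ} (ha : IntegrableOn a s) :
    IntegrableOn (fun y => conj (a y)) s :=
  Integrable.mono ha (Complex.continuous_conj.comp_aestronglyMeasurable ha.1)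
    (Eventually.of_forall fun y => by simp)

/-- The integral equation of `m₀ - (q̄/z) m₁`. -/
theorem EnergyPot.first_identity (H : EnergyPot q g) {z : ℝ} (hz : 1 / 4 ≤ |z|) {x : ℝ} (hx : 0 ≤ x) :
    z * jostComp H.toDecay z 0 x - conj (q x) * jostComp H.toDecay z 1 x = (z - (z : ℂ)⁻¹) -
      ∫ y in Set.Ioi x, (Complex.I * excess q y * jostComp H.toDecay z 0 y -
        conj (g y) * jostComp H.toDecay z 1 y) := by
  set m₀ := jostComp H.toDecay z 0 with hm₀
  set m₁ := jostComp H.toDecay z 1 with hm₁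
  have hz0 : (z : ℂ) ≠ 0 := by exact_mod_cast ne_zero_of_quarter_le hz
  have c0 : Continuous m₀ := continuous_jostComp H.toDecay z 0
  have c1 : Continuous m₁ := continuous_jostComp H.toDecay z 1
  have hc := H.continuous
  have hc' : Continuous fun x => conj (q x) := Complex.continuous_conj.comp hc
  have hgc : ∀ a b, IntervalIntegrable (fun y => conj (g y)) volume a b := fun a b =>
    (intervalIntegrable_iff.2 (integrableOn_conj (intervalIntegrable_iff.1 (H.intervalIntegrable a b))))
  have hint : IntegrableOn (fun y => Complex.I * excess q y * m₀ y - conj (g y) * m₁ y) (Set.Ioi x) := by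
    refine IntegrableOn.mono_set ?_ (Set.Ioi_subset_Ioi hx)
    refine Integrable.sub ?_ ?_
    · exact IntegrableOn.mul_jostComp (H.integrableOn_excess.const_mul Complex.I) H.toDecay z 0
    · exact IntegrableOn.mul_jostComp (integrableOn_conj H.integrableOn_deriv) H.toDecay z 1
  have hfin : ∀ b, x ≤ b → ∫ y in x..b, (Complex.I * excess q y * m₀ y - conj (g y) * m₁ y) =
      (z * m₀ b - conj (q b) * m₁ b) - (z * m₀ x - conj (q x) * m₁ x) := by
    -- In the derivative of zm₀ - q̄m₁ the terms izq̄m₁ cancel, and -im₀ + i|q|²m₀ combine to i(|q|²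
    -- - 1)m₀. The term with q̄' comes from `integral_primitive_mul`.
    intro b hb
    have e1 := intervalIntegral.integral_eq_sub_of_hasDerivAt_of_le hb c0.continuousOn
      (fun y hy => (hasDerivAt_jostComp H.toDecay hz (hx.trans_lt hy.1)).1)
      (Continuous.intervalIntegrable (by fun_prop) _ _)
    have e2 := integral_primitive_mul hb (hgc x b) (fun y _ => H.conj_primitive x y) c1.continuousOn
      (fun y hy => (hasDerivAt_jostComp H.toDecay hz (hx.trans_lt hy.1)).2)
      (Continuous.intervalIntegrable (by fun_prop) _ _)
    rw [← hm₀, ← hm₁] at e1 e2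
    have e3 : (z * m₀ b - conj (q b) * m₁ b) - (z * m₀ x - conj (q x) * m₁ x) =
        z * (m₀ b - m₀ x) - (conj (q b) * m₁ b - conj (q x) * m₁ x) := by ring
    rw [e3, ← e1, ← e2, ← intervalIntegral.integral_const_mul, ← intervalIntegral.integral_sub]
    · refine intervalIntegral.integral_congr fun y _ => ?_
      simp only [excess]
      field_simp
      ring
    · exact Continuous.intervalIntegrable (by fun_prop) _ _
    · refine ((hgc x b).mul_continuousOn c1.continuousOn).add
        (Continuous.intervalIntegrable (by fun_prop) _ _)
  have hlim := intervalIntegral_tendsto_integral_Ioi x hint tendsto_id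
  have hlim2 : Tendsto (fun b => (z * m₀ b - conj (q b) * m₁ b) - (z * m₀ x - conj (q x) * m₁ x)) atTop
      (𝓝 ((z * 1 - conj 1 * (z : ℂ)⁻¹) - (z * m₀ x - conj (q x) * m₁ x))) := by
    obtain ⟨t0, t1⟩ := tendsto_jostComp H.toDecay hz
    have t2 : Tendsto (fun b => conj (q b)) atTop (𝓝 (conj 1)) :=
      (Complex.continuous_conj.tendsto 1).comp H.tendsto
    exact ((t0.const_mul _).sub (t2.mul t1)).sub_const _
  have := tendsto_nhds_unique_of_eventuallyEq hlim hlim2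
    ((eventually_ge_atTop x).mono fun b hb => hfin b hb)
  rw [this]
  simp

/-- The integral equation of `m₁ - (q/z) m₀`. -/
theorem EnergyPot.second_identity (H : EnergyPot q g) {z : ℝ} (hz : 1 / 4 ≤ |z|) {x : ℝ} (hx : 0 ≤ x) :
    z * jostComp H.toDecay z 1 x - q x * jostComp H.toDecay z 0 x =
      ∫ y in Set.Ioi x, Complex.exp (-2 * Complex.I * spectralZeta z * (y - x : ℝ)) *
        (g y * jostComp H.toDecay z 0 y + Complex.I * excess q y * jostComp H.toDecay z 1 y) := by
  set m₀ := jostComp H.toDecay z 0 with hm₀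
  set m₁ := jostComp H.toDecay z 1 with hm₁
  set e : ℝ → ℂ := fun y => Complex.exp (-2 * Complex.I * spectralZeta z * (y - x : ℝ)) with he
  have hz0 : (z : ℂ) ≠ 0 := by exact_mod_cast ne_zero_of_quarter_le hz
  have c0 : Continuous m₀ := continuous_jostComp H.toDecay z 0
  have c1 : Continuous m₁ := continuous_jostComp H.toDecay z 1
  have ce : Continuous e := by fun_prop
  have hed : ∀ y, HasDerivAt e (-2 * Complex.I * spectralZeta z * e y) y := by
    intro y
    have h1 : HasDerivAt (fun y : ℝ => -2 * Complex.I * spectralZeta z * ((y - x : ℝ) : ℂ))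
        (-2 * Complex.I * spectralZeta z) y := by
      simpa using (((hasDerivAt_id y).sub_const x).ofReal_comp).const_mul
        (-2 * Complex.I * spectralZeta z)
    exact h1.cexp.congr_deriv (mul_comm _ _)
  have hen : ∀ y, ‖e y‖ = 1 := fun y => norm_exp_two_I _ _
  have hζ : (2 * spectralZeta z : ℂ) = z - (z : ℂ)⁻¹ := by
    rw [spectralZeta]
    push_cast
    ring
  have hc := H.continuous
  have hc' : Continuous fun x => conj (q x) := Complex.continuous_conj.comp hc
  have hg := H.intervalIntegrable
  have hint : IntegrableOn (fun y => e y * (g y * m₀ y + Complex.I * excess q y * m₁ y)) (Set.Ioi x) := by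
    refine IntegrableOn.mono_set ?_ (Set.Ioi_subset_Ioi hx)
    refine Integrable.bdd_mul (c := 1) (Integrable.add ?_ ?_) ce.aestronglyMeasurable
      (Eventually.of_forall fun y => (hen y).le)
    · exact IntegrableOn.mul_jostComp H.integrableOn_deriv H.toDecay z 0
    · exact IntegrableOn.mul_jostComp (H.integrableOn_excess.const_mul Complex.I) H.toDecay z 1
  have hfin : ∀ b, x ≤ b → ∫ y in x..b, e y * (g y * m₀ y + Complex.I * excess q y * m₁ y) =
      (z * m₁ x - q x * m₀ x) - e b * (z * m₁ b - q b * m₀ b) := by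
    -- With the phase included, -2iζ + iz = i/z in the equation for m₁ and -2iζ - i/z = -iz in that
    -- for m₀. The terms of order z then cancel in zm₁ - qm₀.
    intro b hb
    have e1 := intervalIntegral.integral_eq_sub_of_hasDerivAt_of_le hb (ce.mul c1).continuousOn
      (fun y hy => (hed y).mul (hasDerivAt_jostComp H.toDecay hz (hx.trans_lt hy.1)).2)
      (Continuous.intervalIntegrable (by fun_prop) _ _)
    have e2 := integral_primitive_mul hb (hg x b) (fun y _ => H.eq_primitive x y)
      (ce.mul c0).continuousOn
      (fun y hy => (hed y).mul (hasDerivAt_jostComp H.toDecay hz (hx.trans_lt hy.1)).1)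
      (Continuous.intervalIntegrable (by fun_prop) _ _)
    rw [← hm₀, ← hm₁] at e1 e2
    have ex : e x = 1 := by simp [he]
    have e3 : (z * m₁ x - q x * m₀ x) - e b * (z * m₁ b - q b * m₀ b) =
        (q b * (e b * m₀ b) - q x * (e x * m₀ x)) - z * (e b * m₁ b - e x * m₁ x) := by
      rw [ex]
      ring
    simp only [Pi.mul_apply] at e1 e2
    rw [e3, ← e1, ← e2, ← intervalIntegral.integral_const_mul, ← intervalIntegral.integral_sub]
    · refine intervalIntegral.integral_congr fun y _ => ?_
      simp only [excess]
      have h3 : (z : ℂ) * (z : ℂ)⁻¹ = 1 := mul_inv_cancel₀ hz0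
      linear_combination (Complex.I * e y * q y * m₀ y - z * Complex.I * e y * m₁ y) * hζ +
        Complex.I * e y * m₁ y * h3
    · refine ((hg x b).mul_continuousOn (ce.mul c0).continuousOn).add
        (Continuous.intervalIntegrable (by fun_prop) _ _)
    · exact Continuous.intervalIntegrable (by fun_prop) _ _
  have hlim := intervalIntegral_tendsto_integral_Ioi x hint tendsto_id
  have hlim2 : Tendsto (fun b => (z * m₁ x - q x * m₀ x) - e b * (z * m₁ b - q b * m₀ b)) atTop
      (𝓝 ((z * m₁ x - q x * m₀ x) - 0)) := by
    obtain ⟨t0, t1⟩ := tendsto_jostComp H.toDecay hz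
    have t2 : Tendsto (fun b => z * m₁ b - q b * m₀ b) atTop (𝓝 (z * (z : ℂ)⁻¹ - 1 * 1)) :=
      (t1.const_mul _).sub (H.tendsto.mul t0)
    rw [mul_inv_cancel₀ hz0, mul_one, sub_self] at t2
    refine Tendsto.const_sub _ ?_
    rw [tendsto_zero_iff_norm_tendsto_zero] at t2 ⊢
    refine t2.congr fun b => ?_
    rw [norm_mul, hen, one_mul]
  have := tendsto_nhds_unique_of_eventuallyEq hlim hlim2
    ((eventually_ge_atTop x).mono fun b hb => hfin b hb)
  rw [this, sub_zero]

end

/-! ### The derivative in the spectral parameter for `|z| ≥ 2` -/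

/-- The operators on bounded continuous functions. -/
abbrev BddOp : Type := (ℝ →ᵇ (Fin 2 → ℂ)) →L[ℂ] (ℝ →ᵇ (Fin 2 → ℂ))

theorem continuousSMul_real {A : Type*} [NormedAddCommGroup A] [NormedSpace ℝ A] :
    ContinuousSMul ℝ A := inferInstance

instance : ContinuousSMul ℝ BddOp := continuousSMul_real (A := BddOp)

theorem norm_mul_add_mul_le {A : Type*} [NormedRing A] {a b c d : A} {α β γ δ : ℝ} (ha : ‖a‖ ≤ α)
    (hb : ‖b‖ ≤ β) (hc : ‖c‖ ≤ γ) (hd : ‖d‖ ≤ δ) : ‖a * b + c * d‖ ≤ α * β + γ * δ :=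
  (norm_add_le _ _).trans (add_le_add
    ((norm_mul_le _ _).trans (mul_le_mul ha hb (norm_nonneg _) ((norm_nonneg _).trans ha)))
    ((norm_mul_le _ _).trans (mul_le_mul hc hd (norm_nonneg _) ((norm_nonneg _).trans hc))))

theorem hasDerivAt_laurent {A : Type*} [NormedAddCommGroup A] [NormedSpace ℝ A] (a b c : A) {z : ℝ}
    (hz : z ≠ 0) :
    HasDerivAt (fun z : ℝ => z⁻¹ • a + b + z • c) ((-(z ^ 2)⁻¹) • a + c) z := by
  refine ((((hasDerivAt_inv hz).smul_const a).add_const b).add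
    ((hasDerivAt_id z).smul_const c)).congr_deriv ?_
  rw [one_smul]

theorem hasDerivAt_const_add_mul {A : Type*} [NormedRing A] [NormedAlgebra ℝ A] {f g : ℝ → A}
    {f' g' : A} {z : ℝ} (c : A) (hf : HasDerivAt f f' z) (hg : HasDerivAt g g' z) :
    HasDerivAt (fun z => c + f z * g z) (f' * g z + f z * g') z :=
  (hf.mul hg).const_add c

theorem VolterraData.hasDerivAt_phiOp_comp {E : Type*} [NormedAddCommGroup E] [NormedSpace ℂ E]
    {D : VolterraData E} (h : D.Moment 1) {z : ℝ} (hz : z ≠ 0) (h1 : |z| ≠ 1) :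
    HasDerivAt (fun z => D.phiOp 0 (spectralZeta z))
      (((1 + z⁻¹ * z⁻¹) / 2) • D.phiOp 1 (spectralZeta z)) z :=
  (VolterraData.hasDerivAt_phiOp_of_ne h le_rfl (spectralZeta_ne_zero hz h1)).scomp z
    (hasDerivAt_spectralZeta hz)

theorem norm_smul_add_le {A : Type*} [NormedAddCommGroup A] [NormedSpace ℝ A] {c : ℝ} {a b : A}
    (hc : |c| ≤ 1) (ha : ‖a‖ ≤ 1) (hb : ‖b‖ ≤ 1) : ‖c • a + b‖ ≤ 2 := by
  refine (norm_add_le _ _).trans ?_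
  rw [norm_smul, Real.norm_eq_abs]
  have := mul_le_one₀ hc (norm_nonneg a) ha
  linarith

theorem norm_smul_mul_le {A : Type*} [NormedAddCommGroup A] [NormedSpace ℝ A] {c : ℝ} {a : A}
    (hc : |c| ≤ 1) : ‖c • a‖ ≤ ‖a‖ := by
  rw [norm_smul, Real.norm_eq_abs]
  exact mul_le_of_le_one_left (norm_nonneg _) hc

theorem HasDerivAt.complex_clm_apply {E : Type*} [NormedAddCommGroup E] [NormedSpace ℂ E]
    {f : ℝ → E →L[ℂ] E} {f' : E →L[ℂ] E} {g : ℝ → E} {g' : E} {z : ℝ} (hf : HasDerivAt f f' z)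
    (hg : HasDerivAt g g' z) : HasDerivAt (fun z => f z (g z)) (f' (g z) + f z g') z := by
  set B := ContinuousLinearMap.bilinearRestrictScalars ℝ (𝕜' := ℂ) (E := E →L[ℂ] E)
    (ContinuousLinearMap.id ℂ (E →L[ℂ] E)) with hB
  exact (B.hasFDerivAt.comp_hasDerivAt z hf).clm_apply hg

/-- The derivative of `opN`. -/
def opNDeriv (z : ℝ) : (ℝ →ᵇ (Fin 2 → ℂ)) →L[ℂ] (ℝ →ᵇ (Fin 2 → ℂ)) :=
  (-(z ^ 2)⁻¹) • (matCLM !![-Complex.I, 0; 0, 0]).compLeftContinuousBounded ℝ +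
    (matCLM !![0, 0; 0, Complex.I]).compLeftContinuousBounded ℝ

theorem hasDerivAt_opN {z : ℝ} (hz : z ≠ 0) : HasDerivAt opN (opNDeriv z) z :=
  hasDerivAt_laurent (A := BddOp) _ _ _ hz

theorem norm_opNDeriv_le {z : ℝ} (hz : 2 ≤ |z|) : ‖opNDeriv z‖ ≤ 2 := by
  have h1 : ‖(matCLM !![-Complex.I, 0; 0, 0]).compLeftContinuousBounded ℝ‖ ≤ 1 :=
    norm_compLeft_le fun i => by fin_cases i <;> simp
  have h2 : ‖(matCLM !![0, 0; 0, Complex.I]).compLeftContinuousBounded ℝ‖ ≤ 1 :=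
    norm_compLeft_le fun i => by fin_cases i <;> simp
  refine norm_smul_add_le (A := BddOp) ?_ h1 h2
  rw [abs_neg, abs_inv, abs_pow]
  exact inv_le_one_of_one_le₀ (one_le_pow₀ (by linarith))

section

variable {p : ℝ → ℂ} {hp : Continuous p}

variable (p hp) in
/-- The derivative of `jostOp`. -/
def jostOpDeriv (z : ℝ) : (ℝ →ᵇ (Fin 2 → ℂ)) →L[ℂ] (ℝ →ᵇ (Fin 2 → ℂ)) :=
  opNDeriv z * (jostData p hp).phiOp 0 (spectralZeta z) +
    opN z * (((1 + z⁻¹ * z⁻¹) / 2) • (jostData p hp).phiOp 1 (spectralZeta z))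

theorem hasDerivAt_jostOp (h : (jostData p hp).Moment 1) {z : ℝ} (hz : 2 ≤ |z|) :
    HasDerivAt (jostOp p hp) (jostOpDeriv p hp z) z := by
  have hz0 : z ≠ 0 := ne_zero_of_quarter_le (by linarith)
  exact hasDerivAt_const_add_mul (A := BddOp) _ (hasDerivAt_opN hz0)
    (VolterraData.hasDerivAt_phiOp_comp h hz0 (by linarith))

/-- Both kernels gain 1/|ζ|, comparable to 1/|z| in this range. For order 1 the remaining factor is
the first moment of V, the only one assumed. -/
theorem exists_norm_phiOp_le (h : (jostData p hp).Moment 1) :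
    ∃ C, 0 ≤ C ∧ ∀ z : ℝ, 2 ≤ |z| → ‖(jostData p hp).phiOp 0 (spectralZeta z)‖ ≤ C / |z| ∧
      ‖(jostData p hp).phiOp 1 (spectralZeta z)‖ ≤ C / |z| := by
  set c : ℕ → ℝ := fun j => ∫ y in Set.Ioi 0, y ^ j * ‖pertV p y‖ with hc
  have hc0 : ∀ j, 0 ≤ c j := fun j => setIntegral_nonneg measurableSet_Ioi fun y hy => by
    have : (0 : ℝ) < y := hy
    positivity
  have key : ∀ j ≤ 1, ∀ z : ℝ, 2 ≤ |z| → ‖(jostData p hp).phiOp j (spectralZeta z)‖ ≤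
      2 ^ j * (j + 1) * (8 / 3 * c j) / |z| := by
    intro j hj z hz
    have hz0 : z ≠ 0 := ne_zero_of_quarter_le (by linarith)
    have h1 := VolterraData.norm_phiOp_le (VolterraData.phi_dominates_div h hj
      (spectralZeta_ne_zero hz0 (by linarith)))
    have h2 : (∫ y in Set.Ioi 0, 2 ^ j * ((j : ℝ) + 1) / |spectralZeta z| * y ^ j *
        ‖(jostData p hp).V y‖) = 2 ^ j * (j + 1) / |spectralZeta z| * c j := by
      rw [hc, ← integral_const_mul]
      refine integral_congr_ae (Eventually.of_forall fun y => ?_)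
      simp only [mul_assoc]
      rfl
    rw [h2] at h1
    refine h1.trans ?_
    have h3 := abs_spectralZeta_ge hz
    have h4 : |spectralZeta z|⁻¹ ≤ 8 / 3 * |z|⁻¹ := by
      rw [show (8 / 3 : ℝ) * |z|⁻¹ = (3 / 8 * |z|)⁻¹ by rw [mul_inv]; norm_num]
      exact inv_anti₀ (by linarith) h3
    calc 2 ^ j * ((j : ℝ) + 1) / |spectralZeta z| * c j =
          2 ^ j * (j + 1) * c j * |spectralZeta z|⁻¹ := by
          rw [div_eq_mul_inv]
          ring
      _ ≤ 2 ^ j * (j + 1) * c j * (8 / 3 * |z|⁻¹) := by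
          have := hc0 j
          gcongr
      _ = _ := by
          rw [div_eq_mul_inv]
          ring
  refine ⟨max (8 / 3 * c 0) (4 * (8 / 3 * c 1)), le_max_of_le_left (by have := hc0 0; positivity),
    fun z hz => ⟨(key 0 (by norm_num) z hz).trans ?_, (key 1 le_rfl z hz).trans ?_⟩⟩
  · gcongr
    norm_num
  · gcongr
    norm_num

/-- The growth of N(z) like |z| is cancelled by the decay of the differentiated oscillatory
operator. -/
theorem exists_norm_jostOpDeriv_le (h : (jostData p hp).Moment 1) :
    ∃ C, 0 ≤ C ∧ ∀ z : ℝ, 2 ≤ |z| → ‖jostOpDeriv p hp z‖ ≤ C := by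
  obtain ⟨C, hC0, hC⟩ := exists_norm_phiOp_le h
  refine ⟨2 * C + 2 * C, by positivity, fun z hz => ?_⟩
  obtain ⟨h0, h1⟩ := hC z hz
  have hζ : |(1 + z⁻¹ * z⁻¹) / 2| ≤ 1 := by
    have e1 : z⁻¹ * z⁻¹ ≤ 1 := by
      rw [← abs_mul_abs_self, abs_inv]
      have : |z|⁻¹ ≤ 1 := inv_le_one_of_one_le₀ (by linarith)
      exact mul_le_one₀ this (by positivity) this
    have h2 := mul_self_nonneg z⁻¹
    rw [abs_of_nonneg (by positivity)]
    linarith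
  have hN : ‖opN z‖ ≤ 2 * |z| := by
    refine (norm_opN_le z).trans ?_
    have : |z|⁻¹ ≤ 1 := inv_le_one_of_one_le₀ (by linarith)
    linarith
  have h3 : C / |z| ≤ C := div_le_self hC0 (by linarith)
  refine (norm_mul_add_mul_le (A := BddOp) (norm_opNDeriv_le hz) (h0.trans h3) hN
    ((norm_smul_mul_le (A := BddOp) hζ).trans h1)).trans_eq ?_
  have : |z| ≠ 0 := by linarith
  field_simp

theorem exists_norm_jostM_le (h : (jostData p hp).Moment 1) :
    ∃ C, 0 ≤ C ∧ ∀ z : ℝ, 1 / 4 ≤ |z| → ‖jostM h z‖ ≤ C := by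
  refine ⟨2 * (‖weightedConst h ![1, 0]‖ + 4 * ‖weightedConst h ![0, 1]‖), by positivity,
    fun z hz => ?_⟩
  have h1 : ‖jostRhs h z‖ ≤ ‖weightedConst h ![1, 0]‖ + 4 * ‖weightedConst h ![0, 1]‖ := by
    refine (norm_add_le _ _).trans ?_
    gcongr
    rw [norm_smul, Real.norm_eq_abs, abs_inv]
    gcongr
    rw [inv_le_comm₀ (by linarith) (by norm_num)]
    linarith
  exact ((jostRes p hp z).le_opNorm _).trans
    (mul_le_mul (norm_jostRes_le h hz) h1 (norm_nonneg _) (by norm_num))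

theorem hasDerivAt_jostRhs (h : (jostData p hp).Moment 1) {z : ℝ} (hz : z ≠ 0) :
    HasDerivAt (jostRhs h) ((-(z ^ 2)⁻¹) • weightedConst h ![0, 1]) z :=
  ((hasDerivAt_inv hz).smul_const _).const_add _

/-- Differentiability comes from `SobolevReg` at level 0, since |z| ≠ 1. The formula is then the
derivative of the identity (1 + K)m = rhs, by uniqueness of derivatives. -/
theorem jostM_deriv_eq (h : (jostData p hp).Moment 1)
    (hL : MemLp (fun y => y ^ 2 * ‖pertV p y‖) 2 (volume.restrict (Set.Ioi 0))) {z : ℝ}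
    (hz : 2 ≤ |z|) : HasDerivAt (jostM h) (deriv (jostM h) z) z ∧
      deriv (jostM h) z + (jostOpDeriv p hp z (jostM h z) + jostOp p hp z (deriv (jostM h) z)) =
        (-(z ^ 2)⁻¹) • weightedConst h ![0, 1] := by
  have hz0 : z ≠ 0 := ne_zero_of_quarter_le (by linarith)
  obtain ⟨-, f', hf', -⟩ := sobolevReg_jostM (k := 0) h h hL
  have hd := (hf' z (by linarith) (by linarith)).differentiableAt.hasDerivAt
  refine ⟨hd, ?_⟩
  have h1 := hd.add (HasDerivAt.complex_clm_apply (E := ℝ →ᵇ (Fin 2 → ℂ)) (hasDerivAt_jostOp h hz) hd)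
  refine h1.unique ((hasDerivAt_jostRhs h hz0).congr_of_eventuallyEq ?_)
  filter_upwards [(isOpen_lt continuous_const continuous_abs).mem_nhds
    (show (1 / 4 : ℝ) < |z| by linarith)] with w hw
  exact jostM_eq h (le_of_lt hw)

/-- In the differentiated equation the term K m' has norm at most half that of m' and is absorbed on
the left. -/
theorem exists_norm_deriv_jostM_le (h : (jostData p hp).Moment 1)
    (hL : MemLp (fun y => y ^ 2 * ‖pertV p y‖) 2 (volume.restrict (Set.Ioi 0))) :
    ∃ C, 0 ≤ C ∧ ∀ z : ℝ, 2 ≤ |z| → ‖deriv (jostM h) z‖ ≤ C := by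
  obtain ⟨C, hC0, hC⟩ := exists_norm_jostOpDeriv_le h
  obtain ⟨D, hD0, hD⟩ := exists_norm_jostM_le h
  refine ⟨2 * (‖weightedConst h ![0, 1]‖ + C * D), by positivity, fun z hz => ?_⟩
  have h1 := (jostM_deriv_eq h hL hz).2
  have h2 : deriv (jostM h) z = (-(z ^ 2)⁻¹) • weightedConst h ![0, 1] -
      (jostOpDeriv p hp z (jostM h z) + jostOp p hp z (deriv (jostM h) z)) := by
    rw [← h1, add_sub_cancel_right]
  have h3 : ‖(-(z ^ 2)⁻¹) • weightedConst h ![0, 1]‖ ≤ ‖weightedConst h ![0, 1]‖ := by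
    refine norm_smul_mul_le (A := ℝ →ᵇ (Fin 2 → ℂ)) ?_
    rw [abs_neg, abs_inv, abs_pow]
    exact inv_le_one_of_one_le₀ (one_le_pow₀ (by linarith))
  have h4 : ‖jostOpDeriv p hp z (jostM h z)‖ ≤ C * D :=
    ((jostOpDeriv p hp z).le_opNorm _).trans
      (mul_le_mul (hC z hz) (hD z (by linarith)) (norm_nonneg _) hC0)
  have h5 : ‖jostOp p hp z (deriv (jostM h) z)‖ ≤ 1 / 2 * ‖deriv (jostM h) z‖ :=
    ((jostOp p hp z).le_opNorm _).trans
      (mul_le_mul_of_nonneg_right (norm_jostOp_le h (by linarith)) (norm_nonneg _))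
  have h6 : ‖deriv (jostM h) z‖ ≤ ‖(-(z ^ 2)⁻¹) • weightedConst h ![0, 1]‖ +
      (‖jostOpDeriv p hp z (jostM h z)‖ + ‖jostOp p hp z (deriv (jostM h) z)‖) := by
    conv_lhs => rw [h2]
    exact (norm_sub_le _ _).trans (by gcongr; exact norm_add_le _ _)
  linarith

end

/-! ### Asymptotics of the normalized Jost solution -/

theorem norm_integral_pair_le_tail {a b u v : ℝ → ℂ} {D x : ℝ} (ha : IntegrableOn a (Set.Ioi 0))
    (hb : IntegrableOn b (Set.Ioi 0)) (hx : 0 ≤ x) (hu : ∀ y, 0 ≤ y → ‖u y‖ ≤ D)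
    (hv : ∀ y, 0 ≤ y → ‖v y‖ ≤ D) :
    ‖∫ y in Set.Ioi x, (a y * u y + b y * v y)‖ ≤ D * ∫ y in Set.Ioi x, (‖a y‖ + ‖b y‖) := by
  have hD : 0 ≤ D := (norm_nonneg _).trans (hu 0 le_rfl)
  have hi : IntegrableOn (fun y => D * (‖a y‖ + ‖b y‖)) (Set.Ioi 0) := (ha.norm.add hb.norm).const_mul D
  rw [← integral_const_mul]
  refine norm_integral_le_of_norm_le (hi.mono_set (Set.Ioi_subset_Ioi hx)) ?_
  filter_upwards [ae_restrict_mem measurableSet_Ioi] with y hy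
  have hy0 : 0 ≤ y := hx.trans (le_of_lt hy)
  refine (norm_add_le _ _).trans ?_
  rw [norm_mul, norm_mul]
  nlinarith [hu y hy0, hv y hy0, norm_nonneg (a y), norm_nonneg (b y)]

theorem norm_integral_pair_le {a b u v : ℝ → ℂ} {D x : ℝ} (ha : IntegrableOn a (Set.Ioi 0))
    (hb : IntegrableOn b (Set.Ioi 0)) (hx : 0 ≤ x) (hu : ∀ y, 0 ≤ y → ‖u y‖ ≤ D)
    (hv : ∀ y, 0 ≤ y → ‖v y‖ ≤ D) :
    ‖∫ y in Set.Ioi x, (a y * u y + b y * v y)‖ ≤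
      D * ((∫ y in Set.Ioi 0, ‖a y‖) + ∫ y in Set.Ioi 0, ‖b y‖) := by
  have hD : 0 ≤ D := (norm_nonneg _).trans (hu 0 le_rfl)
  rw [← integral_add ha.norm hb.norm]
  refine (norm_integral_pair_le_tail ha hb hx hu hv).trans (mul_le_mul_of_nonneg_left ?_ hD)
  exact setIntegral_mono_set (ha.norm.add hb.norm) (Eventually.of_forall fun y => by positivity)
    (Set.Ioi_subset_Ioi hx).eventuallyLE

/-- Integration against a pair of densities, as a functional on bounded continuous functions. -/
def pairFunctional (μ : Measure ℝ) {a b : ℝ → ℂ} (ha : Integrable a μ) (hb : Integrable b μ) :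
    (ℝ →ᵇ (Fin 2 → ℂ)) →L[ℂ] ℂ :=
  have hi : ∀ {a : ℝ → ℂ} (_ : Integrable a μ) (i : Fin 2) (f : ℝ →ᵇ (Fin 2 → ℂ)),
      Integrable (fun y => a y * f y i) μ := fun ha i f =>
    Integrable.mul_bdd (c := ‖f‖) ha
      ((continuous_apply i).comp f.continuous).aestronglyMeasurable
      (Eventually.of_forall fun y => (norm_le_pi_norm _ i).trans (f.norm_coe_le_norm y))
  LinearMap.mkContinuous
    { toFun := fun f => ∫ y, (a y * f y 0 + b y * f y 1) ∂μ
      map_add' := fun f f' => by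
        refine Eq.trans ?_ (integral_add ((hi ha 0 f).add (hi hb 1 f))
          ((hi ha 0 f').add (hi hb 1 f')))
        refine integral_congr_ae (Eventually.of_forall fun y => ?_)
        simp
        ring
      map_smul' := fun c f => by
        rw [RingHom.id_apply, ← integral_smul]
        refine integral_congr_ae (Eventually.of_forall fun y => ?_)
        simp
        ring } (∫ y, (‖a y‖ + ‖b y‖) ∂μ) fun f => by
      rw [← integral_mul_const]
      refine norm_integral_le_of_norm_le ((ha.norm.add hb.norm).mul_const _)
        (Eventually.of_forall fun y => ?_)
      refine (norm_add_le _ _).trans ?_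
      rw [norm_mul, norm_mul, add_mul]
      gcongr
      · exact (norm_le_pi_norm _ 0).trans (f.norm_coe_le_norm y)
      · exact (norm_le_pi_norm _ 1).trans (f.norm_coe_le_norm y)

theorem pairFunctional_apply (μ : Measure ℝ) {a b : ℝ → ℂ} (ha : Integrable a μ)
    (hb : Integrable b μ) (f : ℝ →ᵇ (Fin 2 → ℂ)) :
    pairFunctional μ ha hb f = ∫ y, (a y * f y 0 + b y * f y 1) ∂μ := rfl

/-- The `z`-derivative of the components of the normalized Jost solution. -/
def jostCompDeriv {q : ℝ → ℂ} (hq : Decay q) (z : ℝ) (i : Fin 2) (x : ℝ) : ℂ :=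
  (Real.exp (weightExp (shiftPert q 0) x) : ℂ) * deriv (jostM (hq.moment 0)) z x i

theorem jostComp_eq {q : ℝ → ℂ} (hq : Decay q) (z : ℝ) (i : Fin 2) (x : ℝ) : jostComp hq z i x =
    (Real.exp (weightExp (shiftPert q 0) x) : ℂ) * jostM (hq.moment 0) z x i := by
  rw [jostComp, jostFun, Pi.smul_apply, Complex.real_smul]

theorem norm_exp_weightExp_le {q : ℝ → ℂ} (hq : Decay q) {x : ℝ} (hx : 0 ≤ x) :
    ‖(Real.exp (weightExp (shiftPert q 0) x) : ℂ)‖ ≤ 1 := by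
  have h1 := (jostData (shiftPert q 0) (hq.continuous_shift 0)).anti 0 x le_rfl hx
  change weightExp _ x ≤ weightExp _ 0 at h1
  rw [weightExp_zero] at h1
  rw [Complex.norm_real, Real.norm_of_nonneg (Real.exp_nonneg _)]
  exact Real.exp_le_one_iff.2 h1

theorem continuous_exp_weightExp {q : ℝ → ℂ} (hq : Decay q) :
    Continuous fun x => (Real.exp (weightExp (shiftPert q 0) x) : ℂ) := by
  have : Continuous (weightExp (shiftPert q 0)) :=
    (jostData (shiftPert q 0) (hq.continuous_shift 0)).continuous_γ
  fun_prop

theorem norm_jostCompDeriv_le {q : ℝ → ℂ} (hq : Decay q) (z : ℝ) (i : Fin 2) {x : ℝ} (hx : 0 ≤ x) :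
    ‖jostCompDeriv hq z i x‖ ≤ ‖deriv (jostM (hq.moment 0)) z‖ := by
  rw [jostCompDeriv, norm_mul]
  exact (mul_le_of_le_one_left (norm_nonneg _) (norm_exp_weightExp_le hq hx)).trans
    ((norm_le_pi_norm _ i).trans (BoundedContinuousFunction.norm_coe_le_norm _ x))

theorem hasDerivAt_jostComp_param {q : ℝ → ℂ} (hq : MomentReg 0 q) {z : ℝ} (hz : 2 ≤ |z|) (i : Fin 2)
    (x : ℝ) : HasDerivAt (fun z => jostComp hq.toDecay z i x) (jostCompDeriv hq.toDecay z i x) z := by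
  have h1 := (jostM_deriv_eq (hq.toDecay.moment 0) hq.memLp hz).1
  have h2 := ((BoundedContinuousFunction.evalCLM ℝ x : (ℝ →ᵇ (Fin 2 → ℂ)) →L[ℝ] _).hasFDerivAt).comp_hasDerivAt
    z h1
  have h3 := (hasDerivAt_pi.1 h2) i
  refine (h3.const_mul _).congr_of_eventuallyEq (Eventually.of_forall fun w => ?_)
  exact jostComp_eq hq.toDecay w i x

section

variable {q g : ℝ → ℂ}

/-- Both integral identities have right sides bounded uniformly in z; dividing by z gives the rate.
The normalized solution itself is bounded uniformly in z because the resolvent is. -/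
theorem EnergyPot.exists_asymptotics (H : EnergyPot q g) : ∃ C, 0 ≤ C ∧ ∀ z : ℝ, 2 ≤ |z| → ∀ x, 0 ≤ x →
    ‖jostComp H.toDecay z 0 x - 1‖ ≤ C / |z| ∧ ‖jostComp H.toDecay z 1 x‖ ≤ C / |z| := by
  obtain ⟨D, hD0, hD⟩ := exists_norm_jostM_le (H.toDecay.moment 0)
  obtain ⟨Q, hQ0, hQ⟩ := H.exists_bound
  set S := (∫ y in Set.Ioi 0, ‖g y‖) + ∫ y in Set.Ioi 0, ‖excess q y‖ with hS
  have hS0 : 0 ≤ S := by positivity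
  have hm : ∀ z : ℝ, 2 ≤ |z| → ∀ i x, 0 ≤ x → ‖jostComp H.toDecay z i x‖ ≤ D := fun z hz i x hx =>
    (norm_jostComp_le H.toDecay z i hx).trans (hD z (by linarith))
  refine ⟨1 + Q * D + D * S, by positivity, fun z hz x hx => ?_⟩
  have hz1 : 1 / 4 ≤ |z| := by linarith
  have hz0 : 0 < |z| := by linarith
  have hzn : ‖(z : ℂ)‖ = |z| := Complex.norm_real z
  have hzi : |z|⁻¹ ≤ 1 := inv_le_one_of_one_le₀ (by linarith)
  constructor
  · have h1 := H.first_identity hz1 hx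
    have h2 : (z : ℂ) * (jostComp H.toDecay z 0 x - 1) = conj (q x) * jostComp H.toDecay z 1 x +
        (-(z : ℂ)⁻¹ - ∫ y in Set.Ioi x, (Complex.I * excess q y * jostComp H.toDecay z 0 y -
        conj (g y) * jostComp H.toDecay z 1 y)) := by linear_combination h1
    have h3 : ‖∫ y in Set.Ioi x, (Complex.I * excess q y * jostComp H.toDecay z 0 y -
        conj (g y) * jostComp H.toDecay z 1 y)‖ ≤ D * S := by
      have := norm_integral_pair_le (H.integrableOn_excess.const_mul Complex.I)
        (integrableOn_conj H.integrableOn_deriv).neg hx (hm z hz 0) (hm z hz 1)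
      simp only [norm_mul, Complex.norm_I, one_mul, Pi.neg_apply, norm_neg, RCLike.norm_conj,
        neg_mul, ← sub_eq_add_neg] at this
      rwa [add_comm, ← hS] at this
    rw [le_div_iff₀ hz0, mul_comm, ← hzn, ← norm_mul, h2]
    refine (norm_add_le _ _).trans ?_
    have h4 := norm_sub_le (-(z : ℂ)⁻¹) (∫ y in Set.Ioi x, (Complex.I * excess q y *
      jostComp H.toDecay z 0 y - conj (g y) * jostComp H.toDecay z 1 y))
    rw [norm_neg, norm_inv, hzn] at h4
    have h5 : ‖conj (q x) * jostComp H.toDecay z 1 x‖ ≤ Q * D := by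
      rw [norm_mul, RCLike.norm_conj]
      exact mul_le_mul (hQ x hx) (hm z hz 1 x hx) (norm_nonneg _) hQ0
    linarith
  · have h1 := H.second_identity hz1 hx
    have h3 : ‖∫ y in Set.Ioi x, Complex.exp (-2 * Complex.I * spectralZeta z * (y - x : ℝ)) *
        (g y * jostComp H.toDecay z 0 y + Complex.I * excess q y * jostComp H.toDecay z 1 y)‖ ≤
          D * S := by
      have := norm_integral_pair_le (x := x) (D := D) H.integrableOn_deriv
        (H.integrableOn_excess.const_mul Complex.I)
        (u := fun y => Complex.exp (-2 * Complex.I * spectralZeta z * (y - x : ℝ)) *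
          jostComp H.toDecay z 0 y)
        (v := fun y => Complex.exp (-2 * Complex.I * spectralZeta z * (y - x : ℝ)) *
          jostComp H.toDecay z 1 y) hx
        (fun y hy => by rw [norm_mul, norm_exp_two_I, one_mul]; exact hm z hz 0 y hy)
        (fun y hy => by rw [norm_mul, norm_exp_two_I, one_mul]; exact hm z hz 1 y hy)
      simp only [norm_mul, Complex.norm_I, one_mul] at this
      rw [← hS] at this
      refine le_trans (le_of_eq ?_) this
      congr 1
      refine integral_congr_ae (Eventually.of_forall fun y => ?_)
      ring
    have h2 : (z : ℂ) * jostComp H.toDecay z 1 x = q x * jostComp H.toDecay z 0 x +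
        (z * jostComp H.toDecay z 1 x - q x * jostComp H.toDecay z 0 x) := by ring
    rw [le_div_iff₀ hz0, mul_comm, ← hzn, ← norm_mul, h2, h1]
    refine (norm_add_le _ _).trans ?_
    have h5 : ‖q x * jostComp H.toDecay z 0 x‖ ≤ Q * D := by
      rw [norm_mul]
      exact mul_le_mul (hQ x hx) (hm z hz 0 x hx) (norm_nonneg _) hQ0
    linarith

/-- Differentiating the first identity in z gains a factor 1/|z| for the derivative of m₀. For m₁
plain boundedness is enough here; the sharper combination zm₁ - qm₀ is treated by the gauge
transformation. -/
theorem EnergyPot.exists_deriv_asymptotics (H : EnergyPot q g) (hM : MomentReg 0 q) :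
    ∃ C, 0 ≤ C ∧ ∀ z : ℝ, 2 < |z| → ∀ x, 0 ≤ x →
      ‖jostCompDeriv H.toDecay z 0 x‖ ≤ C / |z| ∧ ‖jostCompDeriv H.toDecay z 1 x‖ ≤ C := by
  obtain ⟨A, hA0, hA⟩ := H.exists_asymptotics
  obtain ⟨D, hD0, hD⟩ := exists_norm_deriv_jostM_le (H.toDecay.moment 0) hM.memLp
  obtain ⟨Q, hQ0, hQ⟩ := H.exists_bound
  set S := (∫ y in Set.Ioi 0, ‖excess q y‖) + ∫ y in Set.Ioi 0, ‖g y‖ with hS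
  have hS0 : 0 ≤ S := by positivity
  have hm : ∀ z : ℝ, 2 ≤ |z| → ∀ i x, 0 ≤ x → ‖jostCompDeriv H.toDecay z i x‖ ≤ D :=
    fun z hz i x hx => (norm_jostCompDeriv_le H.toDecay z i hx).trans (hD z hz)
  refine ⟨1 + A + Q * D + D * S + D, by positivity, fun z hz x hx => ?_⟩
  have hz1 : 1 / 4 ≤ |z| := by linarith
  have hz0 : 0 < |z| := by linarith
  have hzn : ‖(z : ℂ)‖ = |z| := Complex.norm_real z
  have hzi : |z|⁻¹ ≤ 1 := inv_le_one_of_one_le₀ (by linarith)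
  refine ⟨?_, (hm z hz.le 1 x hx).trans (by have := mul_nonneg hQ0 hD0; have := mul_nonneg hD0 hS0; linarith)⟩
  set γ : ℝ → ℂ := fun y => (Real.exp (weightExp (shiftPert q 0) y) : ℂ) with hγ
  set μ := volume.restrict (Set.Ioi x) with hμ
  have hb : ∀ {a : ℝ → ℂ}, IntegrableOn a (Set.Ioi 0) → Integrable (fun y => a y * γ y) μ := by
    intro a ha
    refine Integrable.mul_bdd (c := 1) (ha.mono_set (Set.Ioi_subset_Ioi hx))
      (continuous_exp_weightExp H.toDecay).aestronglyMeasurable ?_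
    filter_upwards [ae_restrict_mem measurableSet_Ioi] with y hy
    exact norm_exp_weightExp_le H.toDecay (hx.trans (le_of_lt hy))
  have ia := hb (H.integrableOn_excess.const_mul Complex.I)
  have ib := hb (integrableOn_conj H.integrableOn_deriv).neg
  -- With the weight e^γ put into the densities, the integral is a continuous linear functional of
  -- `jostM`. It can be differentiated in z without interchanging limits.
  set Λ := pairFunctional μ ia ib with hΛ
  have hd0 := hasDerivAt_jostComp_param hM hz.le 0 x
  have hd1 := hasDerivAt_jostComp_param hM hz.le 1 x
  have hdM := (jostM_deriv_eq (H.toDecay.moment 0) hM.memLp hz.le).1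
  have hdΛ : HasDerivAt (fun w => Λ (jostM (H.toDecay.moment 0) w))
      (Λ (deriv (jostM (H.toDecay.moment 0)) z)) z :=
    (Λ.restrictScalars ℝ).hasFDerivAt.comp_hasDerivAt z hdM
  have hid : HasDerivAt (fun w : ℝ => (w : ℂ)) 1 z := (hasDerivAt_id z).ofReal_comp
  have hinv : HasDerivAt (fun w : ℝ => (w : ℂ)⁻¹) (-1 / (z : ℂ) ^ 2) z :=
    hid.inv (by simpa using ne_zero_of_quarter_le hz1)
  have hL := (hid.mul hd0).sub (hd1.const_mul (conj (q x)))
  have hR := (hid.sub hinv).sub hdΛ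
  have heq : (fun w : ℝ => (w : ℂ) * jostComp H.toDecay w 0 x - conj (q x) * jostComp H.toDecay w 1 x)
      =ᶠ[𝓝 z] fun w => ((w : ℂ) - (w : ℂ)⁻¹) - Λ (jostM (H.toDecay.moment 0) w) := by
    filter_upwards [(isOpen_lt continuous_const continuous_abs).mem_nhds
      (show (1 / 4 : ℝ) < |z| by linarith)] with w hw
    rw [H.first_identity (le_of_lt hw) hx, hΛ, pairFunctional_apply]
    congr 1
    refine integral_congr_ae (Eventually.of_forall fun y => ?_)
    simp only [jostComp_eq, hγ, Pi.neg_apply]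
    ring
  have hder := (hL.congr_of_eventuallyEq heq.symm).unique hR
  have hΛn : ‖Λ (deriv (jostM (H.toDecay.moment 0)) z)‖ ≤ D * S := by
    have := norm_integral_pair_le (H.integrableOn_excess.const_mul Complex.I)
      (integrableOn_conj H.integrableOn_deriv).neg hx (hm z hz.le 0) (hm z hz.le 1)
    simp only [norm_mul, Complex.norm_I, one_mul, Pi.neg_apply, norm_neg, RCLike.norm_conj] at this
    rw [← hS] at this
    refine le_trans (le_of_eq ?_) this
    rw [hΛ, pairFunctional_apply]
    congr 1
    refine integral_congr_ae (Eventually.of_forall fun y => ?_)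
    simp only [jostCompDeriv, hγ, Pi.neg_apply]
    ring
  have h2 : (z : ℂ) * jostCompDeriv H.toDecay z 0 x =
      -(jostComp H.toDecay z 0 x - 1) + conj (q x) * jostCompDeriv H.toDecay z 1 x +
      (((z : ℂ) ^ 2)⁻¹ - Λ (deriv (jostM (H.toDecay.moment 0)) z)) := by
    linear_combination hder
  rw [le_div_iff₀ hz0, mul_comm, ← hzn, ← norm_mul, h2]
  have e1 := (hA z hz.le x hx).1
  have e2 : A / |z| ≤ A := div_le_self hA0 (by linarith)
  have e3 : ‖conj (q x) * jostCompDeriv H.toDecay z 1 x‖ ≤ Q * D := by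
    rw [norm_mul, RCLike.norm_conj]
    exact mul_le_mul (hQ x hx) (hm z hz.le 1 x hx) (norm_nonneg _) hQ0
  have e4 : ‖((z : ℂ) ^ 2)⁻¹‖ ≤ 1 := by
    rw [norm_inv, norm_pow, hzn]
    exact inv_le_one_of_one_le₀ (one_le_pow₀ (by linarith))
  have e5 := norm_add₃_le (a := -(jostComp H.toDecay z 0 x - 1))
    (b := conj (q x) * jostCompDeriv H.toDecay z 1 x)
    (c := (((z : ℂ) ^ 2)⁻¹ - Λ (deriv (jostM (H.toDecay.moment 0)) z)))
  rw [norm_neg] at e5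
  have e6 := norm_sub_le (((z : ℂ) ^ 2)⁻¹) (Λ (deriv (jostM (H.toDecay.moment 0)) z))
  linarith

end

/-! ### Half line Fourier transforms -/

/-- The Fourier transform of the restriction to the half line, in the normalization `e^{-2iζy}`. -/
def halfFT (f : ℝ → ℂ) (ζ : ℝ) : ℂ :=
  ∫ y : ℝ in Set.Ioi 0, Complex.exp (-2 * Complex.I * ζ * y) * f y

/-- The outer region `|z| > 2`. -/
def outer : Set ℝ := {z | 2 < |z|}

theorem isOpen_outer : IsOpen outer := isOpen_lt continuous_const continuous_abs

theorem measurableSet_outer : MeasurableSet outer := isOpen_outer.measurableSet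

theorem injOn_spectralZeta_outer : Set.InjOn spectralZeta outer := by
  intro z hz w hw h
  have hz' : 2 < |z| := hz
  have hw' : 2 < |w| := hw
  have hz0 : z ≠ 0 := ne_zero_of_quarter_le (by linarith)
  have hw0 : w ≠ 0 := ne_zero_of_quarter_le (by linarith)
  unfold spectralZeta at h
  have h1 : (z - w) * (z * w + 1) = 0 := by
    field_simp at h
    linear_combination h
  rcases mul_eq_zero.1 h1 with h2 | h2
  · exact sub_eq_zero.1 h2
  · exfalso
    have h3 : |z * w| = 1 := by
      rw [show z * w = -1 by linarith]
      norm_num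
    rw [abs_mul] at h3
    nlinarith

/-- Change of variables: ζ is injective on the outer region and ζ' ≥ 1/2 there, whence the factor
2c. -/
theorem lintegral_comp_spectralZeta_le (G : ℝ → ℝ≥0∞) {c : ℝ} (hc : 0 < c) :
    ∫⁻ z in outer, G (spectralZeta z / c) ≤ ENNReal.ofReal (2 * c) * ∫⁻ w, G w := by
  have hd : ∀ z ∈ outer, HasDerivWithinAt (fun z => spectralZeta z / c)
      ((1 + z⁻¹ * z⁻¹) / 2 / c) outer z := fun z hz =>
    ((hasDerivAt_spectralZeta (ne_zero_of_quarter_le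
      (by have : 2 < |z| := hz; linarith))).div_const c).hasDerivWithinAt
  have hinj : Set.InjOn (fun z => spectralZeta z / c) outer := fun z hz w hw h =>
    injOn_spectralZeta_outer hz hw ((div_left_inj' hc.ne').1 h)
  have h1 := lintegral_image_eq_lintegral_abs_deriv_mul measurableSet_outer hd hinj G
  calc ∫⁻ z in outer, G (spectralZeta z / c) ≤ ∫⁻ z in outer, ENNReal.ofReal (2 * c) *
        (ENNReal.ofReal |(1 + z⁻¹ * z⁻¹) / 2 / c| * G (spectralZeta z / c)) := by
        refine lintegral_mono fun z => ?_
        rw [← mul_assoc, ← ENNReal.ofReal_mul (by positivity)]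
        refine le_mul_of_one_le_left' ?_
        rw [ENNReal.one_le_ofReal]
        have h2 := mul_self_nonneg z⁻¹
        rw [abs_of_nonneg (by positivity)]
        have h3 : 2 * c * ((1 + z⁻¹ * z⁻¹) / 2 / c) = 1 + z⁻¹ * z⁻¹ := by
          generalize z⁻¹ * z⁻¹ = w
          field_simp
        rw [h3]
        linarith
    _ = ENNReal.ofReal (2 * c) * ∫⁻ w in (fun z => spectralZeta z / c) '' outer, G w := by
        rw [h1, lintegral_const_mul' _ _ ENNReal.ofReal_ne_top]
    _ ≤ _ := by
        gcongr
        exact Measure.restrict_le_self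

theorem halfFT_eq_fourier (f : ℝ → ℂ) (ζ : ℝ) :
    halfFT f ζ = 𝓕 ((Set.Ioi (0 : ℝ)).indicator f) (ζ / Real.pi) := by
  rw [halfFT, Real.fourier_real_eq_integral_exp_smul, ← integral_indicator measurableSet_Ioi]
  refine integral_congr_ae (Eventually.of_forall fun y => ?_)
  have hpi : (Real.pi : ℂ) ≠ 0 := by exact_mod_cast Real.pi_ne_zero
  by_cases hy : y ∈ Set.Ioi (0 : ℝ)
  · simp only [Set.indicator_of_mem hy, smul_eq_mul]
    congr 2
    push_cast
    field_simp
  · simp [Set.indicator_of_notMem hy]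

theorem integrable_indicator_Ioi {f : ℝ → ℂ} (hf : IntegrableOn f (Set.Ioi 0)) :
    Integrable ((Set.Ioi (0 : ℝ)).indicator f) :=
  (integrable_indicator_iff measurableSet_Ioi).2 hf

theorem continuous_halfFT {f : ℝ → ℂ} (hf : IntegrableOn f (Set.Ioi 0)) : Continuous (halfFT f) := by
  have hcont : Continuous (𝓕 ((Set.Ioi (0 : ℝ)).indicator f)) :=
    VectorFourier.fourierIntegral_continuous Real.continuous_fourierChar
      (by exact continuous_inner) (integrable_indicator_Ioi hf)
  rw [show halfFT f = fun ζ => _ from funext (halfFT_eq_fourier f)]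
  fun_prop

/-- Plancherel for the restriction of f to the half line, transported to the variable z; the
rescaling of frequency by π gives the constant. -/
theorem lintegral_halfFT_le {f : ℝ → ℂ} (hf : IntegrableOn f (Set.Ioi 0))
    (hf2 : MemLp f 2 (volume.restrict (Set.Ioi 0))) :
    ∫⁻ z in outer, ‖halfFT f (spectralZeta z)‖ₑ ^ 2 ≤
      ENNReal.ofReal (2 * Real.pi) * ∫⁻ y in Set.Ioi 0, ‖f y‖ₑ ^ 2 := by
  have h2 : MemLp ((Set.Ioi (0 : ℝ)).indicator f) 2 volume :=
    (memLp_indicator_iff_restrict measurableSet_Ioi).2 hf2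
  have h3 := (eLpNorm_fourier_eq (integrable_indicator_Ioi hf) h2).2
  simp only [halfFT_eq_fourier]
  refine (lintegral_comp_spectralZeta_le (fun w => ‖𝓕 ((Set.Ioi (0 : ℝ)).indicator f) w‖ₑ ^ 2)
    Real.pi_pos).trans_eq ?_
  congr 1
  rw [eLpNorm_indicator_eq_eLpNorm_restrict measurableSet_Ioi,
    eLpNorm_eq_lintegral_rpow_enorm_toReal two_ne_zero ENNReal.ofNat_ne_top,
    eLpNorm_eq_lintegral_rpow_enorm_toReal two_ne_zero ENNReal.ofNat_ne_top] at h3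
  simpa using ENNReal.rpow_left_injective (by norm_num) h3

theorem measurable_spectralZeta : Measurable spectralZeta := by
  unfold spectralZeta
  fun_prop

theorem memLp_halfFT {f : ℝ → ℂ} (hf : IntegrableOn f (Set.Ioi 0))
    (hf2 : MemLp f 2 (volume.restrict (Set.Ioi 0))) :
    MemLp (fun z => halfFT f (spectralZeta z)) 2 (volume.restrict outer) := by
  have hmeas : Measurable fun z => halfFT f (spectralZeta z) :=
    (continuous_halfFT hf).measurable.comp measurable_spectralZeta
  rw [memLp_two_iff_lintegral_sq hmeas.aestronglyMeasurable]
  exact (lintegral_halfFT_le hf hf2).trans_lt (ENNReal.mul_lt_top ENNReal.ofReal_lt_top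
    ((memLp_two_iff_lintegral_sq hf2.1).1 hf2))

theorem memLp_inv_outer : MemLp (fun z : ℝ => |z|⁻¹) 2 (volume.restrict outer) := by
  have hm : Measurable fun z : ℝ => |z|⁻¹ := by fun_prop
  rw [memLp_two_iff_lintegral_sq hm.aestronglyMeasurable]
  have h1 : ∫⁻ z in outer, ‖|z|⁻¹‖ₑ ^ 2 ≤
      ∫⁻ z, (fun t => (Set.Ioi (2 : ℝ)).indicator (fun t => ENNReal.ofReal (t ^ (-2 : ℝ))) t) |z| := by
    rw [← lintegral_indicator measurableSet_outer]
    refine lintegral_mono fun z => ?_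
    by_cases hz : z ∈ outer
    · have hz' : |z| ∈ Set.Ioi (2 : ℝ) := hz
      have : (0 : ℝ) < |z| := by linarith [Set.mem_Ioi.1 hz']
      simp only [Set.indicator_of_mem hz, Set.indicator_of_mem hz']
      rw [Real.enorm_of_nonneg (by positivity), ← ENNReal.ofReal_pow (by positivity)]
      refine ENNReal.ofReal_le_ofReal ?_
      rw [Real.rpow_neg this.le, inv_pow]
      norm_cast
    · simp [Set.indicator_of_notMem hz]
  refine h1.trans_lt ((lintegral_comp_abs_le _).trans_lt (ENNReal.mul_lt_top (by simp) ?_))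
  refine (lintegral_mono' Measure.restrict_le_self le_rfl).trans_lt ?_
  rw [lintegral_indicator measurableSet_Ioi]
  have := (integrableOn_Ioi_rpow_of_lt (show (-2 : ℝ) < -1 by norm_num) (show (0 : ℝ) < 2 by norm_num))
  exact this.lintegral_lt_top

/-! ### Bounds in the outer region -/

section

variable {q g : ℝ → ℂ}

/-- In the second identity at x = 0, replacing m₀ by 1 isolates the half line transform of q'. The
errors involve m₀ - 1 and m₁, both O(1/z), against integrable densities. -/
theorem EnergyPot.exists_outer_bound (H : EnergyPot q g) : ∃ C, ∀ z ∈ outer,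
    ‖z * jostComp H.toDecay z 1 0 - q 0 * jostComp H.toDecay z 0 0‖ ≤
      ‖halfFT g (spectralZeta z)‖ + C * |z|⁻¹ := by
  obtain ⟨A, hA0, hA⟩ := H.exists_asymptotics
  set S := (∫ y in Set.Ioi 0, ‖g y‖) + ∫ y in Set.Ioi 0, ‖excess q y‖ with hS
  refine ⟨A * S, fun z hz => ?_⟩
  have hz2 : 2 < |z| := hz
  rw [H.second_identity (by linarith) le_rfl]
  set e : ℝ → ℂ := fun y => Complex.exp (-2 * Complex.I * spectralZeta z * y) with he
  have ce : Continuous e := by fun_prop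
  have hen : ∀ y, ‖e y‖ = 1 := fun y => norm_exp_two_I _ _
  have ib : ∀ {a : ℝ → ℂ}, IntegrableOn a (Set.Ioi 0) → IntegrableOn (fun y => e y * a y) (Set.Ioi 0) :=
    fun ha => Integrable.bdd_mul (c := 1) ha ce.aestronglyMeasurable
      (Eventually.of_forall fun y => (hen y).le)
  have i1 : IntegrableOn (fun y => g y * (e y * (jostComp H.toDecay z 0 y - 1)) +
      Complex.I * excess q y * (e y * jostComp H.toDecay z 1 y)) (Set.Ioi 0) := by
    have j1 := ib ((IntegrableOn.mul_jostComp H.integrableOn_deriv H.toDecay z 0).sub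
      H.integrableOn_deriv)
    have j2 := ib (IntegrableOn.mul_jostComp (H.integrableOn_excess.const_mul Complex.I)
      H.toDecay z 1)
    refine (j1.add j2).congr (Eventually.of_forall fun y => ?_)
    simp only [Pi.add_apply, Pi.sub_apply]
    ring
  have h1 : (∫ y in Set.Ioi 0, Complex.exp (-2 * Complex.I * spectralZeta z * (y - 0 : ℝ)) *
        (g y * jostComp H.toDecay z 0 y + Complex.I * excess q y * jostComp H.toDecay z 1 y)) =
      halfFT g (spectralZeta z) + ∫ y in Set.Ioi 0,
        (g y * (e y * (jostComp H.toDecay z 0 y - 1)) +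
          Complex.I * excess q y * (e y * jostComp H.toDecay z 1 y)) := by
    rw [halfFT, ← integral_add (ib H.integrableOn_deriv) i1]
    refine integral_congr_ae (Eventually.of_forall fun y => ?_)
    simp only [he, sub_zero]
    ring
  rw [h1]
  refine (norm_add_le _ _).trans (add_le_add le_rfl ?_)
  have h2 := norm_integral_pair_le (x := 0) (D := A / |z|) H.integrableOn_deriv
    (H.integrableOn_excess.const_mul Complex.I)
    (u := fun y => e y * (jostComp H.toDecay z 0 y - 1)) (v := fun y => e y * jostComp H.toDecay z 1 y)
    le_rfl
    (fun y hy => by rw [norm_mul, hen, one_mul]; exact (hA z hz2.le y hy).1)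
    (fun y hy => by rw [norm_mul, hen, one_mul]; exact (hA z hz2.le y hy).2)
  refine h2.trans_eq ?_
  simp only [norm_mul, Complex.norm_I, one_mul]
  rw [← hS, div_eq_mul_inv]
  ring

theorem EnergyPot.integrableOn_mul (H : EnergyPot q g) :
    IntegrableOn (fun y : ℝ => (y : ℂ) * (q y - 1)) (Set.Ioi 0) := by
  have hc := H.continuous
  refine Integrable.mono (H.integrableOn 0)
    (Continuous.aestronglyMeasurable (by fun_prop)) (Eventually.of_forall fun y => ?_)
  rw [norm_mul, norm_mul, norm_norm, Complex.norm_real, Real.norm_eq_abs,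
    Real.norm_of_nonneg (by positivity)]
  gcongr
  linarith

end

/-! ### Hardy's inequality and derivatives of half line Fourier transforms -/

/-- Hardy's inequality for the tail integrals of a nonnegative function. -/
theorem lintegral_tail_sq_le {h : ℝ → ℝ≥0∞} (hh : Measurable h) :
    ∫⁻ x in Set.Ioi 0, (∫⁻ y in Set.Ioi x, h y) ^ 2 ≤
      4 * ∫⁻ y in Set.Ioi 0, (ENNReal.ofReal y * h y) ^ 2 := by
  set k : ℝ → ℝ → ℝ≥0∞ := fun x y => (Set.Ioi x).indicator (fun y => ENNReal.ofReal y⁻¹) y with hk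
  set u : ℝ → ℝ≥0∞ := fun y => ENNReal.ofReal (y ^ (-(1 / 2) : ℝ)) with hu
  have hkm : Measurable (Function.uncurry k) := by
    have : Function.uncurry k = Set.indicator {p : ℝ × ℝ | p.1 < p.2}
        (fun p => ENNReal.ofReal p.2⁻¹) := by
      ext ⟨x, y⟩
      simp [hk, Set.indicator]
    rw [this]
    exact Measurable.indicator (by fun_prop) (measurableSet_lt measurable_fst measurable_snd)
  have hum : Measurable u := by fun_prop
  have hrw : ∀ x ∈ Set.Ioi (0 : ℝ), ∀ f : ℝ → ℝ≥0∞, ∫⁻ y in Set.Ioi 0, k x y * f y =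
      ∫⁻ y in Set.Ioi x, ENNReal.ofReal y⁻¹ * f y := by
    intro x hx f
    have e : ∀ y, k x y * f y = (Set.Ioi x).indicator (fun y => ENNReal.ofReal y⁻¹ * f y) y := by
      intro y
      by_cases hy : y ∈ Set.Ioi x
      · simp only [hk, Set.indicator_of_mem hy]
      · simp only [hk, Set.indicator_of_notMem hy, zero_mul]
    simp only [e]
    rw [setLIntegral_indicator measurableSet_Ioi, Set.inter_eq_left.2 (Set.Ioi_subset_Ioi (le_of_lt hx))]
  -- Schur's test for the kernel 1/y on x < y, applied to y h(y) with weight y^{-1/2} in both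
  -- variables. Each of the two constants is 2, which gives the 4.
  have h1 := lintegral_schur (μ := volume.restrict (Set.Ioi 0)) (ν := volume.restrict (Set.Ioi 0))
    hkm (h := fun y => ENNReal.ofReal y * h y) (by fun_prop) hum hum (A := 2) (B := 2) ?_ ?_ ?_
  · refine le_trans (le_of_eq ?_) (h1.trans_eq (by norm_num))
    refine setLIntegral_congr_fun measurableSet_Ioi fun x hx => ?_
    rw [hrw x hx]
    congr 1
    refine setLIntegral_congr_fun measurableSet_Ioi fun y hy => ?_
    have hy0 : 0 < y := lt_trans hx hy
    rw [← mul_assoc, ← ENNReal.ofReal_mul (by positivity), inv_mul_cancel₀ hy0.ne',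
      ENNReal.ofReal_one, one_mul]
  · filter_upwards [ae_restrict_mem measurableSet_Ioi] with y hy
    exact ⟨(ENNReal.ofReal_pos.2 (Real.rpow_pos_of_pos hy _)).ne', ENNReal.ofReal_ne_top⟩
  · filter_upwards [ae_restrict_mem measurableSet_Ioi] with x hx
    have hx0 : 0 < x := hx
    rw [hrw x hx]
    refine le_of_eq ?_
    calc _ = ∫⁻ y in Set.Ioi x, ENNReal.ofReal (y ^ (-(3 / 2) : ℝ)) := by
          refine setLIntegral_congr_fun measurableSet_Ioi fun y hy => ?_
          have hy0 : 0 < y := hx0.trans hy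
          simp only [hu]
          rw [← ENNReal.ofReal_mul (by positivity), ← Real.rpow_neg_one, ← Real.rpow_add hy0]
          norm_num
      _ = _ := by
          rw [lintegral_rpow_Ioi hx0, ENNReal.ofReal_mul (by norm_num)]
          simp [hu]
  · filter_upwards [ae_restrict_mem measurableSet_Ioi] with y hy
    have hy0 : 0 < y := hy
    have e : ∀ x, k x y * u x = (Set.Iio y).indicator (fun x => ENNReal.ofReal y⁻¹ * u x) x := by
      intro x
      by_cases hxy : x < y
      · simp [hk, hxy]
      · simp [hk, hxy]
    simp only [e]
    rw [setLIntegral_indicator measurableSet_Iio, lintegral_const_mul _ hum]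
    have e2 : ∫⁻ x in Set.Iio y ∩ Set.Ioi 0, u x ≤ ENNReal.ofReal (2 * y ^ (1 / 2 : ℝ)) := by
      rw [← lintegral_rpow_Ioc hy0]
      exact lintegral_mono_set fun x hx => ⟨hx.2, le_of_lt hx.1⟩
    refine (mul_le_mul_right e2 _).trans_eq ?_
    rw [← ENNReal.ofReal_mul (by positivity), show (2 : ℝ≥0∞) = ENNReal.ofReal 2 by simp, hu,
      ← ENNReal.ofReal_mul (by norm_num)]
    congr 1
    rw [mul_left_comm, ← Real.rpow_neg_one, ← Real.rpow_add hy0]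
    norm_num

theorem memLp_tail {h : ℝ → ℝ} (hi : IntegrableOn h (Set.Ioi 0)) (h0 : ∀ y, 0 ≤ h y)
    (hy : MemLp (fun y => y * h y) 2 (volume.restrict (Set.Ioi 0))) :
    MemLp (fun x => ∫ y in Set.Ioi x, h y) 2 (volume.restrict (Set.Ioi 0)) := by
  -- Hardy's inequality was stated for measurable functions, whereas h is only almost everywhere
  -- measurable.
  set h' : ℝ → ℝ≥0∞ := fun y => ENNReal.ofReal (hi.1.mk h y) with hh'
  have hm' : Measurable h' := (hi.1.stronglyMeasurable_mk.measurable).ennreal_ofReal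
  have hae : ∀ᵐ y ∂volume.restrict (Set.Ioi 0), h' y = ENNReal.ofReal (h y) := by
    filter_upwards [hi.1.ae_eq_mk] with y hy
    rw [hh', hy]
  have hcont : ContinuousOn (fun x => ∫ y in Set.Ioi x, h y) (Set.Ioi 0) := by
    have h1 : ContinuousOn (fun x => (∫ y in Set.Ioi 0, h y) - ∫ y in (0 : ℝ)..x, h y) (Set.Ioi 0) := by
      intro x hx
      have h2 : IntegrableOn h (Set.uIcc 0 (x + 1)) := by
        rw [Set.uIcc_of_le (by have : 0 < x := hx; linarith), integrableOn_Icc_iff_integrableOn_Ioc]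
        exact hi.mono_set Set.Ioc_subset_Ioi_self
      have h3 := intervalIntegral.continuousOn_primitive_interval h2
      refine ((continuousAt_const.sub (h3.continuousAt ?_))).continuousWithinAt
      rw [Set.uIcc_of_le (by have : 0 < x := hx; linarith)]
      exact Icc_mem_nhds hx (by linarith)
    refine h1.congr fun x hx => ?_
    have := intervalIntegral.integral_interval_add_Ioi' (a := (0 : ℝ)) (b := x) (f := h) (μ := volume)
      ((intervalIntegrable_iff_integrableOn_Ioc_of_le (le_of_lt hx)).2
        (hi.mono_set Set.Ioc_subset_Ioi_self)) (hi.mono_set (Set.Ioi_subset_Ioi (le_of_lt hx)))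
    linarith
  rw [memLp_two_iff_lintegral_sq (hcont.aestronglyMeasurable measurableSet_Ioi)]
  rw [memLp_two_iff_lintegral_sq hy.1] at hy
  have e1 : ∫⁻ x in Set.Ioi 0, ‖∫ y in Set.Ioi x, h y‖ₑ ^ 2 =
      ∫⁻ x in Set.Ioi 0, (∫⁻ y in Set.Ioi x, h' y) ^ 2 := by
    refine setLIntegral_congr_fun measurableSet_Ioi fun x hx => ?_
    rw [Real.enorm_of_nonneg (setIntegral_nonneg measurableSet_Ioi fun y _ => h0 y),
      ofReal_integral_eq_lintegral_ofReal (hi.mono_set (Set.Ioi_subset_Ioi (le_of_lt hx)))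
        (Eventually.of_forall h0)]
    congr 1
    exact (lintegral_congr_ae (ae_restrict_of_ae_restrict_of_subset
      (Set.Ioi_subset_Ioi (le_of_lt hx)) hae)).symm
  have e2 : ∫⁻ y in Set.Ioi 0, (ENNReal.ofReal y * h' y) ^ 2 = ∫⁻ y in Set.Ioi 0, ‖y * h y‖ₑ ^ 2 := by
    refine lintegral_congr_ae ?_
    filter_upwards [hae, ae_restrict_mem measurableSet_Ioi] with y hy hy0
    have : 0 < y := hy0
    rw [hy, ← ENNReal.ofReal_mul this.le, Real.enorm_of_nonneg (mul_nonneg this.le (h0 y))]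
  rw [e1]
  refine (lintegral_tail_sq_le hm').trans_lt ?_
  rw [e2]
  exact ENNReal.mul_lt_top (by simp) hy

theorem differentiableAt_halfFT {f : ℝ → ℂ} (hf : IntegrableOn f (Set.Ioi 0))
    (hyf : IntegrableOn (fun y : ℝ => (y : ℂ) * f y) (Set.Ioi 0)) (ζ : ℝ) :
    DifferentiableAt ℝ (halfFT f) ζ := by
  rw [show halfFT f = fun ζ => _ from funext (halfFT_eq_fourier f)]
  have h1 : Integrable fun y : ℝ => y • (Set.Ioi (0 : ℝ)).indicator f y := by
    refine (integrable_indicator_Ioi hyf).congr (Eventually.of_forall fun y => ?_)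
    by_cases hy : y ∈ Set.Ioi (0 : ℝ)
    · simp [Set.indicator_of_mem hy]
    · simp [Set.indicator_of_notMem hy]
  have h2 := (Real.hasDerivAt_fourier (integrable_indicator_Ioi hf) h1 (ζ / Real.pi)).differentiableAt
  exact h2.comp ζ (differentiableAt_id.div_const Real.pi)

theorem norm_exp_two_I_sub_one_le (t : ℝ) :
    ‖Complex.exp (-2 * Complex.I * t) - 1‖ ≤ 2 * |t| := by
  have h := Real.norm_exp_I_mul_ofReal_sub_one_le (x := -2 * t)
  rw [Real.norm_eq_abs, abs_mul] at h
  norm_num at h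
  refine le_trans (le_of_eq ?_) h
  congr 3
  ring

/-- Since yf is only in L², the derivative need not be an absolutely convergent integral. Difference
quotients with step 1/(n + 1) are half line transforms of d_n f with |d_n| ≤ 2|y|, so Plancherel
bounds them uniformly in L², and Fatou's lemma passes to the limit. -/
theorem memLp_deriv_halfFT {f : ℝ → ℂ} (hf : IntegrableOn f (Set.Ioi 0))
    (hyf : MemLp (fun y : ℝ => (y : ℂ) * f y) 2 (volume.restrict (Set.Ioi 0)))
    (hd : Differentiable ℝ (halfFT f)) :
    MemLp (fun z => deriv (halfFT f) (spectralZeta z)) 2 (volume.restrict outer) := by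
  have hm : Measurable fun z => deriv (halfFT f) (spectralZeta z) :=
    (measurable_deriv _).comp measurable_spectralZeta
  rw [memLp_two_iff_lintegral_sq hm.aestronglyMeasurable]
  set a : ℕ → ℝ := fun n => ((n : ℝ) + 1)⁻¹ with ha
  have ha0 : ∀ n, 0 < a n := fun n => by positivity
  set d : ℕ → ℝ → ℂ := fun n y => (a n : ℂ)⁻¹ * (Complex.exp (-2 * Complex.I * (a n * y : ℝ)) - 1) with hdq
  have hdn : ∀ n y, ‖d n y‖ ≤ 2 * |y| := by
    intro n y
    rw [hdq, norm_mul, norm_inv, Complex.norm_real, Real.norm_of_nonneg (ha0 n).le]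
    have := norm_exp_two_I_sub_one_le (a n * y)
    rw [abs_mul, abs_of_pos (ha0 n)] at this
    calc _ ≤ (a n)⁻¹ * (2 * (a n * |y|)) := by gcongr
      _ = _ := by
        have := (ha0 n).ne'
        field_simp
  have hdf : ∀ n y, ‖d n y * f y‖ ≤ ‖2 * ((y : ℂ) * f y)‖ := by
    intro n y
    rw [norm_mul, norm_mul 2, norm_mul (y : ℂ), Complex.norm_real, ← mul_assoc]
    have := hdn n y
    gcongr
    simpa using this
  have hdc : ∀ n, Continuous (d n) := fun n => by fun_prop
  have hdi : ∀ n, IntegrableOn (fun y => d n y * f y) (Set.Ioi 0) := by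
    intro n
    refine Integrable.bdd_mul (c := (a n)⁻¹ * 2) hf (hdc n).aestronglyMeasurable
      (Eventually.of_forall fun y => ?_)
    rw [hdq, norm_mul, norm_inv, Complex.norm_real, Real.norm_of_nonneg (ha0 n).le]
    have h1 := norm_sub_le (Complex.exp (-2 * Complex.I * (a n * y : ℝ))) 1
    have h2 : ‖Complex.exp (-2 * Complex.I * (a n * y : ℝ))‖ = 1 := by
      simpa using norm_exp_two_I 1 (a n * y)
    rw [h2, norm_one] at h1
    have := (inv_pos.2 (ha0 n)).le
    gcongr
    linarith
  have hd2 : ∀ n, MemLp (fun y => d n y * f y) 2 (volume.restrict (Set.Ioi 0)) := by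
    intro n
    refine (hyf.const_mul 2).mono ((hdc n).aestronglyMeasurable.mul hf.1)
      (Eventually.of_forall fun y => hdf n y)
  have hq : ∀ n ζ, halfFT (fun y => d n y * f y) ζ = (a n)⁻¹ • (halfFT f (ζ + a n) - halfFT f ζ) := by
    intro n ζ
    have ib : ∀ ζ : ℝ, IntegrableOn (fun y : ℝ => Complex.exp (-2 * Complex.I * ζ * y) * f y) (Set.Ioi 0) :=
      fun ζ => Integrable.bdd_mul (c := 1) hf (Continuous.aestronglyMeasurable (by fun_prop))
        (Eventually.of_forall fun y => (norm_exp_two_I _ _).le)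
    rw [halfFT, halfFT, halfFT, ← integral_sub (ib _) (ib _), ← integral_smul]
    refine integral_congr_ae (Eventually.of_forall fun y => ?_)
    simp only [hdq, Complex.real_smul]
    have : Complex.exp (-2 * Complex.I * (ζ + a n : ℝ) * y) =
        Complex.exp (-2 * Complex.I * ζ * y) * Complex.exp (-2 * Complex.I * (a n * y : ℝ)) := by
      rw [← Complex.exp_add]
      congr 1
      push_cast
      ring
    rw [this]
    push_cast
    ring
  have hlim : ∀ ζ, Tendsto (fun n => ‖halfFT (fun y => d n y * f y) ζ‖ₑ ^ 2) atTop
      (𝓝 (‖deriv (halfFT f) ζ‖ₑ ^ 2)) := by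
    intro ζ
    have h1 := (hd ζ).hasDerivAt.tendsto_slope_zero_right
    have h2 : Tendsto a atTop (𝓝[>] 0) := by
      refine tendsto_nhdsWithin_iff.2 ⟨?_, Eventually.of_forall ha0⟩
      have := tendsto_one_div_add_atTop_nhds_zero_nat (𝕜 := ℝ)
      simpa [ha] using this
    have h3 := h1.comp h2
    have h4 : Continuous fun w : ℂ => ‖w‖ₑ ^ 2 := by fun_prop
    refine ((h4.tendsto _).comp h3).congr fun n => ?_
    simp only [Function.comp_apply, hq]
  have hfat := lintegral_liminf_le (μ := volume.restrict outer) (u := atTop)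
    (f := fun n z => ‖halfFT (fun y => d n y * f y) (spectralZeta z)‖ₑ ^ 2) fun n =>
      (((continuous_halfFT (hdi n)).measurable.comp measurable_spectralZeta).enorm.pow_const 2)
  have e1 : ∫⁻ z in outer, ‖deriv (halfFT f) (spectralZeta z)‖ₑ ^ 2 =
      ∫⁻ z in outer, liminf (fun n => ‖halfFT (fun y => d n y * f y) (spectralZeta z)‖ₑ ^ 2) atTop := by
    refine lintegral_congr fun z => ?_
    exact ((hlim (spectralZeta z)).liminf_eq).symm
  rw [e1]
  refine hfat.trans_lt ?_
  set B := ENNReal.ofReal (2 * Real.pi) * ∫⁻ y : ℝ in Set.Ioi 0, ‖2 * ((y : ℂ) * f y)‖ₑ ^ 2 with hB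
  have hBt : B < ⊤ := ENNReal.mul_lt_top ENNReal.ofReal_lt_top
    ((memLp_two_iff_lintegral_sq (hyf.const_mul 2).1).1 (hyf.const_mul 2))
  have hle : ∀ n, ∫⁻ z in outer, ‖halfFT (fun y => d n y * f y) (spectralZeta z)‖ₑ ^ 2 ≤ B := by
    intro n
    refine (lintegral_halfFT_le (hdi n) (hd2 n)).trans ?_
    rw [hB]
    gcongr with y
    exact enorm_le_iff_norm_le.2 (hdf n y)
  exact (liminf_le_of_frequently_le' (Frequently.of_forall hle)).trans_lt hBt

section

variable {q g : ℝ → ℂ}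

theorem EnergyPot.integrableOn_sub_one (H : EnergyPot q g) :
    IntegrableOn (fun y => q y - 1) (Set.Ioi 0) := by
  have hc := H.continuous
  refine Integrable.mono (H.integrableOn 0)
    (Continuous.aestronglyMeasurable (by fun_prop)) (Eventually.of_forall fun y => ?_)
  rw [norm_mul, norm_norm, Real.norm_of_nonneg (by positivity)]
  exact le_mul_of_one_le_left (norm_nonneg _) (by linarith [abs_nonneg y])

/-- Integration by parts moves the derivative off q'. The point is that q - 1 has an integrable
first moment while q' is not assumed to, so differentiability of the transform of q' is obtained
through that of q - 1. -/
theorem EnergyPot.halfFT_eq (H : EnergyPot q g) (ζ : ℝ) :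
    halfFT g ζ = -(q 0 - 1) + 2 * Complex.I * ζ * halfFT (fun y => q y - 1) ζ := by
  set e : ℝ → ℂ := fun y => Complex.exp (-2 * Complex.I * ζ * y) with he
  have ce : Continuous e := by fun_prop
  have hen : ∀ y, ‖e y‖ = 1 := fun y => norm_exp_two_I _ _
  have hed : ∀ y, HasDerivAt e (-2 * Complex.I * ζ * e y) y := by
    intro y
    have h1 : HasDerivAt (fun y : ℝ => -2 * Complex.I * ζ * (y : ℂ)) (-2 * Complex.I * ζ) y := by
      simpa using ((hasDerivAt_id y).ofReal_comp).const_mul (-2 * Complex.I * (ζ : ℂ))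
    exact h1.cexp.congr_deriv (mul_comm _ _)
  have ib : ∀ {a : ℝ → ℂ}, IntegrableOn a (Set.Ioi 0) → IntegrableOn (fun y => e y * a y) (Set.Ioi 0) :=
    fun ha => Integrable.bdd_mul (c := 1) ha ce.aestronglyMeasurable
      (Eventually.of_forall fun y => (hen y).le)
  have i1 := ib H.integrableOn_deriv
  have i2 := (ib H.integrableOn_sub_one).const_mul (-2 * Complex.I * ζ)
  have l1 := intervalIntegral_tendsto_integral_Ioi 0 (i1.add i2) tendsto_id
  have hfin : ∀ b, 0 ≤ b → ∫ y in (0 : ℝ)..b, (e y * g y + -2 * Complex.I * ζ * (e y * (q y - 1))) =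
      (q b - 1) * e b - (q 0 - 1) := by
    intro b hb
    have h1 := integral_primitive_mul (u := fun y => q y - 1) hb (H.intervalIntegrable 0 b)
      (fun x _ => by rw [H.eq_primitive 0 x]; ring) ce.continuousOn
      (fun y _ => hed y) (Continuous.intervalIntegrable (by fun_prop) _ _)
    have e0 : e 0 = 1 := by simp [he]
    rw [e0, mul_one] at h1
    rw [← h1]
    refine intervalIntegral.integral_congr fun y _ => ?_
    ring
  have l2 : Tendsto (fun b => (q b - 1) * e b - (q 0 - 1)) atTop (𝓝 (0 - (q 0 - 1))) := by
    refine Tendsto.sub_const ?_ _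
    have h1 : Tendsto (fun b => q b - 1) atTop (𝓝 0) := by simpa using H.tendsto.sub_const 1
    rw [tendsto_zero_iff_norm_tendsto_zero] at h1 ⊢
    refine h1.congr fun b => ?_
    rw [norm_mul, hen, mul_one]
  have h3 := tendsto_nhds_unique_of_eventuallyEq l1 l2 ((eventually_ge_atTop 0).mono fun b hb => hfin b hb)
  rw [integral_add' i1 i2, integral_const_mul] at h3
  rw [halfFT, halfFT]
  linear_combination h3

theorem EnergyPot.differentiable_halfFT (H : EnergyPot q g) : Differentiable ℝ (halfFT g) := by
  rw [show halfFT g = fun ζ => _ from funext H.halfFT_eq]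
  intro ζ
  have h1 := differentiableAt_halfFT H.integrableOn_sub_one H.integrableOn_mul ζ
  have h2 : DifferentiableAt ℝ (fun ζ : ℝ => (ζ : ℂ)) ζ := (hasDerivAt_id ζ).ofReal_comp.differentiableAt
  exact ((h2.const_mul (2 * Complex.I)).mul h1).const_add _

theorem EnergyPot.memLp_deriv_halfFT (H : EnergyPot q g) :
    MemLp (fun z => deriv (halfFT g) (spectralZeta z)) 2 (volume.restrict outer) :=
  DefocusingNLS.memLp_deriv_halfFT H.integrableOn_deriv H.memLp_mul_deriv H.differentiable_halfFT

end

/-! ### The gauge transformation removing the diagonal part of the second equation -/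

/-- The density `|q|² - 1` as a real function. -/
def excessReal (q : ℝ → ℂ) (x : ℝ) : ℝ := Complex.normSq (q x) - 1

theorem excess_eq (q : ℝ → ℂ) (x : ℝ) : excess q x = (excessReal q x : ℂ) := by
  rw [excess, excessReal, Complex.mul_conj, Complex.ofReal_sub, Complex.ofReal_one]

/-- The tail `∫ₓ^∞ (|q|² - 1)`. -/
def tailPhase (q : ℝ → ℂ) (x : ℝ) : ℝ :=
  (∫ y in Set.Ioi 0, excessReal q y) - ∫ y in (0 : ℝ)..x, excessReal q y

/-- The gauge factor `exp (-(i / z) ∫ₓ^∞ (|q|² - 1))`. -/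
def gauge (q : ℝ → ℂ) (z x : ℝ) : ℂ := Complex.exp (Complex.I * ((-(tailPhase q x * z⁻¹) : ℝ) : ℂ))

theorem norm_gauge (q : ℝ → ℂ) (z x : ℝ) : ‖gauge q z x‖ = 1 := by
  rw [gauge, mul_comm]
  exact Complex.norm_exp_ofReal_mul_I _

theorem hasDerivAt_gauge {q : ℝ → ℂ} (hq : Continuous q) (z x : ℝ) :
    HasDerivAt (gauge q z) (Complex.I * (z : ℂ)⁻¹ * excess q x * gauge q z x) x := by
  have hc : Continuous (excessReal q) := (Complex.continuous_normSq.comp hq).sub continuous_const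
  have h1 : HasDerivAt (tailPhase q) (-excessReal q x) x := by
    have := (intervalIntegral.integral_hasDerivAt_right (hc.intervalIntegrable 0 x)
      (hc.stronglyMeasurableAtFilter _ _) hc.continuousAt).const_sub (∫ y in Set.Ioi 0, excessReal q y)
    exact this
  have h2 := (((h1.mul_const z⁻¹).neg).ofReal_comp.const_mul Complex.I).cexp
  refine h2.congr_deriv ?_
  rw [excess_eq, gauge]
  simp only [Pi.neg_apply]
  push_cast
  ring

theorem hasDerivAt_gauge_param (q : ℝ → ℂ) {z : ℝ} (hz : z ≠ 0) (x : ℝ) :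
    HasDerivAt (fun z => gauge q z x)
      (Complex.I * tailPhase q x * ((z : ℂ)⁻¹) ^ 2 * gauge q z x) z := by
  have h2 := ((((hasDerivAt_inv hz).const_mul (tailPhase q x)).neg).ofReal_comp.const_mul Complex.I).cexp
  refine h2.congr_deriv ?_
  rw [gauge]
  simp only [Pi.neg_apply]
  push_cast
  rw [inv_pow]
  ring

theorem continuous_gauge {q : ℝ → ℂ} (hq : Continuous q) (z : ℝ) : Continuous (gauge q z) :=
  continuous_iff_continuousAt.2 fun x => (hasDerivAt_gauge hq z x).continuousAt

theorem norm_gauge_sub_one_le (q : ℝ → ℂ) (z x : ℝ) :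
    ‖gauge q z x - 1‖ ≤ |tailPhase q x| * |z|⁻¹ := by
  have h := Real.norm_exp_I_mul_ofReal_sub_one_le (x := -(tailPhase q x * z⁻¹))
  rwa [norm_neg, norm_mul, Real.norm_eq_abs, Real.norm_eq_abs, abs_inv] at h

/-- The tail integral controlling the Jost solution near infinity. -/
def tailMass (q g : ℝ → ℂ) (x : ℝ) : ℝ := ∫ y in Set.Ioi x, (‖g y‖ + ‖excess q y‖)

section

variable {q g : ℝ → ℂ}

theorem EnergyPot.integrableOn_mass (H : EnergyPot q g) :
    IntegrableOn (fun y => ‖g y‖ + ‖excess q y‖) (Set.Ioi 0) :=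
  H.integrableOn_deriv.norm.add H.integrableOn_excess.norm

theorem EnergyPot.exists_norm_excess_le (H : EnergyPot q g) :
    ∃ C, 0 ≤ C ∧ ∀ x, 0 ≤ x → ‖excess q x‖ ≤ C * ‖q x - 1‖ := by
  obtain ⟨C, hC0, hC⟩ := H.exists_bound
  refine ⟨C + 1, by positivity, fun x hx => ?_⟩
  have e : excess q x = (q x - 1) * conj (q x) + conj (q x - 1) := by
    rw [excess, map_sub, map_one]
    ring
  rw [e]
  refine (norm_add_le _ _).trans ?_
  rw [norm_mul, RCLike.norm_conj, RCLike.norm_conj]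
  nlinarith [hC x hx, norm_nonneg (q x - 1)]

theorem tailMass_nonneg (q g : ℝ → ℂ) (x : ℝ) : 0 ≤ tailMass q g x := by
  rw [tailMass]
  positivity

/-- Hardy's inequality, as y times the density is in L²: for q' by assumption, for |q|² - 1 because
it is bounded by a multiple of |q - 1|. -/
theorem EnergyPot.memLp_tailMass (H : EnergyPot q g) :
    MemLp (tailMass q g) 2 (volume.restrict (Set.Ioi 0)) := by
  obtain ⟨C, hC0, hC⟩ := H.exists_norm_excess_le
  refine memLp_tail H.integrableOn_mass (fun y => by positivity) ?_
  refine (H.memLp_mul_deriv.norm.add (H.memLp_mul.norm.const_mul C)).mono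
    (continuous_id.aestronglyMeasurable.mul H.integrableOn_mass.1) ?_
  filter_upwards [ae_restrict_mem measurableSet_Ioi] with y hy
  have hy0 : 0 < y := hy
  simp only [Pi.add_apply, norm_mul, Complex.norm_real, Real.norm_eq_abs, abs_of_pos hy0]
  rw [abs_of_nonneg (by positivity), abs_of_nonneg (by positivity), mul_add]
  have := mul_le_mul_of_nonneg_left (hC y hy0.le) hy0.le
  linarith

theorem EnergyPot.abs_tailPhase_le (H : EnergyPot q g) {x : ℝ} (hx : 0 ≤ x) :
    |tailPhase q x| ≤ tailMass q g x := by
  have hi : IntegrableOn (excessReal q) (Set.Ioi 0) := by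
    have := H.integrableOn_excess.re
    refine this.congr (Eventually.of_forall fun y => ?_)
    simp [excess_eq]
  have h1 := intervalIntegral.integral_interval_add_Ioi' (a := (0 : ℝ)) (b := x) (f := excessReal q)
    (μ := volume) ((intervalIntegrable_iff_integrableOn_Ioc_of_le hx).2
        (hi.mono_set Set.Ioc_subset_Ioi_self)) (hi.mono_set (Set.Ioi_subset_Ioi hx))
  have h2 : tailPhase q x = ∫ y in Set.Ioi x, excessReal q y := by
    rw [tailPhase]
    linarith
  rw [h2, ← Real.norm_eq_abs]
  refine norm_integral_le_of_norm_le (H.integrableOn_mass.mono_set (Set.Ioi_subset_Ioi hx))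
    (Eventually.of_forall fun y => ?_)
  rw [excess_eq, Complex.norm_real]
  linarith [norm_nonneg (g y)]

theorem EnergyPot.tailMass_le (H : EnergyPot q g) {x : ℝ} (hx : 0 ≤ x) :
    tailMass q g x ≤ tailMass q g 0 :=
  setIntegral_mono_set H.integrableOn_mass (Eventually.of_forall fun y => by positivity)
    (Set.Ioi_subset_Ioi hx).eventuallyLE

theorem EnergyPot.norm_sub_one_le (H : EnergyPot q g) {x : ℝ} (hx : 0 ≤ x) :
    ‖q x - 1‖ ≤ tailMass q g x := by
  have hi : IntegrableOn g (Set.Ioi x) := H.integrableOn_deriv.mono_set (Set.Ioi_subset_Ioi hx)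
  have h1 := (intervalIntegral_tendsto_integral_Ioi x hi tendsto_id).const_add (q x)
  have h2 := tendsto_nhds_unique (h1.congr fun y => (H.eq_primitive x y).symm) H.tendsto
  rw [← h2, sub_add_cancel_left, norm_neg]
  exact norm_integral_le_of_norm_le (H.integrableOn_mass.mono_set (Set.Ioi_subset_Ioi hx))
    (Eventually.of_forall fun y => by linarith [norm_nonneg (excess q y)])

/-- Refines `EnergyPot.exists_asymptotics` by keeping the integrals over (x,∞) instead of (0,∞). The
factor tending to zero in x is what later pairs with yq'. -/
theorem EnergyPot.exists_tail_bound (H : EnergyPot q g) : ∃ C, 0 ≤ C ∧ ∀ z ∈ outer, ∀ x, 0 ≤ x →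
    ‖jostComp H.toDecay z 0 x - 1‖ ≤ C * |z|⁻¹ * tailMass q g x := by
  obtain ⟨D, hD0, hD⟩ := exists_norm_jostM_le (H.toDecay.moment 0)
  obtain ⟨Q, hQ0, hQ⟩ := H.exists_bound
  obtain ⟨E, hE0, hE⟩ := H.exists_norm_excess_le
  have hm : ∀ z : ℝ, 2 ≤ |z| → ∀ i x, 0 ≤ x → ‖jostComp H.toDecay z i x‖ ≤ D := fun z hz i x hx =>
    (norm_jostComp_le H.toDecay z i hx).trans (hD z (by linarith))
  refine ⟨2 * (Q * D + E * D + D), by positivity, fun z hz x hx => ?_⟩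
  have hz2 : 2 < |z| := hz
  have hz1 : 1 / 4 ≤ |z| := by linarith
  have hz0 : 0 < |z| := by linarith
  have hzC : (z : ℂ) ≠ 0 := by simpa using ne_zero_of_quarter_le hz1
  have hzn : ‖(z : ℂ)‖ = |z| := Complex.norm_real z
  have hzi : |z|⁻¹ ≤ 1 / 2 := by
    rw [inv_le_comm₀ hz0 (by norm_num)]
    linarith
  have hzi0 : 0 < |z|⁻¹ := inv_pos.2 hz0
  set τ := tailMass q g x with hτ
  have hτ0 : 0 ≤ τ := tailMass_nonneg q g x
  set m₀ := jostComp H.toDecay z 0 with hm₀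
  set m₁ := jostComp H.toDecay z 1 with hm₁
  set W := z * m₁ x - q x * m₀ x with hW
  have i1 := H.first_identity hz1 hx
  have i2 := H.second_identity hz1 hx
  set I₁ := ∫ y in Set.Ioi x, (Complex.I * excess q y * jostComp H.toDecay z 0 y -
        conj (g y) * jostComp H.toDecay z 1 y) with hI₁
  have nI : ‖I₁‖ ≤ D * τ := by
    have := norm_integral_pair_le_tail (H.integrableOn_excess.const_mul Complex.I)
      (integrableOn_conj H.integrableOn_deriv).neg hx (hm z hz2.le 0) (hm z hz2.le 1)
    simp only [norm_mul, Complex.norm_I, one_mul, Pi.neg_apply, norm_neg, RCLike.norm_conj,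
      neg_mul, ← sub_eq_add_neg] at this
    simp only [add_comm ‖excess q _‖] at this
    exact this
  have nW : ‖W‖ ≤ D * τ := by
    have := norm_integral_pair_le_tail (x := x) (D := D) H.integrableOn_deriv
      (H.integrableOn_excess.const_mul Complex.I)
      (u := fun y => Complex.exp (-2 * Complex.I * spectralZeta z * (y - x : ℝ)) * m₀ y)
      (v := fun y => Complex.exp (-2 * Complex.I * spectralZeta z * (y - x : ℝ)) * m₁ y) hx
      (fun y hy => by rw [norm_mul, norm_exp_two_I, one_mul]; exact hm z hz2.le 0 y hy)
      (fun y hy => by rw [norm_mul, norm_exp_two_I, one_mul]; exact hm z hz2.le 1 y hy)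
    simp only [norm_mul, Complex.norm_I, one_mul] at this
    rw [hW, i2]
    refine le_trans (le_of_eq ?_) this
    congr 1
    refine integral_congr_ae (Eventually.of_forall fun y => ?_)
    simp only [hm₀, hm₁]
    ring
  -- The second identity is used to eliminate m₁ from the first. The leftover (m₀ - 1)/z is absorbed
  -- on the left, as |z| > 2.
  have e1 : (z : ℂ) * (m₀ x - 1) = (z : ℂ)⁻¹ * (m₀ x - 1) +
      ((z : ℂ)⁻¹ * (conj (q x) * W + excess q x * m₀ x) - I₁) := by
    have h3 : (z : ℂ)⁻¹ * z = 1 := inv_mul_cancel₀ hzC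
    rw [hW, excess]
    linear_combination i1 + -conj (q x) * m₁ x * h3
  have n1 : ‖(z : ℂ)⁻¹ * (conj (q x) * W + excess q x * m₀ x)‖ ≤ Q * D * τ + E * D * τ := by
    have a1 : ‖conj (q x) * W‖ ≤ Q * (D * τ) := by
      rw [norm_mul, RCLike.norm_conj]
      exact mul_le_mul (hQ x hx) nW (norm_nonneg _) hQ0
    have a2 : ‖excess q x * m₀ x‖ ≤ E * τ * D := by
      rw [norm_mul]
      exact mul_le_mul ((hE x hx).trans (mul_le_mul_of_nonneg_left (H.norm_sub_one_le hx) hE0))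
        (hm z hz2.le 0 x hx) (norm_nonneg _) (by positivity)
    rw [norm_mul, norm_inv, hzn]
    refine (mul_le_of_le_one_left (norm_nonneg _) (by linarith)).trans ((norm_add_le _ _).trans ?_)
    linarith
  have n2 : |z| * ‖m₀ x - 1‖ ≤ 1 / 2 * ‖m₀ x - 1‖ + (Q * D + E * D + D) * τ := by
    rw [← hzn, ← norm_mul, e1]
    refine (norm_add_le _ _).trans ?_
    have a1 := norm_sub_le ((z : ℂ)⁻¹ * (conj (q x) * W + excess q x * m₀ x)) I₁
    have a2 : ‖(z : ℂ)⁻¹ * (m₀ x - 1)‖ ≤ 1 / 2 * ‖m₀ x - 1‖ := by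
      rw [norm_mul, norm_inv, hzn]
      gcongr
    linarith
  have n3 : |z| * ‖m₀ x - 1‖ ≤ 2 * (Q * D + E * D + D) * τ := by
    nlinarith [norm_nonneg (m₀ x - 1)]
  calc ‖m₀ x - 1‖ = |z|⁻¹ * (|z| * ‖m₀ x - 1‖) := by
        rw [← mul_assoc, inv_mul_cancel₀ hz0.ne', one_mul]
    _ ≤ |z|⁻¹ * (2 * (Q * D + E * D + D) * τ) := by gcongr
    _ = _ := by ring

/-- The gauged form of the integral equation of `m₁ - (q/z) m₀`. -/
theorem EnergyPot.gauged_identity (H : EnergyPot q g) {z : ℝ} (hz : 1 / 4 ≤ |z|) :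
    (z * jostComp H.toDecay z 1 0 - q 0 * jostComp H.toDecay z 0 0) * gauge q z 0 =
      ∫ y : ℝ in Set.Ioi 0, Complex.exp (-2 * Complex.I * spectralZeta z * y) *
        ((g y + Complex.I * (z : ℂ)⁻¹ * (excess q y * q y)) *
          (gauge q z y * jostComp H.toDecay z 0 y)) := by
  set m₀ := jostComp H.toDecay z 0 with hm₀
  set m₁ := jostComp H.toDecay z 1 with hm₁
  set ε : ℝ → ℂ := fun y => Complex.exp (-2 * Complex.I * spectralZeta z * y) with hε
  set e : ℝ → ℂ := fun y => ε y * gauge q z y with he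
  have hz0 : (z : ℂ) ≠ 0 := by exact_mod_cast ne_zero_of_quarter_le hz
  have hc := H.continuous
  have hc' : Continuous fun x => conj (q x) := Complex.continuous_conj.comp hc
  have hcx : Continuous (excess q) := by unfold excess; fun_prop
  have c0 : Continuous m₀ := continuous_jostComp H.toDecay z 0
  have c1 : Continuous m₁ := continuous_jostComp H.toDecay z 1
  have cε : Continuous ε := by fun_prop
  have ce : Continuous e := cε.mul (continuous_gauge hc z)
  have hεd : ∀ y, HasDerivAt ε (-2 * Complex.I * spectralZeta z * ε y) y := by
    intro y
    have h1 : HasDerivAt (fun y : ℝ => -2 * Complex.I * spectralZeta z * (y : ℂ))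
        (-2 * Complex.I * spectralZeta z) y := by
      simpa using ((hasDerivAt_id y).ofReal_comp).const_mul (-2 * Complex.I * (spectralZeta z : ℂ))
    exact h1.cexp.congr_deriv (mul_comm _ _)
  have hed : ∀ y, HasDerivAt e
      ((-2 * Complex.I * spectralZeta z + Complex.I * (z : ℂ)⁻¹ * excess q y) * e y) y := by
    intro y
    refine ((hεd y).mul (hasDerivAt_gauge hc z y)).congr_deriv ?_
    simp only [he]
    ring
  have hen : ∀ y, ‖e y‖ = 1 := fun y => by
    rw [he, norm_mul, norm_gauge, mul_one]
    exact norm_exp_two_I _ _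
  have hζ : (2 * spectralZeta z : ℂ) = z - (z : ℂ)⁻¹ := by
    rw [spectralZeta]
    push_cast
    ring
  have hg := H.intervalIntegrable
  obtain ⟨Q, hQ0, hQ⟩ := H.exists_bound
  have hint : IntegrableOn (fun y => e y * ((g y + Complex.I * (z : ℂ)⁻¹ * (excess q y * q y)) * m₀ y))
      (Set.Ioi 0) := by
    refine Integrable.bdd_mul (c := 1) ?_ ce.aestronglyMeasurable
      (Eventually.of_forall fun y => (hen y).le)
    refine IntegrableOn.mul_jostComp (Integrable.add H.integrableOn_deriv (Integrable.const_mul ?_ _))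
      H.toDecay z 0
    refine Integrable.mul_bdd (c := Q) H.integrableOn_excess hc.aestronglyMeasurable ?_
    filter_upwards [ae_restrict_mem measurableSet_Ioi] with y hy
    exact hQ y (le_of_lt hy)
  have hfin : ∀ b, 0 ≤ b →
      ∫ y in (0 : ℝ)..b, e y * ((g y + Complex.I * (z : ℂ)⁻¹ * (excess q y * q y)) * m₀ y) =
      (z * m₁ 0 - q 0 * m₀ 0) * e 0 - e b * (z * m₁ b - q b * m₀ b) := by
    -- Differentiating the gauge adds (i/z)(|q|² - 1)(zm₁ - qm₀). Its m₁ part cancels the term with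
    -- m₁ in the ungauged identity, and its m₀ part is the extra summand with the factor 1/z.
    intro b hb
    have e1 := intervalIntegral.integral_eq_sub_of_hasDerivAt_of_le hb (ce.mul c1).continuousOn
      (fun y hy => (hed y).mul (hasDerivAt_jostComp H.toDecay hz hy.1).2)
      (Continuous.intervalIntegrable (by fun_prop) _ _)
    have e2 := integral_primitive_mul hb (hg 0 b) (fun y _ => H.eq_primitive 0 y)
      (ce.mul c0).continuousOn
      (fun y hy => (hed y).mul (hasDerivAt_jostComp H.toDecay hz hy.1).1)
      (Continuous.intervalIntegrable (by fun_prop) _ _)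
    rw [← hm₀, ← hm₁] at e1 e2
    have e3 : (z * m₁ 0 - q 0 * m₀ 0) * e 0 - e b * (z * m₁ b - q b * m₀ b) =
        (q b * (e b * m₀ b) - q 0 * (e 0 * m₀ 0)) - z * (e b * m₁ b - e 0 * m₁ 0) := by
      ring
    simp only [Pi.mul_apply] at e1 e2
    rw [e3, ← e1, ← e2, ← intervalIntegral.integral_const_mul, ← intervalIntegral.integral_sub]
    · refine intervalIntegral.integral_congr fun y _ => ?_
      simp only [excess]
      have h3 : (z : ℂ) * (z : ℂ)⁻¹ = 1 := mul_inv_cancel₀ hz0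
      linear_combination (Complex.I * e y * q y * m₀ y - z * Complex.I * e y * m₁ y) * hζ +
        Complex.I * e y * m₁ y * (q y * conj (q y)) * h3
    · refine ((hg 0 b).mul_continuousOn (ce.mul c0).continuousOn).add
        (Continuous.intervalIntegrable (by fun_prop) _ _)
    · exact Continuous.intervalIntegrable (by fun_prop) _ _
  have hlim := intervalIntegral_tendsto_integral_Ioi 0 hint tendsto_id
  have hlim2 : Tendsto (fun b => (z * m₁ 0 - q 0 * m₀ 0) * e 0 - e b * (z * m₁ b - q b * m₀ b)) atTop
      (𝓝 ((z * m₁ 0 - q 0 * m₀ 0) * e 0 - 0)) := by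
    obtain ⟨t0, t1⟩ := tendsto_jostComp H.toDecay hz
    have t2 : Tendsto (fun b => z * m₁ b - q b * m₀ b) atTop (𝓝 (z * (z : ℂ)⁻¹ - 1 * 1)) :=
      (t1.const_mul _).sub (H.tendsto.mul t0)
    rw [mul_inv_cancel₀ hz0, mul_one, sub_self] at t2
    refine Tendsto.const_sub _ ?_
    rw [tendsto_zero_iff_norm_tendsto_zero] at t2 ⊢
    refine t2.congr fun b => ?_
    rw [norm_mul, hen, one_mul]
  have h4 := tendsto_nhds_unique_of_eventuallyEq hlim hlim2
    ((eventually_ge_atTop 0).mono fun b hb => hfin b hb)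
  have e0 : e 0 = gauge q z 0 := by simp [he, hε]
  rw [sub_zero, e0] at h4
  rw [← h4]
  refine integral_congr_ae (Eventually.of_forall fun y => ?_)
  simp only [he]
  ring

end

/-! ### The derivative of `z m₁ - q m₀` in the outer region -/

section

variable {q g : ℝ → ℂ}

/-- The first component of the normalized Jost solution, gauged. -/
def gaugedComp (hq : Decay q) (z x : ℝ) : ℂ := gauge q z x * jostComp hq z 0 x

/-- The `z`-derivative of `gaugedComp`. -/
def gaugedCompDeriv (hq : Decay q) (z x : ℝ) : ℂ :=
  Complex.I * tailPhase q x * ((z : ℂ)⁻¹) ^ 2 * gauge q z x * jostComp hq z 0 x +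
    gauge q z x * jostCompDeriv hq z 0 x

theorem hasDerivAt_gaugedComp (hM : MomentReg 0 q) {z : ℝ} (hz : 2 ≤ |z|) (x : ℝ) :
    HasDerivAt (fun z => gaugedComp hM.toDecay z x) (gaugedCompDeriv hM.toDecay z x) z :=
  (hasDerivAt_gauge_param q (ne_zero_of_quarter_le (by linarith)) x).mul
    (hasDerivAt_jostComp_param hM hz 0 x)

theorem continuous_gaugedComp (hq : Decay q) (z : ℝ) : Continuous (gaugedComp hq z) :=
  (continuous_gauge hq.continuous z).mul (continuous_jostComp hq z 0)

theorem continuous_tailPhase (hq : Continuous q) : Continuous (tailPhase q) := by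
  have hc : Continuous (excessReal q) := (Complex.continuous_normSq.comp hq).sub continuous_const
  exact continuous_const.sub (intervalIntegral.continuous_primitive (fun a b => hc.intervalIntegrable a b) 0)

theorem continuous_gaugedCompDeriv (hq : Decay q) (z : ℝ) : Continuous (gaugedCompDeriv hq z) := by
  have h1 := continuous_gauge hq.continuous z
  have h2 := continuous_jostComp hq z 0
  have h3 := continuous_tailPhase hq.continuous
  have h4 : Continuous (jostCompDeriv hq z 0) :=
    (continuous_exp_weightExp hq).mul ((continuous_apply 0).comp
      (BoundedContinuousFunction.continuous (deriv (jostM (hq.moment 0)) z)))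
  unfold gaugedCompDeriv
  fun_prop

/-- The gauge is unimodular, differs from 1 by at most the tail over |z|, and has z-derivative of
order z⁻². The bounds for m₀ therefore survive multiplication by it. -/
theorem EnergyPot.exists_gauged_bounds (H : EnergyPot q g) (hM : MomentReg 0 q) :
    ∃ C, 0 ≤ C ∧ ∀ z ∈ outer, ∀ x, 0 ≤ x → ‖gaugedComp H.toDecay z x‖ ≤ C ∧
      ‖gaugedComp H.toDecay z x - 1‖ ≤ C * |z|⁻¹ * tailMass q g x ∧
      ‖gaugedCompDeriv H.toDecay z x‖ ≤ C * |z|⁻¹ := by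
  obtain ⟨D, hD0, hD⟩ := exists_norm_jostM_le (H.toDecay.moment 0)
  obtain ⟨A, hA0, hA⟩ := H.exists_deriv_asymptotics hM
  obtain ⟨T, hT0, hT⟩ := H.exists_tail_bound
  have hS0 := tailMass_nonneg q g 0
  refine ⟨D + T + A + tailMass q g 0 * D, by positivity, fun z hz x hx => ?_⟩
  have hz2 : 2 < |z| := hz
  have hz0 : 0 < |z| := by linarith
  have hzi : |z|⁻¹ ≤ 1 := inv_le_one_of_one_le₀ (by linarith)
  have hzi0 : 0 < |z|⁻¹ := inv_pos.2 hz0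
  have hm := (norm_jostComp_le H.toDecay z 0 hx).trans (hD z (by linarith))
  have hτ := H.abs_tailPhase_le hx
  have hτ0 := tailMass_nonneg q g x
  have hSD : 0 ≤ tailMass q g 0 * D := by positivity
  refine ⟨?_, ?_, ?_⟩
  · rw [gaugedComp, norm_mul, norm_gauge, one_mul]
    linarith
  · have e : gaugedComp H.toDecay z x - 1 = (gauge q z x - 1) * jostComp H.toDecay z 0 x +
        (jostComp H.toDecay z 0 x - 1) := by
      rw [gaugedComp]
      ring
    have n1 : ‖(gauge q z x - 1) * jostComp H.toDecay z 0 x‖ ≤ tailMass q g x * |z|⁻¹ * D := by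
      rw [norm_mul]
      refine mul_le_mul ((norm_gauge_sub_one_le q z x).trans ?_) hm (norm_nonneg _) (by positivity)
      gcongr
    have n2 := hT z hz x hx
    rw [e]
    refine (norm_add_le _ _).trans ((add_le_add n1 n2).trans ?_)
    have : 0 ≤ (A + tailMass q g 0 * D) * (|z|⁻¹ * tailMass q g x) := by positivity
    nlinarith
  · have n1 : ‖Complex.I * tailPhase q x * ((z : ℂ)⁻¹) ^ 2 * gauge q z x * jostComp H.toDecay z 0 x‖ ≤
        tailMass q g 0 * |z|⁻¹ * D := by
      rw [norm_mul, norm_mul, norm_gauge, mul_one, norm_mul, norm_mul, Complex.norm_I, one_mul,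
        norm_pow, norm_inv, Complex.norm_real, Complex.norm_real, Real.norm_eq_abs, Real.norm_eq_abs]
      have h1 := hτ.trans (H.tailMass_le hx)
      have h2 : |z|⁻¹ ^ 2 ≤ |z|⁻¹ := pow_le_of_le_one hzi0.le hzi (by norm_num)
      gcongr
    have n2 : ‖gauge q z x * jostCompDeriv H.toDecay z 0 x‖ ≤ A * |z|⁻¹ := by
      rw [norm_mul, norm_gauge, one_mul, ← div_eq_mul_inv]
      exact (hA z hz2 x hx).1
    rw [gaugedCompDeriv]
    refine (norm_add_le _ _).trans ((add_le_add n1 n2).trans ?_)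
    have : 0 ≤ (D + T) * |z|⁻¹ := by positivity
    nlinarith

/-- The part of the gauged integral equation that decays like `1/z`. -/
def gaugedRest (hq : Decay q) (g : ℝ → ℂ) (z y : ℝ) : ℂ :=
  Complex.exp (-2 * Complex.I * spectralZeta z * y) * (g y * (gaugedComp hq z y - 1) +
    Complex.I * (z : ℂ)⁻¹ * (excess q y * q y) * gaugedComp hq z y)

/-- The `z`-derivative of `gaugedRest`. -/
def gaugedRestDeriv (hq : Decay q) (g : ℝ → ℂ) (z y : ℝ) : ℂ :=
  Complex.exp (-2 * Complex.I * spectralZeta z * y) *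
    (-2 * Complex.I * ((1 + z⁻¹ * z⁻¹) / 2 : ℝ) * y * (g y * (gaugedComp hq z y - 1) +
      Complex.I * (z : ℂ)⁻¹ * (excess q y * q y) * gaugedComp hq z y) +
    (g y * gaugedCompDeriv hq z y + (-Complex.I * ((z : ℂ)⁻¹) ^ 2 * (excess q y * q y) * gaugedComp hq z y +
      Complex.I * (z : ℂ)⁻¹ * (excess q y * q y) * gaugedCompDeriv hq z y)))

theorem hasDerivAt_gaugedRest (hM : MomentReg 0 q) {z : ℝ} (hz : 2 ≤ |z|) (y : ℝ) :
    HasDerivAt (fun z => gaugedRest hM.toDecay g z y) (gaugedRestDeriv hM.toDecay g z y) z := by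
  have hz0 : z ≠ 0 := ne_zero_of_quarter_le (by linarith)
  have h1 := ((((hasDerivAt_spectralZeta hz0).ofReal_comp.const_mul (-2 * Complex.I)).mul_const
    (y : ℂ))).cexp
  have h2 := hasDerivAt_gaugedComp hM hz y
  have hinv : HasDerivAt (fun w : ℝ => (w : ℂ)⁻¹) (-1 / (z : ℂ) ^ 2) z :=
    HasDerivAt.inv (hasDerivAt_id z).ofReal_comp (by simpa using hz0)
  refine (h1.mul (((h2.sub_const 1).const_mul (g y)).add
    (((hinv.const_mul Complex.I).mul_const (excess q y * q y)).mul h2))).congr_deriv ?_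
  rw [gaugedRestDeriv]
  simp only [Pi.add_apply, Pi.mul_apply]
  ring

/-- Differentiating the phase produces a factor y. On the term with q' this is affordable because
the other factor is bounded by the tail mass: yq' and the tail are both in L². On the terms with
|q|² - 1 the first moment of q - 1 suffices, and every term retains a factor 1/|z|. -/
theorem EnergyPot.exists_gaugedRest_bounds (H : EnergyPot q g) (hM : MomentReg 0 q) :
    ∃ b : ℝ → ℝ, IntegrableOn b (Set.Ioi 0) ∧ ∀ z ∈ outer, ∀ y, 0 < y →
      ‖gaugedRest H.toDecay g z y‖ ≤ b y ∧ ‖gaugedRestDeriv H.toDecay g z y‖ ≤ |z|⁻¹ * b y := by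
  obtain ⟨C, hC0, hC⟩ := H.exists_gauged_bounds hM
  obtain ⟨Q, hQ0, hQ⟩ := H.exists_bound
  obtain ⟨E, hE0, hE⟩ := H.exists_norm_excess_le
  set τ := tailMass q g with hτ
  refine ⟨fun y => 2 * C * (y * ‖g y‖ * τ y) + (C + C * τ 0) * ‖g y‖ +
    4 * Q * E * C * ((1 + |y|) * ‖q y - 1‖), ?_, fun z hz y hy => ?_⟩
  · have h1 : IntegrableOn (fun y => y * ‖g y‖ * τ y) (Set.Ioi 0) := by
      refine (H.memLp_mul_deriv.norm.integrable_mul H.memLp_tailMass).congr ?_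
      filter_upwards [ae_restrict_mem measurableSet_Ioi] with y hy
      rw [Pi.mul_apply, norm_mul, Complex.norm_real, Real.norm_of_nonneg (le_of_lt hy)]
    exact ((h1.const_mul _).add (H.integrableOn_deriv.norm.const_mul _)).add
      ((H.integrableOn 0).const_mul _)
  · have hz2 : 2 < |z| := hz
    have hz0 : 0 < |z| := by linarith
    have hzi : |z|⁻¹ ≤ 1 := inv_le_one_of_one_le₀ (by linarith)
    have hzi0 : 0 < |z|⁻¹ := inv_pos.2 hz0
    have hzn : ‖(z : ℂ)⁻¹‖ = |z|⁻¹ := by rw [norm_inv, Complex.norm_real, Real.norm_eq_abs]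
    obtain ⟨c1, c2, c3⟩ := hC z hz y hy.le
    have hτ0 : 0 ≤ τ y := tailMass_nonneg q g y
    have hτ1 : τ y ≤ τ 0 := H.tailMass_le hy.le
    set P := ‖q y - 1‖ with hP
    have hP0 : 0 ≤ P := norm_nonneg _
    have hκ : ‖excess q y * q y‖ ≤ E * P * Q := by
      rw [norm_mul]
      exact mul_le_mul (hE y hy.le) (hQ y hy.le) (norm_nonneg _) (by positivity)
    have hG0 : 0 ≤ ‖g y‖ := norm_nonneg _
    have a1 : ‖g y * (gaugedComp H.toDecay z y - 1)‖ ≤ ‖g y‖ * (C * |z|⁻¹ * τ y) := by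
      rw [norm_mul]
      gcongr
    have a2 : ‖Complex.I * (z : ℂ)⁻¹ * (excess q y * q y) * gaugedComp H.toDecay z y‖ ≤
        |z|⁻¹ * (E * P * Q) * C := by
      rw [norm_mul, norm_mul, norm_mul, Complex.norm_I, one_mul, hzn]
      gcongr
    have a3 := (norm_add_le (g y * (gaugedComp H.toDecay z y - 1))
      (Complex.I * (z : ℂ)⁻¹ * (excess q y * q y) * gaugedComp H.toDecay z y)).trans (add_le_add a1 a2)
    have hEPQ : 0 ≤ Q * E * C * P := by positivity
    have hGτ : 0 ≤ C * (‖g y‖ * τ y) := by positivity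
    have hyGτ : 0 ≤ C * (y * ‖g y‖ * τ y) := by positivity
    have hyE : 0 ≤ Q * E * C * (y * P) := by positivity
    constructor
    · rw [gaugedRest, norm_mul, norm_exp_two_I, one_mul]
      refine a3.trans ?_
      have b1 : ‖g y‖ * (C * |z|⁻¹ * τ y) ≤ C * τ 0 * ‖g y‖ := by
        calc ‖g y‖ * (C * |z|⁻¹ * τ y) ≤ ‖g y‖ * (C * 1 * τ 0) := by gcongr
          _ = _ := by ring
      have b2 : |z|⁻¹ * (E * P * Q) * C ≤ Q * E * C * P := by
        calc |z|⁻¹ * (E * P * Q) * C ≤ 1 * (E * P * Q) * C := by gcongr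
          _ = _ := by ring
      beta_reduce
      rw [abs_of_pos hy]
      have b3 : 0 ≤ C * ‖g y‖ := by positivity
      nlinarith
    · have hζ : ‖(-2 * Complex.I * ((1 + z⁻¹ * z⁻¹) / 2 : ℝ) * y : ℂ)‖ ≤ 2 * y := by
        have h2 := mul_self_nonneg z⁻¹
        have e1 : z⁻¹ * z⁻¹ ≤ 1 := by
          rw [← abs_mul_abs_self, abs_inv]
          exact mul_le_one₀ hzi hzi0.le hzi
        rw [norm_mul, norm_mul, norm_mul, norm_neg, Complex.norm_I, mul_one, Complex.norm_real,
          Complex.norm_real, Real.norm_of_nonneg hy.le, Real.norm_of_nonneg (by positivity)]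
        gcongr
        rw [RCLike.norm_ofNat]
        linarith
      have b1 : ‖g y * gaugedCompDeriv H.toDecay z y‖ ≤ ‖g y‖ * (C * |z|⁻¹) := by
        rw [norm_mul]
        gcongr
      have b2 : ‖-Complex.I * ((z : ℂ)⁻¹) ^ 2 * (excess q y * q y) * gaugedComp H.toDecay z y‖ ≤
          |z|⁻¹ * (E * P * Q) * C := by
        rw [norm_mul, norm_mul, norm_mul, norm_neg, Complex.norm_I, one_mul, norm_pow, hzn]
        have h2 : |z|⁻¹ ^ 2 ≤ |z|⁻¹ := pow_le_of_le_one hzi0.le hzi (by norm_num)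
        gcongr
      have b3 : ‖Complex.I * (z : ℂ)⁻¹ * (excess q y * q y) * gaugedCompDeriv H.toDecay z y‖ ≤
          |z|⁻¹ * (E * P * Q) * C := by
        rw [norm_mul, norm_mul, norm_mul, Complex.norm_I, one_mul, hzn]
        have : C * |z|⁻¹ ≤ C := mul_le_of_le_one_right hC0 hzi
        gcongr
        linarith
      rw [gaugedRestDeriv, norm_mul, norm_exp_two_I, one_mul]
      refine (norm_add_le _ _).trans ?_
      have d1 := mul_le_mul hζ a3 (norm_nonneg _) (by positivity)
      rw [← norm_mul] at d1
      refine (add_le_add d1 ((norm_add_le _ _).trans (add_le_add b1 ((norm_add_le _ _).trans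
        (add_le_add b2 b3))))).trans ?_
      beta_reduce
      rw [abs_of_pos hy]
      have b4 : 0 ≤ C * τ 0 * ‖g y‖ := by
        have := hτ0.trans hτ1
        positivity
      have : 2 * y * (‖g y‖ * (C * |z|⁻¹ * τ y) + |z|⁻¹ * (E * P * Q) * C) +
          (‖g y‖ * (C * |z|⁻¹) + (|z|⁻¹ * (E * P * Q) * C + |z|⁻¹ * (E * P * Q) * C)) =
          |z|⁻¹ * (2 * (C * (y * ‖g y‖ * τ y)) + C * ‖g y‖ + 2 * (Q * E * C * (y * P)) +
            2 * (Q * E * C * P)) := by ring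
      rw [this]
      refine mul_le_mul_of_nonneg_left ?_ hzi0.le
      nlinarith

/-- Differentiate the gauged identity at x = 0: the leading term is ζ'(z) times the derivative of
the transform of q', with ζ' ≤ 1, and the rest is O(1/z). Undoing the gauge costs a term of size
O(|z|)·O(z⁻²). -/
theorem EnergyPot.exists_deriv_outer_bound (H : EnergyPot q g) (hM : MomentReg 0 q) :
    ∃ C, ∀ z ∈ outer,
      ‖jostComp H.toDecay z 1 0 + z * jostCompDeriv H.toDecay z 1 0 -
        q 0 * jostCompDeriv H.toDecay z 0 0‖ ≤
      ‖deriv (halfFT g) (spectralZeta z)‖ + C * |z|⁻¹ := by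
  obtain ⟨b, hb, hbz⟩ := H.exists_gaugedRest_bounds hM
  obtain ⟨D, hD0, hD⟩ := exists_norm_jostM_le (H.toDecay.moment 0)
  set S := tailMass q g 0 with hS
  have hS0 : 0 ≤ S := tailMass_nonneg q g 0
  refine ⟨(∫ y in Set.Ioi 0, b y) + S * (D + ‖q 0‖ * D), fun z hz => ?_⟩
  have hz2 : 2 < |z| := hz
  have hz0 : 0 < |z| := by linarith
  have hz0' : z ≠ 0 := ne_zero_of_quarter_le (by linarith)
  have hzi : |z|⁻¹ ≤ 1 := inv_le_one_of_one_le₀ (by linarith)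
  have hzi0 : 0 < |z|⁻¹ := inv_pos.2 hz0
  set Ω : ℝ → ℂ := fun z => z * jostComp H.toDecay z 1 0 - q 0 * jostComp H.toDecay z 0 0 with hΩ
  set Ω' := jostComp H.toDecay z 1 0 + z * jostCompDeriv H.toDecay z 1 0 -
        q 0 * jostCompDeriv H.toDecay z 0 0 with hΩ'
  have hid : HasDerivAt (fun w : ℝ => (w : ℂ)) 1 z := (hasDerivAt_id z).ofReal_comp
  have hdΩ : HasDerivAt Ω Ω' z := by
    refine ((hid.mul (hasDerivAt_jostComp_param hM hz2.le 1 0)).sub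
      ((hasDerivAt_jostComp_param hM hz2.le 0 0).const_mul (q 0))).congr_deriv ?_
    rw [hΩ', one_mul]
  have hmeas : ∀ w, AEStronglyMeasurable (gaugedRest H.toDecay g w) (volume.restrict (Set.Ioi 0)) := by
    intro w
    have hc := H.continuous
    have hc' : Continuous fun x => conj (q x) := Complex.continuous_conj.comp hc
    have hcx : Continuous (excess q) := by unfold excess; fun_prop
    have h1 := continuous_gaugedComp H.toDecay w
    refine AEStronglyMeasurable.mul (Continuous.aestronglyMeasurable (by fun_prop))
      ((H.integrableOn_deriv.1.mul (Continuous.aestronglyMeasurable (by fun_prop))).add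
      (Continuous.aestronglyMeasurable (by fun_prop)))
  have hmeas' : AEStronglyMeasurable (gaugedRestDeriv H.toDecay g z) (volume.restrict (Set.Ioi 0)) := by
    have hc := H.continuous
    have hc' : Continuous fun x => conj (q x) := Complex.continuous_conj.comp hc
    have hcx : Continuous (excess q) := by unfold excess; fun_prop
    have h1 := continuous_gaugedComp H.toDecay z
    have h2 := continuous_gaugedCompDeriv H.toDecay z
    have hgm := H.integrableOn_deriv.1
    refine AEStronglyMeasurable.mul (Continuous.aestronglyMeasurable (by fun_prop))
      (AEStronglyMeasurable.add (AEStronglyMeasurable.mul (Continuous.aestronglyMeasurable (by fun_prop))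
        ((hgm.mul (Continuous.aestronglyMeasurable (by fun_prop))).add
          (Continuous.aestronglyMeasurable (by fun_prop))))
        ((hgm.mul (Continuous.aestronglyMeasurable (by fun_prop))).add
          (Continuous.aestronglyMeasurable (by fun_prop))))
  have hint : ∀ w ∈ outer, IntegrableOn (gaugedRest H.toDecay g w) (Set.Ioi 0) := by
    intro w hw
    refine Integrable.mono' hb (hmeas w) ?_
    filter_upwards [ae_restrict_mem measurableSet_Ioi] with y hy
    exact (hbz w hw y hy).1
  -- The majorant b is independent of z in the outer region, where 1/|z| ≤ 1.
  have hdR := (hasDerivAt_integral_of_dominated_loc_of_deriv_le (bound := b)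
    (μ := volume.restrict (Set.Ioi 0)) (F := gaugedRest H.toDecay g) (F' := gaugedRestDeriv H.toDecay g)
    (isOpen_outer.mem_nhds hz) (Eventually.of_forall hmeas) (hint z hz) hmeas' (by
      filter_upwards [ae_restrict_mem measurableSet_Ioi] with y hy w hw
      have hw2 : 2 < |w| := hw
      have h1 := hbz w hw y hy
      exact h1.2.trans (mul_le_of_le_one_left ((norm_nonneg _).trans h1.1)
        (inv_le_one_of_one_le₀ (by linarith)))) hb
    (Eventually.of_forall fun y w hw => hasDerivAt_gaugedRest hM (le_of_lt hw) y)).2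
  set R' := ∫ y in Set.Ioi 0, gaugedRestDeriv H.toDecay g z y with hR'
  have nR' : ‖R'‖ ≤ |z|⁻¹ * ∫ y in Set.Ioi 0, b y := by
    rw [← integral_const_mul]
    refine norm_integral_le_of_norm_le (hb.const_mul _) ?_
    filter_upwards [ae_restrict_mem measurableSet_Ioi] with y hy
    exact (hbz z hz y hy).2
  have heq : ∀ w ∈ outer, Ω w * gauge q w 0 =
      halfFT g (spectralZeta w) + ∫ y in Set.Ioi 0, gaugedRest H.toDecay g w y := by
    intro w hw
    have hw2 : 2 < |w| := hw
    have ib : IntegrableOn (fun y : ℝ => Complex.exp (-2 * Complex.I * spectralZeta w * y) * g y)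
        (Set.Ioi 0) :=
      Integrable.bdd_mul (c := 1) H.integrableOn_deriv (Continuous.aestronglyMeasurable (by fun_prop))
        (Eventually.of_forall fun y => (norm_exp_two_I _ _).le)
    rw [hΩ, H.gauged_identity (by linarith), halfFT, ← integral_add ib (hint w hw)]
    refine integral_congr_ae (Eventually.of_forall fun y => ?_)
    simp only [gaugedRest, gaugedComp]
    ring
  have hdL := (H.differentiable_halfFT (spectralZeta z)).hasDerivAt.scomp z (hasDerivAt_spectralZeta hz0')
  have h1 := (hdL.add hdR).congr_of_eventuallyEq (f₁ := fun w => Ω w * gauge q w 0)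
    ((isOpen_outer.mem_nhds hz : outer ∈ 𝓝 z) |> fun h => by filter_upwards [h] with w hw; exact heq w hw)
  have h2 := (hdΩ.mul (hasDerivAt_gauge_param q hz0' 0)).unique h1
  have h3 : Ω' * gauge q z 0 = ((1 + z⁻¹ * z⁻¹) / 2) • deriv (halfFT g) (spectralZeta z) + R' -
      Ω z * (Complex.I * tailPhase q 0 * ((z : ℂ)⁻¹) ^ 2 * gauge q z 0) := by
    rw [← h2]
    ring
  have h4 : ‖Ω'‖ = ‖Ω' * gauge q z 0‖ := by rw [norm_mul, norm_gauge, mul_one]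
  have nΩ : ‖Ω z‖ ≤ |z| * (D + ‖q 0‖ * D) := by
    have m := fun i => (norm_jostComp_le H.toDecay z i (le_refl 0)).trans (hD z (by linarith))
    refine (norm_sub_le _ _).trans ?_
    rw [norm_mul, norm_mul, Complex.norm_real, Real.norm_eq_abs]
    have m0 := m 0
    have m1 := m 1
    have e1 : |z| * ‖jostComp H.toDecay z 1 0‖ ≤ |z| * D := by gcongr
    have e2 : ‖q 0‖ * ‖jostComp H.toDecay z 0 0‖ ≤ |z| * (‖q 0‖ * D) :=
      (mul_le_mul_of_nonneg_left m0 (norm_nonneg _)).trans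
        (le_mul_of_one_le_left (by positivity) (by linarith))
    linarith
  have n1 : ‖((1 + z⁻¹ * z⁻¹) / 2) • deriv (halfFT g) (spectralZeta z)‖ ≤
      ‖deriv (halfFT g) (spectralZeta z)‖ := by
    refine norm_smul_mul_le ?_
    have e1 : z⁻¹ * z⁻¹ ≤ 1 := by
      rw [← abs_mul_abs_self, abs_inv]
      exact mul_le_one₀ hzi hzi0.le hzi
    have h2 := mul_self_nonneg z⁻¹
    rw [abs_of_nonneg (by positivity)]
    linarith
  have n2 : ‖Ω z * (Complex.I * tailPhase q 0 * ((z : ℂ)⁻¹) ^ 2 * gauge q z 0)‖ ≤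
      S * (D + ‖q 0‖ * D) * |z|⁻¹ := by
    rw [norm_mul, norm_mul, norm_gauge, mul_one, norm_mul, norm_mul, Complex.norm_I, one_mul, norm_pow,
      norm_inv, Complex.norm_real, Complex.norm_real, Real.norm_eq_abs, Real.norm_eq_abs]
    have hτ := H.abs_tailPhase_le (le_refl 0)
    calc ‖Ω z‖ * (|tailPhase q 0| * |z|⁻¹ ^ 2) ≤ |z| * (D + ‖q 0‖ * D) * (S * |z|⁻¹ ^ 2) := by gcongr
      _ = _ := by field_simp
  rw [h4, h3]
  refine (norm_sub_le _ _).trans ?_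
  have n3 := norm_add_le (((1 + z⁻¹ * z⁻¹) / 2) • deriv (halfFT g) (spectralZeta z)) R'
  linarith

end

/-! ### The reflection coefficient in the outer region -/

/-- The quotient of the two determinants, the reflection coefficient off `z = ±1`. -/
def detQuot (q : ℝ → ℂ) (z : ℝ) : ℂ := detB q z / detA q z

theorem EnergyPot.exists_component_bounds {q g : ℝ → ℂ} (H : EnergyPot q g) (hM : MomentReg 0 q) :
    ∃ D : ℝ, 0 ≤ D ∧ ∃ b : ℝ → ℝ, MemLp b 2 (volume.restrict outer) ∧ ∀ z ∈ outer,
      (∀ i, ‖jostComp H.toDecay z i 0‖ ≤ D) ∧ (∀ i, ‖jostCompDeriv H.toDecay z i 0‖ ≤ D) ∧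
      ‖z * jostComp H.toDecay z 1 0 - q 0 * jostComp H.toDecay z 0 0‖ ≤ b z ∧
      ‖jostComp H.toDecay z 1 0 + z * jostCompDeriv H.toDecay z 1 0 -
        q 0 * jostCompDeriv H.toDecay z 0 0‖ ≤ b z := by
  obtain ⟨D, hD0, hD⟩ := exists_norm_jostM_le (H.toDecay.moment 0)
  obtain ⟨A, hA0, hA⟩ := exists_norm_deriv_jostM_le (H.toDecay.moment 0) hM.memLp
  obtain ⟨B, hB⟩ := H.exists_outer_bound
  obtain ⟨C, hC⟩ := H.exists_deriv_outer_bound hM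
  have m1 := (memLp_halfFT H.integrableOn_deriv H.memLp_deriv).norm
  have m2 := H.memLp_deriv_halfFT.norm
  refine ⟨D + A, by positivity, fun z => (‖halfFT g (spectralZeta z)‖ +
    ‖deriv (halfFT g) (spectralZeta z)‖) + (|B| + |C|) * |z|⁻¹,
    (m1.add m2).add (memLp_inv_outer.const_mul _), fun z hz => ?_⟩
  have hz2 : 2 < |z| := hz
  have hzi : 0 ≤ |z|⁻¹ := by positivity
  have n1 := norm_nonneg (halfFT g (spectralZeta z))
  have n2 := norm_nonneg (deriv (halfFT g) (spectralZeta z))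
  have a1 := mul_le_mul_of_nonneg_right (le_abs_self B) hzi
  have a2 := mul_le_mul_of_nonneg_right (le_abs_self C) hzi
  have a5 := mul_nonneg (abs_nonneg B) hzi
  have a6 := mul_nonneg (abs_nonneg C) hzi
  have hBz := hB z hz
  have hCz := hC z hz
  refine ⟨fun i => ?_, fun i => ?_, ?_, ?_⟩
  · have := (norm_jostComp_le H.toDecay z i (le_refl 0)).trans (hD z (by linarith))
    linarith
  · have := (norm_jostCompDeriv_le H.toDecay z i (le_refl 0)).trans (hA z hz2.le)
    linarith
  · beta_reduce
    rw [add_mul]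
    linarith
  · beta_reduce
    rw [add_mul]
    linarith

theorem norm_mul_le_of_le {a b : ℂ} {α β : ℝ} (ha : ‖a‖ ≤ α) (hb : ‖b‖ ≤ β) : ‖a * b‖ ≤ α * β := by
  rw [norm_mul]
  exact mul_le_mul ha hb (norm_nonneg _) ((norm_nonneg _).trans ha)

/-- The determinant identity gives |det_A| ≥ |1 - z⁻²| ≥ 3/4 in this range, with no genericity. -/
theorem norm_detA_ge {q : ℝ → ℂ} (hq : Decay q) (hr : Decay (reflectPot q)) {z : ℝ} (hz : 2 ≤ |z|) :
    1 / 2 ≤ ‖detA q z‖ := by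
  have h1 := normSq_detA_sub hq hr (by linarith : 1 / 4 ≤ |z|)
  rw [Complex.normSq_eq_norm_sq, Complex.normSq_eq_norm_sq] at h1
  have h2 : (z ^ 2)⁻¹ ≤ 1 / 4 := by
    rw [inv_le_comm₀ (by nlinarith [sq_abs z]) (by norm_num)]
    nlinarith [sq_abs z]
  have h3 : 0 ≤ ‖detA q z‖ := norm_nonneg _
  nlinarith [sq_nonneg ‖detB q z‖]

/-- The reflected potential has value -conj q(0) at the origin, so z det_B can be rewritten with zm₁
- qm₀ and its reflected analogue, the terms in q(0) cancelling. Each product then pairs a bounded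
factor with one in L², and so does each product in the z-derivative. -/
theorem exists_outer_bounds {q g g' : ℝ → ℂ} (H : EnergyPot q g) (H' : EnergyPot (reflectPot q) g')
    (hM : MomentReg 0 q) (hM' : MomentReg 0 (reflectPot q)) :
    ∃ b : ℝ → ℝ, MemLp b 2 (volume.restrict outer) ∧ ∀ z ∈ outer,
      |z| * ‖detQuot q z‖ ≤ b z ∧ |z| * ‖deriv (detQuot q) z‖ ≤ b z := by
  obtain ⟨D, hD0, b, hb, hbz⟩ := H.exists_component_bounds hM
  obtain ⟨D', hD0', b', hb', hbz'⟩ := H'.exists_component_bounds hM'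
  set K := D + D' with hK
  have hK0 : 0 ≤ K := by positivity
  refine ⟨fun z => (6 * K + 16 * K ^ 3) * (b z + b' z), (hb.add hb').const_mul _, fun z hz => ?_⟩
  have hz2 : 2 < |z| := hz
  have hzC : (z : ℂ) ≠ 0 := by simpa using ne_zero_of_quarter_le (by linarith : 1 / 4 ≤ |z|)
  have hzn : ‖(z : ℂ)‖ = |z| := Complex.norm_real z
  obtain ⟨f1, f2, f3, f4⟩ := hbz z hz
  obtain ⟨k1, k2, k3, k4⟩ := hbz' z hz
  have hβ0 : 0 ≤ b z := (norm_nonneg _).trans f3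
  have hβ0' : 0 ≤ b' z := (norm_nonneg _).trans k3
  set β := b z + b' z with hβ
  have hA : 1 / 2 ≤ ‖detA q z‖ := norm_detA_ge H.toDecay H'.toDecay hz2.le
  have hAi : ‖(detA q z)⁻¹‖ ≤ 2 := by
    rw [norm_inv, inv_le_comm₀ (by linarith) (by norm_num)]
    linarith
  have hA0 : detA q z ≠ 0 := norm_pos_iff.1 (by linarith)
  have hq0 : reflectPot q 0 = -conj (q 0) := by simp [reflectPot]
  have eB : ∀ w : ℝ, 1 / 4 ≤ |w| → w * detB q w =
      -(jostComp H.toDecay w 0 0 * conj (w * jostComp H'.toDecay w 1 0 -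
          reflectPot q 0 * jostComp H'.toDecay w 0 0) +
        (w * jostComp H.toDecay w 1 0 - q 0 * jostComp H.toDecay w 0 0) *
          conj (jostComp H'.toDecay w 0 0)) := by
    intro w hw
    have e1 : detB q w = -(jostComp H.toDecay w 0 0 * conj (jostComp H'.toDecay w 1 0) +
        jostComp H.toDecay w 1 0 * conj (jostComp H'.toDecay w 0 0)) :=
      detB_eq H.toDecay H'.toDecay hw
    rw [e1, hq0]
    simp only [map_sub, map_mul, map_neg, Complex.conj_ofReal, Complex.conj_conj]
    ring
  have eA : ∀ w : ℝ, 1 / 4 ≤ |w| → detA q w =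
      conj (jostComp H.toDecay w 0 0 * jostComp H'.toDecay w 0 0 +
        jostComp H.toDecay w 1 0 * jostComp H'.toDecay w 1 0) := fun w hw =>
    detA_eq H.toDecay H'.toDecay hw
  have hev : ∀ᶠ w in 𝓝 z, 1 / 4 ≤ |w| := by
    filter_upwards [isOpen_outer.mem_nhds hz] with w hw
    have : 2 < |w| := hw
    linarith
  have kc : ‖conj (jostComp hM'.toDecay z 0 0)‖ ≤ D' := by
    rw [RCLike.norm_conj]; exact k1 0
  have kd : ‖conj (jostCompDeriv hM'.toDecay z 0 0)‖ ≤ D' := by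
    rw [RCLike.norm_conj]; exact k2 0
  have c3 : K * β = D * b z + D * b' z + D' * b z + D' * b' z := by rw [hK, hβ]; ring
  have hzB : ‖(z : ℂ) * detB q z‖ ≤ K * β := by
    rw [eB z (by linarith), norm_neg]
    refine (norm_add_le _ _).trans ?_
    have c1 := norm_mul_le_of_le (f1 0) ((RCLike.norm_conj _).trans_le k3)
    have c2 := norm_mul_le_of_le f3 kc
    nlinarith [mul_nonneg hD0 hβ0, mul_nonneg hD0' hβ0']
  have hKβ : 0 ≤ K * β := (norm_nonneg _).trans hzB
  have hK3β : 0 ≤ K ^ 3 * β := by positivity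
  have hQ : |z| * ‖detQuot q z‖ ≤ 2 * (K * β) := by
    rw [detQuot, div_eq_mul_inv, ← hzn, ← norm_mul, ← mul_assoc]
    exact (norm_mul_le_of_le hzB hAi).trans_eq (mul_comm _ _)
  refine ⟨hQ.trans (by nlinarith), ?_⟩
  have hid : HasDerivAt (fun w : ℝ => (w : ℂ)) 1 z := (hasDerivAt_id z).ofReal_comp
  have dF0 := hasDerivAt_jostComp_param hM hz2.le 0 0
  have dF1 := hasDerivAt_jostComp_param hM hz2.le 1 0
  have dG0 := hasDerivAt_jostComp_param hM' hz2.le 0 0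
  have dG1 := hasDerivAt_jostComp_param hM' hz2.le 1 0
  have dΩ := (hid.mul dF1).sub (dF0.const_mul (q 0))
  have dΩ' := (hid.mul dG1).sub (dG0.const_mul (reflectPot q 0))
  simp only [one_mul] at dΩ dΩ'
  have dB := (((dF0.mul (hasDerivAt_conj dΩ')).add
    (dΩ.mul (hasDerivAt_conj dG0))).neg).congr_of_eventuallyEq
    (f₁ := fun w => w * detB q w) (hev.mono fun w hw => eB w hw)
  have dA := (hasDerivAt_conj ((dF0.mul dG0).add (dF1.mul dG1))).congr_of_eventuallyEq
    (f₁ := detA q) (hev.mono fun w hw => eA w hw)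
  obtain ⟨B', hB', nB⟩ : ∃ B', HasDerivAt (fun w : ℝ => w * detB q w) B' z ∧ ‖B'‖ ≤ 2 * (K * β) := by
    refine ⟨_, dB, ?_⟩
    rw [norm_neg]
    have d1 := norm_mul_le_of_le (f2 0) ((RCLike.norm_conj _).trans_le k3)
    have d2 := norm_mul_le_of_le (f1 0) ((RCLike.norm_conj _).trans_le k4)
    have d3 := norm_mul_le_of_le f4 kc
    have d4 := norm_mul_le_of_le f3 kd
    refine (norm_add_le _ _).trans ((add_le_add (norm_add_le _ _) (norm_add_le _ _)).trans
      ((add_le_add (add_le_add d1 d2) (add_le_add d3 d4)).trans ?_))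
    nlinarith [mul_nonneg hD0 hβ0, mul_nonneg hD0' hβ0']
  obtain ⟨A', hA', nA⟩ : ∃ A', HasDerivAt (detA q) A' z ∧ ‖A'‖ ≤ 4 * K ^ 2 := by
    refine ⟨_, dA, ?_⟩
    rw [RCLike.norm_conj]
    have d1 := norm_mul_le_of_le (f2 0) (k1 0)
    have d2 := norm_mul_le_of_le (f1 0) (k2 0)
    have d3 := norm_mul_le_of_le (f2 1) (k1 1)
    have d4 := norm_mul_le_of_le (f1 1) (k2 1)
    refine (norm_add_le _ _).trans ((add_le_add (norm_add_le _ _) (norm_add_le _ _)).trans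
      ((add_le_add (add_le_add d1 d2) (add_le_add d3 d4)).trans ?_))
    have : K ^ 2 = D ^ 2 + 2 * (D * D') + D' ^ 2 := by rw [hK]; ring
    nlinarith [mul_nonneg hD0 hD0', sq_nonneg D, sq_nonneg D']
  -- It is zr whose derivative is controlled; zr' is then recovered as (zr)' - r.
  have dZQ : HasDerivAt (fun w : ℝ => w * detQuot q w)
      ((B' * detA q z - z * detB q z * A') / detA q z ^ 2) z :=
    (hB'.div hA' hA0).congr_of_eventuallyEq (Eventually.of_forall fun w => by
      simp only [detQuot, Pi.div_apply]
      ring)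
  have hinv : HasDerivAt (fun w : ℝ => (w : ℂ)⁻¹) (-1 / (z : ℂ) ^ 2) z := hid.inv hzC
  have dQ : HasDerivAt (detQuot q) (deriv (detQuot q) z) z := by
    refine ((hinv.mul dZQ).congr_of_eventuallyEq (f₁ := detQuot q) ?_).differentiableAt.hasDerivAt
    filter_upwards [hev] with w hw
    have : (w : ℂ) ≠ 0 := by simpa using ne_zero_of_quarter_le hw
    simp only [Pi.mul_apply]
    field_simp
  have e1 := (hid.mul dQ).unique dZQ
  have e2 : (z : ℂ) * deriv (detQuot q) z = B' * (detA q z)⁻¹ -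
      z * detB q z * A' * ((detA q z)⁻¹ * (detA q z)⁻¹) - detQuot q z := by
    have e3 : (B' * detA q z - z * detB q z * A') / detA q z ^ 2 =
        B' * (detA q z)⁻¹ - z * detB q z * A' * ((detA q z)⁻¹ * (detA q z)⁻¹) := by
      field_simp
    rw [← e3, ← e1]
    ring
  rw [← hzn, ← norm_mul, e2]
  have d1 := norm_mul_le_of_le nB hAi
  have d2 := norm_mul_le_of_le (norm_mul_le_of_le hzB nA) (norm_mul_le_of_le hAi hAi)
  have d3 : ‖detQuot q z‖ ≤ 2 * (K * β) :=
    (le_mul_of_one_le_left (norm_nonneg _) (by linarith)).trans hQ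
  refine (norm_sub_le _ _).trans ((add_le_add ((norm_sub_le _ _).trans (add_le_add d1 d2)) d3).trans_eq ?_)
  ring

/-- L² bounds alone would not give continuity of r at z = 0; this pointwise decay at infinity does,
after inversion. -/
theorem exists_detQuot_le {q g g' : ℝ → ℂ} (H : EnergyPot q g) (H' : EnergyPot (reflectPot q) g') :
    ∃ C, ∀ z ∈ outer, ‖detQuot q z‖ ≤ C * |z|⁻¹ := by
  obtain ⟨D, hD0, hD⟩ := exists_norm_jostM_le (H.toDecay.moment 0)
  obtain ⟨D', hD0', hD'⟩ := exists_norm_jostM_le (H'.toDecay.moment 0)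
  obtain ⟨A, hA0, hA⟩ := H.exists_asymptotics
  obtain ⟨A', hA0', hA'⟩ := H'.exists_asymptotics
  refine ⟨(D * A' + A * D') * 2, fun z hz => ?_⟩
  have hz2 : 2 < |z| := hz
  have hA1 : 1 / 2 ≤ ‖detA q z‖ := norm_detA_ge H.toDecay H'.toDecay hz2.le
  have hAi : ‖(detA q z)⁻¹‖ ≤ 2 := by
    rw [norm_inv, inv_le_comm₀ (by linarith) (by norm_num)]
    linarith
  have e1 : detB q z = -(jostComp H.toDecay z 0 0 * conj (jostComp H'.toDecay z 1 0) +
      jostComp H.toDecay z 1 0 * conj (jostComp H'.toDecay z 0 0)) :=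
    detB_eq H.toDecay H'.toDecay (by linarith)
  have m := (norm_jostComp_le H.toDecay z 0 (le_refl 0)).trans (hD z (by linarith))
  have m' := (norm_jostComp_le H'.toDecay z 0 (le_refl 0)).trans (hD' z (by linarith))
  have c1 := norm_mul_le_of_le m ((RCLike.norm_conj _).trans_le (hA' z hz2.le 0 le_rfl).2)
  have c2 := norm_mul_le_of_le (hA z hz2.le 0 le_rfl).2 ((RCLike.norm_conj _).trans_le m')
  have hB : ‖detB q z‖ ≤ D * (A' / |z|) + A / |z| * D' := by
    rw [e1, norm_neg]
    exact (norm_add_le _ _).trans (add_le_add c1 c2)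
  rw [detQuot, div_eq_mul_inv]
  refine (norm_mul_le_of_le hB hAi).trans_eq ?_
  rw [div_eq_mul_inv, div_eq_mul_inv]
  ring

/-! ### Potentials in the weighted energy space -/

/-- Continuous representatives of the elements of the weighted energy space. -/
structure EnergyRep (m : ℕ) (q g : ℝ → ℂ) : Prop where
  continuous : Continuous q
  intervalIntegrable : ∀ a b, IntervalIntegrable g volume a b
  eq_primitive : ∀ a x, q x = q a + ∫ t in a..x, g t
  memL2 : MemL2Weighted m (fun x => q x - (Real.tanh x : ℂ))
  memL2_deriv : MemL2Weighted 1 g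

theorem MemWeightedEnergy.exists_rep {m : ℕ} {q : ℝ → ℂ} (h : MemWeightedEnergy m 1 1 q) :
    ∃ q' g, q =ᵐ[volume] q' ∧ EnergyRep m q' g := by
  obtain ⟨h1, g, hg, hg2⟩ := h
  obtain ⟨c, hc⟩ := exists_ae_eq_primitive hg
  have hgl := hg.2.1
  rw [locallyIntegrableOn_univ] at hgl
  have hgi : ∀ a b, IntervalIntegrable g volume a b := fun a b =>
    (intervalIntegrable_iff').2 (hgl.integrableOn_isCompact isCompact_uIcc)
  refine ⟨_, g, hc, continuous_const.add (intervalIntegral.continuous_primitive hgi 0), hgi, ?_, ?_,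
    hg2⟩
  · intro a x
    rw [add_assoc, intervalIntegral.integral_add_adjacent_intervals (hgi 0 a) (hgi a x)]
  · refine MemLp.ae_eq ?_ h1
    filter_upwards [hc] with x hx
    rw [hx]

theorem MemL2Weighted.aestronglyMeasurable {n : ℕ} {f : ℝ → ℂ} (hf : MemL2Weighted n f) :
    AEStronglyMeasurable f volume := by
  have hc : Continuous fun x : ℝ => ((1 + |x|) ^ n)⁻¹ :=
    Continuous.inv₀ (by fun_prop) fun x => by positivity
  refine (hc.aestronglyMeasurable.smul hf.1).congr (Eventually.of_forall fun x => ?_)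
  have hx : (1 + |x|) ^ n ≠ 0 := by positivity
  simp only [Pi.smul_apply', smul_smul, inv_mul_cancel₀ hx, one_smul]

/-- The function tanh is odd and real, so the reflection of q differs from tanh by the reflection of
q - tanh up to sign and conjugation. -/
theorem EnergyRep.reflect {m : ℕ} {q g : ℝ → ℂ} (h : EnergyRep m q g) :
    EnergyRep m (reflectPot q) (fun x => conj (g (-x))) := by
  have hneg : ∀ {n : ℕ} {f f' : ℝ → ℂ}, MemL2Weighted n f → (∀ x, ‖f' x‖ = ‖f (-x)‖) →
      (AEStronglyMeasurable f volume → AEStronglyMeasurable f' volume) → MemL2Weighted n f' := by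
    intro n f f' hf hff hm
    have h1 := hf.comp_measurePreserving (Measure.measurePreserving_neg (volume : Measure ℝ))
    have hc : Continuous fun x : ℝ => (1 + |x|) ^ n := by fun_prop
    refine h1.mono (hc.aestronglyMeasurable.smul (hm hf.aestronglyMeasurable))
      (Eventually.of_forall fun x => ?_)
    simp only [Function.comp_apply, norm_smul, hff, abs_neg]
    exact le_rfl
  have hmeas : ∀ {f : ℝ → ℂ}, AEStronglyMeasurable f volume →
      AEStronglyMeasurable (fun x => conj (f (-x))) volume := fun hf =>
    Complex.continuous_conj.comp_aestronglyMeasurable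
      (hf.comp_measurePreserving (Measure.measurePreserving_neg (volume : Measure ℝ)))
  refine ⟨continuous_reflectPot h.continuous, fun a b => ?_, fun a x => ?_, ?_, ?_⟩
  · have h1 := (IntervalIntegrable.iff_comp_neg (by simp)).1 (h.intervalIntegrable (-a) (-b))
    simp only [neg_neg] at h1
    exact intervalIntegrable_iff.2 (integrableOn_conj (intervalIntegrable_iff.1 h1))
  · have h1 := h.eq_primitive (-a) (-x)
    have h2 : ∫ t in a..x, conj (g (-t)) = conj (∫ t in a..x, g (-t)) := by
      rw [intervalIntegral, intervalIntegral, map_sub, integral_conj, integral_conj]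
    rw [reflectPot, reflectPot, h1, h2, intervalIntegral.integral_comp_neg,
      intervalIntegral.integral_symm (-x) (-a), map_add, map_neg]
    ring
  · refine hneg h.memL2 (fun x => ?_) fun hf => ?_
    · rw [← RCLike.norm_conj, ← norm_neg]
      simp only [reflectPot, Real.tanh_neg, map_sub, map_neg, Complex.conj_conj, Complex.conj_ofReal,
        Complex.ofReal_neg]
      congr 1
      ring
    · have := (hmeas hf).neg
      refine this.congr (Eventually.of_forall fun x => ?_)
      simp only [Pi.neg_apply, reflectPot, Real.tanh_neg, map_sub, map_neg, Complex.conj_ofReal,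
        Complex.ofReal_neg]
      ring
  · exact hneg h.memL2_deriv (fun x => RCLike.norm_conj _) hmeas

theorem abs_tanh_sub_one_le (x : ℝ) : |Real.tanh x - 1| ≤ 2 * Real.exp (-(2 * x)) := by
  have h1 : 0 < Real.exp x := Real.exp_pos x
  have h2 : 0 < Real.exp (-x) := Real.exp_pos (-x)
  have h3 : Real.tanh x - 1 = -(2 * Real.exp (-x) / (Real.exp x + Real.exp (-x))) := by
    rw [Real.tanh_eq_sinh_div_cosh, Real.sinh_eq, Real.cosh_eq]
    field_simp
    ring
  rw [h3, abs_neg, abs_of_nonneg (by positivity), show -(2 * x) = -x + -x by ring, Real.exp_add,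
    div_le_iff₀ (by positivity)]
  have h4 : Real.exp (-x) * Real.exp x = 1 := by rw [← Real.exp_add]; simp
  have h5 : 2 * (Real.exp (-x) * Real.exp (-x)) * (Real.exp x + Real.exp (-x)) =
      2 * Real.exp (-x) * (Real.exp (-x) * Real.exp x) + 2 * Real.exp (-x) ^ 3 := by ring
  rw [h5, h4]
  have := pow_pos h2 3
  linarith

theorem memLp_exp_neg : MemLp (fun y : ℝ => Real.exp (-y)) 2 (volume.restrict (Set.Ioi 0)) := by
  rw [memLp_two_iff_integrable_sq (Continuous.aestronglyMeasurable (by fun_prop))]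
  have := exp_neg_integrableOn_Ioi 0 (show (0 : ℝ) < 2 by norm_num)
  refine this.congr (Eventually.of_forall fun y => ?_)
  simp only [← Real.exp_nat_mul]
  congr 1
  push_cast
  ring

theorem memLp_inv_one_add : MemLp (fun y : ℝ => (1 + |y|)⁻¹) 2 volume := by
  have hc : Continuous fun y : ℝ => (1 + |y|)⁻¹ :=
    Continuous.inv₀ (by fun_prop) fun y => by positivity
  rw [memLp_two_iff_integrable_sq hc.aestronglyMeasurable]
  have := integrable_one_add_norm (E := ℝ) (μ := volume) (r := 2) (by simp)
  refine this.congr (Eventually.of_forall fun y => ?_)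
  simp only [Real.norm_eq_abs]
  rw [Real.rpow_neg (by positivity), inv_pow]
  norm_cast

/-- On the positive half line tanh - 1 decays exponentially, so tanh may be replaced by 1 under any
polynomial weight. -/
theorem EnergyRep.memLp_sub_one {m : ℕ} {q g : ℝ → ℂ} (h : EnergyRep m q g) :
    MemLp (fun y : ℝ => (1 + |y|) ^ m * ‖q y - 1‖) 2 (volume.restrict (Set.Ioi 0)) := by
  have h1 := (h.memL2.restrict (Set.Ioi 0)).norm.add
    (memLp_exp_neg.const_mul (2 * m.factorial * Real.exp 1))
  have hc := h.continuous
  refine h1.mono (Continuous.aestronglyMeasurable (by fun_prop)) ?_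
  filter_upwards [ae_restrict_mem measurableSet_Ioi] with y hy
  have hy0 : 0 < y := hy
  -- The factorial comes from tᵐ/m! ≤ eᵗ at t = 1 + y. Against e^{-2y} this leaves the square
  -- integrable e^{-y}.
  have e1 : (1 + |y|) ^ m ≤ m.factorial * (Real.exp 1 * Real.exp y) := by
    rw [← Real.exp_add, abs_of_pos hy0]
    have := Real.pow_div_factorial_le_exp (1 + y) (by positivity) m
    rwa [div_le_iff₀ (by positivity), mul_comm] at this
  have e2 := abs_tanh_sub_one_le y
  have e3 : ‖(Real.tanh y : ℂ) - 1‖ ≤ 2 * Real.exp (-(2 * y)) := by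
    rw [← Complex.ofReal_one, ← Complex.ofReal_sub, Complex.norm_real]
    exact e2
  have e4 : ‖q y - 1‖ ≤ ‖q y - Real.tanh y‖ + 2 * Real.exp (-(2 * y)) := by
    have : q y - 1 = (q y - Real.tanh y) + ((Real.tanh y : ℂ) - 1) := by ring
    rw [this]
    exact (norm_add_le _ _).trans (add_le_add le_rfl e3)
  rw [Real.norm_of_nonneg (by positivity), Pi.add_apply, Real.norm_of_nonneg (by positivity), norm_smul,
    Real.norm_of_nonneg (by positivity)]
  calc (1 + |y|) ^ m * ‖q y - 1‖ ≤
        (1 + |y|) ^ m * (‖q y - Real.tanh y‖ + 2 * Real.exp (-(2 * y))) := by gcongr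
    _ ≤ (1 + |y|) ^ m * ‖q y - Real.tanh y‖ +
        m.factorial * (Real.exp 1 * Real.exp y) * (2 * Real.exp (-(2 * y))) := by
        rw [mul_add]
        gcongr
    _ = _ := by
        have e5 : Real.exp (-(2 * y)) = Real.exp (-y) * Real.exp (-y) := by
          rw [← Real.exp_add]
          congr 1
          ring
        have e6 : Real.exp y * Real.exp (-y) = 1 := by rw [← Real.exp_add]; simp
        rw [e5]
        linear_combination (2 * m.factorial * Real.exp 1 * Real.exp (-y)) * e6

/-- Cauchy–Schwarz with 1/(1 + |y|) in L² costs one power of the weight, which accounts for k + 2 in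
L² against k + 1 in L¹. -/
theorem EnergyRep.integrableOn {k : ℕ} {q g : ℝ → ℂ} (h : EnergyRep (k + 2) q g) :
    IntegrableOn (fun y : ℝ => (1 + |y|) ^ (k + 1) * ‖q y - 1‖) (Set.Ioi 0) := by
  refine (h.memLp_sub_one.integrable_mul (memLp_inv_one_add.restrict _)).congr
    (Eventually.of_forall fun y => ?_)
  have : (1 + |y|) ≠ 0 := by positivity
  simp only [Pi.mul_apply]
  field_simp
  ring

theorem EnergyRep.decay {k : ℕ} {q g : ℝ → ℂ} (h : EnergyRep (k + 2) q g) : Decay q := by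
  have hc := h.continuous
  refine ⟨hc, fun X => ?_⟩
  have h1 : IntegrableOn (fun y : ℝ => (1 + |y|) * ‖q y - 1‖) (Set.Ioi 0) := by
    refine Integrable.mono h.integrableOn (Continuous.aestronglyMeasurable (by fun_prop))
      (Eventually.of_forall fun y => ?_)
    rw [Real.norm_of_nonneg (by positivity), Real.norm_of_nonneg (by positivity)]
    gcongr
    exact le_self_pow₀ (by linarith [abs_nonneg y]) (by omega)
  -- For X < 0 the additional piece is compact, and continuity of q is enough there.
  have h2 : IntegrableOn (fun y : ℝ => (1 + |y|) * ‖q y - 1‖) (Set.Icc (min X 0) 0) :=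
    Continuous.integrableOn_Icc (by fun_prop)
  refine (h2.union h1).mono_set fun y hy => ?_
  rcases le_or_gt y 0 with h3 | h3
  · exact Or.inl ⟨(min_le_left _ _).trans (le_of_lt hy), h3⟩
  · exact Or.inr h3

theorem shiftPert_zero (q : ℝ → ℂ) (y : ℝ) : shiftPert q 0 y = q y - 1 := by
  rw [shiftPert, add_zero]

theorem EnergyRep.momentReg {k : ℕ} {q g : ℝ → ℂ} (h : EnergyRep (k + 2) q g) : MomentReg k q := by
  refine ⟨h.decay, moment_of_integrableOn _ ?_, ?_⟩
  · simp only [shiftPert_zero]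
    exact h.integrableOn
  · have hV := continuous_pertV (h.decay.continuous_shift 0)
    refine (h.memLp_sub_one.const_mul 2).mono (Continuous.aestronglyMeasurable (by fun_prop)) ?_
    filter_upwards [ae_restrict_mem measurableSet_Ioi] with y hy
    have hy0 : 0 < y := hy
    have h1 := norm_pertV_le (shiftPert q 0) y
    rw [shiftPert_zero] at h1
    rw [Real.norm_of_nonneg (by positivity), Real.norm_of_nonneg (by positivity), abs_of_pos hy0]
    calc y ^ (k + 2) * ‖pertV (shiftPert q 0) y‖ ≤ (1 + y) ^ (k + 2) * (2 * ‖q y - 1‖) := by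
          gcongr
          linarith
      _ = _ := by ring

theorem EnergyRep.energyPot {k : ℕ} {q g : ℝ → ℂ} (h : EnergyRep (k + 2) q g) : EnergyPot q g := by
  have hc := h.continuous
  have hw := h.memL2_deriv.restrict (Set.Ioi 0)
  have hgm : AEStronglyMeasurable g (volume.restrict (Set.Ioi 0)) :=
    h.memL2_deriv.aestronglyMeasurable.restrict
  refine ⟨h.decay, h.intervalIntegrable, h.eq_primitive, ?_, ?_, ?_, ?_⟩
  · have h1 := hw.norm.integrable_mul (memLp_inv_one_add.restrict (Set.Ioi 0))
    refine Integrable.mono h1 hgm (Eventually.of_forall fun y => ?_)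
    have : (1 + |y|) ≠ 0 := by positivity
    rw [Pi.mul_apply, norm_smul, pow_one, Real.norm_of_nonneg (show 0 ≤ 1 + |y| by positivity),
      Real.norm_of_nonneg (by positivity)]
    refine le_of_eq ?_
    field_simp
  · refine hw.mono hgm (Eventually.of_forall fun y => ?_)
    rw [norm_smul, pow_one, Real.norm_of_nonneg (by positivity)]
    exact le_mul_of_one_le_left (norm_nonneg _) (by linarith [abs_nonneg y])
  · refine h.memLp_sub_one.mono (Continuous.aestronglyMeasurable (by fun_prop))
      (Eventually.of_forall fun y => ?_)
    rw [norm_mul, Complex.norm_real, Real.norm_eq_abs, Real.norm_of_nonneg (by positivity)]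
    gcongr
    calc |y| ≤ 1 + |y| := by linarith
      _ ≤ _ := le_self_pow₀ (by linarith [abs_nonneg y]) (by omega)
  · refine hw.mono (Complex.continuous_ofReal.aestronglyMeasurable.mul hgm)
      (Eventually.of_forall fun y => ?_)
    rw [norm_mul, norm_smul, pow_one, Complex.norm_real, Real.norm_eq_abs,
      Real.norm_of_nonneg (by positivity)]
    gcongr
    linarith

/-! ### Functions invariant under inversion -/

theorem measurableSet_annulus : MeasurableSet annulus := isCompact_annulus.measurableSet

/-- The punctured disc |z| < 1/2 is the image of the outer region under inversion, with Jacobian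
w⁻². -/
theorem lintegral_le_regions (F : ℝ → ℝ≥0∞) :
    ∫⁻ z, F z ≤ (∫⁻ z in annulus, F z) + (∫⁻ z in outer, F z) +
      ∫⁻ w in outer, ENNReal.ofReal (w ^ 2)⁻¹ * F w⁻¹ := by
  have h1 : ∫⁻ w in (fun w : ℝ => w⁻¹) '' outer, F w =
      ∫⁻ w in outer, ENNReal.ofReal (w ^ 2)⁻¹ * F w⁻¹ := by
    rw [lintegral_image_eq_lintegral_abs_deriv_mul (f' := fun w => -(w ^ 2)⁻¹) measurableSet_outer
      (fun w hw => (hasDerivAt_inv (ne_zero_of_quarter_le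
        (by have : 2 < |w| := hw; linarith))).hasDerivWithinAt) inv_injective.injOn]
    refine lintegral_congr fun w => ?_
    rw [abs_neg, abs_of_nonneg (by positivity)]
  have h2 : ∀ᵐ z : ℝ, z ∈ annulus ∪ outer ∪ (fun w : ℝ => w⁻¹) '' outer := by
    have : ∀ᵐ z : ℝ, z ≠ 0 := by simp [ae_iff]
    filter_upwards [this] with z hz
    rcases lt_or_ge (|z|) (1 / 2) with h | h
    · refine Or.inr ⟨z⁻¹, ?_, inv_inv z⟩
      change 2 < |z⁻¹|
      rw [abs_inv, lt_inv_comm₀ (by norm_num) (abs_pos.2 hz)]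
      linarith
    · rcases le_or_gt (|z|) 2 with h' | h'
      · exact Or.inl (Or.inl ⟨h, h'⟩)
      · exact Or.inl (Or.inr h')
  rw [← h1, ← setLIntegral_univ F, ← setLIntegral_congr (eventuallyEq_univ.2 h2)]
  exact (lintegral_union_le _ _ _).trans (add_le_add (lintegral_union_le _ _ _) le_rfl)

theorem memLp_of_annulus_outer {f : ℝ → ℂ} (hm : Measurable f) {b b' : ℝ → ℝ}
    (hb : MemLp b 2 (volume.restrict annulus)) (hfb : ∀ᵐ z, z ∈ annulus → ‖f z‖ ≤ b z)
    (hb' : MemLp b' 2 (volume.restrict outer)) (hfb' : ∀ z ∈ outer, ‖f z‖ ≤ b' z)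
    (hfi : ∀ z ∈ outer, |z|⁻¹ * ‖f z⁻¹‖ ≤ b' z) : MemLp f 2 volume := by
  rw [memLp_two_iff_lintegral_sq hm.aestronglyMeasurable]
  rw [memLp_two_iff_lintegral_sq hb.1] at hb
  rw [memLp_two_iff_lintegral_sq hb'.1] at hb'
  refine (lintegral_le_regions _).trans_lt
    (ENNReal.add_lt_top.2 ⟨ENNReal.add_lt_top.2 ⟨hb.trans_le' ?_, hb'.trans_le' ?_⟩, hb'.trans_le' ?_⟩)
  · refine setLIntegral_mono_ae' measurableSet_annulus ?_
    filter_upwards [hfb] with z hz hza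
    gcongr
    exact enorm_le_iff_norm_le.2 ((hz hza).trans (Real.le_norm_self _))
  · refine setLIntegral_mono' measurableSet_outer fun z hz => ?_
    gcongr
    exact enorm_le_iff_norm_le.2 ((hfb' z hz).trans (Real.le_norm_self _))
  · refine setLIntegral_mono' measurableSet_outer fun z hz => ?_
    have e : ENNReal.ofReal (z ^ 2)⁻¹ * ‖f z⁻¹‖ₑ ^ 2 = ‖|z|⁻¹ * ‖f z⁻¹‖‖ₑ ^ 2 := by
      rw [enorm_mul, mul_pow, enorm_norm, Real.enorm_of_nonneg (by positivity),
        ← ENNReal.ofReal_pow (by positivity), inv_pow, sq_abs]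
    rw [e]
    gcongr
    refine enorm_le_iff_norm_le.2 ?_
    rw [Real.norm_of_nonneg (by positivity)]
    exact (hfi z hz).trans (Real.le_norm_self _)

theorem ae_abs_ne_one : ∀ᵐ z : ℝ, |z| ≠ 1 := by
  have h : {z : ℝ | ¬ |z| ≠ 1} ⊆ {1, -1} := fun z hz => by
    simpa using eq_or_eq_neg_of_abs_eq (not_not.1 hz)
  exact measure_mono_null h ((Set.toFinite _).measure_zero _)

section

variable {f : ℝ → ℂ}

/-- Near 0 the symmetry gives |f(z)| = |f(1/z)| ≤ C|z|. At other small z it transfers continuity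
from 1/z. -/
theorem continuous_of_inv (hinv : ∀ z ≠ 0, f z⁻¹ = conj (f z)) (h0 : f 0 = 0) (hS : SobolevReg 0 f)
    (hC : ∃ C, ∀ z ∈ outer, ‖f z‖ ≤ C * |z|⁻¹) : Continuous f := by
  obtain ⟨C, hC⟩ := hC
  refine continuous_iff_continuousAt.2 fun z => ?_
  by_cases hz : z = 0
  · subst hz
    rw [ContinuousAt, h0]
    refine squeeze_zero_norm' (a := fun z => |C| * |z|) ?_ ?_
    · filter_upwards [Metric.ball_mem_nhds (0 : ℝ) (show (0 : ℝ) < 1 / 2 by norm_num)] with z hz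
      by_cases hz0 : z = 0
      · rw [hz0, h0]
        simp
      have hz1 : |z| < 1 / 2 := by simpa using hz
      have hz2 : z⁻¹ ∈ outer := by
        change 2 < |z⁻¹|
        rw [abs_inv, lt_inv_comm₀ (by norm_num) (abs_pos.2 hz0)]
        linarith
      have := hC _ hz2
      rw [hinv z hz0, RCLike.norm_conj, abs_inv, inv_inv] at this
      exact this.trans (mul_le_mul_of_nonneg_right (le_abs_self C) (abs_nonneg z))
    · have : Continuous fun z : ℝ => |C| * |z| := by fun_prop
      simpa using this.tendsto 0
  · rcases lt_or_ge (1 / 4) (|z|) with h | h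
    · exact hS.1 z h
    · have h1 : ContinuousAt f z⁻¹ := by
        refine hS.1 _ ?_
        rw [abs_inv, lt_inv_comm₀ (by norm_num) (abs_pos.2 hz)]
        linarith
      have h2 : ContinuousAt (fun w => conj (f w⁻¹)) z :=
        Complex.continuous_conj.continuousAt.comp (h1.comp (continuousAt_inv₀ hz))
      refine h2.congr ?_
      filter_upwards [isOpen_ne.mem_nhds hz] with w hw
      rw [hinv w hw, Complex.conj_conj]

theorem hasDerivAt_of_inv (hinv : ∀ z ≠ 0, f z⁻¹ = conj (f z)) {z : ℝ} (hz : z ≠ 0)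
    (hd : DifferentiableAt ℝ f z⁻¹) :
    HasDerivAt f (conj ((-(z ^ 2)⁻¹) • deriv f z⁻¹)) z := by
  refine (hasDerivAt_conj (hd.hasDerivAt.scomp z (hasDerivAt_inv hz))).congr_of_eventuallyEq ?_
  filter_upwards [isOpen_ne.mem_nhds hz] with w hw
  simp only [Function.comp_apply, hinv w hw, Complex.conj_conj]

/-- With w = 1/z and the Jacobian w⁻², the square integral of f' near 0 becomes that of |w||f'(w)|
at infinity, since |f'(1/w)| = |w|²|f'(w)|. This is why the weight on the derivative is needed
although H^{1,1} does not ask for it. -/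
theorem memSobolevWeighted_of_inv (hinv : ∀ z ≠ 0, f z⁻¹ = conj (f z)) (h0 : f 0 = 0)
    (hS : SobolevReg 0 f) (hC : ∃ C, ∀ z ∈ outer, ‖f z‖ ≤ C * |z|⁻¹)
    (hb : ∃ b : ℝ → ℝ, MemLp b 2 (volume.restrict outer) ∧ ∀ z ∈ outer,
      |z| * ‖f z‖ ≤ b z ∧ |z| * ‖deriv f z‖ ≤ b z) : MemSobolevWeighted 1 1 f := by
  have hc := continuous_of_inv hinv h0 hS hC
  obtain ⟨b, hb, hbz⟩ := hb
  obtain ⟨-, f', hf', a, ha, haz⟩ := hS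
  obtain ⟨K, hK⟩ := (isCompact_closedBall (0 : ℝ) 2).exists_bound_of_continuousOn hc.continuousOn
  have hin : ∀ z ∈ outer, |z⁻¹| ≤ 1 / 2 := fun z hz => by
    have hz2 : 2 < |z| := hz
    rw [abs_inv, inv_le_comm₀ (by linarith) (by norm_num)]
    linarith
  have hfw : MemLp (fun z : ℝ => (1 + |z|) ^ 1 • f z) 2 volume := by
    refine memLp_of_annulus_outer (b := fun _ => 3 * K) (b' := fun z => 2 * b z + |K| * 2 * |z|⁻¹)
      (by fun_prop) (memLp_const _) (Eventually.of_forall fun z hz => ?_)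
      ((hb.const_mul 2).add (memLp_inv_outer.const_mul _)) (fun z hz => ?_) fun z hz => ?_
    · have h1 := hK z (by rw [mem_closedBall_zero_iff]; exact hz.2)
      rw [norm_smul, pow_one, Real.norm_of_nonneg (by positivity)]
      exact mul_le_mul (by linarith [hz.2]) h1 (norm_nonneg _) (by norm_num)
    · have hz2 : 2 < |z| := hz
      have h1 := (hbz z hz).1
      have h2 : 0 ≤ |K| * 2 * |z|⁻¹ := by positivity
      rw [norm_smul, pow_one, Real.norm_of_nonneg (by positivity)]
      nlinarith [norm_nonneg (f z)]
    · have h3 := hin z hz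
      have h1 := hK z⁻¹ (by rw [mem_closedBall_zero_iff]; exact h3.trans (by norm_num))
      have h2 : 0 ≤ b z := le_trans (by positivity) (hbz z hz).1
      rw [norm_smul, pow_one, Real.norm_of_nonneg (by positivity)]
      have h4 : (1 + |z⁻¹|) * ‖f z⁻¹‖ ≤ 2 * |K| :=
        mul_le_mul (by linarith) (h1.trans (le_abs_self K)) (norm_nonneg _) (by norm_num)
      have h5 := mul_le_mul_of_nonneg_left h4 (inv_nonneg.2 (abs_nonneg z))
      linarith
  have hf2 : MemLp f 2 volume := by
    refine hfw.mono hc.aestronglyMeasurable (Eventually.of_forall fun z => ?_)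
    rw [norm_smul, pow_one, Real.norm_of_nonneg (by positivity)]
    exact le_mul_of_one_le_left (norm_nonneg _) (by linarith [abs_nonneg z])
  have hd : ∀ z, z ≠ 0 → |z| ≠ 1 → DifferentiableAt ℝ f z := by
    intro z hz hz1
    rcases lt_or_ge (1 / 4) (|z|) with h | h
    · exact (hf' z h hz1).differentiableAt
    · refine (hasDerivAt_of_inv hinv hz (hf' z⁻¹ ?_ ?_).differentiableAt).differentiableAt
      · rw [abs_inv, lt_inv_comm₀ (by norm_num) (abs_pos.2 hz)]
        linarith
      · rw [abs_inv]
        exact fun h => hz1 (inv_eq_one.1 h)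
  have hfd : MemLp (deriv f) 2 volume := by
    refine memLp_of_annulus_outer (measurable_deriv f) ha ?_ hb (fun z hz => ?_) fun z hz => ?_
    · filter_upwards [ae_abs_ne_one] with z hz1 hz
      rw [(hf' z (by linarith [hz.1]) hz1).deriv]
      exact haz z hz hz1
    · have hz2 : 2 < |z| := hz
      exact (le_mul_of_one_le_left (norm_nonneg _) (by linarith)).trans (hbz z hz).2
    · have hz2 : 2 < |z| := hz
      have hz0 : z ≠ 0 := ne_zero_of_quarter_le (by linarith)
      have h1 := hasDerivAt_of_inv hinv (inv_ne_zero hz0) (by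
        rw [inv_inv]
        exact hd z hz0 (by linarith))
      rw [h1.deriv, RCLike.norm_conj, norm_smul, inv_inv, norm_neg, inv_pow, inv_inv, Real.norm_eq_abs,
        abs_pow]
      refine le_trans (le_of_eq ?_) (hbz z hz).2
      field_simp
  refine ⟨fun j hj => ?_, hfw⟩
  interval_cases j
  · refine ⟨f, ⟨?_, ?_, fun φ _ _ _ => by simp⟩, hf2⟩ <;>
      exact hc.continuousOn.locallyIntegrableOn MeasurableSet.univ
  -- Continuity of f at 0, 1 and -1 excludes point masses, so the classical derivative off these
  -- points is the weak one.
  · refine ⟨deriv f, hasWeakDerivOn_one (S := {0, 1, -1}) (Set.toFinite _).countable isOpen_univ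
      hc.continuousOn (fun z hz => ?_) ?_, hfd⟩
    · simp only [Set.mem_sdiff, Set.mem_univ, Set.mem_insert_iff, Set.mem_singleton_iff, not_or,
        true_and] at hz
      refine (hd z hz.1 fun h => ?_).hasDerivAt
      rcases eq_or_eq_neg_of_abs_eq h with h | h
      · exact hz.2.1 h
      · exact hz.2.2 h
    · exact (hfd.locallyIntegrable (by norm_num)).locallyIntegrableOn _

theorem MemSobolevWeighted.congr_ae {m n : ℕ} {f₁ : ℝ → ℂ} (h : MemSobolevWeighted m n f)
    (hf : f =ᵐ[volume] f₁) : MemSobolevWeighted m n f₁ := by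
  refine ⟨fun j hj => ?_, ?_⟩
  · obtain ⟨g, hg, hg2⟩ := h.1 j hj
    exact ⟨g, hg.congr_ae hf, hg2⟩
  · refine MemLp.ae_eq ?_ h.2
    filter_upwards [hf] with x hx
    rw [hx]

end

/-! ### The reflection coefficient -/

theorem detQuot_ae_eq_reflection (q : ℝ → ℂ) : detQuot q =ᵐ[volume] reflection q := by
  filter_upwards [ae_abs_ne_one] with z hz
  exact (reflection_eq q hz).symm

theorem detQuot_inv {q : ℝ → ℂ} (hq : Decay q) (hr : Decay (reflectPot q)) {z : ℝ} (hz : z ≠ 0) :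
    detQuot q z⁻¹ = conj (detQuot q z) := by
  have hz2 : (z : ℂ) ^ 2 ≠ 0 := pow_ne_zero 2 (by exact_mod_cast hz)
  rw [detQuot, detQuot, detA_inv hq hr hz, detB_inv hq hr hz, mul_div_mul_left _ _ hz2, map_div₀]

theorem EnergyRep.memSobolevWeighted_reflection {q g : ℝ → ℂ} (h : EnergyRep 2 q g) (hg : IsGeneric q) :
    MemSobolevWeighted 1 1 (reflection q) := by
  have h' : EnergyRep (0 + 2) q g := h
  -- The value of the quotient at z = 0 is meaningless; setting it to 0 gives the continuous
  -- extension and changes only a null set.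
  have hz : ∀ z : ℝ, z ≠ 0 → Function.update (detQuot q) 0 0 z = detQuot q z := fun z hz =>
    Function.update_of_ne hz _ _
  have hzo : ∀ z ∈ outer, z ≠ 0 := fun z hz => ne_zero_of_quarter_le
    (by have : 2 < |z| := hz; linarith)
  refine (memSobolevWeighted_of_inv (f := Function.update (detQuot q) 0 0) (fun z hz0 => ?_) (by simp)
    ?_ ?_ ?_).congr_ae (EventuallyEq.trans ?_ (detQuot_ae_eq_reflection q))
  · rw [hz z hz0, hz z⁻¹ (inv_ne_zero hz0), detQuot_inv h'.decay h'.reflect.decay hz0]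
  · refine (sobolevReg_quotient h'.momentReg h'.reflect.momentReg hg).congr fun z hz' => ?_
    rw [hz z (ne_zero_of_quarter_le hz'.le), detQuot]
  · obtain ⟨C, hC⟩ := exists_detQuot_le h'.energyPot h'.reflect.energyPot
    refine ⟨C, fun z hzz => ?_⟩
    rw [hz z (hzo z hzz)]
    exact hC z hzz
  · obtain ⟨b, hb, hbz⟩ := exists_outer_bounds h'.energyPot h'.reflect.energyPot h'.momentReg
      h'.reflect.momentReg
    refine ⟨b, hb, fun z hzz => ?_⟩
    have e : Function.update (detQuot q) 0 0 =ᶠ[𝓝 z] detQuot q := by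
      filter_upwards [isOpen_ne.mem_nhds (hzo z hzz)] with w hw
      exact hz w hw
    rw [e.deriv_eq, e.eq_of_nhds]
    exact hbz z hzz
  · have : ∀ᵐ z : ℝ, z ≠ 0 := by simp [ae_iff]
    filter_upwards [this] with z hz'
    exact hz z hz'

/-- At level 1 the first derivative is continuous across |z| = 1, so its classical derivative off z
= ±1 is the second weak derivative, with the L² bound of the class. -/
theorem SobolevReg.exists_hasWeakDerivOn_two {f : ℝ → ℂ} (h : SobolevReg 1 f) {U : Set ℝ}
    (hU : IsOpen U) (hUa : U ⊆ annulus) :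
    ∃ g, HasWeakDerivOn 2 U f g ∧ MemLp g 2 (volume.restrict U) := by
  obtain ⟨f', hf', hc, f'', hf'', b, hb, hbz⟩ := h
  have hU4 : ∀ z ∈ U, 1 / 4 < |z| := fun z hz => by linarith [(hUa hz).1]
  have hd : ∀ z ∈ U, |z| ≠ 1 → HasDerivAt f' (deriv f' z) z := fun z hz h1 =>
    (hf'' z (hU4 z hz) h1).differentiableAt.hasDerivAt
  have hm : MemLp (deriv f') 2 (volume.restrict U) := by
    refine (hb.mono_measure (Measure.restrict_mono hUa le_rfl)).mono
      (measurable_deriv f').aestronglyMeasurable ?_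
    filter_upwards [ae_restrict_mem hU.measurableSet, ae_restrict_of_ae ae_abs_ne_one] with z hz h1
    rw [(hf'' z (hU4 z hz) h1).deriv]
    exact (hbz z (hUa hz) h1).trans (Real.le_norm_self _)
  have : IsFiniteMeasure (volume.restrict U) :=
    ⟨by rw [Measure.restrict_apply_univ]
        exact (measure_mono hUa).trans_lt isCompact_annulus.measure_lt_top⟩
  have hi : IntegrableOn (deriv f') U := hm.integrable (by norm_num)
  refine ⟨deriv f', hasWeakDerivOn_two (S := {1, -1}) (Set.toFinite _).countable hU
    (fun z hz => hf' z (hU4 z hz)) (fun z hz => (hc z (hU4 z hz)).continuousWithinAt)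
    (fun z hz => hd z hz.1 fun h1 => hz.2 ?_) hi.locallyIntegrableOn, hm⟩
  simpa using eq_or_eq_neg_of_abs_eq h1

theorem EnergyRep.exists_hasWeakDerivOn_two {q g : ℝ → ℂ} (h : EnergyRep 3 q g) (hg : IsGeneric q)
    {U : Set ℝ} (hU : IsOpen U) (hUa : U ⊆ annulus) :
    ∃ r, HasWeakDerivOn 2 U (reflection q) r ∧ MemLp r 2 (volume.restrict U) := by
  have h' : EnergyRep (1 + 2) q g := h
  obtain ⟨r, hr, hr2⟩ := (sobolevReg_quotient h'.momentReg h'.reflect.momentReg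
    hg).exists_hasWeakDerivOn_two hU hUa
  exact ⟨r, hr.congr_ae (detQuot_ae_eq_reflection q), hr2⟩

end DefocusingNLS

end

/-! ### The theorem, after passing to the continuous representative -/

theorem mainTheorem3 (q : ℝ → ℂ) :
    (DefocusingNLS.MemWeightedEnergy 2 1 1 q →
      (∀ z : ℝ, z ≠ 0 → DefocusingNLS.JostWellDefined q z) ∧
        (DefocusingNLS.IsGeneric q →
          DefocusingNLS.MemSobolevWeighted 1 1 (DefocusingNLS.reflection q))) ∧
    (DefocusingNLS.MemWeightedEnergy 3 1 1 q → DefocusingNLS.IsGeneric q →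
      ∃ g : ℝ → ℂ,
        DefocusingNLS.HasWeakDerivOn 2
          (Set.Ioo (1 / 2 : ℝ) (3 / 2) ∪ Set.Ioo (-(3 / 2) : ℝ) (-(1 / 2)))
          (DefocusingNLS.reflection q) g ∧
        MeasureTheory.MemLp g 2 (MeasureTheory.volume.restrict
          (Set.Ioo (1 / 2 : ℝ) (3 / 2) ∪ Set.Ioo (-(3 / 2) : ℝ) (-(1 / 2))))) := by
  refine ⟨fun h => ?_, fun h hg => ?_⟩
  · obtain ⟨q', g, hq, H⟩ := h.exists_rep
    have H' : DefocusingNLS.EnergyRep (0 + 2) q' g := H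
    rw [DefocusingNLS.jostWellDefined_congr hq, DefocusingNLS.isGeneric_congr hq,
      DefocusingNLS.reflection_congr hq]
    exact ⟨fun z hz => DefocusingNLS.jostWellDefined H'.decay H'.reflect.decay hz,
      H.memSobolevWeighted_reflection⟩
  · obtain ⟨q', g, hq, H⟩ := h.exists_rep
    rw [DefocusingNLS.isGeneric_congr hq] at hg
    rw [DefocusingNLS.reflection_congr hq]
    refine H.exists_hasWeakDerivOn_two hg (isOpen_Ioo.union isOpen_Ioo) ?_
    rintro z (⟨h1, h2⟩ | ⟨h1, h2⟩)
    · exact ⟨h1.le.trans (le_abs_self z), abs_le.2 ⟨by linarith, by linarith⟩⟩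
    · exact ⟨by linarith [neg_le_abs z], abs_le.2 ⟨by linarith, by linarith⟩⟩
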